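/- **Setting.** Let $N\ge 2$ be even, $\mathbb T=\mathbb Z/N\mathbb Z\simeq\{0,\dots,N-1\}$, $r=\tfrac12(1-N^{-1/2})$, $\ell=\tfrac12(1+N^{-1/2})$, $\tau=r/\ell$, $\nu=1-2\sqrt{r\ell}$. For $x,x'\in\mathbb T$ let $|(x,x']|\in\{0,\dots,N-1\}$ be the number of sites of the counterclockwise interval $(x,x']$ (so $|(x,x]|=0$), and $\mathrm{dist}(x,x')=|(x,x']|\wedge|(x',x]|$. Write $\nabla f(x)=f(x+1)-f(x)$ and $\Delta f(x)=f(x+1)+f(x-1)-2f(x)$. Let $\tilde a(x)$, $x\in\mathbb T$, be random variables with $\frac1{c_0}\le\tilde a(x)\le c_0$ a.s., and put $a(x)=\tilde a(x)-1$ and $R(x,x')=-\frac12\sum_{y\in(x,x']}a(y)$. Given $\tilde a$, let $Q^L(\cdot,x)$ and $Q^R(\cdot,x)$, $x\in\mathbb T$, be independent Poisson processes of rates $\ell\tilde a(x)$ and $r\tilde a(x)$, and let $\mathcal F(t)$ be the $\sigma$-algebra generated by $a$ and by all these processes up to time $t$. Inhomogeneous ASEP on $\mathbb T$ is driven by these clocks: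 when $Q^R(\cdot,x)$ rings, a particle at $x$ (if there is one) jumps to $x+1$ if that site is empty, and when $Q^L(\cdot,x)$ rings, a particle at $x+1$ (if there is one) jumps to $x$ if that site is empty. It starts from a deterministic configuration $\eta(0,\cdot)\in\{0,1\}^{\mathbb T}$ with exactly $N/2$ particles. The height function is $h(0,x)=\sum_{0<y\le x}(2\eta(0,y)-1)$, $x=0,\dots,N-1$; each jump from $x$ to $x+1$ decreases $h(t,x)$ by $2$ and each jump from $x+1$ to $x$ increases it by $2$. Put $Z(t,x)=\tau^{h(t,x)/2}e^{\nu t}$ and $W(t,x)=N\,\nabla Z(t,x)\,\nabla Z(t,x-1)$. Assume that the initial condition is near stationary: $$Z(0,x)\le c_1,\qquad |Z(0,x)-Z(0,x')|\le c_1\,(\mathrm{dist}(x,x')/N)^{u_{ic}},\qquad x,x'\in\mathbb T.$$ **The good event.** Let $q(t;x,y)$ be the kernel of $e^{tH}$, where $H=\sqrt{r\ell}\,\tilde a(x)\Delta-\nu a(x)$, let $p(t;x,y)$ be the kernel of $e^{t\Delta/2}$, and let $\rho=q-p$. For $u\in(0,1]$, $0<v<u_{rt}$ and $\Lambda,T<\infty$,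 let $\Omega(u,v,\Lambda,T,N)$ be the event that $\sup_{x\ne x'}|R(x,x')|\,(|(x,x']|/N)^{-u_{rt}}\le\Lambda$ and that for all $t\in[0,N^2T]$ and $x,x',y\in\mathbb T$, with $d=\mathrm{dist}(x,x')$: * $\sum_{y}q(t;x,y)\le\Lambda$ and $q(t;x,y)\le\Lambda(t+1)^{-1/2}$; * $|q(t;x,y)-q(t;x',y)|\le d^u(t+1)^{-(u+1)/2}\Lambda$ and $\sum_y|q(t;x,y)-q(t;x',y)|\le d^u(t+1)^{-u/2}\Lambda$; * $\sum_y|\rho(t;x,y)|\le(tN^{-2})^{v/2}\Lambda$; * $\sum_y|\rho(t;x,y)-\rho(t;x',y)|\le\big(d^u(1+t)^{-u/2}N^{-v}+(d/N)^u\big)\Lambda$; * $|\rho(t;x,y)-\rho(t;x',y)|\le\big(d^u(1+t)^{-(u+1)/2}N^{-v}+(d/N)^u(1+t)^{-1/2}\big)\Lambda$; * $\sup_{t'\in[t,t+1]}q(t';x,y)\le\Lambda\,q(t+1;x,y)$. Put $\Omega'=\Omega(u,v,\Lambda,T,N)\cap\Omega(1,v,\Lambda,T,N)$, $\mathbf E_{\Omega'}[\,\cdot\,]=\mathbf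 E[\,\cdot\mid a(x),x\in\mathbb T]\,1_{\Omega'}$ and $\mathbf E_{\Omega'}[\,\cdot\mid\mathcal F(s)]=\mathbf E[\,\cdot\mid\mathcal F(s)]\,1_{\Omega'}$. **Proposition.** Let $u_{rt},u_{ic},c_0>0$, $c_1\in\mathbb R$, $u\in(\frac12,1)$, $v\in(0,u_{rt})$ and $\Lambda,T<\infty$. There is a constant $c\in(0,\infty)$, depending only on these parameters, such that for every even $N\ge2$, every environment, clocks and initial condition as above, all $s,t\in[0,N^2T]$ and all $x\in\mathbb T$, the variable $W(t+s,x)$ is integrable and, almost surely, $$\mathbf E_{\Omega'}\Big[\,\big|\mathbf E_{\Omega'}[W(t+s,x)\mid\mathcal F(s)]\big|\,\Big]\le c\,\Big(N^{-(\frac u2\wedge u_{ic}\wedge v)}\log(N+1)+\frac1{\sqrt{t+1}}+\frac N{t+1}\Big).$$ -/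

import Mathlib

open MeasureTheory
open scoped NNReal Nat

noncomputable section

namespace InhomASEP

/-! ## The discrete torus, the scaling and the environment -/

section Torus

variable {N : ℕ} [NeZero N]

/-- The number of sites of the counterclockwise half-open interval `(x, x']` of the torus. -/
def arc (x x' : ZMod N) : ℕ := (x' - x).val

/-- Geodesic distance on the torus. -/
def torusDist (x x' : ZMod N) : ℕ := min (arc x x') (arc x' x)

/-- The partial sums `R(x, x') = - (1/2) ∑_{y ∈ (x, x']} (a(y) - 1)`. -/
def partialSum (a : ZMod N → ℝ) (x x' : ZMod N) : ℝ :=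
  -(1 / 2) * ∑ k ∈ Finset.range (arc x x'), (a (x + 1 + (k : ZMod N)) - 1)

/-- The Hölder seminorm `sup |f(x, x')| / (|(x, x']| / N)^w` over the intervals of the torus.
The degenerate intervals `x = x'` contribute the value `0` when `w > 0`. -/
def holderSeminorm (w : ℝ) (f : ZMod N → ZMod N → ℝ) : ℝ :=
  ⨆ p : ZMod N × ZMod N, |f p.1 p.2| / ((arc p.1 p.2 : ℝ) / N) ^ w

end Torus

/-- Jump rate to the right, under the weak asymmetry scaling. -/
def rateR (N : ℕ) : ℝ := (1 / 2) * (1 - 1 / √(N : ℝ))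

/-- Jump rate to the left, under the weak asymmetry scaling. -/
def rateL (N : ℕ) : ℝ := (1 / 2) * (1 + 1 / √(N : ℝ))

/-- `τ = r / ℓ`. -/
def tau (N : ℕ) : ℝ := rateR N / rateL N

/-- `ν = 1 - 2 √(r ℓ)`. -/
def nu (N : ℕ) : ℝ := 1 - 2 * √(rateR N * rateL N)

/-! ## Semigroup kernels and the good event -/

section Kernels

variable {N : ℕ} [NeZero N]

/-- The matrix of the discrete Laplacian `Δ f(x) = f(x+1) + f(x-1) - 2 f(x)`. -/
def laplacian (N : ℕ) [NeZero N] : Matrix (ZMod N) (ZMod N) ℝ :=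
  Matrix.of fun x y =>
    (if y = x + 1 then 1 else 0) + (if y = x - 1 then 1 else 0) - 2 * (if y = x then 1 else 0)

/-- The matrix of the operator `√(rℓ) a(x) Δ - ν (a(x) - 1)`. -/
def hamiltonian (a : ZMod N → ℝ) : Matrix (ZMod N) (ZMod N) ℝ :=
  Matrix.of fun x y =>
    √(rateR N * rateL N) * a x * laplacian N x y - (if y = x then nu N * (a x - 1) else 0)

/-- Kernel of the semigroup generated by `hamiltonian a`. -/
def semigroupKernel (a : ZMod N → ℝ) (t : ℝ) (x y : ZMod N) : ℝ :=
  NormedSpace.exp (t • hamiltonian a) x y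

/-- Transition kernel of the homogeneous continuous-time walk, with generator `Δ / 2`. -/
def heatKernel (t : ℝ) (x y : ZMod N) : ℝ :=
  NormedSpace.exp (t • ((1 / 2 : ℝ) • laplacian N)) x y

/-- The remainder `semigroupKernel - heatKernel`. -/
def remainderKernel (a : ZMod N → ℝ) (t : ℝ) (x y : ZMod N) : ℝ :=
  semigroupKernel a t x y - heatKernel t x y

/-- The environments `a` that belong to the good event with parameters `(u, v, Λ, T, N)`;
`w` is the Hölder exponent of the environment. -/
structure GoodEnvironment (w u v Λ T : ℝ) (a : ZMod N → ℝ) : Prop where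
  sum_le : ∀ t : ℝ, 0 ≤ t → t ≤ (N : ℝ) ^ 2 * T → ∀ x,
    ∑ y, semigroupKernel a t x y ≤ Λ
  sup_le : ∀ t : ℝ, 0 ≤ t → t ≤ (N : ℝ) ^ 2 * T → ∀ x y,
    semigroupKernel a t x y ≤ Λ / √(t + 1)
  grad_sup_le : ∀ t : ℝ, 0 ≤ t → t ≤ (N : ℝ) ^ 2 * T → ∀ x x' y,
    |semigroupKernel a t x y - semigroupKernel a t x' y|
      ≤ (torusDist x x' : ℝ) ^ u / (t + 1) ^ ((u + 1) / 2) * Λ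
  grad_sum_le : ∀ t : ℝ, 0 ≤ t → t ≤ (N : ℝ) ^ 2 * T → ∀ x x',
    ∑ y, |semigroupKernel a t x y - semigroupKernel a t x' y|
      ≤ (torusDist x x' : ℝ) ^ u / (t + 1) ^ (u / 2) * Λ
  rem_sum_le : ∀ t : ℝ, 0 ≤ t → t ≤ (N : ℝ) ^ 2 * T → ∀ x,
    ∑ y, |remainderKernel a t x y| ≤ (t / (N : ℝ) ^ 2) ^ (v / 2) * Λ
  rem_grad_sum_le : ∀ t : ℝ, 0 ≤ t → t ≤ (N : ℝ) ^ 2 * T → ∀ x x',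
    ∑ y, |remainderKernel a t x y - remainderKernel a t x' y|
      ≤ ((torusDist x x' : ℝ) ^ u / (1 + t) ^ (u / 2) * (N : ℝ) ^ (-v)
          + ((torusDist x x' : ℝ) / N) ^ u) * Λ
  rem_grad_sup_le : ∀ t : ℝ, 0 ≤ t → t ≤ (N : ℝ) ^ 2 * T → ∀ x x' y,
    |remainderKernel a t x y - remainderKernel a t x' y|
      ≤ ((torusDist x x' : ℝ) ^ u / (1 + t) ^ ((u + 1) / 2) * (N : ℝ) ^ (-v)
          + ((torusDist x x' : ℝ) / N) ^ u / (1 + t) ^ (1 / 2 : ℝ)) * Λ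
  local_le : ∀ t : ℝ, 0 ≤ t → t ≤ (N : ℝ) ^ 2 * T → ∀ x y, ∀ t' ∈ Set.Icc t (t + 1),
    semigroupKernel a t' x y ≤ Λ * semigroupKernel a (t + 1) x y
  holder_le : holderSeminorm w (partialSum a) ≤ Λ

end Kernels

/-! ## Particle configurations and height functions -/

section Dynamics

variable {N : ℕ} [NeZero N]

/-- A set of occupied sites, together with a height function. -/
structure State (N : ℕ) where
  occupied : Finset (ZMod N)
  height : ZMod N → ℤ

/-- The height function `h(0, x) = ∑_{0 < y ≤ x} (2 η(y) - 1)`, `x = 0, …, N - 1`. -/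
def initialHeight (A : Finset (ZMod N)) (x : ZMod N) : ℤ :=
  ∑ k ∈ Finset.Icc 1 x.val, (2 * (if (k : ZMod N) ∈ A then 1 else 0) - 1)

def initialState (A : Finset (ZMod N)) : State N := ⟨A, initialHeight A⟩

/-- Attempted jump from `x` to `x + 1`, suppressed if `x` is empty or `x + 1` is occupied. -/
def jumpRight (x : ZMod N) (σ : State N) : State N :=
  if x ∈ σ.occupied ∧ x + 1 ∉ σ.occupied then
    ⟨insert (x + 1) (σ.occupied.erase x), Function.update σ.height x (σ.height x - 2)⟩
  else σ

/-- Attempted jump from `x + 1` to `x`, suppressed if `x + 1` is empty or `x` is occupied. -/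
def jumpLeft (x : ZMod N) (σ : State N) : State N :=
  if x + 1 ∈ σ.occupied ∧ x ∉ σ.occupied then
    ⟨insert x (σ.occupied.erase (x + 1)), Function.update σ.height x (σ.height x + 2)⟩
  else σ

/-! The graphical construction, for one realisation of the clocks: `QL t x` and `QR t x` are the
numbers of rings, up to time `t`, of the left and right clocks of the bond `(x, x + 1)`. -/

/-- Total number of rings up to time `t`. -/
def totalRings (QL QR : ℝ≥0 → ZMod N → ℕ) (t : ℝ≥0) : ℕ := ∑ x, (QL t x + QR t x)

/-- Time of the `n`-th ring (and `0` for `n = 0`). -/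
def ringTime (QL QR : ℝ≥0 → ZMod N → ℕ) (n : ℕ) : ℝ≥0 := sInf {t | n ≤ totalRings QL QR t}

open Classical in
/-- The state after `n` rings: the `(n+1)`-st ring is attributed to the clock that increases
between the `n`-th and the `(n+1)`-st ring time. This clock is unique unless two clocks ring
simultaneously, which has probability `0` for the clocks considered here. -/
def stateAfter (QL QR : ℝ≥0 → ZMod N → ℕ) (A : Finset (ZMod N)) : ℕ → State N
  | 0 => initialState A
  | n + 1 =>
    if hR : ∃ x, QR (ringTime QL QR n) x < QR (ringTime QL QR (n + 1)) x then
      jumpRight hR.choose (stateAfter QL QR A n)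
    else if hL : ∃ x, QL (ringTime QL QR n) x < QL (ringTime QL QR (n + 1)) x then
      jumpLeft hL.choose (stateAfter QL QR A n)
    else stateAfter QL QR A n

/-- The inhomogeneous ASEP at time `t`, started from the occupied set `A`. -/
def asep (QL QR : ℝ≥0 → ZMod N → ℕ) (A : Finset (ZMod N)) (t : ℝ≥0) : State N :=
  stateAfter QL QR A (totalRings QL QR t)

/-- The Gärtner transform of a height function at time `t`. -/
def gartner (h : ZMod N → ℤ) (t : ℝ≥0) (x : ZMod N) : ℝ :=
  tau N ^ ((h x : ℝ) / 2) * Real.exp (nu N * t)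

/-- Near stationary initial condition. -/
def NearStationary (uIc c : ℝ) (A : Finset (ZMod N)) : Prop :=
  (∀ x : ZMod N, gartner (initialHeight A) 0 x ≤ c) ∧
    ∀ x x' : ZMod N, |gartner (initialHeight A) 0 x - gartner (initialHeight A) 0 x'|
      ≤ c * ((torusDist x x' : ℝ) / N) ^ uIc

end Dynamics

/-! ## Probability -/

section Probability

variable {N : ℕ} [NeZero N] {Ω : Type*} [MeasurableSpace Ω]

/-- The `σ`-algebra generated by the random environment. -/
@[reducible] def envSigma (a : Ω → ZMod N → ℝ) : MeasurableSpace Ω :=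
  ⨆ x, MeasurableSpace.comap (fun ω => a ω x - 1) inferInstance

/-- The `σ`-algebra generated by the environment and by the clocks up to time `t`. -/
@[reducible] def clockSigma (a : Ω → ZMod N → ℝ) (QL QR : Ω → ℝ≥0 → ZMod N → ℕ) (t : ℝ≥0) :
    MeasurableSpace Ω :=
  envSigma a ⊔ ⨆ s : Set.Iic t, ⨆ x,
    (MeasurableSpace.comap (fun ω => QL ω s x) ⊤ ⊔ MeasurableSpace.comap (fun ω => QR ω s x) ⊤)

/-- The weight of `k` under the Poisson law of mean `m`. -/
def poissonWeight (m : ℝ) (k : ℕ) : ℝ := Real.exp (-m) * m ^ k / (k ! : ℝ)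

/-- `a` is a random environment and, given `a`, the `QL · x`, `QR · x` are independent Poisson
processes of rates `ℓ a(x)` and `r a(x)`: they are counting processes whose increments after time
`s`, given the environment and all clocks up to time `s`, are independent Poisson variables. -/
structure IsClockSystem (μ : Measure Ω) (a : Ω → ZMod N → ℝ)
    (QL QR : Ω → ℝ≥0 → ZMod N → ℕ) : Prop where
  measurable_env : ∀ x, Measurable fun ω => a ω x
  measurable_left : ∀ t x, Measurable fun ω => QL ω t x
  measurable_right : ∀ t x, Measurable fun ω => QR ω t x
  left_zero : ∀ ω x, QL ω 0 x = 0
  right_zero : ∀ ω x, QR ω 0 x = 0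
  left_mono : ∀ ω x, Monotone fun t => QL ω t x
  right_mono : ∀ ω x, Monotone fun t => QR ω t x
  left_rightCont : ∀ ω x t, ContinuousWithinAt (fun t => QL ω t x) (Set.Ici t) t
  right_rightCont : ∀ ω x t, ContinuousWithinAt (fun t => QR ω t x) (Set.Ici t) t
  increments : ∀ s t : ℝ≥0, s ≤ t → ∀ k l : ZMod N → ℕ,
    μ[Set.indicator {ω | ∀ x, QL ω t x = QL ω s x + k x ∧ QR ω t x = QR ω s x + l x}
        (fun _ => (1 : ℝ)) | clockSigma a QL QR s]
      =ᵐ[μ] fun ω => ∏ x,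
        (poissonWeight (rateL N * a ω x * ((t : ℝ) - s)) (k x) *
          poissonWeight (rateR N * a ω x * ((t : ℝ) - s)) (l x))

/-- The process `Z(t, x)`. -/
def Z (QL QR : Ω → ℝ≥0 → ZMod N → ℕ) (A : Finset (ZMod N)) (t : ℝ≥0) (x : ZMod N) (ω : Ω) : ℝ :=
  gartner (asep (QL ω) (QR ω) A t).height t x

/-- The process `W(t, x) = N ∇Z(t, x) ∇Z(t, x - 1)`, where `∇f(x) = f(x + 1) - f(x)`. -/
def W (QL QR : Ω → ℝ≥0 → ZMod N → ℕ) (A : Finset (ZMod N)) (t : ℝ≥0) (x : ZMod N) (ω : Ω) : ℝ :=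
  N * (Z QL QR A t (x + 1) ω - Z QL QR A t x ω) * (Z QL QR A t x ω - Z QL QR A t (x - 1) ω)

/-- The good event `Ω(u, v, Λ, T, N) ∩ Ω(1, v, Λ, T, N)`. -/
def goodEvent (w u v Λ T : ℝ) (a : Ω → ZMod N → ℝ) : Set Ω :=
  {ω | GoodEnvironment w u v Λ T (a ω) ∧ GoodEnvironment w 1 v Λ T (a ω)}

/-- `E[f | environment] 1_G`. -/
def quenchedExp (μ : Measure Ω) (a : Ω → ZMod N → ℝ) (G : Set Ω) (f : Ω → ℝ) : Ω → ℝ :=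
  G.indicator (μ[f | envSigma a])

/-- `E[f | environment, clocks up to time s] 1_G`. -/
def quenchedCondExp (μ : Measure Ω) (a : Ω → ZMod N → ℝ) (QL QR : Ω → ℝ≥0 → ZMod N → ℕ)
    (G : Set Ω) (s : ℝ≥0) (f : Ω → ℝ) : Ω → ℝ :=
  G.indicator (μ[f | clockSigma a QL QR s])

end Probability

end InhomASEP

end

set_option linter.unusedSectionVars false

noncomputable section

/-! ## Exponentials of real matrices -/



namespace InhomASEP

section MatrixExp

open scoped Matrix Matrix.Norms.Operator
open NormedSpace

variable {n : Type*} [Fintype n] [DecidableEq n]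

/-! The Gärtner transform linearises the exclusion process. With `τ = r/ℓ` and `ν = 1 - 2√(rℓ)` the
drift of `Z` is `hamiltonian` applied to `Z`, in every environment (`zval_drift`), and the
martingale parts at distinct sites are orthogonal. Second moments of `Z` therefore obey a closed
Duhamel formula with kernel `q` and noise density `bracket` (`duhamel`). A look at the four local
occupations shows that `N * bracket` equals `Z² - W` up to an error `O(N^(-β)) Z²`, where `β = min
(u/2) u_ic v` (`abs_bracketError_le`). So `W = N ∇Z ∇Z` solves a renewal equation
(`duhamel_gradProd`): `E W(t,x) = N E[(∇q Z)(∇q Z)] + ∫ ∑_y ∇q(t-r;x,y) ∇q(t-r;x-1,y) E[Z² - W +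
error](r,y) dr`.

The initial term is `O(N/(t+1))` by the `ℓ¹` decay of `∇q`. The `Z²` term is small by cancellation:
for the homogeneous kernel `∑_y ∇p ∇p` is the time derivative of `-p(2t; 1)`
(`integral_heatGradProd_sum`), so a frozen `Z²` contributes `O((1+t)^(-1/2))`, which is `O(N/(t+1))`
when `t ≤ N² T`. Replacing `q` by `p` costs `N^(-β)`, and freezing `Z²` costs its space-time modulus
of continuity (`spatial_regularity`, `temporal_regularity`). Integrating the spatial modulus against
`|∇p ∇p|` produces the logarithm (`integral_heatGradProd_dist_le`).

The `W` term is not small but contracts. The energy identity for `p` and the inequality `2|AB| ≤ A²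
+ B²` bound `∫ ∑_y |∇p ∇p|` by one, and the inequality is strict at short times, so the mass is at
most `1 - 1/200` (`integral_abs_heatGradProd_le`); for large `N` the same holds for `q` with a
smaller gap. Convolution with such a weight almost preserves the profile `N^(-β) log(N+1) + N/(t+L)`
once `L` is large (`convolution_weight_le`), and iterating the renewal inequality gives
`gradMoment_bound`. When `N^(-β)` is not small, the a priori moment bound is already enough.

The absolute value of a conditional expectation is handled by duality: `m ⬝ᵥ |P_t W|` equals the
pairing of `P_t W` with the signed measure `m · sign(P_t W)`, which is dominated by `m`, so all
moment bounds apply to it.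

These estimates concern a finite matrix semigroup. Half filling makes the height a function on the
torus, and `Z(t,x) Z(t,y)` is `e^(2νt) τ^(h(t,0))` times a function of the particle configuration.
Including the change of `τ^(h(0))` in the jump rates gives the matrix `generator` on the finite type
`HalfFilled N`. The link with the clocks is the Markov property `IsClockSystem.condExp_stateVec`:
over a time step `δ`, none, one, or at least two rings reproduce `exp(δ · generator)` up to `O(δ²)`,
and a function of time with quadratically small increments is constant. -/

theorem hasDerivAt_matrixExp (M : Matrix n n ℝ) (t : ℝ) :
    HasDerivAt (fun s : ℝ => exp (s • M)) (exp (t • M) * M) t :=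
  hasDerivAt_exp_smul_const M t

theorem hasDerivAt_matrixExp' (M : Matrix n n ℝ) (t : ℝ) :
    HasDerivAt (fun s : ℝ => exp (s • M)) (M * exp (t • M)) t :=
  hasDerivAt_exp_smul_const' M t

theorem hasDerivAt_matrix_entry {m : Type*} [Fintype m] {F : ℝ → Matrix m n ℝ}
    {F' : Matrix m n ℝ} {t : ℝ} (h : HasDerivAt F F' t) (i : m) (j : n) :
    HasDerivAt (fun s => F s i j) (F' i j) t := by
  have h1 : HasDerivAt (fun s => F s i) (F' i) t := by
    exact (hasDerivAt_pi.1 h) i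
  exact (hasDerivAt_pi.1 h1) j

theorem continuous_matrixExp (M : Matrix n n ℝ) : Continuous fun s : ℝ => exp (s • M) :=
  continuous_iff_continuousAt.2 fun t => (hasDerivAt_matrixExp M t).continuousAt

theorem continuous_matrixExp_entry (M : Matrix n n ℝ) (i j : n) :
    Continuous fun s : ℝ => exp (s • M) i j :=
  (continuous_matrixExp M).matrix_elem i j

theorem matrixExp_add (M : Matrix n n ℝ) (s t : ℝ) :
    exp ((s + t) • M) = exp (s • M) * exp (t • M) := by
  rw [add_smul]
  exact Matrix.exp_add_of_commute _ _ (((Commute.refl M).smul_left s).smul_right t)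

/-- Scalar matrices commute with everything. This is what allows a shift to nonnegative matrices,
and it also extracts the total jump rate and the factor `e^(2νt)` from the semigroups. -/
theorem matrixExp_add_scalar (M : Matrix n n ℝ) (c t : ℝ) :
    exp (t • (M + c • (1 : Matrix n n ℝ))) = Real.exp (c * t) • exp (t • M) := by
  have h1 : exp ((c * t) • (1 : Matrix n n ℝ)) = Real.exp (c * t) • (1 : Matrix n n ℝ) := by
    have : (c * t) • (1 : Matrix n n ℝ) = Matrix.diagonal fun _ => c * t := by
      ext i j
      simp [Matrix.one_apply, Matrix.diagonal_apply]
    rw [this, Matrix.exp_diagonal]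
    ext i j
    simp [Matrix.one_apply, Matrix.diagonal_apply, Pi.exp_def, Real.exp_eq_exp_ℝ]
  have h2 : t • (M + c • (1 : Matrix n n ℝ)) = t • M + (c * t) • 1 := by
    rw [smul_add, smul_smul, mul_comm]
  rw [h2, Matrix.exp_add_of_commute _ _ ((Commute.one_right _).smul_right _), h1]
  simp

theorem matrixExp_hasSum_smul (M : Matrix n n ℝ) :
    HasSum (fun k : ℕ => ((k ! : ℝ)⁻¹) • M ^ k) (exp M) :=
  exp_series_hasSum_exp' (𝕂 := ℝ) M

theorem matrixExp_hasSum (M : Matrix n n ℝ) (i j : n) :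
    HasSum (fun k : ℕ => ((k ! : ℝ)⁻¹) * (M ^ k) i j) (exp M i j) := by
  have h := matrixExp_hasSum_smul M
  have h1 : HasSum (fun k : ℕ => (((k ! : ℝ)⁻¹) • M ^ k) i) (exp M i) := Pi.hasSum.1 h i
  exact Pi.hasSum.1 h1 j

theorem matrix_pow_nonneg {M : Matrix n n ℝ} (h : ∀ i j, 0 ≤ M i j) (k : ℕ) (i j : n) :
    0 ≤ (M ^ k) i j := by
  induction k generalizing i j with
  | zero => simp only [pow_zero, Matrix.one_apply]; split_ifs <;> norm_num
  | succ k ih =>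
    rw [pow_succ, Matrix.mul_apply]
    exact Finset.sum_nonneg fun l _ => mul_nonneg (ih i l) (h l j)

/-- Symmetries of a matrix are symmetries of its exponential. -/
theorem matrixExp_apply_equiv {M : Matrix n n ℝ} (e : n ≃ n) (h : ∀ i j, M (e i) (e j) = M i j)
    (i j : n) : exp M (e i) (e j) = exp M i j := by
  have hk : ∀ (k : ℕ) (i j : n), (M ^ k) (e i) (e j) = (M ^ k) i j := by
    intro k
    induction k with
    | zero => intro i j; simp [Matrix.one_apply]
    | succ k ih =>
      intro i j
      rw [pow_succ, Matrix.mul_apply, Matrix.mul_apply, ← Equiv.sum_comp e]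
      simp only [ih, h]
  have h1 := matrixExp_hasSum M (e i) (e j)
  simp only [hk] at h1
  exact h1.unique (matrixExp_hasSum M i j)

theorem matrixExp_nonneg_of_nonneg {M : Matrix n n ℝ} (h : ∀ i j, 0 ≤ M i j) (i j : n) :
    0 ≤ exp M i j :=
  (matrixExp_hasSum M i j).nonneg fun k => mul_nonneg (by positivity) (matrix_pow_nonneg h k i j)

theorem one_le_matrixExp_diag {M : Matrix n n ℝ} (h : ∀ i j, 0 ≤ M i j) (i : n) :
    1 ≤ exp M i i := by
  have := le_hasSum (matrixExp_hasSum M i i) 0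
    fun k _ => mul_nonneg (by positivity) (matrix_pow_nonneg h k i i)
  simpa using this

/-- The exponential of a matrix with nonnegative off-diagonal entries is nonnegative. -/
theorem matrixExp_nonneg {M : Matrix n n ℝ} (h : ∀ i j, i ≠ j → 0 ≤ M i j) {t : ℝ} (ht : 0 ≤ t)
    (i j : n) : 0 ≤ exp (t • M) i j := by
  -- Adding a large multiple of the identity makes every entry nonnegative and changes the
  -- exponential only by a positive factor.
  obtain ⟨c, hc⟩ : ∃ c : ℝ, ∀ i, -c ≤ M i i :=
    ⟨∑ k, |M k k|, fun i => by
      have : |M i i| ≤ ∑ k, |M k k| :=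
        Finset.single_le_sum (f := fun k => |M k k|) (fun k _ => abs_nonneg _) (Finset.mem_univ i)
      have h2 := neg_abs_le (M i i)
      linarith⟩
  have hN : ∀ i j, 0 ≤ (t • (M + c • (1 : Matrix n n ℝ))) i j := by
    intro i j
    refine mul_nonneg ht ?_
    by_cases hij : i = j
    · subst hij
      simpa using by linarith [hc i]
    · simpa [Matrix.one_apply, hij] using h i j hij
  have h1 := matrixExp_nonneg_of_nonneg hN i j
  rw [matrixExp_add_scalar] at h1
  exact nonneg_of_mul_nonneg_right h1 (Real.exp_pos _)

/-- The tail of the series is compared with `‖M‖²` times the full series through `(k+2)! ≥ k!`. The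
quadratic order in `M` is what makes one time step of the Markov property accurate to second order.
-/
theorem norm_matrixExp_sub_one_sub_le (M : Matrix n n ℝ) :
    ‖exp M - 1 - M‖ ≤ ‖M‖ ^ 2 * Real.exp ‖M‖ := by
  have h := matrixExp_hasSum_smul M
  have h2 : HasSum (fun k : ℕ => (((k + 2)! : ℝ)⁻¹) • M ^ (k + 2)) (exp M - 1 - M) := by
    have h0 := (hasSum_nat_add_iff' 2).2 h
    have e : exp M - ∑ k ∈ Finset.range 2, ((k ! : ℝ)⁻¹) • M ^ k = exp M - 1 - M := by
      simp [Finset.sum_range_succ, sub_sub]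
    rwa [e] at h0
  have h3 : HasSum (fun k : ℕ => ‖M‖ ^ 2 * (((k ! : ℝ)⁻¹) • ‖M‖ ^ k))
      (‖M‖ ^ 2 * Real.exp ‖M‖) := by
    rw [Real.exp_eq_exp_ℝ]
    exact (exp_series_hasSum_exp' (𝕂 := ℝ) ‖M‖).mul_left _
  rw [← h2.tsum_eq, ← h3.tsum_eq]
  refine tsum_of_norm_bounded (h3.summable.hasSum) fun k => ?_
  rw [norm_smul, norm_inv, smul_eq_mul, Real.norm_natCast, pow_add]
  have e1 : ‖M ^ k * M ^ 2‖ ≤ ‖M‖ ^ 2 * ‖M‖ ^ k := by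
    rcases Nat.eq_zero_or_pos k with rfl | hk
    · simpa using norm_pow_le' M (n := 2) (by norm_num)
    · refine (norm_mul_le _ _).trans ?_
      rw [mul_comm]
      exact mul_le_mul (norm_pow_le' M (by norm_num)) (norm_pow_le' M hk) (norm_nonneg _)
        (by positivity)
  have e2 : (((k + 2)! : ℝ)⁻¹) ≤ ((k ! : ℝ)⁻¹) := by
    apply inv_anti₀ (by positivity)
    exact_mod_cast Nat.factorial_le (by omega)
  calc _ ≤ ((k ! : ℝ)⁻¹) * (‖M‖ ^ 2 * ‖M‖ ^ k) := by gcongr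
    _ = _ := by ring

end MatrixExp

end InhomASEP

/-! ## The torus and its heat kernel -/



namespace InhomASEP

section TorusDist

variable {N : ℕ} [NeZero N]

theorem torusDist_eq (x y : ZMod N) : torusDist x y = min (y - x).val (x - y).val := rfl

theorem torusDist_sub (x y : ZMod N) : torusDist x y = torusDist (x - y) 0 := by
  simp [torusDist_eq]

theorem torusDist_comm (x y : ZMod N) : torusDist x y = torusDist y x := by
  rw [torusDist_eq, torusDist_eq, min_comm]

theorem torusDist_self (x : ZMod N) : torusDist x x = 0 := by simp [torusDist_eq]

theorem torusDist_le (x y : ZMod N) : torusDist x y ≤ N :=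
  (min_le_left _ _).trans (ZMod.val_lt _).le

theorem one_le_torusDist {x y : ZMod N} (h : x ≠ y) : 1 ≤ torusDist x y := by
  have h1 : (y - x).val ≠ 0 := by
    rw [Ne, ZMod.val_eq_zero, sub_eq_zero]; exact h.symm
  have h2 : (x - y).val ≠ 0 := by
    rw [Ne, ZMod.val_eq_zero, sub_eq_zero]; exact h
  rw [torusDist_eq]
  omega

theorem val_add_one_le (k : ZMod N) : (k + 1).val ≤ k.val + 1 := by
  refine (ZMod.val_add_le _ _).trans ?_
  rcases Nat.lt_or_ge 1 N with h | h
  · have : Fact (1 < N) := ⟨h⟩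
    rw [ZMod.val_one]
  · have hN : N = 1 := le_antisymm h (NeZero.pos N)
    have := ZMod.val_lt (1 : ZMod N)
    omega

theorem val_sub_one {k : ZMod N} (hk : k ≠ 0) : (k - 1).val + 1 = k.val := by
  have h0 : k.val ≠ 0 := by rwa [Ne, ZMod.val_eq_zero]
  have h1 : ((k.val - 1 : ℕ) : ZMod N) = k - 1 := by
    rw [Nat.cast_sub (by omega), ZMod.natCast_zmod_val, Nat.cast_one]
  rw [← h1, ZMod.val_natCast_of_lt]
  · omega
  · have := ZMod.val_lt k; omega

theorem torusDist_zero_eq (k : ZMod N) : torusDist k 0 = min (-k).val k.val := by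
  rw [torusDist_eq, zero_sub, sub_zero]

theorem torusDist_neg (k : ZMod N) : torusDist (-k) 0 = torusDist k 0 := by
  rw [torusDist_zero_eq, torusDist_zero_eq, neg_neg, min_comm]

theorem torusDist_add_one_le (k : ZMod N) : torusDist (k + 1) 0 ≤ torusDist k 0 + 1 := by
  rw [torusDist_zero_eq, torusDist_zero_eq, neg_add, ← sub_eq_add_neg]
  have h1 := val_add_one_le k
  by_cases hk : k = 0
  · subst hk; simp at h1 ⊢; omega
  · have := val_sub_one (neg_ne_zero.2 hk)
    omega

theorem torusDist_sub_one_le (k : ZMod N) : torusDist (k - 1) 0 ≤ torusDist k 0 + 1 := by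
  have := torusDist_add_one_le (-k)
  rwa [show -k + 1 = -(k - 1) by ring, torusDist_neg, torusDist_neg] at this

/-- The distance to `0` is the smaller of `k.val` and `(-k).val`, and one of the two steps lowers
the smaller of them by one. At the antipode of `0` both neighbours can be closer. -/
theorem torusDist_step_down {k : ZMod N} (hk : k ≠ 0) :
    torusDist (k + 1) 0 + 1 ≤ torusDist k 0 ∨ torusDist (k - 1) 0 + 1 ≤ torusDist k 0 := by
  have h1 := val_sub_one hk
  have h2 := val_sub_one (neg_ne_zero.2 hk)
  rw [torusDist_zero_eq (k + 1), torusDist_zero_eq (k - 1), torusDist_zero_eq k,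
    show -(k + 1) = -k - 1 by ring]
  omega

theorem zmod_one_ne_zero (hN : 2 ≤ N) : (1 : ZMod N) ≠ 0 := by
  have : Fact (1 < N) := ⟨hN⟩
  exact one_ne_zero

theorem torusDist_succ_self (hN : 2 ≤ N) (x : ZMod N) : torusDist (x + 1) x = 1 := by
  rw [torusDist_sub, add_sub_cancel_left]
  have h1 := torusDist_add_one_le (0 : ZMod N)
  rw [zero_add, torusDist_self] at h1
  exact le_antisymm h1 (one_le_torusDist (zmod_one_ne_zero hN))

/-- Concave functions of the distance to the origin are superharmonic off the origin. -/
theorem laplace_concave_dist_le (f : ℝ → ℝ) (hmono : ∀ a b : ℝ, 0 ≤ a → a ≤ b → f a ≤ f b) {b : ℝ}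
    (hf : ∀ m : ℝ, 1 ≤ m → f (m + 1) + f (m - 1) - 2 * f m ≤ b) {k : ZMod N} (hk : k ≠ 0) :
    f (torusDist (k + 1) 0) + f (torusDist (k - 1) 0) - 2 * f (torusDist k 0) ≤ b := by
  have h0 := one_le_torusDist hk
  have hp := torusDist_add_one_le k
  have hm := torusDist_sub_one_le k
  have key := hf (torusDist k 0) (by exact_mod_cast h0)
  have up : ∀ j : ZMod N, torusDist j 0 ≤ torusDist k 0 + 1 →
      f (torusDist j 0) ≤ f (torusDist k 0 + 1) := fun j hj =>
    hmono _ _ (by positivity) (by exact_mod_cast hj)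
  have down : ∀ j : ZMod N, torusDist j 0 + 1 ≤ torusDist k 0 →
      f (torusDist j 0) ≤ f (torusDist k 0 - 1) := fun j hj =>
    hmono _ _ (by positivity) (by
      have : (torusDist j 0 : ℝ) + 1 ≤ torusDist k 0 := by exact_mod_cast hj
      linarith)
  -- One neighbour lies at distance at most `m - 1` and the other at most `m + 1`. Monotonicity of
  -- `f` covers the sites around the antipode, where the second distance need not be `m + 1`.
  rcases torusDist_step_down hk with h | h
  · linarith [down _ h, up _ hm]
  · linarith [down _ h, up _ hp]

/-- Since `a ↦ a^γ` is concave, the Laplacian of this weight can be positive only at the origin. As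
a weight in the energy identity it therefore leaves only the return probability. -/
theorem laplace_rpow_dist_le {γ : ℝ} (h0 : 0 < γ) (h1 : γ ≤ 1) (k : ZMod N) :
    ((torusDist (k + 1) 0 : ℝ) ^ γ + (torusDist (k - 1) 0 : ℝ) ^ γ
      - 2 * (torusDist k 0 : ℝ) ^ γ) ≤ if k = 0 then 2 else 0 := by
  split_ifs with hk
  · subst hk
    have hp : (torusDist ((0 : ZMod N) + 1) 0 : ℝ) ≤ 1 := by
      have := torusDist_add_one_le (0 : ZMod N)
      rw [torusDist_self] at this
      exact_mod_cast this
    have hm : (torusDist ((0 : ZMod N) - 1) 0 : ℝ) ≤ 1 := by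
      have := torusDist_sub_one_le (0 : ZMod N)
      rw [torusDist_self] at this
      exact_mod_cast this
    have e1 := Real.rpow_le_one (by positivity) hp h0.le
    have e2 := Real.rpow_le_one (by positivity) hm h0.le
    have e3 : 0 ≤ (torusDist (0 : ZMod N) 0 : ℝ) ^ γ := by positivity
    linarith
  · refine laplace_concave_dist_le (fun a => a ^ γ)
      (fun a b ha hab => Real.rpow_le_rpow ha hab h0.le) ?_ hk
    intro m hm
    have hc := (Real.concaveOn_rpow h0.le h1).2 (show m + 1 ∈ Set.Ici (0 : ℝ) by simp; linarith)
      (show m - 1 ∈ Set.Ici (0 : ℝ) by simp; linarith) (show (0 : ℝ) ≤ 1 / 2 by norm_num)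
      (show (0 : ℝ) ≤ 1 / 2 by norm_num) (by norm_num)
    simp only [smul_eq_mul] at hc
    rw [show 1 / 2 * (m + 1) + 1 / 2 * (m - 1) = m by ring] at hc
    linarith

theorem laplace_sq_dist_le (k : ZMod N) :
    ((torusDist (k + 1) 0 : ℝ) ^ 2 + (torusDist (k - 1) 0 : ℝ) ^ 2
      - 2 * (torusDist k 0 : ℝ) ^ 2) ≤ 2 := by
  by_cases hk : k = 0
  · subst hk
    have hp : (torusDist ((0 : ZMod N) + 1) 0 : ℝ) ≤ 1 := by
      have := torusDist_add_one_le (0 : ZMod N)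
      rw [torusDist_self] at this
      exact_mod_cast this
    have hm : (torusDist ((0 : ZMod N) - 1) 0 : ℝ) ≤ 1 := by
      have := torusDist_sub_one_le (0 : ZMod N)
      rw [torusDist_self] at this
      exact_mod_cast this
    have e1 := pow_le_one₀ (n := 2) (by positivity) hp
    have e2 := pow_le_one₀ (n := 2) (by positivity) hm
    have e3 : 0 ≤ (torusDist (0 : ZMod N) 0 : ℝ) ^ 2 := by positivity
    linarith
  · exact laplace_concave_dist_le (fun a => a ^ 2)
      (fun a b ha hab => pow_le_pow_left₀ ha hab 2) (fun m _ => by nlinarith) hk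

end TorusDist

/-! ### The discrete Laplacian and summation by parts. -/

section Laplacian

variable {N : ℕ} [NeZero N]

theorem laplacian_apply (x y : ZMod N) : laplacian N x y =
    (if y = x + 1 then 1 else 0) + (if y = x - 1 then 1 else 0) - 2 * (if y = x then 1 else 0) :=
  rfl

theorem sum_laplacian_mul (f : ZMod N → ℝ) (x : ZMod N) :
    ∑ y, laplacian N x y * f y = f (x + 1) + f (x - 1) - 2 * f x := by
  simp only [laplacian_apply, sub_mul, add_mul, ite_mul, one_mul, zero_mul,
    Finset.sum_sub_distrib, Finset.sum_add_distrib, Finset.sum_ite_eq',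
    Finset.mem_univ, if_true, mul_ite, mul_one, mul_zero]

theorem laplacian_symm (x y : ZMod N) : laplacian N x y = laplacian N y x := by
  have h1 : (y = x + 1) ↔ (x = y - 1) := by rw [eq_sub_iff_add_eq, eq_comm]
  have h2 : (y = x - 1) ↔ (x = y + 1) := by rw [eq_sub_iff_add_eq, eq_comm]
  simp only [laplacian_apply, h1, h2, eq_comm (a := y) (b := x)]
  ring

theorem laplacian_shift (x y z : ZMod N) : laplacian N (x + z) (y + z) = laplacian N x y := by
  have h1 : (y + z = x + z + 1) ↔ (y = x + 1) := by
    rw [add_right_comm, add_left_inj]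
  have h2 : (y + z = x + z - 1) ↔ (y = x - 1) := by
    rw [add_sub_right_comm, add_left_inj]
  simp only [laplacian_apply, h1, h2, add_left_inj]

theorem laplacian_nonneg_of_ne {x y : ZMod N} (h : x ≠ y) : 0 ≤ laplacian N x y := by
  rw [laplacian_apply, if_neg h.symm]
  split_ifs <;> norm_num

theorem sum_shift (f : ZMod N → ℝ) (z : ZMod N) : ∑ k, f (k + z) = ∑ k, f k :=
  Equiv.sum_comp (Equiv.addRight z) f

theorem sum_shift_sub (f : ZMod N → ℝ) (z : ZMod N) : ∑ k, f (k - z) = ∑ k, f k :=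
  Equiv.sum_comp (Equiv.subRight z) f

theorem sum_reflect (f : ZMod N → ℝ) (x : ZMod N) : ∑ y, f (x - y) = ∑ k, f k :=
  Equiv.sum_comp (Equiv.subLeft x) f

theorem sum_mul_laplace (f g : ZMod N → ℝ) :
    ∑ k, f k * (g (k + 1) + g (k - 1) - 2 * g k)
      = ∑ k, g k * (f (k + 1) + f (k - 1) - 2 * f k) := by
  have h1 := sum_shift (fun k => f (k - 1) * g k) 1
  have h2 := sum_shift_sub (fun k => f (k + 1) * g k) 1
  simp only [add_sub_cancel_right, sub_add_cancel] at h1 h2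
  have e1 : ∑ k, f k * (g (k + 1) + g (k - 1) - 2 * g k)
      = ∑ k, f k * g (k + 1) + ∑ k, f k * g (k - 1) - ∑ k, 2 * (f k * g k) := by
    rw [← Finset.sum_add_distrib, ← Finset.sum_sub_distrib]
    exact Finset.sum_congr rfl fun k _ => by ring
  rw [e1, h1, h2, ← Finset.sum_add_distrib, ← Finset.sum_sub_distrib]
  exact Finset.sum_congr rfl fun k _ => by ring

end Laplacian

/-! ### The homogeneous heat kernel, its energy identities and the product of its gradients. -/

section Heat

open NormedSpace

variable {N : ℕ} [NeZero N]

/-- The heat kernel as a function of the difference of its arguments. -/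
def heatProfile (N : ℕ) [NeZero N] (t : ℝ) (k : ZMod N) : ℝ := heatKernel t k 0

theorem heatKernel_nonneg {t : ℝ} (ht : 0 ≤ t) (x y : ZMod N) : 0 ≤ heatKernel t x y :=
  matrixExp_nonneg (fun i j hij => mul_nonneg (by norm_num) (laplacian_nonneg_of_ne hij)) ht x y

theorem heatKernel_zero (x y : ZMod N) : heatKernel 0 x y = if x = y then 1 else 0 := by
  simp [heatKernel, Matrix.one_apply]

theorem heatKernel_symm (t : ℝ) (x y : ZMod N) : heatKernel t x y = heatKernel t y x := by
  have h : (laplacian N).transpose = laplacian N := by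
    ext i j; exact laplacian_symm j i
  have h2 := Matrix.exp_transpose (t • ((1 / 2 : ℝ) • laplacian N))
  rw [Matrix.transpose_smul, Matrix.transpose_smul, h] at h2
  have := congrFun (congrFun h2 x) y
  exact this

theorem heatKernel_shift (t : ℝ) (x y z : ZMod N) :
    heatKernel t (x + z) (y + z) = heatKernel t x y := by
  refine matrixExp_apply_equiv (Equiv.addRight z) (fun i j => ?_) x y
  exact congrArg (fun a => t * (1 / 2 * a)) (laplacian_shift i j z)

theorem heatKernel_add (s t : ℝ) (x y : ZMod N) :
    heatKernel (s + t) x y = ∑ z, heatKernel s x z * heatKernel t z y := by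
  have := congrFun (congrFun (matrixExp_add ((1 / 2 : ℝ) • laplacian N) s t) x) y
  rwa [Matrix.mul_apply] at this

theorem hasDerivAt_heatKernel (t : ℝ) (x y : ZMod N) :
    HasDerivAt (fun s => heatKernel s x y)
      ((1 / 2) * (heatKernel t (x + 1) y + heatKernel t (x - 1) y - 2 * heatKernel t x y)) t := by
  have h := hasDerivAt_matrix_entry (hasDerivAt_matrixExp' ((1 / 2 : ℝ) • laplacian N) t) x y
  have e : (((1 / 2 : ℝ) • laplacian N) * exp (t • ((1 / 2 : ℝ) • laplacian N))) x y
      = (1 / 2) * (heatKernel t (x + 1) y + heatKernel t (x - 1) y - 2 * heatKernel t x y) := by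
    rw [Matrix.smul_mul, Matrix.smul_apply, Matrix.mul_apply, smul_eq_mul]
    exact congrArg _ (sum_laplacian_mul (fun z => heatKernel t z y) x)
  rw [e] at h
  exact h

theorem continuous_heatKernel (x y : ZMod N) : Continuous fun s => heatKernel s x y :=
  continuous_iff_continuousAt.2 fun t => (hasDerivAt_heatKernel t x y).continuousAt

theorem heatKernel_eq_profile (t : ℝ) (x y : ZMod N) :
    heatKernel t x y = heatProfile N t (x - y) := by
  have := heatKernel_shift t (x - y) 0 y
  rwa [sub_add_cancel, zero_add] at this

theorem heatProfile_nonneg {t : ℝ} (ht : 0 ≤ t) (k : ZMod N) : 0 ≤ heatProfile N t k :=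
  heatKernel_nonneg ht k 0

theorem heatProfile_zero (k : ZMod N) : heatProfile N 0 k = if k = 0 then 1 else 0 :=
  heatKernel_zero k 0

theorem hasDerivAt_heatProfile (t : ℝ) (k : ZMod N) :
    HasDerivAt (fun s => heatProfile N s k)
      ((1 / 2) * (heatProfile N t (k + 1) + heatProfile N t (k - 1) - 2 * heatProfile N t k)) t :=
  hasDerivAt_heatKernel t k 0

theorem continuous_heatProfile (k : ZMod N) : Continuous fun s => heatProfile N s k :=
  continuous_heatKernel k 0

theorem integral_eq_of_hasDerivAt {f f' : ℝ → ℝ} (h : ∀ r, HasDerivAt f (f' r) r)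
    (hc : Continuous f') (t : ℝ) : ∫ r in (0 : ℝ)..t, f' r = f t - f 0 :=
  intervalIntegral.integral_eq_sub_of_hasDerivAt (fun r _ => h r) (hc.intervalIntegrable _ _)

theorem hasDerivAt_sum_heatProfile (ψ : ZMod N → ℝ) (t : ℝ) :
    HasDerivAt (fun s => ∑ k, ψ k * heatProfile N s k)
      ((1 / 2) * ∑ k, heatProfile N t k * (ψ (k + 1) + ψ (k - 1) - 2 * ψ k)) t := by
  have h : HasDerivAt (fun s => ∑ k, ψ k * heatProfile N s k) (∑ k, ψ k * ((1 / 2) *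
      (heatProfile N t (k + 1) + heatProfile N t (k - 1) - 2 * heatProfile N t k))) t :=
    HasDerivAt.fun_sum fun k _ => (hasDerivAt_heatProfile t k).const_mul _
  rw [← sum_mul_laplace, Finset.mul_sum]
  convert h using 2
  ring

theorem sum_heatProfile (t : ℝ) : ∑ k, heatProfile N t k = 1 := by
  have h : ∀ r, HasDerivAt (fun s => ∑ k, (1 : ℝ) * heatProfile N s k) 0 r := fun r => by
    convert hasDerivAt_sum_heatProfile (N := N) (fun _ => (1 : ℝ)) r using 1
    norm_num
  have h1 := integral_eq_of_hasDerivAt h continuous_const t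
  simp only [intervalIntegral.integral_zero, one_mul, heatProfile_zero, Finset.sum_ite_eq',
    Finset.mem_univ, if_true] at h1
  linarith

theorem sum_heatKernel (t : ℝ) (x : ZMod N) : ∑ y, heatKernel t x y = 1 := by
  simp only [heatKernel_eq_profile]
  rw [sum_reflect (heatProfile N t)]
  exact sum_heatProfile t

/-- The derivative in time of the mean of `ψ` is half the mean of `Δψ`, hence at most one. With `ψ`
the squared distance this is the diffusive bound on the variance of the walk. -/
theorem sum_heatProfile_le {ψ : ZMod N → ℝ} (h0 : ψ 0 = 0)
    (h : ∀ k, ψ (k + 1) + ψ (k - 1) - 2 * ψ k ≤ 2) {t : ℝ} (ht : 0 ≤ t) :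
    ∑ k, ψ k * heatProfile N t k ≤ t := by
  have h1 := integral_eq_of_hasDerivAt (hasDerivAt_sum_heatProfile ψ)
    (by have := continuous_heatProfile (N := N); fun_prop) t
  have h2 : ∫ r in (0 : ℝ)..t,
      ((1 / 2) * ∑ k, heatProfile N r k * (ψ (k + 1) + ψ (k - 1) - 2 * ψ k)) ≤ ∫ _ in (0 : ℝ)..t,
        (1 : ℝ) := by
    refine intervalIntegral.integral_mono_on ht ?_ (by simp) fun r hr => ?_
    · refine Continuous.intervalIntegrable ?_ _ _
      have := continuous_heatProfile (N := N)
      fun_prop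
    · have : ∑ k, heatProfile N r k * (ψ (k + 1) + ψ (k - 1) - 2 * ψ k)
          ≤ ∑ k, heatProfile N r k * 2 :=
        Finset.sum_le_sum fun k _ => mul_le_mul_of_nonneg_left (h k) (heatProfile_nonneg hr.1 k)
      rw [← Finset.sum_mul, sum_heatProfile] at this
      linarith
  have h3 : ∑ k, ψ k * heatProfile N 0 k = 0 := by
    simp [heatProfile_zero, h0]
  rw [h1, h3] at h2
  simpa using h2

/-- The weighted Dirichlet energy of the heat kernel. -/
def heatEnergy (ψ : ZMod N → ℝ) (t : ℝ) : ℝ :=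
  ∑ k, ψ k * ((heatProfile N t (k + 1) - heatProfile N t k) ^ 2
    + (heatProfile N t k - heatProfile N t (k - 1)) ^ 2)

theorem continuous_heatEnergy (ψ : ZMod N → ℝ) : Continuous (heatEnergy ψ) := by
  unfold heatEnergy
  have := continuous_heatProfile (N := N)
  fun_prop

/-- From `2 p Δp = Δ(p²) - (∇⁺p)² - (∇⁻p)²`, moving `Δ` onto `ψ` by summation by parts. The choice
`ψ = 1` computes the total Dirichlet energy; a power of the distance gives the energy far from the
diagonal. -/
theorem integral_heatEnergy (ψ : ZMod N → ℝ) (t : ℝ) :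
    (1 / 2) * ∫ r in (0 : ℝ)..t, heatEnergy ψ r = ψ 0 - ∑ k, ψ k * heatProfile N t k ^ 2
      + (1 / 2) * ∫ r in (0 : ℝ)..t, ∑ k, heatProfile N r k ^ 2
        * (ψ (k + 1) + ψ (k - 1) - 2 * ψ k) := by
  have hc := continuous_heatProfile (N := N)
  have hd : ∀ r, HasDerivAt (fun s => ∑ k, ψ k * heatProfile N s k ^ 2)
      ((1 / 2) * (∑ k, heatProfile N r k ^ 2 * (ψ (k + 1) + ψ (k - 1) - 2 * ψ k))
        - (1 / 2) * heatEnergy ψ r) r := by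
    intro r
    have h : HasDerivAt (fun s => ∑ k, ψ k * heatProfile N s k ^ 2) (∑ k, ψ k *
        ((2 : ℕ) * heatProfile N r k ^ (2 - 1) * ((1 / 2) *
        (heatProfile N r (k + 1) + heatProfile N r (k - 1) - 2 * heatProfile N r k)))) r :=
      HasDerivAt.fun_sum fun k _ => ((hasDerivAt_heatProfile r k).pow 2).const_mul _
    rw [← sum_mul_laplace ψ (fun k => heatProfile N r k ^ 2), heatEnergy, ← mul_sub,
      ← Finset.sum_sub_distrib, Finset.mul_sum]
    convert h using 2
    push_cast
    ring
  have h1 := integral_eq_of_hasDerivAt hd (by have := continuous_heatEnergy ψ; fun_prop) t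
  rw [intervalIntegral.integral_sub, intervalIntegral.integral_const_mul,
    intervalIntegral.integral_const_mul] at h1
  · have h0 : ∑ k, ψ k * heatProfile N 0 k ^ 2 = ψ 0 := by
      simp [heatProfile_zero]
    rw [h0] at h1
    linarith
  · exact Continuous.intervalIntegrable (by fun_prop) _ _
  · exact Continuous.intervalIntegrable (by have := continuous_heatEnergy ψ; fun_prop) _ _

/-- The weight vanishes at `0` and its Laplacian is at most `2` at `0` and nonpositive elsewhere, so
only the squared return probability remains on the right. -/
theorem integral_heatEnergy_rpow_dist_le {γ : ℝ} (h0 : 0 < γ) (h1 : γ ≤ 1) {t : ℝ} (ht : 0 ≤ t) :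
    (1 / 2) * ∫ r in (0 : ℝ)..t, heatEnergy (fun k : ZMod N => (torusDist k 0 : ℝ) ^ γ) r
      ≤ ∫ r in (0 : ℝ)..t, heatProfile N r 0 ^ 2 := by
  have hc := continuous_heatProfile (N := N)
  rw [integral_heatEnergy]
  have e1 : ((torusDist (0 : ZMod N) 0 : ℝ)) ^ γ = 0 := by
    rw [torusDist_self]; simp [h0.ne']
  have e2 : 0 ≤ ∑ k : ZMod N, (torusDist k 0 : ℝ) ^ γ * heatProfile N t k ^ 2 :=
    Finset.sum_nonneg fun k _ => by positivity
  have e3 : ∫ r in (0 : ℝ)..t, ∑ k : ZMod N, heatProfile N r k ^ 2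
        * ((torusDist (k + 1) 0 : ℝ) ^ γ + (torusDist (k - 1) 0 : ℝ) ^ γ
          - 2 * (torusDist k 0 : ℝ) ^ γ) ≤ ∫ r in (0 : ℝ)..t, 2 * heatProfile N r 0 ^ 2 := by
    refine intervalIntegral.integral_mono_on ht ?_ ?_ fun r hr => ?_
    · exact Continuous.intervalIntegrable (by fun_prop) _ _
    · exact Continuous.intervalIntegrable (by fun_prop) _ _
    · calc _ ≤ ∑ k : ZMod N, heatProfile N r k ^ 2 * (if k = 0 then 2 else 0) :=
            Finset.sum_le_sum fun k _ =>
              mul_le_mul_of_nonneg_left (laplace_rpow_dist_le h0 h1 k) (sq_nonneg _)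
        _ = _ := by simp [mul_comm]
  rw [intervalIntegral.integral_const_mul] at e3
  rw [e1]
  linarith

/-- The kernel `∇p(t; x, y) ∇p(t; x - 1, y)`. -/
def heatGradProd (t : ℝ) (x y : ZMod N) : ℝ :=
  (heatKernel t (x + 1) y - heatKernel t x y) * (heatKernel t x y - heatKernel t (x - 1) y)

theorem heatGradProd_eq (t : ℝ) (x y : ZMod N) : heatGradProd t x y =
    (heatProfile N t (x - y + 1) - heatProfile N t (x - y))
      * (heatProfile N t (x - y) - heatProfile N t (x - y - 1)) := by
  simp only [heatGradProd, heatKernel_eq_profile, add_sub_right_comm, sub_right_comm]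

theorem continuous_heatGradProd (x y : ZMod N) : Continuous fun t => heatGradProd t x y := by
  unfold heatGradProd
  have := continuous_heatKernel (N := N)
  fun_prop

theorem sum_abs_heatGradProd_le (ψ : ZMod N → ℝ) (hψ : ∀ k, 0 ≤ ψ k) (t : ℝ) (x : ZMod N) :
    ∑ y, |heatGradProd t x y| * ψ (x - y) ≤ (1 / 2) * heatEnergy ψ t := by
  simp only [heatGradProd_eq]
  rw [sum_reflect (fun k => |(heatProfile N t (k + 1) - heatProfile N t k)
      * (heatProfile N t k - heatProfile N t (k - 1))| * ψ k) x, heatEnergy, Finset.mul_sum]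
  refine Finset.sum_le_sum fun k _ => ?_
  have := two_mul_le_add_sq |heatProfile N t (k + 1) - heatProfile N t k|
    |heatProfile N t k - heatProfile N t (k - 1)|
  rw [sq_abs, sq_abs] at this
  rw [abs_mul]
  nlinarith [hψ k]

/-- By symmetry and Chapman–Kolmogorov, `∑_y p(t;i,y) p(t;j,y)` is the profile at time `2t` at `i -
j`. The sum is thus minus the Laplacian at `1` of the profile at time `2t`. -/
theorem heatGradProd_sum_eq (t : ℝ) (x : ZMod N) : ∑ y, heatGradProd t x y =
    -(heatProfile N (t + t) 2 + heatProfile N (t + t) 0 - 2 * heatProfile N (t + t) 1) := by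
  have h : ∀ i j : ZMod N, ∑ y, heatKernel t i y * heatKernel t j y
      = heatProfile N (t + t) (i - j) := fun i j => by
    rw [← heatKernel_eq_profile, heatKernel_add]
    exact Finset.sum_congr rfl fun y _ => by rw [heatKernel_symm t j y]
  have e : ∑ y, heatGradProd t x y = ∑ y, heatKernel t (x + 1) y * heatKernel t x y
      - ∑ y, heatKernel t (x + 1) y * heatKernel t (x - 1) y
      - ∑ y, heatKernel t x y * heatKernel t x y + ∑ y, heatKernel t x y * heatKernel t (x - 1) y := by
    rw [← Finset.sum_sub_distrib, ← Finset.sum_sub_distrib, ← Finset.sum_add_distrib]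
    exact Finset.sum_congr rfl fun y _ => by rw [heatGradProd]; ring
  rw [e, h, h, h, h, show x + 1 - x = 1 by ring, show x + 1 - (x - 1) = 2 by ring,
    show x - x = 0 by ring, show x - (x - 1) = 1 by ring]
  ring

/-- The integrand is the exact time derivative of `-p(2t; 1)`, which vanishes at time zero. Although
the absolute integral is of order one, the signed one decays in `t`: this is the cancellation that
makes the `Z²` term harmless. -/
theorem integral_heatGradProd_sum (hN : 2 ≤ N) (t : ℝ) (x : ZMod N) :
    ∫ r in (0 : ℝ)..t, ∑ y, heatGradProd r x y = -heatProfile N (t + t) 1 := by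
  have hd : ∀ r, HasDerivAt (fun s => -heatProfile N (s + s) 1) (∑ y, heatGradProd r x y) r := by
    intro r
    have h := HasDerivAt.comp (h := fun s : ℝ => s + s) r
      (hasDerivAt_heatProfile (N := N) (r + r) 1) ((hasDerivAt_id' r).add (hasDerivAt_id' r))
    refine h.neg.congr_deriv ?_
    rw [heatGradProd_sum_eq, show (1 : ZMod N) + 1 = 2 by norm_num, sub_self]
    ring
  have hc := continuous_heatGradProd (N := N)
  rw [integral_eq_of_hasDerivAt hd (by fun_prop) t, add_zero, heatProfile_zero,
    if_neg (zmod_one_ne_zero hN)]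
  ring

/-- The walk has jump rate at most one, so it has not moved by time `t` with probability at least
`e^(-t)`. In matrix terms, `Δ/2 + 1` has nonnegative entries and the diagonal of its exponential is
at least one. -/
theorem exp_neg_le_heatProfile {t : ℝ} (ht : 0 ≤ t) : Real.exp (-t) ≤ heatProfile N t 0 := by
  have hM : (t • ((1 / 2 : ℝ) • laplacian N)) = t • (((1 / 2 : ℝ) • laplacian N
      + (1 : ℝ) • (1 : Matrix (ZMod N) (ZMod N) ℝ)) + (-1 : ℝ) • 1) := by
    congr 1; simp [add_assoc]
  have h0 : ∀ i j, 0 ≤ (t • ((1 / 2 : ℝ) • laplacian N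
      + (1 : ℝ) • (1 : Matrix (ZMod N) (ZMod N) ℝ))) i j := by
    intro i j
    refine mul_nonneg ht ?_
    simp only [Matrix.add_apply, Matrix.smul_apply, smul_eq_mul, Matrix.one_apply, laplacian_apply,
      eq_comm (a := j) (b := i)]
    split_ifs <;> norm_num
  have h1 := one_le_matrixExp_diag h0 (0 : ZMod N)
  have h2 : heatProfile N t 0 = Real.exp (-1 * t) * exp (t • ((1 / 2 : ℝ) • laplacian N
      + (1 : ℝ) • (1 : Matrix (ZMod N) (ZMod N) ℝ))) 0 0 := by
    change exp (t • ((1 / 2 : ℝ) • laplacian N)) (0 : ZMod N) 0 = _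
    rw [hM, matrixExp_add_scalar]
    rfl
  rw [h2, neg_one_mul]
  exact le_mul_of_one_le_right (Real.exp_pos _).le h1

/-- The total mass of `|∇p(t; x, y) ∇p(t; x - 1, y)|` is less than one, uniformly in `N`. -/
theorem integral_abs_heatGradProd_le (hN : 3 ≤ N) {t : ℝ} (ht : 0 ≤ t) (x : ZMod N) :
    ∫ r in (0 : ℝ)..t, ∑ y, |heatGradProd r x y| ≤ 1 - 1 / 200 := by
  have hc := continuous_heatProfile (N := N)
  have hcg := continuous_heatGradProd (N := N)
  have hce := continuous_heatEnergy (fun _ : ZMod N => (1 : ℝ))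
  have hN2 : (2 : ZMod N) ≠ 0 := by
    have h2 : ((2 : ℕ) : ZMod N) ≠ 0 := by
      rw [Ne, ZMod.natCast_eq_zero_iff]
      intro h
      have := Nat.le_of_dvd (by norm_num) h
      omega
    exact_mod_cast h2
  have hN1 := zmod_one_ne_zero (N := N) (by omega)
  have h12 : (2 : ZMod N) ≠ 1 := fun h => hN1 (by
    have : (1 : ZMod N) + 1 = 1 := (show (1 : ZMod N) + 1 = 2 by norm_num).trans h
    simpa using this)
  -- The identity `|AB| = (A² + B²)/2 - (|A| - |B|)²/2` turns the sum into the energy minus a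
  -- nonnegative deficit. Only the deficit at `k = 1` is kept.
  have pw : ∀ r, ∑ y, |heatGradProd r x y| ≤ (1 / 2) * heatEnergy (fun _ : ZMod N => (1 : ℝ)) r
      - (1 / 2) * (|heatProfile N r 2 - heatProfile N r 1|
        - |heatProfile N r 1 - heatProfile N r 0|) ^ 2 := by
    intro r
    simp only [heatGradProd_eq]
    rw [sum_reflect (fun k => |(heatProfile N r (k + 1) - heatProfile N r k)
      * (heatProfile N r k - heatProfile N r (k - 1))|) x, heatEnergy, Finset.mul_sum]
    have e : ∀ k : ZMod N, |(heatProfile N r (k + 1) - heatProfile N r k)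
        * (heatProfile N r k - heatProfile N r (k - 1))|
        = (1 / 2) * ((1 : ℝ) * ((heatProfile N r (k + 1) - heatProfile N r k) ^ 2
          + (heatProfile N r k - heatProfile N r (k - 1)) ^ 2))
          - (1 / 2) * (|heatProfile N r (k + 1) - heatProfile N r k|
            - |heatProfile N r k - heatProfile N r (k - 1)|) ^ 2 := by
      intro k
      rw [abs_mul, ← sq_abs (heatProfile N r (k + 1) - heatProfile N r k),
        ← sq_abs (heatProfile N r k - heatProfile N r (k - 1))]
      ring
    rw [Finset.sum_congr rfl fun k _ => e k, Finset.sum_sub_distrib]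
    have := Finset.single_le_sum (f := fun k : ZMod N =>
      (1 / 2) * (|heatProfile N r (k + 1) - heatProfile N r k|
            - |heatProfile N r k - heatProfile N r (k - 1)|) ^ 2)
      (fun k _ => by positivity) (Finset.mem_univ 1)
    simp only [sub_self, show (1 : ZMod N) + 1 = 2 by norm_num] at this
    linarith
  -- For `r ≤ 1/4` the walk is at `0` with probability at least `3/4`, so the sites `1` and `2`,
  -- distinct from `0` and from each other because `N ≥ 3`, share mass at most `1/4`. The two
  -- gradients around site `1` then differ in modulus by at least `1/4`.
  have gap : ∀ r : ℝ, 0 ≤ r → r ≤ 1 / 4 → (1 : ℝ) / 32 ≤ (1 / 2) * (|heatProfile N r 2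
      - heatProfile N r 1| - |heatProfile N r 1 - heatProfile N r 0|) ^ 2 := by
    intro r h0 h1
    have g0 := exp_neg_le_heatProfile (N := N) h0
    have g1 := Real.add_one_le_exp (-r)
    have hsum := sum_heatProfile (N := N) r
    have g2 : heatProfile N r 0 + heatProfile N r 1 + heatProfile N r 2 ≤ 1 := by
      rw [← hsum]
      have := Finset.sum_le_sum_of_subset_of_nonneg (Finset.subset_univ {(0 : ZMod N), 1, 2})
        (f := heatProfile N r) fun k _ _ => heatProfile_nonneg h0 k
      rw [Finset.sum_insert (by simp [hN1.symm, hN2.symm]), Finset.sum_insert (by simp [h12.symm]),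
        Finset.sum_singleton] at this
      linarith
    have p1 := heatProfile_nonneg (N := N) h0 1
    have p2 := heatProfile_nonneg (N := N) h0 2
    have a1 : |heatProfile N r 2 - heatProfile N r 1| ≤ 1 / 4 := by
      rw [abs_le]; constructor <;> linarith
    have a2 : (1 : ℝ) / 2 ≤ |heatProfile N r 1 - heatProfile N r 0| := by
      rw [abs_sub_comm]
      exact le_trans (by linarith) (le_abs_self _)
    nlinarith
  -- With weight `ψ = 1` the energy identity gives `1 - ∑ p²`, which is at most one.
  have main : ∀ s : ℝ, 0 ≤ s → ∫ r in (0 : ℝ)..s, ∑ y, |heatGradProd r x y|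
      ≤ 1 - ∫ r in (0 : ℝ)..s, (1 / 2) * (|heatProfile N r 2 - heatProfile N r 1|
        - |heatProfile N r 1 - heatProfile N r 0|) ^ 2 := by
    intro s hs
    have h1 := intervalIntegral.integral_mono_on (μ := volume) hs
      (f := fun r => ∑ y, |heatGradProd r x y|)
      (g := fun r => (1 / 2) * heatEnergy (fun _ : ZMod N => (1 : ℝ)) r
        - (1 / 2) * (|heatProfile N r 2 - heatProfile N r 1|
        - |heatProfile N r 1 - heatProfile N r 0|) ^ 2)
      (Continuous.intervalIntegrable (by fun_prop) _ _)
      (Continuous.intervalIntegrable (by fun_prop) _ _) fun r _ => pw r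
    rw [intervalIntegral.integral_sub (Continuous.intervalIntegrable (by fun_prop) _ _)
      (Continuous.intervalIntegrable (by fun_prop) _ _),
      intervalIntegral.integral_const_mul, integral_heatEnergy] at h1
    have h2 : 0 ≤ ∑ k, (1 : ℝ) * heatProfile N s k ^ 2 :=
      Finset.sum_nonneg fun k _ => by positivity
    simp only [show (1 : ℝ) + 1 - 2 * 1 = 0 by norm_num, mul_zero, Finset.sum_const_zero,
      intervalIntegral.integral_zero, add_zero] at h1
    linarith
  -- Enlarging the time to at least `1/4` collects the full deficit `(1/4)(1/32) = 1/128`, which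
  -- exceeds `1/200`.
  set t' := max t (1 / 4) with ht'
  have hmono : ∫ r in (0 : ℝ)..t, ∑ y, |heatGradProd r x y|
      ≤ ∫ r in (0 : ℝ)..t', ∑ y, |heatGradProd r x y| :=
    intervalIntegral.integral_mono_interval le_rfl ht (le_max_left _ _)
      (Filter.Eventually.of_forall fun r => Finset.sum_nonneg fun y _ => abs_nonneg _)
      (Continuous.intervalIntegrable (by fun_prop) _ _)
  have hgap : (1 : ℝ) / 200 ≤ ∫ r in (0 : ℝ)..t', (1 / 2) * (|heatProfile N r 2
      - heatProfile N r 1| - |heatProfile N r 1 - heatProfile N r 0|) ^ 2 := by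
    have e1 : ∫ r in (0 : ℝ)..(1 / 4), (1 / 2) * (|heatProfile N r 2
      - heatProfile N r 1| - |heatProfile N r 1 - heatProfile N r 0|) ^ 2
      ≤ ∫ r in (0 : ℝ)..t', (1 / 2) * (|heatProfile N r 2
      - heatProfile N r 1| - |heatProfile N r 1 - heatProfile N r 0|) ^ 2 :=
      intervalIntegral.integral_mono_interval le_rfl (by norm_num) (le_max_right _ _)
      (Filter.Eventually.of_forall fun r => by positivity)
      (Continuous.intervalIntegrable (by fun_prop) _ _)
    have e2 : ∫ _ in (0 : ℝ)..(1 / 4), (1 : ℝ) / 32 ≤ ∫ r in (0 : ℝ)..(1 / 4), (1 / 2) *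
      (|heatProfile N r 2 - heatProfile N r 1| - |heatProfile N r 1 - heatProfile N r 0|) ^ 2 :=
      intervalIntegral.integral_mono_on (by norm_num) (by simp)
        (Continuous.intervalIntegrable (by fun_prop) _ _) fun r hr => gap r hr.1 hr.2
    rw [intervalIntegral.integral_const] at e2
    norm_num at e2 ⊢
    norm_num at e1
    linarith
  have := main t' (le_max_of_le_left ht)
  linarith

end Heat

end InhomASEP

/-! ## Kernel estimates on the good event -/

namespace InhomASEP

section KernelBounds

variable {N : ℕ} [NeZero N]

theorem semigroupKernel_nonneg {a : ZMod N → ℝ} (ha : ∀ x, 0 ≤ a x) {t : ℝ} (ht : 0 ≤ t)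
    (x y : ZMod N) : 0 ≤ semigroupKernel a t x y := by
  refine matrixExp_nonneg (fun i j hij => ?_) ht x y
  simp only [hamiltonian, Matrix.of_apply, if_neg hij.symm, sub_zero]
  exact mul_nonneg (mul_nonneg (Real.sqrt_nonneg _) (ha i)) (laplacian_nonneg_of_ne hij)

theorem semigroupKernel_zero (a : ZMod N → ℝ) (x y : ZMod N) :
    semigroupKernel a 0 x y = if x = y then 1 else 0 := by
  simp [semigroupKernel, Matrix.one_apply]

theorem continuous_semigroupKernel (a : ZMod N → ℝ) (x y : ZMod N) :
    Continuous fun t => semigroupKernel a t x y :=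
  continuous_matrixExp_entry _ x y

theorem semigroupKernel_eq_add (a : ZMod N → ℝ) (t : ℝ) (x y : ZMod N) :
    semigroupKernel a t x y = heatKernel t x y + remainderKernel a t x y := by
  rw [remainderKernel]; ring

/-- A probability density on the torus with small increments is small. -/
theorem le_of_sum_le_one_of_increments {f : ZMod N → ℝ} (hf : ∀ k, 0 ≤ f k) (hs : ∑ k, f k ≤ 1)
    {D : ℝ} (hD : ∀ k, |f (k + 1) - f k| ≤ D) {n : ℕ} (hn : 1 ≤ n) (hnN : n ≤ N) (k : ZMod N) :
    f k ≤ 1 / n + n * D := by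
  have hD0 : 0 ≤ D := (abs_nonneg _).trans (hD 0)
  have h1 : ∀ j : ℕ, f k ≤ f (k + j) + j * D := by
    intro j
    induction j with
    | zero => simp
    | succ j ih =>
      have := (abs_le.1 (hD (k + j))).1
      push_cast
      rw [← add_assoc]
      linarith
  have h2 : ∑ j ∈ Finset.range n, f (k + (j : ZMod N)) ≤ 1 := by
    refine le_trans ?_ hs
    rw [← Finset.sum_image (f := f) (g := fun j : ℕ => k + (j : ZMod N))]
    · exact Finset.sum_le_sum_of_subset_of_nonneg (Finset.subset_univ _) fun i _ _ => hf i
    · intro i hi j hj hij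
      simp only [Finset.coe_range, Set.mem_Iio] at hi hj
      have h3 : (i : ZMod N) = j := add_left_cancel hij
      have h4 := congrArg ZMod.val h3
      rwa [ZMod.val_natCast_of_lt (by omega), ZMod.val_natCast_of_lt (by omega)] at h4
  -- The bound `f k ≤ f (k + j) + n D` is averaged over the `n` distinct sites `k, …, k + n - 1`,
  -- whose total mass is at most one.
  have h3 : ∑ _j ∈ Finset.range n, f k ≤ ∑ j ∈ Finset.range n, (f (k + (j : ZMod N)) + n * D) := by
    refine Finset.sum_le_sum fun j hj => (h1 j).trans ?_
    have : (j : ℝ) ≤ n := by exact_mod_cast (Finset.mem_range.1 hj).le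
    gcongr
  rw [Finset.sum_add_distrib, Finset.sum_const, Finset.sum_const, Finset.card_range,
    nsmul_eq_mul, nsmul_eq_mul] at h3
  have hn0 : (0 : ℝ) < n := by exact_mod_cast hn
  rw [← mul_le_mul_iff_right₀ hn0]
  calc (n : ℝ) * f k ≤ 1 + n * (n * D) := by linarith
    _ = n * (1 / n + n * D) := by field_simp

theorem torusDist_rpow_nonneg (x y : ZMod N) (u : ℝ) : 0 ≤ (torusDist x y : ℝ) ^ u := by positivity

/-- The kernel estimates used below; `K` is a common constant. -/
structure KernelBounds (u β K T : ℝ) (a : ZMod N → ℝ) : Prop where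
  env_nonneg : ∀ x, 0 ≤ a x
  env_le : ∀ x, a x ≤ K
  env_sub_le : ∀ x, |a x - 1| ≤ K * (N : ℝ) ^ (-β)
  sum_le : ∀ t : ℝ, 0 ≤ t → t ≤ (N : ℝ) ^ 2 * T → ∀ x, ∑ y, semigroupKernel a t x y ≤ K
  sup_le : ∀ t : ℝ, 0 ≤ t → t ≤ (N : ℝ) ^ 2 * T → ∀ x y,
    semigroupKernel a t x y ≤ K * (1 + t) ^ (-(1 / 2) : ℝ)
  diff_le : ∀ t : ℝ, 0 ≤ t → t ≤ (N : ℝ) ^ 2 * T → ∀ x x' y,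
    |semigroupKernel a t x y - semigroupKernel a t x' y|
      ≤ K * (torusDist x x' : ℝ) ^ u * (1 + t) ^ (-((u + 1) / 2))
  grad_le : ∀ t : ℝ, 0 ≤ t → t ≤ (N : ℝ) ^ 2 * T → ∀ x y,
    |semigroupKernel a t (x + 1) y - semigroupKernel a t x y| ≤ K * (1 + t) ^ (-1 : ℝ)
  grad_sum_le : ∀ t : ℝ, 0 ≤ t → t ≤ (N : ℝ) ^ 2 * T → ∀ x,
    ∑ y, |semigroupKernel a t (x + 1) y - semigroupKernel a t x y| ≤ K * (1 + t) ^ (-(1 / 2) : ℝ)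
  rem_sum_le : ∀ t : ℝ, 0 ≤ t → t ≤ (N : ℝ) ^ 2 * T → ∀ x,
    ∑ y, |remainderKernel a t x y| ≤ K * (N : ℝ) ^ (-β) * (1 + t) ^ (u / 2)
  rem_diff_sum_le : ∀ t : ℝ, 0 ≤ t → t ≤ (N : ℝ) ^ 2 * T → ∀ x x',
    ∑ y, |remainderKernel a t x y - remainderKernel a t x' y|
      ≤ K * (N : ℝ) ^ (-β) * (torusDist x x' : ℝ) ^ u
  rem_grad_sum_le : ∀ t : ℝ, 0 ≤ t → t ≤ (N : ℝ) ^ 2 * T → ∀ x,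
    ∑ y, |remainderKernel a t (x + 1) y - remainderKernel a t x y|
      ≤ K * (N : ℝ) ^ (-β) * (1 + t) ^ (-(1 / 4) : ℝ)
  heat_sup_le : ∀ t : ℝ, 0 ≤ t → t ≤ (N : ℝ) ^ 2 * T → ∀ x y : ZMod N,
    heatKernel t x y ≤ K * (1 + t) ^ (-(1 / 2) : ℝ)
  heat_grad_le : ∀ t : ℝ, 0 ≤ t → t ≤ (N : ℝ) ^ 2 * T → ∀ x y : ZMod N,
    |heatKernel t (x + 1) y - heatKernel t x y| ≤ K * (1 + t) ^ (-1 : ℝ)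
  heat_grad_sum_le : ∀ t : ℝ, 0 ≤ t → t ≤ (N : ℝ) ^ 2 * T → ∀ x : ZMod N,
    ∑ y, |heatKernel t (x + 1) y - heatKernel t x y| ≤ K * (1 + t) ^ (-(1 / 2) : ℝ)

/-- At time zero the kernel is the identity, with row sums one. -/
theorem GoodEnvironment.one_le {w u v Λ T : ℝ} {a : ZMod N → ℝ} (h : GoodEnvironment w u v Λ T a)
    (hT : 0 ≤ T) : 1 ≤ Λ := by
  have := h.sum_le 0 le_rfl (by positivity) 0
  simpa [semigroupKernel_zero] using this

/-- The Hölder bound on `partialSum` is applied to the interval `(x - 1, x]`, which contains the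
single site `x`. -/
theorem GoodEnvironment.env_sub_le {w u v Λ T : ℝ} {a : ZMod N → ℝ}
    (h : GoodEnvironment w u v Λ T a) (hN : 2 ≤ N) (x : ZMod N) :
    |a x - 1| ≤ 2 * Λ * (N : ℝ) ^ (-w) := by
  have h1 := (le_ciSup (f := fun p : ZMod N × ZMod N =>
    |partialSum a p.1 p.2| / ((arc p.1 p.2 : ℝ) / N) ^ w) (Set.finite_range _).bddAbove
    (x - 1, x)).trans h.holder_le
  have : Fact (1 < N) := ⟨hN⟩
  have e1 : arc (x - 1) x = 1 := by
    rw [arc, sub_sub_cancel, ZMod.val_one]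
  have hN0 : (0 : ℝ) < N := by positivity
  simp only [e1, partialSum, Finset.range_one, Finset.sum_singleton, Nat.cast_zero, add_zero,
    sub_add_cancel, Nat.cast_one] at h1
  rw [abs_mul, div_le_iff₀ (by positivity), one_div (N : ℝ), Real.inv_rpow hN0.le,
    ← Real.rpow_neg hN0.le] at h1
  norm_num at h1
  linarith

set_option maxHeartbeats 1600000 in
-- Two mechanisms are at work. Up to times `N² T` a factor `N^(-2γ)` can be traded for `(1 +
-- t)^(-γ)`, and bounds on the gradient of `p` follow from those on `q` and `ρ` because `p = q - ρ`.
-- In the constant, `7 Λ (T+1)` comes from the pointwise bound on `p`, `Λ (T+1)^(v/2)` from the row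
-- sums of `ρ`, and `c` from the environment.
theorem kernelBounds_of_good {w u v β Λ T c : ℝ} (hN : 2 ≤ N) (hT : 0 ≤ T) (hu : 0 ≤ u)
    (hu1 : u ≤ 1) (hvw : v ≤ w) (hβ : 0 ≤ β) (hβv : β ≤ v) (hβu : β ≤ u / 2) {a : ZMod N → ℝ}
    (ha : ∀ x, 0 ≤ a x) (hac : ∀ x, a x ≤ c) (hg : GoodEnvironment w u v Λ T a)
    (hg1 : GoodEnvironment w 1 v Λ T a) :
    KernelBounds u β (7 * Λ * (T + 1) + Λ * (T + 1) ^ (v / 2) + c) T a := by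
  have hΛ := hg.one_le hT
  have hc : 0 ≤ c := (ha 0).trans (hac 0)
  have hN0 : (0 : ℝ) < N := by positivity
  have hN1 : (1 : ℝ) ≤ N := by exact_mod_cast (by omega : 1 ≤ N)
  set K := 7 * Λ * (T + 1) + Λ * (T + 1) ^ (v / 2) + c with hK
  have hTv : 0 ≤ Λ * (T + 1) ^ (v / 2) := by positivity
  have hΛT : Λ ≤ Λ * (T + 1) := le_mul_of_one_le_right (by linarith) (by linarith)
  have hK7 : 7 * (Λ * (T + 1)) ≤ K := by rw [hK]; linarith
  have hKΛ : Λ ≤ K := by linarith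
  have hNβv : (N : ℝ) ^ (-v) ≤ (N : ℝ) ^ (-β) := Real.rpow_le_rpow_of_exponent_le hN1 (by linarith)
  have hNv1 : (N : ℝ) ^ (-v) ≤ 1 := Real.rpow_le_one_of_one_le_of_nonpos hN1 (by linarith)
  have hNβ0 : 0 < (N : ℝ) ^ (-β) := by positivity
  have ht1 : ∀ t : ℝ, 0 ≤ t → t ≤ (N : ℝ) ^ 2 * T → 1 + t ≤ (N : ℝ) ^ 2 * (T + 1) := by
    intro t _ h
    nlinarith
  have hNinv : ∀ γ : ℝ, 0 ≤ γ → γ ≤ 1 → ∀ t : ℝ, 0 ≤ t → t ≤ (N : ℝ) ^ 2 * T →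
      (N : ℝ) ^ (-(2 * γ)) ≤ (T + 1) * (1 + t) ^ (-γ) := by
    intro γ h0 h1 t ht htT
    have e1 : ((N : ℝ) ^ 2 * (T + 1)) ^ (-γ) ≤ (1 + t) ^ (-γ) :=
      Real.rpow_le_rpow_of_nonpos (by linarith) (ht1 t ht htT) (by linarith)
    rw [Real.mul_rpow (by positivity) (by linarith), ← Real.rpow_natCast, ← Real.rpow_mul hN0.le]
      at e1
    have e2 : (1 : ℝ) ≤ (T + 1) * (T + 1) ^ (-γ) := by
      have : (T + 1) * (T + 1) ^ (-γ) = (T + 1) ^ (1 + -γ) := by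
        rw [Real.rpow_add (by linarith), Real.rpow_one]
      rw [this]
      exact Real.one_le_rpow (by linarith) (by linarith)
    have e3 : (((2 : ℕ) : ℝ) * -γ) = -(2 * γ) := by push_cast; ring
    rw [e3] at e1
    have e4 : 0 < (N : ℝ) ^ (-(2 * γ)) := by positivity
    nlinarith
  have hone : ∀ x : ZMod N, (torusDist (x + 1) x : ℝ) = 1 := fun x => by
    rw [torusDist_succ_self hN]; norm_num
  have hpos : ∀ t : ℝ, 0 ≤ t → ∀ γ : ℝ, 0 < (1 + t) ^ γ := fun t ht γ => by positivity
  have hNm1 : (N : ℝ) ^ (-(2 * (1 / 2)) : ℝ) = 1 / N := by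
    norm_num [Real.rpow_neg_one]
  have grad_le : ∀ t : ℝ, 0 ≤ t → t ≤ (N : ℝ) ^ 2 * T → ∀ x y,
      |semigroupKernel a t (x + 1) y - semigroupKernel a t x y| ≤ Λ * (1 + t) ^ (-1 : ℝ) := by
    intro t ht htT x y
    have := hg1.grad_sup_le t ht htT (x + 1) x y
    rw [hone, Real.one_rpow, add_comm t 1, show ((1 : ℝ) + 1) / 2 = 1 by norm_num, one_div,
      ← Real.rpow_neg (by linarith)] at this
    linarith
  have grad_sum_le : ∀ t : ℝ, 0 ≤ t → t ≤ (N : ℝ) ^ 2 * T → ∀ x,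
      ∑ y, |semigroupKernel a t (x + 1) y - semigroupKernel a t x y|
        ≤ Λ * (1 + t) ^ (-(1 / 2) : ℝ) := by
    intro t ht htT x
    have := hg1.grad_sum_le t ht htT (x + 1) x
    rw [hone, Real.one_rpow, add_comm t 1, one_div ((1 + t) ^ (1 / 2 : ℝ)),
      ← Real.rpow_neg (by linarith)] at this
    linarith
  have rem_grad_sum : ∀ t : ℝ, 0 ≤ t → t ≤ (N : ℝ) ^ 2 * T → ∀ x,
      ∑ y, |remainderKernel a t (x + 1) y - remainderKernel a t x y|
        ≤ ((1 + t) ^ (-(1 / 2) : ℝ) * (N : ℝ) ^ (-v) + 1 / N) * Λ := by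
    intro t ht htT x
    have := hg1.rem_grad_sum_le t ht htT (x + 1) x
    rwa [hone, Real.one_rpow, one_div ((1 + t) ^ (1 / 2 : ℝ)), Real.rpow_one,
      ← Real.rpow_neg (by linarith)] at this
  have rem_grad : ∀ t : ℝ, 0 ≤ t → t ≤ (N : ℝ) ^ 2 * T → ∀ x y,
      |remainderKernel a t (x + 1) y - remainderKernel a t x y|
        ≤ ((1 + t) ^ (-1 : ℝ) * (N : ℝ) ^ (-v) + 1 / N * (1 + t) ^ (-(1 / 2) : ℝ)) * Λ := by
    intro t ht htT x y
    have := hg1.rem_grad_sup_le t ht htT (x + 1) x y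
    rwa [hone, Real.one_rpow, show ((1 : ℝ) + 1) / 2 = 1 by norm_num,
      one_div ((1 + t) ^ (1 : ℝ)), Real.rpow_one (1 / (N : ℝ)),
      div_eq_mul_inv (1 / (N : ℝ)) ((1 + t) ^ (1 / 2 : ℝ)),
      ← Real.rpow_neg (by linarith), ← Real.rpow_neg (by linarith)] at this
  have heat_grad : ∀ t : ℝ, 0 ≤ t → t ≤ (N : ℝ) ^ 2 * T → ∀ x y : ZMod N,
      |heatKernel t (x + 1) y - heatKernel t x y| ≤ 3 * (Λ * (T + 1)) * (1 + t) ^ (-1 : ℝ) := by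
    intro t ht htT x y
    have h1 := grad_le t ht htT x y
    have h2 := rem_grad t ht htT x y
    have h3 := hNinv (1 / 2) (by norm_num) (by norm_num) t ht htT
    rw [hNm1] at h3
    have e : heatKernel t (x + 1) y - heatKernel t x y
        = (semigroupKernel a t (x + 1) y - semigroupKernel a t x y)
          - (remainderKernel a t (x + 1) y - remainderKernel a t x y) := by
      rw [remainderKernel, remainderKernel]; ring
    have e2 : (1 + t) ^ (-1 : ℝ) = (1 + t) ^ (-(1 / 2) : ℝ) * (1 + t) ^ (-(1 / 2) : ℝ) := by
      rw [← Real.rpow_add (by linarith)]; norm_num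
    have p1 := hpos t ht (-1)
    have p2 := hpos t ht (-(1 / 2))
    have h4 : 1 / N * (1 + t) ^ (-(1 / 2) : ℝ) ≤ (T + 1) * (1 + t) ^ (-1 : ℝ) := by
      rw [e2, ← mul_assoc]; gcongr
    have h5 : (1 + t) ^ (-1 : ℝ) * (N : ℝ) ^ (-v) ≤ (T + 1) * (1 + t) ^ (-1 : ℝ) := by
      nlinarith
    have h6 := mul_le_mul_of_nonneg_right (add_le_add h5 h4) (by linarith : 0 ≤ Λ)
    rw [e]
    refine (abs_sub _ _).trans ?_
    nlinarith
  have heat_grad_sum : ∀ t : ℝ, 0 ≤ t → t ≤ (N : ℝ) ^ 2 * T → ∀ x : ZMod N,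
      ∑ y, |heatKernel t (x + 1) y - heatKernel t x y|
        ≤ 3 * (Λ * (T + 1)) * (1 + t) ^ (-(1 / 2) : ℝ) := by
    intro t ht htT x
    have h1 := grad_sum_le t ht htT x
    have h2 := rem_grad_sum t ht htT x
    have h3 := hNinv (1 / 2) (by norm_num) (by norm_num) t ht htT
    rw [hNm1] at h3
    have p2 := hpos t ht (-(1 / 2))
    have h5 : (1 + t) ^ (-(1 / 2) : ℝ) * (N : ℝ) ^ (-v) ≤ (T + 1) * (1 + t) ^ (-(1 / 2) : ℝ) := by
      nlinarith
    have h6 := mul_le_mul_of_nonneg_right (add_le_add h5 h3) (by linarith : 0 ≤ Λ)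
    have h7 : ∑ y, |heatKernel t (x + 1) y - heatKernel t x y|
        ≤ ∑ y, |semigroupKernel a t (x + 1) y - semigroupKernel a t x y|
          + ∑ y, |remainderKernel a t (x + 1) y - remainderKernel a t x y| := by
      rw [← Finset.sum_add_distrib]
      refine Finset.sum_le_sum fun y _ => ?_
      have e : heatKernel t (x + 1) y - heatKernel t x y
        = (semigroupKernel a t (x + 1) y - semigroupKernel a t x y)
          - (remainderKernel a t (x + 1) y - remainderKernel a t x y) := by
        rw [remainderKernel, remainderKernel]; ring
      rw [e]
      exact abs_sub _ _
    refine h7.trans ?_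
    nlinarith
  refine ⟨ha, fun x => (hac x).trans (by rw [hK]; nlinarith), fun x => ?_, fun t ht htT x =>
    (hg.sum_le t ht htT x).trans hKΛ, fun t ht htT x y => ?_, fun t ht htT x x' y => ?_,
    fun t ht htT x y => (grad_le t ht htT x y).trans (by have := hpos t ht (-1); gcongr),
    fun t ht htT x => (grad_sum_le t ht htT x).trans
      (by have := hpos t ht (-(1 / 2)); gcongr), fun t ht htT x => ?_,
    fun t ht htT x x' => ?_, fun t ht htT x => ?_, fun t ht htT x y => ?_, fun t ht htT x y =>
    (heat_grad t ht htT x y).trans (by have := hpos t ht (-1); gcongr; linarith),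
    fun t ht htT x => (heat_grad_sum t ht htT x).trans
      (by have := hpos t ht (-(1 / 2)); gcongr; linarith)⟩
  · refine (hg.env_sub_le hN x).trans ?_
    have h1 : (N : ℝ) ^ (-w) ≤ (N : ℝ) ^ (-β) :=
      Real.rpow_le_rpow_of_exponent_le hN1 (by linarith)
    have h2 : 0 < (N : ℝ) ^ (-w) := by positivity
    have h3 : 2 * Λ ≤ K := by linarith
    gcongr
  · have := hg.sup_le t ht htT x y
    rw [Real.sqrt_eq_rpow, add_comm t 1, div_eq_mul_inv, ← Real.rpow_neg (by linarith)] at this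
    have p := hpos t ht (-(1 / 2))
    exact this.trans (by gcongr)
  · have := hg.grad_sup_le t ht htT x x' y
    rw [add_comm t 1, div_eq_mul_inv, ← Real.rpow_neg (by linarith)] at this
    have p := hpos t ht (-((u + 1) / 2))
    have p2 := torusDist_rpow_nonneg x x' u
    calc _ ≤ _ := this
      _ = Λ * (torusDist x x' : ℝ) ^ u * (1 + t) ^ (-((u + 1) / 2)) := by ring
      _ ≤ _ := by gcongr
  · refine (hg.rem_sum_le t ht htT x).trans ?_
    -- A rescaled time in `(0, 1]`, so that lowering the exponent from `v/2` to `β/2` only increases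
    -- the power. At `β` the factor `N^(-β)` splits off exactly.
    set y := (1 + t) / ((N : ℝ) ^ 2 * (T + 1)) with hy
    have hy0 : 0 < y := by positivity
    have hy1 : y ≤ 1 := by
      rw [hy, div_le_one (by positivity)]; exact ht1 t ht htT
    have h1 : (t / (N : ℝ) ^ 2) ^ (v / 2) ≤ (T + 1) ^ (v / 2) * y ^ (v / 2) := by
      rw [← Real.mul_rpow (by linarith) hy0.le]
      refine Real.rpow_le_rpow (by positivity) ?_ (by linarith)
      rw [hy]
      have : (T + 1) * ((1 + t) / ((N : ℝ) ^ 2 * (T + 1))) = (1 + t) / (N : ℝ) ^ 2 := by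
        field_simp
      rw [this]
      gcongr
      linarith
    have h2 : y ^ (v / 2) ≤ y ^ (β / 2) :=
      Real.rpow_le_rpow_of_exponent_ge hy0 hy1 (by linarith)
    have h3 : y ^ (β / 2) ≤ (N : ℝ) ^ (-β) * (1 + t) ^ (u / 2) := by
      have e1 : y ≤ ((N : ℝ) ^ (-2 : ℝ)) * (1 + t) := by
        rw [hy, div_eq_mul_inv, mul_comm, Real.rpow_neg hN0.le, Real.rpow_two]
        gcongr
        exact le_mul_of_one_le_right (by positivity) (by linarith)
      have e2 := Real.rpow_le_rpow hy0.le e1 (by linarith : 0 ≤ β / 2)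
      rw [Real.mul_rpow (by positivity) (by linarith), ← Real.rpow_mul hN0.le,
        show (-2 : ℝ) * (β / 2) = -β by ring] at e2
      refine e2.trans ?_
      gcongr
      · linarith
      · linarith
    calc (t / (N : ℝ) ^ 2) ^ (v / 2) * Λ
        ≤ ((T + 1) ^ (v / 2) * ((N : ℝ) ^ (-β) * (1 + t) ^ (u / 2))) * Λ := by
          have := h2.trans h3
          have := mul_le_mul_of_nonneg_left this (by positivity : 0 ≤ (T + 1) ^ (v / 2))
          have := h1.trans this
          gcongr
      _ = (Λ * (T + 1) ^ (v / 2)) * (N : ℝ) ^ (-β) * (1 + t) ^ (u / 2) := by ring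
      _ ≤ _ := by
        have := hpos t ht (u / 2)
        have : Λ * (T + 1) ^ (v / 2) ≤ K := by rw [hK]; nlinarith
        gcongr
  · refine (hg.rem_grad_sum_le t ht htT x x').trans ?_
    have p2 := torusDist_rpow_nonneg x x' u
    have h1 : (torusDist x x' : ℝ) ^ u / (1 + t) ^ (u / 2) ≤ (torusDist x x' : ℝ) ^ u :=
      div_le_self p2 (Real.one_le_rpow (by linarith) (by linarith))
    have h2 : ((torusDist x x' : ℝ) / N) ^ u ≤ (torusDist x x' : ℝ) ^ u * (N : ℝ) ^ (-β) := by
      rw [Real.div_rpow (by positivity) hN0.le, div_eq_mul_inv, ← Real.rpow_neg hN0.le]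
      gcongr
      linarith
    have h3 : (torusDist x x' : ℝ) ^ u / (1 + t) ^ (u / 2) * (N : ℝ) ^ (-v)
        ≤ (torusDist x x' : ℝ) ^ u * (N : ℝ) ^ (-β) := by gcongr
    have h4 := mul_le_mul_of_nonneg_right (add_le_add h3 h2) (by linarith : 0 ≤ Λ)
    have h5 : 2 * Λ ≤ K := by linarith
    calc _ ≤ _ := h4
      _ = (2 * Λ) * (N : ℝ) ^ (-β) * (torusDist x x' : ℝ) ^ u := by ring
      _ ≤ _ := by gcongr
  · refine (rem_grad_sum t ht htT x).trans ?_
    -- The term `1/N` splits as `N^(-1/2) N^(-1/2)`: one half is at most `N^(-β)` because `β ≤ u/2 ≤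
    -- 1/2`, the other is traded for `(1 + t)^(-1/4)`. This is where the exponent `1/4` originates.
    have h1 := hNinv (1 / 4) (by norm_num) (by norm_num) t ht htT
    have h2 : 1 / (N : ℝ) ≤ (N : ℝ) ^ (-β) * (N : ℝ) ^ (-(2 * (1 / 4)) : ℝ) := by
      rw [← Real.rpow_add hN0, one_div, ← Real.rpow_neg_one]
      exact Real.rpow_le_rpow_of_exponent_le hN1 (by linarith)
    have h3 : (1 + t) ^ (-(1 / 2) : ℝ) ≤ (1 + t) ^ (-(1 / 4) : ℝ) :=
      Real.rpow_le_rpow_of_exponent_le (by linarith) (by norm_num)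
    have p := hpos t ht (-(1 / 4))
    have p2 := hpos t ht (-(1 / 2))
    have h4 : 1 / (N : ℝ) ≤ (T + 1) * ((N : ℝ) ^ (-β) * (1 + t) ^ (-(1 / 4) : ℝ)) := by
      refine h2.trans ?_
      have := mul_le_mul_of_nonneg_left h1 hNβ0.le
      linarith
    have h5 : (1 + t) ^ (-(1 / 2) : ℝ) * (N : ℝ) ^ (-v)
        ≤ (N : ℝ) ^ (-β) * (1 + t) ^ (-(1 / 4) : ℝ) := by
      rw [mul_comm]; gcongr
    set q := (N : ℝ) ^ (-β) * (1 + t) ^ (-(1 / 4) : ℝ) with hq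
    have hq0 : 0 < q := by positivity
    have h6 := mul_le_mul_of_nonneg_right (add_le_add h5 h4) (by linarith : 0 ≤ Λ)
    have h7 : Λ + Λ * (T + 1) ≤ K := by linarith
    calc _ ≤ _ := h6
      _ = (Λ + Λ * (T + 1)) * q := by ring
      _ ≤ K * q := by gcongr
      _ = _ := by rw [hq]; ring
  · rw [heatKernel_eq_profile]
    -- The averaging window has length of order `√(1 + t)`, which balances `1/n` against `n D` with
    -- `D` of order `1/(1 + t)`. Dividing by `T + 1` keeps it no longer than the torus.
    set z := √((1 + t) / (T + 1)) with hz
    have hz0 : 0 < z := Real.sqrt_pos.2 (by positivity)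
    have hzN : z ≤ N := by
      rw [hz, Real.sqrt_le_left hN0.le, div_le_iff₀ (by linarith)]
      exact ht1 t ht htT
    have hn1 : 1 ≤ ⌈z⌉₊ := Nat.one_le_ceil_iff.2 hz0
    have hnN : ⌈z⌉₊ ≤ N := Nat.ceil_le.2 hzN
    have h1 := le_of_sum_le_one_of_increments (f := heatProfile N t) (heatProfile_nonneg ht)
      (sum_heatProfile t).le (D := 3 * (Λ * (T + 1)) * (1 + t) ^ (-1 : ℝ))
      (fun k => by
        have := heat_grad t ht htT k 0
        simpa [heatKernel_eq_profile] using this) hn1 hnN (x - y)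
    have p2 := hpos t ht (-(1 / 2))
    have p1 := hpos t ht (-1)
    have hst : (1 + t) ^ (-(1 / 2) : ℝ) = (√(1 + t))⁻¹ := by
      rw [Real.rpow_neg (by linarith), Real.sqrt_eq_rpow]
    have hst1 : (1 + t) ^ (-1 : ℝ) = (√(1 + t))⁻¹ * (√(1 + t))⁻¹ := by
      rw [Real.rpow_neg_one, ← mul_inv, Real.mul_self_sqrt (by linarith)]
    have hs1 : 1 ≤ √(1 + t) := Real.one_le_sqrt.2 (by linarith)
    have hzs : z ≤ √(1 + t) := Real.sqrt_le_sqrt (div_le_self (by linarith) (by linarith))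
    have hc1 : (⌈z⌉₊ : ℝ) ≤ 2 * √(1 + t) := by
      have := (Nat.ceil_lt_add_one hz0.le).le
      linarith
    have hc2 : 1 / (⌈z⌉₊ : ℝ) ≤ (T + 1) * (√(1 + t))⁻¹ := by
      have e1 : 1 / (⌈z⌉₊ : ℝ) ≤ 1 / z := by
        have := Nat.le_ceil z
        gcongr
      have e2 : 1 / z = √(T + 1) * (√(1 + t))⁻¹ := by
        rw [hz, Real.sqrt_div' _ (by linarith)]
        field_simp
      have e3 : √(T + 1) ≤ T + 1 := by
        rw [Real.sqrt_le_left (by linarith)]; nlinarith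
      rw [e2] at e1
      refine e1.trans ?_
      gcongr
    have hc3 : (⌈z⌉₊ : ℝ) * (3 * (Λ * (T + 1)) * (1 + t) ^ (-1 : ℝ))
        ≤ 6 * (Λ * (T + 1)) * (√(1 + t))⁻¹ := by
      rw [hst1]
      have : (2 * √(1 + t)) * (3 * (Λ * (T + 1)) * ((√(1 + t))⁻¹ * (√(1 + t))⁻¹))
          = 6 * (Λ * (T + 1)) * (√(1 + t))⁻¹ := by
        field_simp
        ring
      rw [← this]
      gcongr
    rw [hst] at p2 ⊢
    have hTΛ : T + 1 ≤ Λ * (T + 1) := le_mul_of_one_le_left (by linarith) hΛ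
    calc _ ≤ _ := h1
      _ ≤ (T + 1) * (√(1 + t))⁻¹ + 6 * (Λ * (T + 1)) * (√(1 + t))⁻¹ := add_le_add hc2 hc3
      _ = ((T + 1) + 6 * (Λ * (T + 1))) * (√(1 + t))⁻¹ := by ring
      _ ≤ _ := by gcongr; linarith

end KernelBounds

end InhomASEP

/-! ## Half-filled configurations and the generator -/

namespace InhomASEP

/-! ### Rates under the weak asymmetry scaling. -/

section Rates

variable {N : ℕ}

/-- The asymmetry `ℓ - r`. -/
def asym (N : ℕ) : ℝ := 1 / √(N : ℝ)

/-- `2 √(r ℓ)`. -/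
def geomRate (N : ℕ) : ℝ := √(1 - asym N ^ 2)

/-- The square root of `τ`. -/
def sqrtTau (N : ℕ) : ℝ := geomRate N / (1 + asym N)

theorem asym_pos (hN : 2 ≤ N) : 0 < asym N := by
  unfold asym
  have : (0 : ℝ) < N := by exact_mod_cast (by omega : 0 < N)
  positivity

theorem asym_sq (hN : 2 ≤ N) : asym N ^ 2 = 1 / N := by
  rw [asym, div_pow, one_pow, Real.sq_sqrt (by positivity)]

theorem asym_le (hN : 2 ≤ N) : asym N ≤ 71 / 100 := by
  have h := asym_sq hN
  have h0 := asym_pos hN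
  have : (1 : ℝ) / N ≤ 1 / 2 := by
    have : (2 : ℝ) ≤ N := by exact_mod_cast hN
    gcongr
  nlinarith

theorem geomRate_sq (hN : 2 ≤ N) : geomRate N ^ 2 = 1 - asym N ^ 2 :=
  Real.sq_sqrt (by nlinarith [asym_le hN, asym_pos hN])

theorem geomRate_ge (hN : 2 ≤ N) : 7 / 10 ≤ geomRate N :=
  Real.le_sqrt_of_sq_le (by nlinarith [asym_le hN, asym_pos hN])

theorem geomRate_le (hN : 2 ≤ N) : geomRate N ≤ 1 := by
  nlinarith [geomRate_sq hN, geomRate_ge hN, asym_pos hN]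

theorem one_sub_geomRate_le (hN : 2 ≤ N) : 1 - geomRate N ≤ asym N ^ 2 := by
  nlinarith [geomRate_sq hN, geomRate_ge hN, geomRate_le hN]

theorem rateR_eq (N : ℕ) : rateR N = (1 - asym N) / 2 := by rw [rateR, asym]; ring

theorem rateL_eq (N : ℕ) : rateL N = (1 + asym N) / 2 := by rw [rateL, asym]; ring

theorem sqrt_rates (hN : 2 ≤ N) : √(rateR N * rateL N) = geomRate N / 2 := by
  rw [rateR_eq, rateL_eq, show (1 - asym N) / 2 * ((1 + asym N) / 2) = (geomRate N / 2) ^ 2 by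
    rw [div_pow, geomRate_sq hN]; ring]
  exact Real.sqrt_sq (by linarith [geomRate_ge hN])

theorem nu_eq (hN : 2 ≤ N) : nu N = 1 - geomRate N := by
  rw [nu, sqrt_rates hN]; ring

theorem rateR_pos (hN : 2 ≤ N) : 0 < rateR N := by rw [rateR_eq]; linarith [asym_le hN]

theorem rateL_pos (hN : 2 ≤ N) : 0 < rateL N := by rw [rateL_eq]; linarith [asym_pos hN]

theorem rateR_add_rateL (N : ℕ) : rateR N + rateL N = 1 := by rw [rateR_eq, rateL_eq]; ring

theorem tau_pos (hN : 2 ≤ N) : 0 < tau N := div_pos (rateR_pos hN) (rateL_pos hN)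

theorem tau_le_one (hN : 2 ≤ N) : tau N ≤ 1 := by
  rw [tau, div_le_one (rateL_pos hN), rateR_eq, rateL_eq]
  linarith [asym_pos hN]

theorem sqrtTau_pos (hN : 2 ≤ N) : 0 < sqrtTau N :=
  div_pos (by linarith [geomRate_ge hN]) (by linarith [asym_pos hN])

theorem sqrtTau_sq (hN : 2 ≤ N) : sqrtTau N ^ 2 = tau N := by
  have h1 := asym_pos hN
  rw [sqrtTau, div_pow, geomRate_sq hN, tau, rateR_eq, rateL_eq, div_eq_div_iff (by positivity)
    (by positivity)]
  ring

theorem tau_rpow_half (hN : 2 ≤ N) (k : ℤ) : tau N ^ ((k : ℝ) / 2) = sqrtTau N ^ k := by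
  rw [← sqrtTau_sq hN, ← Real.rpow_natCast, ← Real.rpow_mul (sqrtTau_pos hN).le,
    ← Real.rpow_intCast]
  congr 1
  push_cast
  ring

end Rates

/-! ### Configurations, their Gärtner transform, the generator and the bracket. -/

section Config

variable {N : ℕ} [NeZero N]

/-- The configurations with density one half. -/
abbrev HalfFilled (N : ℕ) : Type := {A : Finset (ZMod N) // 2 * A.card = N}

theorem card_exchange {A : Finset (ZMod N)} {x y : ZMod N} (hx : x ∈ A) (hy : y ∉ A) :
    (insert y (A.erase x)).card = A.card := by
  rw [Finset.card_insert_of_notMem (fun h => hy (Finset.mem_of_mem_erase h)),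
    Finset.card_erase_add_one hx]

/-- Effect of a ring of the right clock of the bond `(x, x + 1)`. -/
def moveRight (x : ZMod N) (A : HalfFilled N) : HalfFilled N :=
  if h : x ∈ A.1 ∧ x + 1 ∉ A.1 then
    ⟨insert (x + 1) (A.1.erase x), by rw [card_exchange h.1 h.2]; exact A.2⟩
  else A

/-- Effect of a ring of the left clock of the bond `(x, x + 1)`. -/
def moveLeft (x : ZMod N) (A : HalfFilled N) : HalfFilled N :=
  if h : x + 1 ∈ A.1 ∧ x ∉ A.1 then
    ⟨insert x (A.1.erase (x + 1)), by rw [card_exchange h.1 h.2]; exact A.2⟩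
  else A

theorem initialHeight_zero (A : Finset (ZMod N)) : initialHeight A 0 = 0 := by
  simp [initialHeight]

/-- The only nontrivial case is the seam from `N - 1` to `0`. There half filling is used: the
increments sum to zero around the torus, so the height closes up. -/
theorem initialHeight_succ {A : Finset (ZMod N)} (hA : 2 * A.card = N) (x : ZMod N) :
    initialHeight A (x + 1) = initialHeight A x + (2 * (if x + 1 ∈ A then 1 else 0) - 1) := by
  have hlt := ZMod.val_lt x
  have hx : ((x.val + 1 : ℕ) : ZMod N) = x + 1 := by
    rw [Nat.cast_add, ZMod.natCast_zmod_val, Nat.cast_one]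
  by_cases h : x.val + 1 < N
  · have hv : (x + 1).val = x.val + 1 := by rw [← hx, ZMod.val_natCast_of_lt h]
    rw [initialHeight, hv, Finset.sum_Icc_succ_top (by omega), hx]
    rfl
  · have hN : x.val + 1 = N := by omega
    have h0 : x + 1 = 0 := by rw [← hx, hN, ZMod.natCast_self]
    have tot : ∑ k ∈ Finset.range N, (2 * (if (k : ZMod N) ∈ A then 1 else 0) - 1 : ℤ) = 0 := by
      have e : ∑ k ∈ Finset.range N, (2 * (if (k : ZMod N) ∈ A then 1 else 0) - 1 : ℤ)
          = ∑ y : ZMod N, (2 * (if y ∈ A then 1 else 0) - 1 : ℤ) := by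
        refine Finset.sum_bij (fun k _ => (k : ZMod N)) (fun _ _ => Finset.mem_univ _) ?_ ?_ ?_
        · intro i hi j hj hij
          have h4 := congrArg ZMod.val hij
          rw [Finset.mem_range] at hi hj
          rwa [ZMod.val_natCast_of_lt hi, ZMod.val_natCast_of_lt hj] at h4
        · intro y _
          exact ⟨y.val, Finset.mem_range.2 (ZMod.val_lt y), ZMod.natCast_zmod_val y⟩
        · intro k _; rfl
      rw [e, Finset.sum_sub_distrib, ← Finset.mul_sum]
      simp only [Finset.sum_ite_mem, Finset.univ_inter, Finset.sum_const, Finset.card_univ,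
        ZMod.card]
      have : (2 * A.card : ℤ) = N := by exact_mod_cast hA
      simp only [nsmul_eq_mul, mul_one]
      linarith
    rw [h0, initialHeight_zero, initialHeight]
    have hr : Finset.range N = Finset.range (x.val + 1) := by rw [hN]
    have hI : ∀ (f : ℕ → ℤ) (n : ℕ), ∑ k ∈ Finset.Icc 1 n, f k = ∑ k ∈ Finset.range n, f (k + 1) := by
      intro f n
      induction n with
      | zero => simp
      | succ n ih => rw [Finset.sum_Icc_succ_top (by omega), ih, Finset.sum_range_succ]
    rw [hr, Finset.sum_range_succ', Nat.cast_zero] at tot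
    rw [hI]
    exact tot.symm

/-- A height function is determined by its gradient, hence by the configuration, up to its value at
the origin. This separates the unbounded quantity `h(0)` from a finite state space. -/
theorem eq_initialHeight {A : Finset (ZMod N)} (hA : 2 * A.card = N) {h : ZMod N → ℤ}
    (hh : ∀ x, h (x + 1) = h x + (2 * (if x + 1 ∈ A then 1 else 0) - 1)) (x : ZMod N) :
    h x = h 0 + initialHeight A x := by
  have key : ∀ n : ℕ, h n = h 0 + initialHeight A n := by
    intro n
    induction n with
    | zero => simp [initialHeight_zero]
    | succ n ih =>
      push_cast
      rw [hh, initialHeight_succ hA, ih]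
      ring
  have := key x.val
  rwa [ZMod.natCast_zmod_val] at this

/-- The Gärtner transform at time zero of a configuration. -/
def zval (A : HalfFilled N) (x : ZMod N) : ℝ := sqrtTau N ^ initialHeight A.1 x

theorem zval_pos (hN : 2 ≤ N) (A : HalfFilled N) (x : ZMod N) : 0 < zval A x :=
  zpow_pos (sqrtTau_pos hN) _

theorem zval_succ (hN : 2 ≤ N) (A : HalfFilled N) (x : ZMod N) :
    zval A (x + 1) = zval A x * (if x + 1 ∈ A.1 then sqrtTau N else (sqrtTau N)⁻¹) := by
  have h0 := (sqrtTau_pos hN).ne'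
  rw [zval, initialHeight_succ A.2, zpow_add₀ h0, zval]
  split_ifs <;> simp

theorem zval_pred (hN : 2 ≤ N) (A : HalfFilled N) (x : ZMod N) :
    zval A (x - 1) = zval A x * (if x ∈ A.1 then (sqrtTau N)⁻¹ else sqrtTau N) := by
  have h0 := (sqrtTau_pos hN).ne'
  have h := zval_succ hN A (x - 1)
  rw [sub_add_cancel] at h
  rw [h]
  split_ifs
  · field_simp
  · field_simp

/-- Indicator that a particle can jump from `x` to `x + 1`. -/
def canRight (x : ZMod N) (A : HalfFilled N) : ℝ := if x ∈ A.1 ∧ x + 1 ∉ A.1 then 1 else 0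

/-- Indicator that a particle can jump from `x + 1` to `x`. -/
def canLeft (x : ZMod N) (A : HalfFilled N) : ℝ := if x + 1 ∈ A.1 ∧ x ∉ A.1 then 1 else 0

/-- The factor by which `τ ^ h(0)` changes when the right clock of `(x, x + 1)` rings. -/
def weightRight (x : ZMod N) (A : HalfFilled N) : ℝ :=
  if x = 0 ∧ x ∈ A.1 ∧ x + 1 ∉ A.1 then (tau N)⁻¹ ^ 2 else 1

/-- The factor by which `τ ^ h(0)` changes when the left clock of `(x, x + 1)` rings. -/
def weightLeft (x : ZMod N) (A : HalfFilled N) : ℝ :=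
  if x = 0 ∧ x + 1 ∈ A.1 ∧ x ∉ A.1 then tau N ^ 2 else 1

/-- Local height relation preserved by the jump of a particle across the bond `(x, x + 1)`. -/
theorem height_relation_right (hN : 2 ≤ N) {A : Finset (ZMod N)} {h : ZMod N → ℤ}
    (hh : ∀ x, h (x + 1) = h x + (2 * (if x + 1 ∈ A then 1 else 0) - 1)) {x : ZMod N}
    (hx : x ∈ A) (hx1 : x + 1 ∉ A) (y : ZMod N) :
    Function.update h x (h x - 2) (y + 1) = Function.update h x (h x - 2) y
      + (2 * (if y + 1 ∈ insert (x + 1) (A.erase x) then 1 else 0) - 1) := by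
  have h1 : x + 1 ≠ x := fun h => zmod_one_ne_zero hN (by simpa using h)
  have hy := hh y
  by_cases e1 : y = x
  · subst e1
    rw [if_neg hx1] at hy
    simp [h1, hy]
    ring
  by_cases e2 : y + 1 = x
  · subst e2
    rw [if_pos hx] at hy
    have e1' : y ≠ y + 1 := e1
    have h3 : ¬ (y + 1 = y + 1 + 1) := fun h => h1 h.symm
    simp [Function.update_of_ne e1', h3, hy]
    ring
  · have h3 : y + 1 ≠ x + 1 := fun h => e1 (by simpa using h)
    simp [e2, h3, hy, e1]

theorem height_relation_left (hN : 2 ≤ N) {A : Finset (ZMod N)} {h : ZMod N → ℤ}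
    (hh : ∀ x, h (x + 1) = h x + (2 * (if x + 1 ∈ A then 1 else 0) - 1)) {x : ZMod N}
    (hx : x ∉ A) (hx1 : x + 1 ∈ A) (y : ZMod N) :
    Function.update h x (h x + 2) (y + 1) = Function.update h x (h x + 2) y
      + (2 * (if y + 1 ∈ insert x (A.erase (x + 1)) then 1 else 0) - 1) := by
  have h1 : x + 1 ≠ x := fun h => zmod_one_ne_zero hN (by simpa using h)
  have hy := hh y
  by_cases e1 : y = x
  · subst e1
    rw [if_pos hx1] at hy
    simp [h1, hy]
    ring
  by_cases e2 : y + 1 = x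
  · subst e2
    rw [if_neg hx] at hy
    have e1' : y ≠ y + 1 := e1
    simp [Function.update_of_ne e1', hy]
    ring
  · have h3 : y + 1 ≠ x + 1 := fun h => e1 (by simpa using h)
    simp [e2, h3, hy, e1]

/-- The true height changes only at `x`, whereas `zval` is normalised to height zero at the origin.
If `x = 0` the renormalisation multiplies each factor of the product by `τ`, and `weightRight`
undoes exactly this. After weighting, a ring at `x` affects only the factors sitting at `x`. -/
theorem weightRight_mul (hN : 2 ≤ N) (A : HalfFilled N) (x y w : ZMod N) :
    weightRight x A * (zval (moveRight x A) y * zval (moveRight x A) w)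
      = zval A y * zval A w * (1 + canRight x A *
        ((1 + (if y = x then 1 else 0) * ((tau N)⁻¹ - 1))
          * (1 + (if w = x then 1 else 0) * ((tau N)⁻¹ - 1)) - 1)) := by
  by_cases h : x ∈ A.1 ∧ x + 1 ∉ A.1
  · have h0 := (sqrtTau_pos hN).ne'
    have ht := (tau_pos hN).ne'
    have hm : (moveRight x A).1 = insert (x + 1) (A.1.erase x) := by
      rw [moveRight, dif_pos h]
    have key : ∀ y, zval (moveRight x A) y = zval A y * (1 + (if y = x then 1 else 0)
        * ((tau N)⁻¹ - 1)) * (if x = 0 then tau N else 1) := by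
      intro y
      have e := eq_initialHeight (moveRight x A).2 (h := Function.update (initialHeight A.1) x
        (initialHeight A.1 x - 2)) (fun y => by
          rw [hm]; exact height_relation_right hN (initialHeight_succ A.2) h.1 h.2 y) y
      have e2 : initialHeight (moveRight x A).1 y = initialHeight A.1 y
          + (if y = x then -2 else 0) + (if x = 0 then 2 else 0) := by
        rw [Function.update_apply, Function.update_apply, initialHeight_zero] at e
        by_cases h3 : x = 0
        · subst h3
          rw [if_pos rfl] at e
          by_cases h4 : y = 0
          · subst h4; simp [initialHeight_zero]
          · rw [if_neg h4, initialHeight_zero] at e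
            rw [if_neg h4, if_pos rfl]; linarith
        · have h3' : ¬ (0 : ZMod N) = x := fun h => h3 h.symm
          by_cases h4 : y = x
          · subst h4; simp only [h3, h3', if_true, if_false] at e ⊢; linarith
          · simp only [h3, h3', h4, if_false] at e ⊢; linarith
      rw [zval, e2, zpow_add₀ h0, zpow_add₀ h0, ← zval, ← sqrtTau_sq hN]
      congr 1
      · congr 1
        split_ifs
        · rw [zpow_neg]; simp
        · simp
      · split_ifs
        · rfl
        · simp
    rw [key y, key w, canRight, if_pos h, weightRight]
    by_cases h3 : x = 0
    · rw [if_pos ⟨h3, h⟩, if_pos h3]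
      field_simp
      ring
    · rw [if_neg (fun h => h3 h.1), if_neg h3]
      ring
  · rw [moveRight, dif_neg h, canRight, if_neg h, weightRight, if_neg (fun h' => h h'.2)]
    ring

theorem weightLeft_mul (hN : 2 ≤ N) (A : HalfFilled N) (x y w : ZMod N) :
    weightLeft x A * (zval (moveLeft x A) y * zval (moveLeft x A) w)
      = zval A y * zval A w * (1 + canLeft x A *
        ((1 + (if y = x then 1 else 0) * (tau N - 1))
          * (1 + (if w = x then 1 else 0) * (tau N - 1)) - 1)) := by
  by_cases h : x + 1 ∈ A.1 ∧ x ∉ A.1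
  · have h0 := (sqrtTau_pos hN).ne'
    have ht := (tau_pos hN).ne'
    have hm : (moveLeft x A).1 = insert x (A.1.erase (x + 1)) := by
      rw [moveLeft, dif_pos h]
    have key : ∀ y, zval (moveLeft x A) y = zval A y * (1 + (if y = x then 1 else 0)
        * (tau N - 1)) * (if x = 0 then (tau N)⁻¹ else 1) := by
      intro y
      have e := eq_initialHeight (moveLeft x A).2 (h := Function.update (initialHeight A.1) x
        (initialHeight A.1 x + 2)) (fun y => by
          rw [hm]; exact height_relation_left hN (initialHeight_succ A.2) h.2 h.1 y) y
      have e2 : initialHeight (moveLeft x A).1 y = initialHeight A.1 y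
          + (if y = x then 2 else 0) + (if x = 0 then -2 else 0) := by
        rw [Function.update_apply, Function.update_apply, initialHeight_zero] at e
        by_cases h3 : x = 0
        · subst h3
          rw [if_pos rfl] at e
          by_cases h4 : y = 0
          · subst h4; simp [initialHeight_zero]
          · rw [if_neg h4, initialHeight_zero] at e
            rw [if_neg h4, if_pos rfl]; linarith
        · have h3' : ¬ (0 : ZMod N) = x := fun h => h3 h.symm
          by_cases h4 : y = x
          · subst h4; simp only [h3, h3', if_true, if_false] at e ⊢; linarith
          · simp only [h3, h3', h4, if_false] at e ⊢; linarith
      rw [zval, e2, zpow_add₀ h0, zpow_add₀ h0, ← zval, ← sqrtTau_sq hN]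
      congr 1
      · congr 1
        split_ifs
        · simp
        · simp
      · split_ifs
        · rw [zpow_neg]; rfl
        · simp
    rw [key y, key w, canLeft, if_pos h, weightLeft]
    by_cases h3 : x = 0
    · rw [if_pos ⟨h3, h⟩, if_pos h3]
      field_simp
      ring
    · rw [if_neg (fun h => h3 h.1), if_neg h3]
      ring
  · rw [moveLeft, dif_neg h, canLeft, if_neg h, weightLeft, if_neg (fun h' => h h'.2)]
    ring

/-- The weighted jump rates. -/
def jumpMatrix (a : ZMod N → ℝ) : Matrix (HalfFilled N) (HalfFilled N) ℝ :=
  Matrix.of fun A B => ∑ x, a x * (rateR N * (weightRight x A * if B = moveRight x A then 1 else 0)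
    + rateL N * (weightLeft x A * if B = moveLeft x A then 1 else 0))

/-- The generator of the half-filled process, acting on functions that scale like `τ ^ h(0)`. -/
def generator (a : ZMod N → ℝ) : Matrix (HalfFilled N) (HalfFilled N) ℝ :=
  jumpMatrix a + (-∑ x, a x) • (1 : Matrix (HalfFilled N) (HalfFilled N) ℝ)

theorem jumpMatrix_nonneg (hN : 2 ≤ N) {a : ZMod N → ℝ} (ha : ∀ x, 0 ≤ a x) (A B : HalfFilled N) :
    0 ≤ jumpMatrix a A B := by
  have h1 := (rateR_pos hN).le
  have h2 := (rateL_pos hN).le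
  have h3 := tau_pos hN
  refine Finset.sum_nonneg fun x _ => mul_nonneg (ha x) (add_nonneg ?_ ?_)
  · refine mul_nonneg h1 (mul_nonneg ?_ (by split_ifs <;> norm_num))
    rw [weightRight]; split_ifs <;> positivity
  · refine mul_nonneg h2 (mul_nonneg ?_ (by split_ifs <;> norm_num))
    rw [weightLeft]; split_ifs <;> positivity

theorem jumpMatrix_mulVec (a : ZMod N → ℝ) (f : HalfFilled N → ℝ) (A : HalfFilled N) :
    ∑ B, jumpMatrix a A B * f B = ∑ x, a x * (rateR N * (weightRight x A * f (moveRight x A))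
      + rateL N * (weightLeft x A * f (moveLeft x A))) := by
  simp only [jumpMatrix, Matrix.of_apply, Finset.sum_mul]
  rw [Finset.sum_comm]
  refine Finset.sum_congr rfl fun x _ => ?_
  have h1 : ∀ C : HalfFilled N, ∑ B, (if B = C then (1 : ℝ) else 0) * f B = f C := by
    intro C; simp
  rw [← h1 (moveRight x A), ← h1 (moveLeft x A)]
  simp only [Finset.mul_sum, ← Finset.sum_add_distrib]
  exact Finset.sum_congr rfl fun B _ => by ring

/-- The density of the bracket of the martingale part of `Z(·, x)`. -/
def bracket (a : ZMod N → ℝ) (x : ZMod N) (A : HalfFilled N) : ℝ :=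
  a x * (rateR N * canRight x A * ((tau N)⁻¹ - 1) ^ 2
    + rateL N * canLeft x A * (tau N - 1) ^ 2) * zval A x ^ 2

/-- The microscopic Cole–Hopf identity. Each of the four occupations of `y`, `y + 1` reduces to
`geomRate² = 1 - asym²`, and this is the reason for the values of `τ` and `ν`. Since the identity is
local, multiplying the rates by `a y` preserves it. -/
theorem zval_drift (hN : 2 ≤ N) (A : HalfFilled N) (y : ZMod N) :
    (rateR N * canRight y A * ((tau N)⁻¹ - 1) + rateL N * canLeft y A * (tau N - 1)) * zval A y
      = geomRate N / 2 * (zval A (y + 1) + zval A (y - 1) - 2 * zval A y)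
        - nu N * zval A y := by
  have he := asym_pos hN
  have he1 := asym_le hN
  have hs := geomRate_ge hN
  have hs2 := geomRate_sq hN
  have h1 : 1 - asym N ≠ 0 := by linarith
  have h2 : 1 + asym N ≠ 0 := by linarith
  have h3 : geomRate N ≠ 0 := by linarith
  rw [zval_succ hN, zval_pred hN, nu_eq hN, canRight, canLeft, tau, rateR_eq, rateL_eq, sqrtTau]
  by_cases m1 : y ∈ A.1 <;> by_cases m2 : y + 1 ∈ A.1 <;> simp only [m1, m2, not_true, not_false_iff,
    and_true, and_false, if_true, if_false] <;> field_simp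
  · linear_combination (-zval A y) * hs2
  · ring
  · linear_combination (-2 * zval A y) * hs2
  · linear_combination (-zval A y) * hs2

/-- A ring at `x` changes only the value at `x`. Two distinct sites are therefore never changed
together and each contributes its own drift, while on the diagonal the square of the jump adds the
bracket. The shift by `2ν` accounts for the two factors `e^(νt)` in `Z Z`. -/
theorem generator_zval_mul (hN : 2 ≤ N) (a : ZMod N → ℝ) (y w : ZMod N) (A : HalfFilled N) :
    ∑ B, (generator a + (2 * nu N) • (1 : Matrix (HalfFilled N) (HalfFilled N) ℝ)) A B
        * (zval B y * zval B w)
      = (∑ y', hamiltonian a y y' * zval A y') * zval A w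
        + zval A y * (∑ w', hamiltonian a w w' * zval A w')
        + if y = w then bracket a y A else 0 := by
  -- The potential `-ν (a - 1)` is `-ν a + ν`. The part `-ν a` belongs to the drift of `zval_drift`,
  -- and the remaining `+ν` is one half of the shift `2ν`.
  have hH : ∀ y, ∑ y', hamiltonian a y y' * zval A y' = a y * (geomRate N / 2
      * (zval A (y + 1) + zval A (y - 1) - 2 * zval A y) - nu N * zval A y)
      + nu N * zval A y := by
    intro y
    have e : ∑ y', hamiltonian a y y' * zval A y' = geomRate N / 2 * a y *
        ∑ y', laplacian N y y' * zval A y' - nu N * (a y - 1) * zval A y := by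
      simp only [hamiltonian, Matrix.of_apply, sub_mul, Finset.sum_sub_distrib, ite_mul, zero_mul,
        Finset.sum_ite_eq', Finset.mem_univ, if_true, sqrt_rates hN, Finset.mul_sum]
      congr 1
      exact Finset.sum_congr rfl fun _ _ => by ring
    rw [e, sum_laplacian_mul]
    ring
  rw [hH, hH, ← zval_drift hN, ← zval_drift hN]
  have e1 : ∑ B, (generator a + (2 * nu N) • (1 : Matrix (HalfFilled N) (HalfFilled N) ℝ)) A B
        * (zval B y * zval B w) = ∑ B, jumpMatrix a A B * (zval B y * zval B w)
        + (2 * nu N - ∑ x, a x) * (zval A y * zval A w) := by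
    simp only [generator, Matrix.add_apply, Matrix.smul_apply, Matrix.one_apply, smul_eq_mul,
      add_mul, mul_ite, mul_one, mul_zero, ite_mul, zero_mul, Finset.sum_add_distrib,
      Finset.sum_ite_eq, Finset.mem_univ, if_true]
    ring
  have e2 : ∑ B, jumpMatrix a A B * (zval B y * zval B w) = (∑ x, a x) * (zval A y * zval A w)
      + ∑ x, (a x * (zval A y * zval A w)) * (
        (if y = x then 1 else 0) * (rateR N * canRight x A * ((tau N)⁻¹ - 1)
          + rateL N * canLeft x A * (tau N - 1))
        + (if w = x then 1 else 0) * (rateR N * canRight x A * ((tau N)⁻¹ - 1)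
          + rateL N * canLeft x A * (tau N - 1))
        + (if y = x then 1 else 0) * (if w = x then 1 else 0) *
          (rateR N * canRight x A * ((tau N)⁻¹ - 1) ^ 2
          + rateL N * canLeft x A * (tau N - 1) ^ 2)) := by
    rw [jumpMatrix_mulVec a (fun B => zval B y * zval B w), Finset.sum_mul,
      ← Finset.sum_add_distrib]
    refine Finset.sum_congr rfl fun x _ => ?_
    rw [weightRight_mul hN, weightLeft_mul hN]
    have := rateR_add_rateL N
    linear_combination (a x * (zval A y * zval A w)) * this
  have e3 : ∀ g : ZMod N → ℝ, ∀ y : ZMod N, ∑ x, (if y = x then (1 : ℝ) else 0) * g x = g y := by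
    intro g y; simp
  have e4 : ∀ g : ZMod N → ℝ, ∑ x, (if y = x then (1 : ℝ) else 0) * (if w = x then 1 else 0) * g x
      = if y = w then g y else 0 := by
    intro g
    simp only [ite_mul, one_mul, zero_mul, eq_comm (a := w), Finset.sum_ite_eq,
      Finset.mem_univ, if_true]
  have e5 : ∑ x, (a x * (zval A y * zval A w)) * (
        (if y = x then 1 else 0) * (rateR N * canRight x A * ((tau N)⁻¹ - 1)
          + rateL N * canLeft x A * (tau N - 1))
        + (if w = x then 1 else 0) * (rateR N * canRight x A * ((tau N)⁻¹ - 1)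
          + rateL N * canLeft x A * (tau N - 1))
        + (if y = x then 1 else 0) * (if w = x then 1 else 0) *
          (rateR N * canRight x A * ((tau N)⁻¹ - 1) ^ 2
          + rateL N * canLeft x A * (tau N - 1) ^ 2))
      = a y * (zval A y * zval A w) * (rateR N * canRight y A * ((tau N)⁻¹ - 1)
          + rateL N * canLeft y A * (tau N - 1))
        + a w * (zval A y * zval A w) * (rateR N * canRight w A * ((tau N)⁻¹ - 1)
          + rateL N * canLeft w A * (tau N - 1))
        + if y = w then bracket a y A else 0 := by
    have e6 : (if y = w then bracket a y A else 0) = if y = w then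
        (a y * (zval A y * zval A w)) * (rateR N * canRight y A * ((tau N)⁻¹ - 1) ^ 2
          + rateL N * canLeft y A * (tau N - 1) ^ 2) else 0 := by
      split_ifs with h
      · subst h; rw [bracket]; ring
      · rfl
    rw [e6, ← e4 (fun x => (a x * (zval A y * zval A w)) * (rateR N * canRight x A
      * ((tau N)⁻¹ - 1) ^ 2 + rateL N * canLeft x A * (tau N - 1) ^ 2)),
      ← e3 (fun x => a x * (zval A y * zval A w) * (rateR N * canRight x A * ((tau N)⁻¹ - 1)
          + rateL N * canLeft x A * (tau N - 1))) y,
      ← e3 (fun x => a x * (zval A y * zval A w) * (rateR N * canRight x A * ((tau N)⁻¹ - 1)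
          + rateL N * canLeft x A * (tau N - 1))) w, ← Finset.sum_add_distrib,
      ← Finset.sum_add_distrib]
    exact Finset.sum_congr rfl fun x _ => by ring
  rw [e1, e2, e5]
  ring

/-- `N ∇Z(x) ∇Z(x - 1)` for a configuration. -/
def gradProd (x : ZMod N) (A : HalfFilled N) : ℝ :=
  N * ((zval A (x + 1) - zval A x) * (zval A x - zval A (x - 1)))

theorem bracket_nonneg (hN : 2 ≤ N) {a : ZMod N → ℝ} (ha : ∀ x, 0 ≤ a x) (x : ZMod N)
    (A : HalfFilled N) : 0 ≤ bracket a x A := by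
  have h1 := (rateR_pos hN).le
  have h2 := (rateL_pos hN).le
  have h3 := ha x
  have h4 : 0 ≤ canRight x A := by rw [canRight]; split_ifs <;> norm_num
  have h5 : 0 ≤ canLeft x A := by rw [canLeft]; split_ifs <;> norm_num
  unfold bracket
  positivity

theorem gradProd_eq (hN : 2 ≤ N) (x : ZMod N) (A : HalfFilled N) : gradProd x A = zval A x ^ 2 *
    (if x ∈ A.1 then (if x + 1 ∈ A.1 then 2 / (geomRate N * (1 + geomRate N))
        else -(2 / ((1 - asym N) * (1 + geomRate N))))
      else (if x + 1 ∈ A.1 then -(2 / ((1 + asym N) * (1 + geomRate N)))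
        else 2 / (geomRate N * (1 + geomRate N)))) := by
  have he := asym_pos hN
  have he1 := asym_le hN
  have hs := geomRate_ge hN
  have hs2 := geomRate_sq hN
  have h1 : 1 - asym N ≠ 0 := by linarith
  have h2 : 1 + asym N ≠ 0 := by linarith
  have h3 : geomRate N ≠ 0 := by linarith
  have h4 : 1 + geomRate N ≠ 0 := by linarith
  have hNe : (N : ℝ) = 1 / asym N ^ 2 := by rw [asym_sq hN]; simp
  have hk : (1 + asym N - geomRate N) ^ 2 * (1 + geomRate N) = 2 * asym N ^ 2 * (1 + asym N) := by
    linear_combination (geomRate N - 1 - 2 * asym N) * hs2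
  rw [gradProd, zval_succ hN, zval_pred hN, sqrtTau, hNe]
  by_cases m1 : x ∈ A.1 <;> by_cases m2 : x + 1 ∈ A.1 <;> simp only [m1, m2, if_true, if_false]
    <;> field_simp
  · linear_combination zval A x ^ 2 * hk
  · linear_combination zval A x ^ 2 * ((asym N - 1) * geomRate N + (asym N + 1)) * hs2
  · linear_combination -zval A x ^ 2 * hk
  · linear_combination zval A x ^ 2 * (geomRate N - 2 * asym N - 1) * hs2

theorem bracket_eq (hN : 2 ≤ N) (a : ZMod N → ℝ) (x : ZMod N) (A : HalfFilled N) :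
    N * bracket a x A = a x * (zval A x ^ 2 *
    (if x ∈ A.1 then (if x + 1 ∈ A.1 then 0 else 2 / (1 - asym N))
      else (if x + 1 ∈ A.1 then 2 / (1 + asym N) else 0))) := by
  have he := asym_pos hN
  have he1 := asym_le hN
  have h1 : 1 - asym N ≠ 0 := by linarith
  have h2 : 1 + asym N ≠ 0 := by linarith
  have hNe : (N : ℝ) = 1 / asym N ^ 2 := by rw [asym_sq hN]; simp
  rw [bracket, canRight, canLeft, tau, rateR_eq, rateL_eq, hNe]
  by_cases m1 : x ∈ A.1 <;> by_cases m2 : x + 1 ∈ A.1 <;> simp only [m1, m2, if_true, if_false,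
    not_true, not_false_iff, and_true, and_false]
  · ring
  · field_simp; ring
  · field_simp; ring
  · ring

theorem abs_gradProd_le (hN : 2 ≤ N) (x : ZMod N) (A : HalfFilled N) :
    |gradProd x A| ≤ 10 * zval A x ^ 2 := by
  have he := asym_pos hN
  have he1 := asym_le hN
  have hs := geomRate_ge hN
  have h0 := sq_nonneg (zval A x)
  rw [gradProd_eq hN, abs_mul, abs_of_nonneg h0, mul_comm]
  refine mul_le_mul_of_nonneg_right ?_ h0
  have b1 : |2 / (geomRate N * (1 + geomRate N))| ≤ 10 := by
    rw [abs_of_pos (by positivity), div_le_iff₀ (by positivity)]; nlinarith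
  have b2 : |2 / ((1 - asym N) * (1 + geomRate N))| ≤ 10 := by
    have : 0 < 1 - asym N := by linarith
    rw [abs_of_pos (by positivity), div_le_iff₀ (by positivity)]; nlinarith
  have b3 : |2 / ((1 + asym N) * (1 + geomRate N))| ≤ 10 := by
    rw [abs_of_pos (by positivity), div_le_iff₀ (by positivity)]; nlinarith
  split_ifs
  · exact b1
  · rwa [abs_neg]
  · rwa [abs_neg]
  · exact b1

theorem bracket_le (hN : 2 ≤ N) {a : ZMod N → ℝ} (ha : ∀ x, 0 ≤ a x) (x : ZMod N)
    (A : HalfFilled N) : N * bracket a x A ≤ 10 * a x * zval A x ^ 2 := by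
  have he := asym_pos hN
  have he1 := asym_le hN
  have h0 := sq_nonneg (zval A x)
  rw [bracket_eq hN, mul_comm 10, mul_assoc]
  refine mul_le_mul_of_nonneg_left ?_ (ha x)
  rw [mul_comm]
  refine mul_le_mul_of_nonneg_right ?_ h0
  have : 0 < 1 - asym N := by linarith
  split_ifs
  · norm_num
  · rw [div_le_iff₀ (by positivity)]; linarith
  · rw [div_le_iff₀ (by positivity)]; linarith
  · norm_num

/-- As the asymmetry vanishes, `gradProd` tends to `Z²` when `x` and `x + 1` have equal occupation
and to `-Z²` otherwise, while `N * bracket` is `0` in the first case and tends to `2 a Z²` in the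
second. So `N * bracket` is close to `a (Z² - gradProd)` in all four cases, with an error linear in
`asym`. -/
theorem abs_bracket_sub_le (hN : 2 ≤ N) {a : ZMod N → ℝ} (ha : ∀ x, 0 ≤ a x) (x : ZMod N)
    (A : HalfFilled N) : |N * bracket a x A - a x * (zval A x ^ 2 - gradProd x A)|
      ≤ 10 * asym N * a x * zval A x ^ 2 := by
  have he := asym_pos hN
  have he1 := asym_le hN
  have hs := geomRate_ge hN
  have hs1 := geomRate_le hN
  have hs2 := one_sub_geomRate_le hN
  have h0 := sq_nonneg (zval A x)
  have hp : 0 < 1 - asym N := by linarith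
  have h3 : 0 < geomRate N := by linarith
  rw [bracket_eq hN, gradProd_eq hN]
  have key : ∀ b c : ℝ, |b - (1 - c)| ≤ 10 * asym N →
      |a x * (zval A x ^ 2 * b) - a x * (zval A x ^ 2 - zval A x ^ 2 * c)|
        ≤ 10 * asym N * a x * zval A x ^ 2 := by
    intro b c hbc
    rw [show a x * (zval A x ^ 2 * b) - a x * (zval A x ^ 2 - zval A x ^ 2 * c)
      = (a x * zval A x ^ 2) * (b - (1 - c)) by ring, abs_mul,
      abs_of_nonneg (mul_nonneg (ha x) h0)]
    calc _ ≤ (a x * zval A x ^ 2) * (10 * asym N) :=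
          mul_le_mul_of_nonneg_left hbc (mul_nonneg (ha x) h0)
      _ = _ := by ring
  have c1 : |0 - (1 - 2 / (geomRate N * (1 + geomRate N)))| ≤ 10 * asym N := by
    have e : 0 - (1 - 2 / (geomRate N * (1 + geomRate N)))
        = (1 - geomRate N) * (geomRate N + 2) / (geomRate N * (1 + geomRate N)) := by
      field_simp; ring
    rw [e, abs_of_nonneg (by apply div_nonneg <;> nlinarith), div_le_iff₀ (by positivity)]
    have : asym N ^ 2 ≤ asym N := by nlinarith
    have g1 : (1 - geomRate N) * (geomRate N + 2) ≤ asym N * 3 :=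
      mul_le_mul (by linarith) (by linarith) (by linarith) he.le
    have g2 : 1 ≤ geomRate N * (1 + geomRate N) := by nlinarith
    nlinarith
  split_ifs
  · exact key _ _ c1
  · apply key
    have e : 2 / (1 - asym N) - (1 - -(2 / ((1 - asym N) * (1 + geomRate N))))
        = (asym N * (1 + geomRate N) - (1 - geomRate N)) / ((1 - asym N) * (1 + geomRate N)) := by
      field_simp; ring
    rw [e, abs_div, abs_of_pos (by positivity : 0 < (1 - asym N) * (1 + geomRate N)),
      div_le_iff₀ (by positivity), abs_le]
    have : asym N ^ 2 ≤ asym N := by nlinarith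
    constructor <;> nlinarith
  · apply key
    have e : 2 / (1 + asym N) - (1 - -(2 / ((1 + asym N) * (1 + geomRate N))))
        = -((asym N * (1 + geomRate N) + (1 - geomRate N)) / ((1 + asym N) * (1 + geomRate N))) := by
      field_simp; ring
    rw [e, abs_neg, abs_div, abs_of_pos (by positivity : 0 < (1 + asym N) * (1 + geomRate N)),
      div_le_iff₀ (by positivity), abs_le]
    have : asym N ^ 2 ≤ asym N := by nlinarith
    constructor <;> nlinarith
  · exact key _ _ c1

end Config

end InhomASEP

/-! ## Elementary integral inequalities -/

namespace InhomASEP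

section Integrals

theorem continuousOn_one_add_rpow (γ : ℝ) {t : ℝ} (ht : 0 ≤ t) :
    ContinuousOn (fun s : ℝ => (1 + s) ^ γ) (Set.uIcc 0 t) := by
  refine ContinuousOn.rpow_const (by fun_prop) fun s hs => Or.inl ?_
  rw [Set.uIcc_of_le ht] at hs
  linarith [hs.1]

theorem intervalIntegrable_one_add_rpow (γ : ℝ) {t : ℝ} (ht : 0 ≤ t) :
    IntervalIntegrable (fun s : ℝ => (1 + s) ^ γ) volume 0 t :=
  (continuousOn_one_add_rpow γ ht).intervalIntegrable

theorem integral_one_add_rpow {γ : ℝ} (hγ : γ ≠ -1) {t : ℝ} (ht : 0 ≤ t) :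
    ∫ s in (0 : ℝ)..t, (1 + s) ^ γ = ((1 + t) ^ (γ + 1) - 1) / (γ + 1) := by
  rw [intervalIntegral.integral_comp_add_left (fun s : ℝ => s ^ γ) 1, add_zero,
    integral_rpow (Or.inr ⟨hγ, ?_⟩), Real.one_rpow]
  rw [Set.uIcc_of_le (by linarith)]
  intro h
  linarith [h.1]

theorem integral_one_add_rpow_le {γ : ℝ} (hγ : -1 < γ) {t : ℝ} (ht : 0 ≤ t) :
    ∫ s in (0 : ℝ)..t, (1 + s) ^ γ ≤ (1 + t) ^ (γ + 1) / (γ + 1) := by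
  rw [integral_one_add_rpow (by linarith) ht]
  exact div_le_div_of_nonneg_right (by linarith) (by linarith)

theorem integral_one_add_rpow_le' {γ : ℝ} (hγ : γ < -1) {t : ℝ} (ht : 0 ≤ t) :
    ∫ s in (0 : ℝ)..t, (1 + s) ^ γ ≤ 1 / (-1 - γ) := by
  rw [integral_one_add_rpow (by linarith) ht, ← neg_div_neg_eq]
  have : 0 ≤ (1 + t) ^ (γ + 1) := by positivity
  rw [show -(γ + 1) = -1 - γ by ring]
  exact div_le_div_of_nonneg_right (by linarith) (by linarith)

/-- Comparison of an integral with a convolution. -/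
theorem integral_le_of_le_sub {f g : ℝ → ℝ} {t : ℝ} (ht : 0 ≤ t) (hf : Continuous f)
    (hg : IntervalIntegrable g volume 0 t) (h : ∀ r, 0 ≤ r → r ≤ t → f r ≤ g (t - r)) :
    ∫ r in (0 : ℝ)..t, f r ≤ ∫ s in (0 : ℝ)..t, g s := by
  have e := intervalIntegral.integral_comp_sub_left (a := 0) (b := t) g t
  rw [sub_self, sub_zero] at e
  rw [← e]
  refine intervalIntegral.integral_mono_on ht (hf.intervalIntegrable _ _) ?_
    fun r hr => h r hr.1 hr.2
  have := hg.comp_sub_left t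
  rw [sub_self, sub_zero] at this
  exact this.symm

theorem sq_sum_mul_le {ι : Type*} [Fintype ι] (c b : ι → ℝ) :
    (∑ i, c i * b i) ^ 2 ≤ (∑ i, |c i|) * ∑ i, |c i| * b i ^ 2 := by
  have h := Finset.sum_mul_sq_le_sq_mul_sq Finset.univ (fun i => √|c i|) (fun i => √|c i| * |b i|)
  have h1 : ∀ i, √|c i| ^ 2 = |c i| := fun i => Real.sq_sqrt (abs_nonneg _)
  have h2 : |∑ i, c i * b i| ≤ ∑ i, √|c i| * (√|c i| * |b i|) := by
    refine (Finset.abs_sum_le_sum_abs _ _).trans_eq (Finset.sum_congr rfl fun i _ => ?_)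
    rw [← mul_assoc, ← sq, h1, abs_mul]
  simp only [mul_pow, h1, sq_abs] at h
  rw [← sq_abs]
  exact (pow_le_pow_left₀ (abs_nonneg _) h2 2).trans h

/-- A function that improves every affine bound by a factor less than one is bounded. -/
theorem le_of_contraction {S : Type*} {f w : S → ℝ} {A q : ℝ} (hq0 : 0 ≤ q) (hq : q < 1)
    (hA : 0 ≤ A) {M₀ : ℝ} (h0 : ∀ s, f s ≤ M₀ * w s) (hM₀ : 0 ≤ M₀) (hw : ∀ s, 0 ≤ w s)
    (h : ∀ M, 0 ≤ M → (∀ s, f s ≤ M * w s) → ∀ s, f s ≤ (A + q * M) * w s) (s : S) :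
    f s ≤ A / (1 - q) * w s := by
  have h1q : 0 < 1 - q := by linarith
  -- `A / (1 - q)` is the fixed point of `M ↦ A + q M`, and each application of `h` shrinks the
  -- distance to it by the factor `q`.
  have key : ∀ n : ℕ, ∀ s, f s ≤ (A / (1 - q) + q ^ n * M₀) * w s := by
    intro n
    induction n with
    | zero =>
      intro s
      refine (h0 s).trans (mul_le_mul_of_nonneg_right ?_ (hw s))
      have : 0 ≤ A / (1 - q) := by positivity
      simpa using this
    | succ n ih =>
      intro s
      have := h _ (by positivity) ih s
      refine this.trans_eq ?_
      congr 1
      field_simp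
      ring
  have lim : Filter.Tendsto (fun n : ℕ => (A / (1 - q) + q ^ n * M₀) * w s) Filter.atTop
      (nhds ((A / (1 - q) + 0 * M₀) * w s)) :=
    (((tendsto_pow_atTop_nhds_zero_of_lt_one hq0 hq).mul_const M₀).const_add _).mul_const _
  rw [zero_mul, add_zero] at lim
  exact ge_of_tendsto' lim fun n => key n s

end Integrals

/-! ## Duhamel formula and second moments -/

section Moments

open scoped Matrix

variable {N : ℕ} [NeZero N]

/-- The semigroup of the half-filled process on functions of degree two in `Z`. -/
def propagator (a : ZMod N → ℝ) (t : ℝ) : Matrix (HalfFilled N) (HalfFilled N) ℝ :=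
  NormedSpace.exp (t • (generator a + (2 * nu N) • (1 : Matrix (HalfFilled N) (HalfFilled N) ℝ)))

/-- The square of `Z(x)`. -/
def zsq (x : ZMod N) (A : HalfFilled N) : ℝ := zval A x ^ 2

/-- The linear functional `∑ α(x) Z(x)`. -/
def zlin (α : ZMod N → ℝ) (A : HalfFilled N) : ℝ := ∑ x, α x * zval A x

/-- The action of the semigroup kernel on a row vector. -/
def kernelRow (a : ZMod N → ℝ) (α : ZMod N → ℝ) (t : ℝ) (y : ZMod N) : ℝ :=
  ∑ x, α x * semigroupKernel a t x y

theorem propagator_nonneg (hN : 2 ≤ N) {a : ZMod N → ℝ} (ha : ∀ x, 0 ≤ a x) {t : ℝ} (ht : 0 ≤ t)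
    (A B : HalfFilled N) : 0 ≤ propagator a t A B := by
  refine matrixExp_nonneg (fun i j hij => ?_) ht A B
  simp only [generator, Matrix.add_apply, Matrix.smul_apply, Matrix.one_apply_ne hij, smul_zero,
    add_zero]
  exact jumpMatrix_nonneg hN ha i j

theorem propagator_add (a : ZMod N → ℝ) (s t : ℝ) :
    propagator a (s + t) = propagator a s * propagator a t :=
  matrixExp_add _ s t

theorem propagator_zero (a : ZMod N → ℝ) : propagator a 0 = 1 := by
  simp [propagator]

theorem hasDerivAt_vecMul_propagator (a : ZMod N → ℝ) (m g : HalfFilled N → ℝ) (t : ℝ) :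
    HasDerivAt (fun r => (m ᵥ* propagator a r) ⬝ᵥ g) ((m ᵥ* propagator a t) ⬝ᵥ
      ((generator a + (2 * nu N) • (1 : Matrix (HalfFilled N) (HalfFilled N) ℝ)) *ᵥ g)) t := by
  have h : ∀ A B, HasDerivAt (fun r => propagator a r A B) ((propagator a t *
      (generator a + (2 * nu N) • (1 : Matrix (HalfFilled N) (HalfFilled N) ℝ))) A B) t :=
    fun A B => hasDerivAt_matrix_entry (hasDerivAt_matrixExp _ t) A B
  have h2 : HasDerivAt (fun r => ∑ B, (∑ A, m A * propagator a r A B) * g B)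
      (∑ B, (∑ A, m A * (propagator a t *
      (generator a + (2 * nu N) • (1 : Matrix (HalfFilled N) (HalfFilled N) ℝ))) A B) * g B) t :=
    HasDerivAt.fun_sum fun B _ => (HasDerivAt.fun_sum fun A _ => (h A B).const_mul _).mul_const _
  rw [Matrix.dotProduct_mulVec, Matrix.vecMul_vecMul]
  exact h2

theorem continuous_vecMul_propagator (a : ZMod N → ℝ) (m g : HalfFilled N → ℝ) :
    Continuous fun r => (m ᵥ* propagator a r) ⬝ᵥ g :=
  continuous_iff_continuousAt.2 fun t => (hasDerivAt_vecMul_propagator a m g t).continuousAt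

theorem vecMul_propagator_nonneg (hN : 2 ≤ N) {a : ZMod N → ℝ} (ha : ∀ x, 0 ≤ a x) {t : ℝ}
    (ht : 0 ≤ t) {m : HalfFilled N → ℝ} (hm : ∀ A, 0 ≤ m A) (B : HalfFilled N) :
    0 ≤ (m ᵥ* propagator a t) B :=
  Finset.sum_nonneg fun A _ => mul_nonneg (hm A) (propagator_nonneg hN ha ht A B)

theorem dotProduct_mono {ι : Type*} [Fintype ι] {m f g : ι → ℝ} (hm : ∀ i, 0 ≤ m i)
    (h : ∀ i, f i ≤ g i) : m ⬝ᵥ f ≤ m ⬝ᵥ g :=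
  Finset.sum_le_sum fun i _ => mul_le_mul_of_nonneg_left (h i) (hm i)

theorem dotProduct_nonneg' {ι : Type*} [Fintype ι] {m f : ι → ℝ} (hm : ∀ i, 0 ≤ m i)
    (h : ∀ i, 0 ≤ f i) : 0 ≤ m ⬝ᵥ f :=
  Finset.sum_nonneg fun i _ => mul_nonneg (hm i) (h i)

theorem continuous_kernelRow (a α : ZMod N → ℝ) (y : ZMod N) :
    Continuous fun t => kernelRow a α t y := by
  unfold kernelRow
  have := continuous_semigroupKernel a
  fun_prop

theorem hasDerivAt_kernelRow (a α : ZMod N → ℝ) (t : ℝ) (y : ZMod N) :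
    HasDerivAt (fun t => kernelRow a α t y) (∑ w, kernelRow a α t w * hamiltonian a w y) t := by
  have h : ∀ x, HasDerivAt (fun t => semigroupKernel a t x y)
      (∑ w, semigroupKernel a t x w * hamiltonian a w y) t := fun x =>
    hasDerivAt_matrix_entry (hasDerivAt_matrixExp (hamiltonian a) t) x y
  have h2 : HasDerivAt (fun t => kernelRow a α t y)
      (∑ x, α x * ∑ w, semigroupKernel a t x w * hamiltonian a w y) t :=
    HasDerivAt.fun_sum fun x _ => (h x).const_mul _
  convert h2 using 1
  simp only [kernelRow, Finset.sum_mul, Finset.mul_sum]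
  rw [Finset.sum_comm]
  exact Finset.sum_congr rfl fun _ _ => Finset.sum_congr rfl fun _ _ => by ring

theorem kernelRow_zero (a α : ZMod N → ℝ) : kernelRow a α 0 = α := by
  ext y
  simp [kernelRow, semigroupKernel_zero]

/-- Duhamel formula for products of two linear functionals of `Z`. -/
theorem duhamel (hN : 2 ≤ N) (a α α' : ZMod N → ℝ) (m : HalfFilled N → ℝ) (t : ℝ) :
    (m ᵥ* propagator a t) ⬝ᵥ (fun A => zlin α A * zlin α' A)
      = m ⬝ᵥ (fun A => zlin (kernelRow a α t) A * zlin (kernelRow a α' t) A)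
        + ∫ r in (0 : ℝ)..t, ∑ w, kernelRow a α (t - r) w * kernelRow a α' (t - r) w
          * ((m ᵥ* propagator a r) ⬝ᵥ bracket a w) := by
  set D : ℝ → ZMod N → ZMod N → ℝ := fun r x y =>
    (m ᵥ* propagator a r) ⬝ᵥ (fun A => zval A x * zval A y) with hD
  have hDd : ∀ r x y, HasDerivAt (fun s => D s x y) ((∑ x', hamiltonian a x x' * D r x' y)
      + (∑ y', hamiltonian a y y' * D r x y')
      + if x = y then (m ᵥ* propagator a r) ⬝ᵥ bracket a x else 0) r := by
    intro r x y
    have h := hasDerivAt_vecMul_propagator a m (fun A => zval A x * zval A y) r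
    have e : ((generator a + (2 * nu N) • (1 : Matrix (HalfFilled N) (HalfFilled N) ℝ)) *ᵥ
        (fun A => zval A x * zval A y)) = fun A => (∑ x', hamiltonian a x x' * zval A x') * zval A y
        + zval A x * (∑ w', hamiltonian a y w' * zval A w')
        + if x = y then bracket a x A else 0 := by
      ext A
      exact generator_zval_mul hN a x y A
    rw [e] at h
    convert h using 1
    simp only [hD, dotProduct, mul_add, Finset.sum_add_distrib, Finset.mul_sum, Finset.sum_mul]
    congr 1
    · congr 1
      · rw [Finset.sum_comm]
        exact Finset.sum_congr rfl fun _ _ => Finset.sum_congr rfl fun _ _ => by ring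
      · rw [Finset.sum_comm]
        exact Finset.sum_congr rfl fun _ _ => Finset.sum_congr rfl fun _ _ => by ring
    · split_ifs <;> simp
  have hk : ∀ (α : ZMod N → ℝ) (r : ℝ) (y : ZMod N), HasDerivAt (fun s => kernelRow a α (t - s) y)
      (-∑ w, kernelRow a α (t - r) w * hamiltonian a w y) r := by
    intro α r y
    have h := HasDerivAt.comp (h := fun s : ℝ => t - s) r (hasDerivAt_kernelRow a α (t - r) y)
      ((hasDerivAt_id' r).const_sub t)
    rw [mul_neg, mul_one] at h
    exact h
  -- Along the interpolation between times `0` and `t` the kernels evolve backwards and the moments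
  -- forwards. The two `hamiltonian` contributions cancel and only the diagonal bracket is left.
  have hG : ∀ r, HasDerivAt (fun s => ∑ x, ∑ y, kernelRow a α (t - s) x * kernelRow a α' (t - s) y
      * D s x y) (∑ w, kernelRow a α (t - r) w * kernelRow a α' (t - r) w
          * ((m ᵥ* propagator a r) ⬝ᵥ bracket a w)) r := by
    intro r
    have h : HasDerivAt (fun s => ∑ x, ∑ y, kernelRow a α (t - s) x * kernelRow a α' (t - s) y
      * D s x y) (∑ x, ∑ y, (((-∑ w, kernelRow a α (t - r) w * hamiltonian a w x)
        * kernelRow a α' (t - r) y + kernelRow a α (t - r) x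
        * (-∑ w, kernelRow a α' (t - r) w * hamiltonian a w y)) * D r x y
        + kernelRow a α (t - r) x * kernelRow a α' (t - r) y *
          ((∑ x', hamiltonian a x x' * D r x' y) + (∑ y', hamiltonian a y y' * D r x y')
          + if x = y then (m ᵥ* propagator a r) ⬝ᵥ bracket a x else 0))) r :=
      HasDerivAt.fun_sum fun x _ => HasDerivAt.fun_sum fun y _ =>
        ((hk α r x).mul (hk α' r y)).mul (hDd r x y)
    convert h using 1
    set p := kernelRow a α (t - r)
    set p' := kernelRow a α' (t - r)
    have e1 : ∑ x, ∑ y, (∑ w, p w * hamiltonian a w x) * p' y * D r x y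
        = ∑ x, ∑ y, p x * p' y * ∑ x', hamiltonian a x x' * D r x' y := by
      rw [Finset.sum_comm]
      conv_rhs => rw [Finset.sum_comm]
      refine Finset.sum_congr rfl fun y _ => ?_
      simp only [Finset.sum_mul, Finset.mul_sum]
      rw [Finset.sum_comm]
      exact Finset.sum_congr rfl fun _ _ => Finset.sum_congr rfl fun _ _ => by ring
    have e2 : ∑ x, ∑ y, p x * (∑ w, p' w * hamiltonian a w y) * D r x y
        = ∑ x, ∑ y, p x * p' y * ∑ y', hamiltonian a y y' * D r x y' := by
      refine Finset.sum_congr rfl fun x _ => ?_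
      simp only [Finset.sum_mul, Finset.mul_sum]
      rw [Finset.sum_comm]
      exact Finset.sum_congr rfl fun _ _ => Finset.sum_congr rfl fun _ _ => by ring
    have e3 : ∑ x, ∑ y, p x * p' y * (if x = y then (m ᵥ* propagator a r) ⬝ᵥ bracket a x else 0)
        = ∑ w, p w * p' w * ((m ᵥ* propagator a r) ⬝ᵥ bracket a w) := by
      simp
    rw [← e3]
    have e4 : ∀ x y, (((-∑ w, p w * hamiltonian a w x) * p' y + p x
        * (-∑ w, p' w * hamiltonian a w y)) * D r x y + p x * p' y *
          ((∑ x', hamiltonian a x x' * D r x' y) + (∑ y', hamiltonian a y y' * D r x y')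
          + if x = y then (m ᵥ* propagator a r) ⬝ᵥ bracket a x else 0))
        = (p x * p' y * ∑ x', hamiltonian a x x' * D r x' y
            - (∑ w, p w * hamiltonian a w x) * p' y * D r x y)
          + (p x * p' y * ∑ y', hamiltonian a y y' * D r x y'
            - p x * (∑ w, p' w * hamiltonian a w y) * D r x y)
          + p x * p' y * (if x = y then (m ᵥ* propagator a r) ⬝ᵥ bracket a x else 0) := by
      intro x y; ring
    simp only [e4, Finset.sum_add_distrib, Finset.sum_sub_distrib]
    rw [e1, e2]
    ring
  have hGG : ∀ (c c' : ZMod N → ℝ) (r : ℝ), ∑ x, ∑ y, c x * c' y * D r x y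
      = (m ᵥ* propagator a r) ⬝ᵥ (fun A => zlin c A * zlin c' A) := by
    intro c c' r
    have e : (fun A : HalfFilled N => zlin c A * zlin c' A)
        = fun A => ∑ x, ∑ y, c x * c' y * (zval A x * zval A y) := by
      ext A
      rw [zlin, zlin, Finset.sum_mul_sum]
      exact Finset.sum_congr rfl fun _ _ => Finset.sum_congr rfl fun _ _ => by ring
    rw [e]
    simp only [hD, dotProduct, Finset.mul_sum]
    conv_rhs => rw [Finset.sum_comm]
    refine Finset.sum_congr rfl fun x _ => ?_
    conv_rhs => rw [Finset.sum_comm]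
    exact Finset.sum_congr rfl fun _ _ => Finset.sum_congr rfl fun _ _ => by ring
  have hc : Continuous fun r => ∑ w, kernelRow a α (t - r) w * kernelRow a α' (t - r) w
          * ((m ᵥ* propagator a r) ⬝ᵥ bracket a w) := by
    have h1 : ∀ (α : ZMod N → ℝ) (w : ZMod N), Continuous fun r => kernelRow a α (t - r) w :=
      fun α w => (continuous_kernelRow a α w).comp (by fun_prop)
    have h2 := fun w => continuous_vecMul_propagator a m (bracket a w)
    exact continuous_finsetSum _ fun w _ => ((h1 α w).mul (h1 α' w)).mul (h2 w)
  have h1 := integral_eq_of_hasDerivAt hG hc t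
  rw [hGG, hGG, sub_self, sub_zero, kernelRow_zero, kernelRow_zero, propagator_zero,
    Matrix.vecMul_one] at h1
  linarith

end Moments

end InhomASEP

/-! ### Second-moment bounds for `Z`. -/

namespace InhomASEP

section MomentBounds

open scoped Matrix

variable {N : ℕ} [NeZero N]

/-- Cauchy–Schwarz with weights `|c x|`. Through it the `ℓ¹` bounds on kernels become second-moment
bounds. -/
theorem dotProduct_zlin_sq_le {m : HalfFilled N → ℝ} (hm : ∀ A, 0 ≤ m A) (c : ZMod N → ℝ)
    {c₁ V : ℝ} (hc : ∑ x, |c x| ≤ c₁) (hV : ∀ x, m ⬝ᵥ zsq x ≤ V) :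
    m ⬝ᵥ (fun A => zlin c A ^ 2) ≤ c₁ ^ 2 * V := by
  have hV0 : 0 ≤ V := (dotProduct_nonneg' hm fun A => sq_nonneg _).trans (hV 0)
  have hc0 : 0 ≤ ∑ x, |c x| := Finset.sum_nonneg fun x _ => abs_nonneg _
  calc m ⬝ᵥ (fun A => zlin c A ^ 2)
      ≤ m ⬝ᵥ (fun A => (∑ x, |c x|) * ∑ x, |c x| * zval A x ^ 2) :=
        dotProduct_mono hm fun A => sq_sum_mul_le c (zval A)
    _ = (∑ x, |c x|) * ∑ x, |c x| * (m ⬝ᵥ zsq x) := by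
        simp only [dotProduct, Finset.mul_sum, zsq]
        rw [Finset.sum_comm]
        exact Finset.sum_congr rfl fun _ _ => Finset.sum_congr rfl fun _ _ => by ring
    _ ≤ (∑ x, |c x|) * ∑ x, |c x| * V := by
        refine mul_le_mul_of_nonneg_left ?_ hc0
        exact Finset.sum_le_sum fun x _ => mul_le_mul_of_nonneg_left (hV x) (abs_nonneg _)
    _ = (∑ x, |c x|) ^ 2 * V := by rw [← Finset.sum_mul]; ring
    _ ≤ _ := by gcongr

variable {u β K T : ℝ} {a : ZMod N → ℝ}

theorem KernelBounds.nonneg (h : KernelBounds u β K T a) : 0 ≤ K :=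
  (h.env_nonneg 0).trans (h.env_le 0)

theorem KernelBounds.sum_abs_le (h : KernelBounds u β K T a) {t : ℝ} (ht : 0 ≤ t)
    (htT : t ≤ (N : ℝ) ^ 2 * T) (x : ZMod N) : ∑ y, |semigroupKernel a t x y| ≤ K := by
  refine le_of_eq_of_le (Finset.sum_congr rfl fun y _ => ?_) (h.sum_le t ht htT x)
  exact abs_of_nonneg (semigroupKernel_nonneg h.env_nonneg ht x y)

theorem KernelBounds.bracket_dot_le (hN : 2 ≤ N) (h : KernelBounds u β K T a)
    {m : HalfFilled N → ℝ} (hm : ∀ A, 0 ≤ m A) (w : ZMod N) :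
    m ⬝ᵥ bracket a w ≤ 10 * K / N * (m ⬝ᵥ zsq w) := by
  have hN0 : (0 : ℝ) < N := by positivity
  have e : 10 * K / N * (m ⬝ᵥ zsq w) = m ⬝ᵥ (fun A => 10 * K / N * zsq w A) := by
    simp only [dotProduct, Finset.mul_sum]
    exact Finset.sum_congr rfl fun _ _ => by ring
  rw [e]
  refine dotProduct_mono hm fun A => ?_
  have h1 := bracket_le hN h.env_nonneg w A
  have h2 : 10 * a w * zval A w ^ 2 ≤ 10 * K * zval A w ^ 2 := by
    have := h.env_le w
    gcongr
  rw [div_mul_eq_mul_div, le_div_iff₀ hN0, zsq]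
  linarith

theorem kernelRow_single (a : ZMod N → ℝ) (t : ℝ) (x : ZMod N) :
    kernelRow a (Pi.single x 1) t = semigroupKernel a t x := by
  ext y
  simp [kernelRow, Pi.single_apply]

theorem zlin_single (x : ZMod N) (A : HalfFilled N) : zlin (Pi.single x 1) A = zval A x := by
  simp [zlin, Pi.single_apply]

/-- Duhamel formula for the square of a linear functional. -/
theorem duhamel_sq (hN : 2 ≤ N) (a α : ZMod N → ℝ) (m : HalfFilled N → ℝ) (t : ℝ) :
    (m ᵥ* propagator a t) ⬝ᵥ (fun A => zlin α A ^ 2)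
      = m ⬝ᵥ (fun A => zlin (kernelRow a α t) A ^ 2)
        + ∫ r in (0 : ℝ)..t, ∑ w, kernelRow a α (t - r) w ^ 2
          * ((m ᵥ* propagator a r) ⬝ᵥ bracket a w) := by
  simp only [sq]
  exact duhamel hN a α α m t

theorem continuous_noise (a α α' : ZMod N → ℝ) (m : HalfFilled N → ℝ) (f : ZMod N → HalfFilled N → ℝ)
    (t : ℝ) : Continuous fun r => ∑ w, kernelRow a α (t - r) w * kernelRow a α' (t - r) w
          * ((m ᵥ* propagator a r) ⬝ᵥ f w) := by
  have h1 : ∀ (α : ZMod N → ℝ) (w : ZMod N), Continuous fun r => kernelRow a α (t - r) w :=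
    fun α w => (continuous_kernelRow a α w).comp (by fun_prop)
  have h2 := fun w => continuous_vecMul_propagator a m (f w)
  exact continuous_finsetSum _ fun w _ => ((h1 α w).mul (h1 α' w)).mul (h2 w)

/-- Bound on the noise term of the Duhamel formula. -/
theorem KernelBounds.noise_le (hN : 2 ≤ N) (h : KernelBounds u β K T a)
    {m : HalfFilled N → ℝ} (hm : ∀ A, 0 ≤ m A) (α : ZMod N → ℝ) {t : ℝ} (ht : 0 ≤ t)
    {f g : ℝ → ℝ} (hg : IntervalIntegrable g volume 0 t)
    (hf : ∀ r, 0 ≤ r → r ≤ t → ∀ w, (m ᵥ* propagator a r) ⬝ᵥ zsq w ≤ f r)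
    (hfg : ∀ r, 0 ≤ r → r ≤ t → (∑ w, kernelRow a α (t - r) w ^ 2) * f r ≤ g (t - r)) :
    ∫ r in (0 : ℝ)..t, ∑ w, kernelRow a α (t - r) w ^ 2 * ((m ᵥ* propagator a r) ⬝ᵥ bracket a w)
      ≤ 10 * K / N * ∫ s in (0 : ℝ)..t, g s := by
  have hK := h.nonneg
  rw [← intervalIntegral.integral_const_mul]
  refine integral_le_of_le_sub ht ?_ (hg.const_mul _) fun r h0 h1 => ?_
  · simpa only [sq] using continuous_noise a α α m (bracket a) t
  · have hmr := fun B => vecMul_propagator_nonneg hN h.env_nonneg h0 hm B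
    calc ∑ w, kernelRow a α (t - r) w ^ 2 * ((m ᵥ* propagator a r) ⬝ᵥ bracket a w)
        ≤ ∑ w, kernelRow a α (t - r) w ^ 2 * (10 * K / N * f r) := by
          refine Finset.sum_le_sum fun w _ => mul_le_mul_of_nonneg_left ?_ (sq_nonneg _)
          refine (h.bracket_dot_le hN hmr w).trans ?_
          exact mul_le_mul_of_nonneg_left (hf r h0 h1 w) (by positivity)
      _ = 10 * K / N * ((∑ w, kernelRow a α (t - r) w ^ 2) * f r) := by
          rw [← Finset.sum_mul]; ring
      _ ≤ _ := mul_le_mul_of_nonneg_left (hfg r h0 h1) (by positivity)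

theorem KernelBounds.sum_sq_le (h : KernelBounds u β K T a) {t : ℝ} (ht : 0 ≤ t)
    (htT : t ≤ (N : ℝ) ^ 2 * T) (x : ZMod N) :
    ∑ w, semigroupKernel a t x w ^ 2 ≤ K ^ 2 * (1 + t) ^ (-(1 / 2) : ℝ) := by
  have hp : 0 ≤ (1 + t) ^ (-(1 / 2) : ℝ) := by positivity
  calc ∑ w, semigroupKernel a t x w ^ 2
      ≤ ∑ w, semigroupKernel a t x w * (K * (1 + t) ^ (-(1 / 2) : ℝ)) := by
        refine Finset.sum_le_sum fun w _ => ?_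
        rw [sq]
        exact mul_le_mul_of_nonneg_left (h.sup_le t ht htT x w)
          (semigroupKernel_nonneg h.env_nonneg ht x w)
    _ = (∑ w, semigroupKernel a t x w) * (K * (1 + t) ^ (-(1 / 2) : ℝ)) := by
        rw [Finset.sum_mul]
    _ ≤ K * (K * (1 + t) ^ (-(1 / 2) : ℝ)) := by
        have := h.nonneg
        exact mul_le_mul_of_nonneg_right (h.sum_le t ht htT x) (by positivity)
    _ = _ := by ring

theorem zsq_eq_zlin (x : ZMod N) : zsq x = fun A : HalfFilled N => zlin (Pi.single x 1) A ^ 2 := by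
  ext A
  rw [zlin_single, zsq]

/-- Uses `(1+s)^(-1/2) ≤ s^(-1/2)` and `e^(-cs) ≤ (cs)^(-1/4)`, whose product is an integrable
power. With `c` of order `N^(-2)` and `t ≤ N² T` the result is of order `N`, matching the factor
`1/N` of the noise, and a large constant in `c` makes the product small. -/
theorem integral_rpow_mul_exp_le {c t : ℝ} (hc : 0 < c) (ht : 0 ≤ t) :
    ∫ s in (0 : ℝ)..t, (1 + s) ^ (-(1 / 2) : ℝ) * Real.exp (-(c * s))
      ≤ 4 * c ^ (-(1 / 4) : ℝ) * t ^ (1 / 4 : ℝ) := by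
  have e : ∫ s in (0 : ℝ)..t, c ^ (-(1 / 4) : ℝ) * s ^ (-(3 / 4) : ℝ)
      = 4 * c ^ (-(1 / 4) : ℝ) * t ^ (1 / 4 : ℝ) := by
    rw [intervalIntegral.integral_const_mul, integral_rpow (Or.inl (by norm_num))]
    norm_num
    ring
  rw [← e]
  refine intervalIntegral.integral_mono_on_of_le_Ioo ht ?_ ?_ fun s hs => ?_
  · exact ((continuousOn_one_add_rpow _ ht).mul (by fun_prop)).intervalIntegrable
  · exact (intervalIntegral.intervalIntegrable_rpow' (by norm_num)).const_mul _
  · have hs0 : 0 < s := hs.1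
    have h1 : (1 + s) ^ (-(1 / 2) : ℝ) ≤ s ^ (-(1 / 2) : ℝ) :=
      Real.rpow_le_rpow_of_nonpos hs0 (by linarith) (by norm_num)
    have h2 : Real.exp (-(c * s)) ≤ (c * s) ^ (-(1 / 4) : ℝ) := by
      have hcs : 0 < c * s := by positivity
      rw [Real.exp_neg, Real.rpow_neg hcs.le]
      apply inv_anti₀ (by positivity)
      have e1 : (c * s) ^ (1 / 4 : ℝ) ≤ 1 + c * s := by
        rcases le_total (c * s) 1 with h | h
        · exact (Real.rpow_le_one hcs.le h (by norm_num)).trans (by linarith)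
        · have := Real.rpow_le_rpow_of_exponent_le h (show (1 / 4 : ℝ) ≤ 1 by norm_num)
          rw [Real.rpow_one] at this
          linarith
      linarith [Real.add_one_le_exp (c * s)]
    calc (1 + s) ^ (-(1 / 2) : ℝ) * Real.exp (-(c * s))
        ≤ s ^ (-(1 / 2) : ℝ) * (c * s) ^ (-(1 / 4) : ℝ) := by gcongr
      _ = c ^ (-(1 / 4) : ℝ) * s ^ (-(3 / 4) : ℝ) := by
        rw [Real.mul_rpow hc.le hs0.le, mul_left_comm, ← Real.rpow_add hs0]
        norm_num

/-- Second moments of `Z` stay bounded up to times of order `N²`. -/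
theorem second_moment_bound (K T : ℝ) (hK : 1 ≤ K) (hT : 0 ≤ T) : ∃ C : ℝ, 1 ≤ C ∧
    ∀ (N : ℕ) [NeZero N], 2 ≤ N → ∀ (u β : ℝ) (a : ZMod N → ℝ), KernelBounds u β K T a →
    ∀ (m : HalfFilled N → ℝ), (∀ A, 0 ≤ m A) → ∀ V : ℝ, (∀ x, m ⬝ᵥ zsq x ≤ V) →
    ∀ t : ℝ, 0 ≤ t → t ≤ (N : ℝ) ^ 2 * T → ∀ x, (m ᵥ* propagator a t) ⬝ᵥ zsq x ≤ C * V := by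
  -- With `c = κ/N²` and `t ≤ N² T` one gets `t/c ≤ (N/(80K³))⁴`, so the noise term `(10K/N) K² · 4
  -- c^(-1/4) t^(1/4)` is at most `1/2`.
  set κ : ℝ := (T + 1) * (80 * K ^ 3) ^ 4 with hκ
  have hκ0 : 0 < κ := by positivity
  have hexp1 : 1 ≤ Real.exp (κ * T) := Real.one_le_exp (by positivity)
  refine ⟨2 * K ^ 2 * Real.exp (κ * T), by nlinarith, ?_⟩
  intro N _ hN u β a h m hm V hV
  have hN0 : (0 : ℝ) < N := by positivity
  have hV0 : 0 ≤ V := (dotProduct_nonneg' hm fun A => sq_nonneg _).trans (hV 0)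
  set c := κ / (N : ℝ) ^ 2 with hc
  have hc0 : 0 < c := by positivity
  let S := {p : ℝ × ZMod N // 0 ≤ p.1 ∧ p.1 ≤ (N : ℝ) ^ 2 * T}
  let f : S → ℝ := fun p => (m ᵥ* propagator a p.1.1) ⬝ᵥ zsq p.1.2
  let w : S → ℝ := fun p => Real.exp (c * p.1.1)
  have hpn : ∀ r, 0 ≤ r → ∀ x : ZMod N, 0 ≤ (m ᵥ* propagator a r) ⬝ᵥ zsq x := fun r hr x =>
    dotProduct_nonneg' (vecMul_propagator_nonneg hN h.env_nonneg hr hm) fun A => sq_nonneg _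
  -- A bound by compactness, with no uniformity in `N`. It only starts the iteration and disappears
  -- in the limit.
  obtain ⟨M₀, hM₀⟩ : ∃ M₀, ∀ r ∈ Set.Icc 0 ((N : ℝ) ^ 2 * T),
      ∑ x, (m ᵥ* propagator a r) ⬝ᵥ zsq x ≤ M₀ := by
    have hcont : Continuous fun r => ∑ x, (m ᵥ* propagator a r) ⬝ᵥ zsq x :=
      continuous_finsetSum _ fun x _ => continuous_vecMul_propagator a m (zsq x)
    obtain ⟨M₀, hM₀⟩ : BddAbove ((fun r => ∑ x, (m ᵥ* propagator a r) ⬝ᵥ zsq x) ''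
        Set.Icc 0 ((N : ℝ) ^ 2 * T)) := (isCompact_Icc.image hcont).bddAbove
    exact ⟨M₀, fun r hr => hM₀ ⟨r, hr, rfl⟩⟩
  have hM0 : 0 ≤ M₀ := (Finset.sum_nonneg fun x _ => hpn 0 le_rfl x).trans
    (hM₀ 0 ⟨le_rfl, by positivity⟩)
  -- A Grönwall argument: in the weighted norm with weight `e^(ct)` the noise term has norm at most
  -- `1/2`.
  have main := le_of_contraction (f := f) (w := w) (A := K ^ 2 * V) (q := 1 / 2) (by norm_num)
    (by norm_num) (by positivity) (M₀ := M₀) (fun p => ?_) hM0 (fun p => (Real.exp_pos _).le) ?_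
  · intro t ht htT x
    have := main ⟨(t, x), ht, htT⟩
    simp only [f, w] at this
    refine this.trans ?_
    have e1 : Real.exp (c * t) ≤ Real.exp (κ * T) := by
      apply Real.exp_le_exp.2
      rw [hc, div_mul_eq_mul_div, div_le_iff₀ (by positivity)]
      nlinarith
    have e2 : 0 ≤ K ^ 2 * V := by positivity
    rw [show K ^ 2 * V / (1 - 1 / 2) = 2 * (K ^ 2 * V) by ring]
    nlinarith
  · have h1 := hM₀ p.1.1 p.2
    have h2 := Finset.single_le_sum (f := fun x => (m ᵥ* propagator a p.1.1) ⬝ᵥ zsq x)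
      (fun x _ => hpn _ p.2.1 x) (Finset.mem_univ p.1.2)
    have h3 : 1 ≤ w p := Real.one_le_exp (mul_nonneg hc0.le p.2.1)
    simp only [f]
    nlinarith
  · rintro M hM hfM ⟨⟨t, x⟩, ht, htT⟩
    simp only [f, w]
    change 0 ≤ t at ht
    change t ≤ (N : ℝ) ^ 2 * T at htT
    have h1 : ∀ r, 0 ≤ r → r ≤ t → ∀ y, (m ᵥ* propagator a r) ⬝ᵥ zsq y ≤ M * Real.exp (c * r) :=
      fun r h0 h1 y => hfM ⟨(r, y), h0, h1.trans htT⟩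
    have hint : IntervalIntegrable (fun s => (K ^ 2 * M * Real.exp (c * t))
        * ((1 + s) ^ (-(1 / 2) : ℝ) * Real.exp (-(c * s)))) volume 0 t :=
      (((continuousOn_one_add_rpow _ ht).mul (by fun_prop)).intervalIntegrable).const_mul _
    have h2 := h.noise_le hN hm (Pi.single x 1) ht hint h1 (fun r h0 h1 => by
      rw [kernelRow_single]
      have e1 := h.sum_sq_le (t := t - r) (by linarith) (by linarith) x
      have e2 : Real.exp (c * r) = Real.exp (c * t) * Real.exp (-(c * (t - r))) := by
        rw [← Real.exp_add]; congr 1; ring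
      calc _ ≤ (K ^ 2 * (1 + (t - r)) ^ (-(1 / 2) : ℝ)) * (M * Real.exp (c * r)) := by gcongr
        _ = _ := by rw [e2]; ring)
    rw [intervalIntegral.integral_const_mul] at h2
    rw [zsq_eq_zlin, duhamel_sq hN]
    have h3 : m ⬝ᵥ (fun A => zlin (kernelRow a (Pi.single x 1) t) A ^ 2) ≤ K ^ 2 * V := by
      refine dotProduct_zlin_sq_le hm _ ?_ hV
      rw [kernelRow_single]
      exact h.sum_abs_le ht htT x
    have h4 := integral_rpow_mul_exp_le hc0 ht
    have h5 : 10 * K / N * (K ^ 2 * (4 * c ^ (-(1 / 4) : ℝ) * t ^ (1 / 4 : ℝ))) ≤ 1 / 2 := by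
      have e1 : c ^ (-(1 / 4) : ℝ) * t ^ (1 / 4 : ℝ) ≤ N * (1 / (80 * K ^ 3)) := by
        rw [Real.rpow_neg hc0.le, ← div_eq_inv_mul, ← Real.div_rpow ht hc0.le]
        have e2 : t / c ≤ (N * (1 / (80 * K ^ 3))) ^ (4 : ℝ) := by
          rw [div_le_iff₀ hc0, hc, hκ]
          have e3 : (N * (1 / (80 * K ^ 3))) ^ (4 : ℝ) * ((T + 1) * (80 * K ^ 3) ^ 4 / (N : ℝ) ^ 2)
              = (N : ℝ) ^ 2 * (T + 1) := by
            have : (4 : ℝ) = ((4 : ℕ) : ℝ) := by norm_num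
            rw [this, Real.rpow_natCast]
            have hK0 : K ≠ 0 := by linarith
            field_simp
          rw [e3]
          nlinarith [sq_nonneg (N : ℝ)]
        have e4 := Real.rpow_le_rpow (by positivity) e2 (show (0 : ℝ) ≤ 1 / 4 by norm_num)
        rwa [← Real.rpow_mul (by positivity), show (4 : ℝ) * (1 / 4) = 1 by norm_num,
          Real.rpow_one] at e4
      have hK0 : 0 < K := by linarith
      calc 10 * K / N * (K ^ 2 * (4 * c ^ (-(1 / 4) : ℝ) * t ^ (1 / 4 : ℝ)))
          = 40 * K ^ 3 / N * (c ^ (-(1 / 4) : ℝ) * t ^ (1 / 4 : ℝ)) := by ring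
        _ ≤ 40 * K ^ 3 / N * (N * (1 / (80 * K ^ 3))) := by gcongr
        _ = 1 / 2 := by field_simp; norm_num
    have h6 : 1 ≤ Real.exp (c * t) := Real.one_le_exp (by positivity)
    have h7 : 10 * K / N * (K ^ 2 * M * Real.exp (c * t) * ∫ s in (0 : ℝ)..t,
        (1 + s) ^ (-(1 / 2) : ℝ) * Real.exp (-(c * s))) ≤ 1 / 2 * M * Real.exp (c * t) := by
      have hK0 : 0 < K := by linarith
      calc _ ≤ 10 * K / N * (K ^ 2 * M * Real.exp (c * t)
            * (4 * c ^ (-(1 / 4) : ℝ) * t ^ (1 / 4 : ℝ))) := by gcongr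
        _ = (10 * K / N * (K ^ 2 * (4 * c ^ (-(1 / 4) : ℝ) * t ^ (1 / 4 : ℝ))))
            * (M * Real.exp (c * t)) := by ring
        _ ≤ 1 / 2 * (M * Real.exp (c * t)) := by gcongr
        _ = _ := by ring
    have h8 : K ^ 2 * V ≤ K ^ 2 * V * Real.exp (c * t) := le_mul_of_one_le_right (by positivity) h6
    linarith

end MomentBounds

end InhomASEP

/-! ## Spatial and temporal regularity -/

namespace InhomASEP

section Regularity

open scoped Matrix

variable {N : ℕ} [NeZero N]

/-- The square of the increment `Z(x) - Z(y)`. -/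
def zdiffSq (x y : ZMod N) (A : HalfFilled N) : ℝ := (zval A x - zval A y) ^ 2

variable {u β K T : ℝ} {a : ZMod N → ℝ}

theorem rpow_neg_time_le (hN : 1 ≤ N) {γ : ℝ} (h0 : 0 ≤ γ) (h1 : γ ≤ 1) (hT : 0 ≤ T) {t : ℝ}
    (ht : 0 ≤ t) (htT : t ≤ (N : ℝ) ^ 2 * T) :
    (1 + t) ^ γ ≤ (T + 1) * (N : ℝ) ^ (2 * γ) := by
  have hN1 : (1 : ℝ) ≤ N := by exact_mod_cast hN
  have e1 : (1 + t) ^ γ ≤ ((N : ℝ) ^ 2 * (T + 1)) ^ γ :=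
    Real.rpow_le_rpow (by linarith) (by nlinarith) h0
  rw [Real.mul_rpow (by positivity) (by linarith), ← Real.rpow_natCast, ← Real.rpow_mul
    (by linarith)] at e1
  have e2 : (T + 1) ^ γ ≤ T + 1 := by
    have := Real.rpow_le_rpow_of_exponent_le (show 1 ≤ T + 1 by linarith) h1
    rwa [Real.rpow_one] at this
  have e3 : 0 < (N : ℝ) ^ (((2 : ℕ) : ℝ) * γ) := by positivity
  push_cast at e1 e3
  nlinarith

theorem dot_add_sq_le {m : HalfFilled N → ℝ} (hm : ∀ A, 0 ≤ m A) (f g : HalfFilled N → ℝ) :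
    m ⬝ᵥ (fun A => (f A + g A) ^ 2) ≤ 2 * (m ⬝ᵥ fun A => f A ^ 2) + 2 * (m ⬝ᵥ fun A => g A ^ 2) := by
  have e : 2 * (m ⬝ᵥ fun A => f A ^ 2) + 2 * (m ⬝ᵥ fun A => g A ^ 2)
      = m ⬝ᵥ (fun A => 2 * f A ^ 2 + 2 * g A ^ 2) := by
    simp only [dotProduct, Finset.mul_sum, mul_add, Finset.sum_add_distrib]
    congr 1 <;> exact Finset.sum_congr rfl fun _ _ => by ring
  rw [e]
  exact dotProduct_mono hm fun A => by nlinarith [sq_nonneg (f A - g A)]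

theorem dot_const_mul {m : HalfFilled N → ℝ} (c : ℝ) (f : HalfFilled N → ℝ) :
    m ⬝ᵥ (fun A => c * f A) = c * (m ⬝ᵥ f) := by
  simp only [dotProduct, Finset.mul_sum]
  exact Finset.sum_congr rfl fun _ _ => by ring

/-- Averages of squared increments against a probability vector. -/
theorem dot_sq_average_le {m : HalfFilled N → ℝ} (hm : ∀ A, 0 ≤ m A) {p : ZMod N → ℝ}
    (hp : ∀ k, 0 ≤ p k) (hp1 : ∑ k, p k = 1) (f : ZMod N → HalfFilled N → ℝ) {b : ZMod N → ℝ}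
    (hb : ∀ k, m ⬝ᵥ (fun A => f k A ^ 2) ≤ b k) :
    m ⬝ᵥ (fun A => (∑ k, p k * f k A) ^ 2) ≤ ∑ k, p k * b k := by
  have hp' : ∑ k, |p k| = 1 := by
    rw [← hp1]; exact Finset.sum_congr rfl fun k _ => abs_of_nonneg (hp k)
  calc m ⬝ᵥ (fun A => (∑ k, p k * f k A) ^ 2)
      ≤ m ⬝ᵥ (fun A => ∑ k, p k * f k A ^ 2) := by
        refine dotProduct_mono hm fun A => ?_
        have := sq_sum_mul_le p (fun k => f k A)
        rw [hp', one_mul] at this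
        refine this.trans_eq (Finset.sum_congr rfl fun k _ => ?_)
        rw [abs_of_nonneg (hp k)]
    _ = ∑ k, p k * (m ⬝ᵥ fun A => f k A ^ 2) := by
        simp only [dotProduct, Finset.mul_sum]
        rw [Finset.sum_comm]
        exact Finset.sum_congr rfl fun _ _ => Finset.sum_congr rfl fun _ _ => by ring
    _ ≤ _ := Finset.sum_le_sum fun k _ => mul_le_mul_of_nonneg_left (hb k) (hp k)

/-- Splitting `q = p + ρ` exhibits the main part as an average of translates of `Z`, which inherits
every translation-invariant modulus of continuity. The remainder is only ever estimated in `ℓ¹`. -/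
theorem zlin_kernel_eq (a : ZMod N → ℝ) (t : ℝ) (x : ZMod N) (A : HalfFilled N) :
    zlin (semigroupKernel a t x) A = (∑ k, heatProfile N t k * zval A (x - k))
      + zlin (remainderKernel a t x) A := by
  rw [← sum_reflect _ x]
  simp only [zlin, sub_sub_cancel, ← heatKernel_eq_profile, semigroupKernel_eq_add, add_mul,
    Finset.sum_add_distrib]

/-- Hölder continuity in space is propagated up to times of order `N²`. -/
theorem spatial_regularity (K T u β : ℝ) (hK : 1 ≤ K) (hT : 0 ≤ T) (hu0 : 0 < u) (hu1 : u < 1)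
    (hβu : β ≤ u / 2) : ∃ C : ℝ, 1 ≤ C ∧
    ∀ (N : ℕ) [NeZero N], 2 ≤ N → ∀ (a : ZMod N → ℝ), KernelBounds u β K T a →
    ∀ (m : HalfFilled N → ℝ), (∀ A, 0 ≤ m A) → ∀ V : ℝ, (∀ x, m ⬝ᵥ zsq x ≤ V) →
    (∀ x y, m ⬝ᵥ zdiffSq x y ≤ V * ((N : ℝ) ^ (-β) * (torusDist x y : ℝ) ^ u) ^ 2) →
    ∀ t : ℝ, 0 ≤ t → t ≤ (N : ℝ) ^ 2 * T → ∀ x y,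
      (m ᵥ* propagator a t) ⬝ᵥ zdiffSq x y
        ≤ C * V * ((N : ℝ) ^ (-β) * (torusDist x y : ℝ) ^ u) ^ 2 := by
  obtain ⟨C₁, hC₁, hmom⟩ := second_moment_bound K T hK hT
  set C₂ : ℝ := 20 * K ^ 3 * C₁ * (2 / (1 - u)) * (T + 1) with hC₂
  have hu1' : 0 < 1 - u := by linarith
  have hC₂0 : 0 ≤ C₂ := by positivity
  refine ⟨2 + 2 * K ^ 2 + C₂, by nlinarith, ?_⟩
  intro N _ hN a h m hm V hV hH t ht htT x y
  have hN0 : (0 : ℝ) < N := by positivity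
  have hN1 : (1 : ℝ) ≤ N := by exact_mod_cast (by omega : 1 ≤ N)
  have hV0 : 0 ≤ V := (dotProduct_nonneg' hm fun A => sq_nonneg _).trans (hV 0)
  have hK0 : 0 ≤ K := by linarith
  by_cases hxy : x = y
  · subst hxy
    have : (zdiffSq x x : HalfFilled N → ℝ) = 0 := by ext A; simp [zdiffSq]
    rw [this, dotProduct_zero]
    have : 0 ≤ 2 + 2 * K ^ 2 + C₂ := by positivity
    positivity
  set d : ℝ := (torusDist x y : ℝ) ^ u with hd
  have hd1 : 1 ≤ d := Real.one_le_rpow (by exact_mod_cast one_le_torusDist hxy) hu0.le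
  set δ : ℝ := (N : ℝ) ^ (-β) * d with hδ
  have hδ0 : 0 ≤ δ := by positivity
  set α : ZMod N → ℝ := Pi.single x 1 - Pi.single y 1 with hα
  have hzα : (zdiffSq x y : HalfFilled N → ℝ) = fun A => zlin α A ^ 2 := by
    ext A
    have : zlin α A = zval A x - zval A y := by
      rw [← zlin_single x, ← zlin_single y]
      simp only [zlin, hα, Pi.sub_apply, sub_mul, Finset.sum_sub_distrib]
    rw [this, zdiffSq]
  have hrow : ∀ s w, kernelRow a α s w = semigroupKernel a s x w - semigroupKernel a s y w := by
    intro s w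
    rw [← kernelRow_single a s x, ← kernelRow_single a s y]
    simp only [kernelRow, hα, Pi.sub_apply, sub_mul, Finset.sum_sub_distrib]
  rw [hzα, duhamel_sq hN]
  have hinit : m ⬝ᵥ (fun A => zlin (kernelRow a α t) A ^ 2) ≤ (2 + 2 * K ^ 2) * V * δ ^ 2 := by
    have e : (fun A => zlin (kernelRow a α t) A ^ 2) = fun A =>
        ((∑ k, heatProfile N t k * (zval A (x - k) - zval A (y - k)))
          + zlin (fun w => remainderKernel a t x w - remainderKernel a t y w) A) ^ 2 := by
      ext A
      have e1 : zlin (kernelRow a α t) A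
          = zlin (semigroupKernel a t x) A - zlin (semigroupKernel a t y) A := by
        simp only [zlin, hrow, sub_mul, Finset.sum_sub_distrib]
      rw [e1, zlin_kernel_eq, zlin_kernel_eq]
      congr 1
      simp only [zlin, mul_sub, sub_mul, Finset.sum_sub_distrib]
      ring
    rw [e]
    refine (dot_add_sq_le hm _ _).trans ?_
    have h1 : m ⬝ᵥ (fun A => (∑ k, heatProfile N t k * (zval A (x - k) - zval A (y - k))) ^ 2)
        ≤ V * δ ^ 2 := by
      refine (dot_sq_average_le hm (heatProfile_nonneg ht) (sum_heatProfile t) _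
        (b := fun _ => V * δ ^ 2) fun k => ?_).trans_eq ?_
      · have := hH (x - k) (y - k)
        rw [torusDist_sub, sub_sub_sub_cancel_right, ← torusDist_sub] at this
        exact this
      · rw [← Finset.sum_mul, sum_heatProfile, one_mul]
    have h2 := dotProduct_zlin_sq_le hm _ (h.rem_diff_sum_le t ht htT x y) hV
    have e3 : (K * (N : ℝ) ^ (-β) * (torusDist x y : ℝ) ^ u) ^ 2 * V = K ^ 2 * V * δ ^ 2 := by
      rw [hδ, hd]; ring
    rw [e3] at h2
    linarith
  have hg : IntervalIntegrable (fun s : ℝ => (2 * K ^ 2 * C₁ * V * d)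
      * (1 + s) ^ (-((u + 1) / 2))) volume 0 t :=
    (intervalIntegrable_one_add_rpow _ ht).const_mul _
  have hnoise := h.noise_le hN hm α ht hg (f := fun _ => C₁ * V)
    (fun r h0 h1 w => hmom N hN u β a h m hm V hV r h0 (h1.trans htT) w) (fun r h0 h1 => by
      have ht' : 0 ≤ t - r := by linarith
      have htT' : t - r ≤ (N : ℝ) ^ 2 * T := by linarith
      -- One factor of the square uses the pointwise Hölder bound, the other the row sums of the two
      -- kernels.
      have e1 : ∑ w, kernelRow a α (t - r) w ^ 2
          ≤ (K * d * (1 + (t - r)) ^ (-((u + 1) / 2))) * (2 * K) := by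
        calc ∑ w, kernelRow a α (t - r) w ^ 2
            ≤ ∑ w, (K * d * (1 + (t - r)) ^ (-((u + 1) / 2)))
              * (|semigroupKernel a (t - r) x w| + |semigroupKernel a (t - r) y w|) := by
              refine Finset.sum_le_sum fun w _ => ?_
              rw [← sq_abs, sq, hrow]
              exact mul_le_mul (h.diff_le _ ht' htT' x y w) (abs_sub _ _) (abs_nonneg _)
                (by positivity)
          _ ≤ _ := by
              rw [← Finset.mul_sum, Finset.sum_add_distrib]
              have := h.sum_abs_le ht' htT' x
              have := h.sum_abs_le ht' htT' y
              refine mul_le_mul_of_nonneg_left (by linarith) (by positivity)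
      calc _ ≤ (K * d * (1 + (t - r)) ^ (-((u + 1) / 2))) * (2 * K) * (C₁ * V) := by gcongr
        _ = _ := by ring)
  rw [intervalIntegral.integral_const_mul] at hnoise
  have hint : ∫ s in (0 : ℝ)..t, (1 + s) ^ (-((u + 1) / 2))
      ≤ (2 / (1 - u)) * ((T + 1) * (N : ℝ) ^ (1 - u)) := by
    have e1 := integral_one_add_rpow_le (γ := -((u + 1) / 2)) (by linarith) ht
    have e2 := rpow_neg_time_le (by omega) (γ := (1 - u) / 2) (by linarith) (by linarith) hT ht htT
    rw [show -((u + 1) / 2) + 1 = (1 - u) / 2 by ring] at e1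
    rw [show 2 * ((1 - u) / 2) = 1 - u by ring] at e2
    refine e1.trans ?_
    rw [div_eq_mul_inv, inv_div, mul_comm]
    gcongr
  -- The noise is of size `N^(-u) d`, where `d` is already the `u`-th power of the distance. It fits
  -- under `(N^(-β) d)²` because `2β ≤ u` and `d ≥ 1`.
  have hNe : 1 / (N : ℝ) * (N : ℝ) ^ (1 - u) * d ≤ δ ^ 2 := by
    have e1 : 1 / (N : ℝ) * (N : ℝ) ^ (1 - u) = (N : ℝ) ^ (-u) := by
      rw [one_div, ← Real.rpow_neg_one, ← Real.rpow_add hN0]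
      congr 1
      ring
    have e2 : (N : ℝ) ^ (-u) ≤ ((N : ℝ) ^ (-β)) ^ 2 := by
      rw [← Real.rpow_natCast, ← Real.rpow_mul hN0.le]
      refine Real.rpow_le_rpow_of_exponent_le hN1 ?_
      push_cast
      linarith
    have e3 : d ≤ d ^ 2 := by nlinarith
    rw [e1, hδ, mul_pow]
    gcongr
  have hfin : 10 * K / N * (2 * K ^ 2 * C₁ * V * d * ∫ s in (0 : ℝ)..t, (1 + s) ^ (-((u + 1) / 2)))
      ≤ C₂ * V * δ ^ 2 := by
    calc _ ≤ 10 * K / N * (2 * K ^ 2 * C₁ * V * d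
          * ((2 / (1 - u)) * ((T + 1) * (N : ℝ) ^ (1 - u)))) := by gcongr
      _ = C₂ * V * (1 / (N : ℝ) * (N : ℝ) ^ (1 - u) * d) := by rw [hC₂]; ring
      _ ≤ _ := by gcongr
  calc _ ≤ (2 + 2 * K ^ 2) * V * δ ^ 2 + C₂ * V * δ ^ 2 := add_le_add hinit (hnoise.trans hfin)
    _ = _ := by ring

/-- Regularity in time, for the squares. -/
theorem temporal_regularity (K T u β : ℝ) (hK : 1 ≤ K) (hT : 0 ≤ T) (hu0 : 0 < u) (hu1 : u < 1)
    (hβ : 0 ≤ β) (hβu : β ≤ u / 2) : ∃ C : ℝ, 1 ≤ C ∧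
    ∀ (N : ℕ) [NeZero N], 2 ≤ N → ∀ (a : ZMod N → ℝ), KernelBounds u β K T a →
    ∀ (m : HalfFilled N → ℝ), (∀ A, 0 ≤ m A) → ∀ V : ℝ, (∀ x, m ⬝ᵥ zsq x ≤ V) →
    (∀ x y, m ⬝ᵥ zdiffSq x y ≤ V * ((N : ℝ) ^ (-β) * (torusDist x y : ℝ) ^ u) ^ 2) →
    ∀ t : ℝ, 0 ≤ t → t ≤ (N : ℝ) ^ 2 * T → ∀ x y,
      m ⬝ᵥ (fun A => |zsq y A - (propagator a t *ᵥ zsq x) A|)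
        ≤ C * V * ((N : ℝ) ^ (-β) * ((torusDist x y : ℝ) ^ u + (1 + t) ^ (u / 2))) := by
  obtain ⟨C₁, hC₁, hmom⟩ := second_moment_bound K T hK hT
  set C₂ : ℝ := 20 * K ^ 3 * C₁ * (T + 1) with hC₂
  have hC₂0 : 0 ≤ C₂ := by positivity
  refine ⟨12 + 6 * K ^ 2 + C₂, by nlinarith, ?_⟩
  intro N _ hN a h m hm V hV hH t ht htT x y
  have hN0 : (0 : ℝ) < N := by positivity
  have hN1 : (1 : ℝ) ≤ N := by exact_mod_cast (by omega : 1 ≤ N)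
  have hV0 : 0 ≤ V := (dotProduct_nonneg' hm fun A => sq_nonneg _).trans (hV 0)
  have hK0 : 0 ≤ K := by linarith
  set ν : ℝ := (N : ℝ) ^ (-β) with hν
  have hν0 : 0 < ν := by positivity
  set θ : ℝ := (1 + t) ^ (u / 2) with hθ
  have hθ1 : 1 ≤ θ := Real.one_le_rpow (by linarith) (by linarith)
  set d : ℝ := (torusDist x y : ℝ) ^ u with hd
  have hd0 : 0 ≤ d := by positivity
  set ε : ℝ := ν * (d + θ) with hε
  have hε0 : 0 < ε := by positivity
  -- `F` is the mean of `Z(t, x)`. Then `Z(y)² - P_t Z²(x) = (Z(y) - F)(Z(y) + F) - (P_t Z²(x) -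
  -- F²)`, and the last bracket is the nonnegative variance produced by the noise.
  set F : HalfFilled N → ℝ := fun A => zlin (semigroupKernel a t x) A with hF
  -- the noise part
  have hpr : ∀ A, (propagator a t *ᵥ zsq x) A = F A ^ 2 + ∫ r in (0 : ℝ)..t,
      ∑ w, kernelRow a (Pi.single x 1) (t - r) w ^ 2
        * (((Pi.single A (1 : ℝ)) ᵥ* propagator a r) ⬝ᵥ bracket a w) := by
    intro A
    have := duhamel_sq hN a (Pi.single x 1) (Pi.single A (1 : ℝ)) t
    rw [← zsq_eq_zlin, single_dotProduct, one_mul, kernelRow_single, ← Matrix.dotProduct_mulVec,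
      single_dotProduct, one_mul] at this
    exact this
  have hle : ∀ A, F A ^ 2 ≤ (propagator a t *ᵥ zsq x) A := by
    intro A
    rw [hpr A, le_add_iff_nonneg_right]
    refine intervalIntegral.integral_nonneg ht fun r hr => Finset.sum_nonneg fun w _ =>
      mul_nonneg (sq_nonneg _) (dotProduct_nonneg' (vecMul_propagator_nonneg hN h.env_nonneg hr.1
        fun B => ?_) (bracket_nonneg hN h.env_nonneg w))
    by_cases hB : B = A
    · subst hB; simp
    · simp [hB]
  have hnoise : m ⬝ᵥ (fun A => (propagator a t *ᵥ zsq x) A - F A ^ 2) ≤ C₂ * V * ε := by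
    have e1 : m ⬝ᵥ (fun A => (propagator a t *ᵥ zsq x) A - F A ^ 2)
        = ∫ r in (0 : ℝ)..t, ∑ w, kernelRow a (Pi.single x 1) (t - r) w ^ 2
          * ((m ᵥ* propagator a r) ⬝ᵥ bracket a w) := by
      have e2 := duhamel_sq hN a (Pi.single x 1) m t
      rw [← zsq_eq_zlin, kernelRow_single, ← Matrix.dotProduct_mulVec] at e2
      have e3 : m ⬝ᵥ (fun A => (propagator a t *ᵥ zsq x) A - F A ^ 2)
          = m ⬝ᵥ (propagator a t *ᵥ zsq x) - m ⬝ᵥ (fun A => F A ^ 2) := by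
        rw [← dotProduct_sub]; rfl
      rw [e3, e2]
      ring
    rw [e1]
    have hg : IntervalIntegrable (fun s : ℝ => (K ^ 2 * C₁ * V) * (1 + s) ^ (-(1 / 2) : ℝ))
        volume 0 t := (intervalIntegrable_one_add_rpow _ ht).const_mul _
    have h2 := h.noise_le hN hm (Pi.single x 1) ht hg (f := fun _ => C₁ * V)
      (fun r h0 h1 w => hmom N hN u β a h m hm V hV r h0 (h1.trans htT) w) (fun r h0 h1 => by
        rw [kernelRow_single]
        have := h.sum_sq_le (t := t - r) (by linarith) (by linarith) x
        calc _ ≤ (K ^ 2 * (1 + (t - r)) ^ (-(1 / 2) : ℝ)) * (C₁ * V) := by gcongr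
          _ = _ := by ring)
    rw [intervalIntegral.integral_const_mul] at h2
    have h3 := integral_one_add_rpow_le (γ := -(1 / 2)) (by norm_num) ht
    rw [show (-(1 / 2) + 1 : ℝ) = 1 / 2 by norm_num] at h3
    have h4 : 1 / (N : ℝ) * (1 + t) ^ (1 / 2 : ℝ) ≤ (T + 1) * ε := by
      -- Half the power is split so that `(1+t)^((1-β)/2)` is traded for `N^(1-β)`, which with the
      -- factor `1/N` leaves `N^(-β)`. The rest is at most `θ`.
      have e1 : (1 + t) ^ (1 / 2 : ℝ) = (1 + t) ^ ((1 - β) / 2) * (1 + t) ^ (β / 2) := by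
        rw [← Real.rpow_add (by linarith)]; congr 1; ring
      have e2 := rpow_neg_time_le (by omega) (γ := (1 - β) / 2) (by linarith) (by linarith) hT ht
        htT
      have e3 : (1 + t) ^ (β / 2) ≤ θ :=
        Real.rpow_le_rpow_of_exponent_le (by linarith) (by linarith)
      have e4 : 1 / (N : ℝ) * (N : ℝ) ^ (2 * ((1 - β) / 2)) = ν := by
        rw [one_div, ← Real.rpow_neg_one, ← Real.rpow_add hN0, hν]
        congr 1
        ring
      calc 1 / (N : ℝ) * (1 + t) ^ (1 / 2 : ℝ)
          = 1 / (N : ℝ) * ((1 + t) ^ ((1 - β) / 2) * (1 + t) ^ (β / 2)) := by rw [e1]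
        _ ≤ 1 / (N : ℝ) * (((T + 1) * (N : ℝ) ^ (2 * ((1 - β) / 2))) * θ) := by gcongr
        _ = (T + 1) * ((1 / (N : ℝ) * (N : ℝ) ^ (2 * ((1 - β) / 2))) * θ) := by ring
        _ ≤ (T + 1) * ε := by
          rw [e4, hε]
          have : 0 ≤ ν * d := by positivity
          gcongr
          linarith
    calc _ ≤ _ := h2
      _ ≤ 10 * K / N * (K ^ 2 * C₁ * V * ((1 + t) ^ (1 / 2 : ℝ) / (1 / 2))) := by gcongr
      _ = 20 * K ^ 3 * C₁ * V * (1 / (N : ℝ) * (1 + t) ^ (1 / 2 : ℝ)) := by ring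
      _ ≤ 20 * K ^ 3 * C₁ * V * ((T + 1) * ε) := by gcongr
      _ = _ := by rw [hC₂]; ring
  -- the drift part
  have hdiff : m ⬝ᵥ (fun A => (zval A y - F A) ^ 2) ≤ (12 + 4 * K ^ 2) * V * ε ^ 2 := by
    have e : (fun A => (zval A y - F A) ^ 2) = fun A =>
        (((zval A y - zval A x) + (∑ k, heatProfile N t k * (zval A x - zval A (x - k))))
          + zlin (fun w => -remainderKernel a t x w) A) ^ 2 := by
      ext A
      rw [hF]
      simp only
      rw [zlin_kernel_eq]
      congr 1
      simp only [zlin, mul_sub, neg_mul, Finset.sum_neg_distrib, Finset.sum_sub_distrib,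
        ← Finset.sum_mul, sum_heatProfile]
      ring
    rw [e]
    have b1 : m ⬝ᵥ (fun A => (zval A y - zval A x) ^ 2) ≤ V * ε ^ 2 := by
      refine (hH y x).trans ?_
      rw [torusDist_comm, hε]
      have : d ≤ d + θ := by linarith
      gcongr
    have b2 : m ⬝ᵥ (fun A => (∑ k, heatProfile N t k * (zval A x - zval A (x - k))) ^ 2)
        ≤ 2 * V * ε ^ 2 := by
      -- The Hölder weight `dist^(2u)` is compared with `θ² (1 + dist²/(1+t))` through `z^u ≤ 1 +
      -- z`. The variance of the walk is at most `t`, so the average of the weight is at most `2θ²`.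
      refine (dot_sq_average_le hm (heatProfile_nonneg ht) (sum_heatProfile t) _
        (b := fun k => V * (ν ^ 2 * (θ ^ 2 * (1 + (torusDist k 0 : ℝ) ^ 2 / (1 + t)))))
        fun k => ?_).trans ?_
      · refine (hH x (x - k)).trans ?_
        rw [torusDist_sub, sub_sub_cancel, mul_pow]
        have hθ2 : θ ^ 2 = (1 + t) ^ u := by
          rw [hθ, ← Real.rpow_natCast, ← Real.rpow_mul (by linarith)]
          congr 1
          push_cast
          ring
        have key : ((torusDist k 0 : ℝ) ^ u) ^ 2
            ≤ θ ^ 2 * (1 + (torusDist k 0 : ℝ) ^ 2 / (1 + t)) := by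
          set z : ℝ := (torusDist k 0 : ℝ) ^ 2 / (1 + t) with hz
          have hz0 : 0 ≤ z := by positivity
          have e1 : ((torusDist k 0 : ℝ) ^ u) ^ 2 = θ ^ 2 * z ^ u := by
            rw [hθ2, ← Real.mul_rpow (by linarith) hz0, hz,
              mul_div_cancel₀ _ (by linarith : 1 + t ≠ 0), ← Real.rpow_natCast,
              ← Real.rpow_natCast, ← Real.rpow_mul (by positivity), ← Real.rpow_mul (by positivity),
              mul_comm]
          have e2 : z ^ u ≤ 1 + z := by
            rcases le_total z 1 with hz1 | hz1
            · exact (Real.rpow_le_one hz0 hz1 hu0.le).trans (by linarith)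
            · have := Real.rpow_le_rpow_of_exponent_le hz1 hu1.le
              rw [Real.rpow_one] at this
              linarith
          rw [e1]
          gcongr
        gcongr
      · have e1 : ∑ k, heatProfile N t k * (V * (ν ^ 2 * (θ ^ 2
            * (1 + (torusDist k 0 : ℝ) ^ 2 / (1 + t)))))
            = V * ν ^ 2 * θ ^ 2 * (∑ k, heatProfile N t k
              + (∑ k, (torusDist k 0 : ℝ) ^ 2 * heatProfile N t k) / (1 + t)) := by
          rw [Finset.sum_div, ← Finset.sum_add_distrib, Finset.mul_sum]
          exact Finset.sum_congr rfl fun k _ => by ring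
        have e2 := sum_heatProfile_le (ψ := fun k : ZMod N => (torusDist k 0 : ℝ) ^ 2)
          (by simp [torusDist_self]) laplace_sq_dist_le ht
        have e3 : (∑ k : ZMod N, (torusDist k 0 : ℝ) ^ 2 * heatProfile N t k) / (1 + t) ≤ 1 := by
          rw [div_le_one (by linarith)]
          exact e2.trans (by linarith)
        rw [e1, sum_heatProfile]
        have e4 : ν ^ 2 * θ ^ 2 ≤ ε ^ 2 := by
          rw [← mul_pow, hε]
          have : θ ≤ d + θ := by linarith
          gcongr
        calc _ ≤ V * ν ^ 2 * θ ^ 2 * (1 + 1) := by gcongr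
          _ = 2 * V * (ν ^ 2 * θ ^ 2) := by ring
          _ ≤ _ := by gcongr
    have b3 : m ⬝ᵥ (fun A => zlin (fun w => -remainderKernel a t x w) A ^ 2)
        ≤ K ^ 2 * V * ε ^ 2 := by
      refine (dotProduct_zlin_sq_le hm (fun w => -remainderKernel a t x w)
        (c₁ := K * ν * θ) ?_ hV).trans ?_
      · simpa only [abs_neg] using h.rem_sum_le t ht htT x
      · have e4 : ν ^ 2 * θ ^ 2 ≤ ε ^ 2 := by
          rw [← mul_pow, hε]
          have : θ ≤ d + θ := by linarith
          gcongr
        calc _ = K ^ 2 * V * (ν ^ 2 * θ ^ 2) := by ring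
          _ ≤ _ := by gcongr
    have c1 := dot_add_sq_le hm (fun A => (zval A y - zval A x)
      + (∑ k, heatProfile N t k * (zval A x - zval A (x - k))))
      (zlin (fun w => -remainderKernel a t x w))
    have c2 := dot_add_sq_le hm (fun A => zval A y - zval A x)
      (fun A => ∑ k, heatProfile N t k * (zval A x - zval A (x - k)))
    have : 0 ≤ K ^ 2 * V * ε ^ 2 := by positivity
    nlinarith
  have hsum : m ⬝ᵥ (fun A => (zval A y + F A) ^ 2) ≤ (2 + 2 * K ^ 2) * V := by
    have c1 := dot_add_sq_le hm (fun A => zval A y) F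
    have c2 := hV y
    have c3 := dotProduct_zlin_sq_le hm _ (h.sum_abs_le ht htT x) hV
    change m ⬝ᵥ (fun A => zval A y ^ 2) ≤ V at c2
    change m ⬝ᵥ (fun A => F A ^ 2) ≤ K ^ 2 * V at c3
    linarith
  -- Young's inequality with parameter `ε`. The difference has second moment of order `ε²` and the
  -- sum of order one, so both terms become of order `ε`.
  have hpt : ∀ A, |zsq y A - (propagator a t *ᵥ zsq x) A|
      ≤ (1 / (2 * ε)) * (zval A y - F A) ^ 2 + (ε / 2) * (zval A y + F A) ^ 2
        + ((propagator a t *ᵥ zsq x) A - F A ^ 2) := by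
    intro A
    have e1 : zsq y A - (propagator a t *ᵥ zsq x) A = (zval A y - F A) * (zval A y + F A)
        - ((propagator a t *ᵥ zsq x) A - F A ^ 2) := by rw [zsq]; ring
    have e2 : |(zval A y - F A) * (zval A y + F A)|
        ≤ (1 / (2 * ε)) * (zval A y - F A) ^ 2 + (ε / 2) * (zval A y + F A) ^ 2 := by
      set p := zval A y - F A
      set q := zval A y + F A
      have key : (1 / (2 * ε)) * p ^ 2 + (ε / 2) * q ^ 2 - |p| * |q|
          = (1 / (2 * ε)) * (|p| - ε * |q|) ^ 2 := by
        rw [← sq_abs p, ← sq_abs q]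
        field_simp
        ring
      rw [abs_mul]
      have : 0 ≤ (1 / (2 * ε)) * (|p| - ε * |q|) ^ 2 := by positivity
      linarith
    rw [e1]
    refine (abs_sub _ _).trans ?_
    rw [abs_of_nonneg (sub_nonneg.2 (hle A))]
    linarith
  have hfin := dotProduct_mono hm hpt
  have hsplit : m ⬝ᵥ (fun A => (1 / (2 * ε)) * (zval A y - F A) ^ 2
        + (ε / 2) * (zval A y + F A) ^ 2 + ((propagator a t *ᵥ zsq x) A - F A ^ 2))
      = (1 / (2 * ε)) * (m ⬝ᵥ fun A => (zval A y - F A) ^ 2)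
        + (ε / 2) * (m ⬝ᵥ fun A => (zval A y + F A) ^ 2)
        + m ⬝ᵥ (fun A => (propagator a t *ᵥ zsq x) A - F A ^ 2) := by
    rw [← dot_const_mul, ← dot_const_mul, ← dotProduct_add, ← dotProduct_add]
    rfl
  rw [hsplit] at hfin
  refine hfin.trans ?_
  have f1 : (1 / (2 * ε)) * (m ⬝ᵥ fun A => (zval A y - F A) ^ 2) ≤ (6 + 2 * K ^ 2) * V * ε := by
    calc _ ≤ (1 / (2 * ε)) * ((12 + 4 * K ^ 2) * V * ε ^ 2) := by gcongr
      _ = _ := by field_simp; ring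
  have f2 : (ε / 2) * (m ⬝ᵥ fun A => (zval A y + F A) ^ 2) ≤ (1 + K ^ 2) * V * ε := by
    calc _ ≤ (ε / 2) * ((2 + 2 * K ^ 2) * V) := by gcongr
      _ = _ := by ring
  have f3 : 0 ≤ V * ε := by positivity
  have f4 : 0 ≤ K ^ 2 * (V * ε) := by positivity
  calc _ ≤ (6 + 2 * K ^ 2) * V * ε + (1 + K ^ 2) * V * ε + C₂ * V * ε :=
        add_le_add (add_le_add f1 f2) hnoise
    _ ≤ (12 + 6 * K ^ 2 + C₂) * V * ε := by linarith

end Regularity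

end InhomASEP

/-! ## The contraction estimate -/

namespace InhomASEP

section Contraction

open scoped Matrix

variable {N : ℕ} [NeZero N]

/-- The product `∇q(t; x, y) ∇q(t; x - 1, y)`. -/
def kernelGradProd (a : ZMod N → ℝ) (t : ℝ) (x y : ZMod N) : ℝ :=
  (semigroupKernel a t (x + 1) y - semigroupKernel a t x y)
    * (semigroupKernel a t x y - semigroupKernel a t (x - 1) y)

/-- The row vector of the gradient at `x`. -/
def gradRow (x : ZMod N) : ZMod N → ℝ := Pi.single (x + 1) 1 - Pi.single x 1

theorem kernelRow_gradRow (a : ZMod N → ℝ) (t : ℝ) (x y : ZMod N) :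
    kernelRow a (gradRow x) t y = semigroupKernel a t (x + 1) y - semigroupKernel a t x y := by
  simp [kernelRow, gradRow, Pi.single_apply, sub_mul, Finset.sum_sub_distrib]

theorem zlin_gradRow (x : ZMod N) (A : HalfFilled N) :
    zlin (gradRow x) A = zval A (x + 1) - zval A x := by
  simp [zlin, gradRow, Pi.single_apply, sub_mul, Finset.sum_sub_distrib]

theorem kernelGradProd_eq (a : ZMod N → ℝ) (t : ℝ) (x y : ZMod N) : kernelGradProd a t x y
    = kernelRow a (gradRow x) t y * kernelRow a (gradRow (x - 1)) t y := by
  simp [kernelRow_gradRow, kernelGradProd]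

theorem continuous_kernelGradProd (a : ZMod N → ℝ) (x y : ZMod N) :
    Continuous fun t => kernelGradProd a t x y := by
  simp only [kernelGradProd_eq]
  exact (continuous_kernelRow _ _ _).mul (continuous_kernelRow _ _ _)

variable {u β K T : ℝ} {a : ZMod N → ℝ}

theorem sum_abs_mul_le {ι : Type*} [Fintype ι] {f g : ι → ℝ} {b c : ℝ} (hf : ∀ i, |f i| ≤ b)
    (hg : ∑ i, |g i| ≤ c) (hb : 0 ≤ b) : ∑ i, |f i * g i| ≤ b * c := by
  simp only [abs_mul]
  calc ∑ i, |f i| * |g i| ≤ ∑ i, b * |g i| :=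
        Finset.sum_le_sum fun i _ => mul_le_mul_of_nonneg_right (hf i) (abs_nonneg _)
    _ = b * ∑ i, |g i| := by rw [Finset.mul_sum]
    _ ≤ _ := mul_le_mul_of_nonneg_left hg hb

/-- One gradient is taken in supremum norm, with decay exponent `1`, the other in `ℓ¹`, with
exponent `1/2`. -/
theorem KernelBounds.sum_abs_kernelGradProd_le (h : KernelBounds u β K T a) {t : ℝ} (ht : 0 ≤ t)
    (htT : t ≤ (N : ℝ) ^ 2 * T) (x : ZMod N) :
    ∑ y, |kernelGradProd a t x y| ≤ K ^ 2 * (1 + t) ^ (-(3 / 2) : ℝ) := by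
  have hK := h.nonneg
  have h1 := h.grad_sum_le t ht htT (x - 1)
  rw [sub_add_cancel] at h1
  have := sum_abs_mul_le (fun y => h.grad_le t ht htT x y) h1 (by positivity)
  refine this.trans_eq ?_
  rw [show (-(3 / 2) : ℝ) = -1 + -(1 / 2) by norm_num, Real.rpow_add (by positivity)]
  ring

theorem KernelBounds.sum_abs_heatGradProd_le (h : KernelBounds u β K T a) {t : ℝ} (ht : 0 ≤ t)
    (htT : t ≤ (N : ℝ) ^ 2 * T) (x : ZMod N) :
    ∑ y, |heatGradProd t x y| ≤ K ^ 2 * (1 + t) ^ (-(3 / 2) : ℝ) := by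
  have hK := h.nonneg
  have h1 := h.heat_grad_sum_le t ht htT (x - 1)
  rw [sub_add_cancel] at h1
  have := sum_abs_mul_le (fun y => h.heat_grad_le t ht htT x y) h1 (by positivity)
  refine this.trans_eq ?_
  rw [show (-(3 / 2) : ℝ) = -1 + -(1 / 2) by norm_num, Real.rpow_add (by positivity)]
  ring

/-- A difference of products is telescoped so that each term has one gradient of `ρ` in `ℓ¹`. The
gain `N^(-β)` lowers the decay from `3/2` to `5/4`, which is still integrable. -/
theorem KernelBounds.sum_abs_gradProd_sub_le (h : KernelBounds u β K T a) {t : ℝ} (ht : 0 ≤ t)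
    (htT : t ≤ (N : ℝ) ^ 2 * T) (x : ZMod N) :
    ∑ y, |kernelGradProd a t x y - heatGradProd t x y|
      ≤ 2 * K ^ 2 * (N : ℝ) ^ (-β) * (1 + t) ^ (-(5 / 4) : ℝ) := by
  have hK := h.nonneg
  have h1 := h.rem_grad_sum_le t ht htT (x - 1)
  have h2 := fun y => h.heat_grad_le t ht htT (x - 1) y
  rw [sub_add_cancel] at h1
  simp only [sub_add_cancel] at h2
  have e1 := sum_abs_mul_le (fun y => h.grad_le t ht htT x y) h1 (by positivity)
  have e2 := sum_abs_mul_le h2 (h.rem_grad_sum_le t ht htT x) (by positivity)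
  rw [show (-(5 / 4) : ℝ) = -1 + -(1 / 4) by norm_num, Real.rpow_add (by positivity)]
  calc ∑ y, |kernelGradProd a t x y - heatGradProd t x y|
      ≤ ∑ y, (|(semigroupKernel a t (x + 1) y - semigroupKernel a t x y)
          * (remainderKernel a t x y - remainderKernel a t (x - 1) y)|
        + |(heatKernel t x y - heatKernel t (x - 1) y)
          * (remainderKernel a t (x + 1) y - remainderKernel a t x y)|) := by
        refine Finset.sum_le_sum fun y _ => le_of_eq_of_le (congrArg _ ?_) (abs_add_le _ _)
        simp only [kernelGradProd, heatGradProd, remainderKernel]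
        ring
    _ ≤ _ := by
        rw [Finset.sum_add_distrib]
        refine (add_le_add e1 e2).trans_eq ?_
        ring

/-- The convolution weights `∑ |∇q ∇q|` are strictly subcritical when `N` is large. -/
theorem KernelBounds.integral_abs_kernelGradProd_le (hN : 3 ≤ N) (h : KernelBounds u β K T a)
    (hs : 8 * K ^ 2 * (N : ℝ) ^ (-β) ≤ 1 / 400) {t : ℝ} (ht : 0 ≤ t)
    (htT : t ≤ (N : ℝ) ^ 2 * T) (x : ZMod N) :
    ∫ r in (0 : ℝ)..t, ∑ y, |kernelGradProd a r x y| ≤ 1 - 1 / 400 := by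
  have c1 := continuous_kernelGradProd a
  have c2 := continuous_heatGradProd (N := N)
  have hi : IntervalIntegrable (fun r : ℝ => 2 * K ^ 2 * (N : ℝ) ^ (-β) * (1 + r) ^ (-(5 / 4) : ℝ))
    volume 0 t := (intervalIntegrable_one_add_rpow _ ht).const_mul _
  have hj : IntervalIntegrable (fun r : ℝ => ∑ y, |heatGradProd r x y|) volume 0 t :=
    Continuous.intervalIntegrable (by fun_prop) _ _
  -- The integral of `(1+s)^(-5/4)` is at most `4`, so replacing `p` by `q` costs at most `8K²
  -- N^(-β) ≤ 1/400`, half of the gap available for `p`.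
  calc ∫ r in (0 : ℝ)..t, ∑ y, |kernelGradProd a r x y|
      ≤ ∫ r in (0 : ℝ)..t, ((∑ y, |heatGradProd r x y|)
          + 2 * K ^ 2 * (N : ℝ) ^ (-β) * (1 + r) ^ (-(5 / 4) : ℝ)) := by
        refine intervalIntegral.integral_mono_on ht
          (Continuous.intervalIntegrable (by fun_prop) _ _) (hj.add hi) fun r hr => ?_
        refine le_trans ?_ (add_le_add le_rfl
          (h.sum_abs_gradProd_sub_le hr.1 (hr.2.trans htT) x))
        rw [← Finset.sum_add_distrib]
        refine Finset.sum_le_sum fun y _ => ?_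
        have := abs_add_le (heatGradProd r x y) (kernelGradProd a r x y - heatGradProd r x y)
        rwa [add_sub_cancel] at this
    _ ≤ (1 - 1 / 200) + 2 * K ^ 2 * (N : ℝ) ^ (-β) * (1 / (-1 - -(5 / 4))) := by
        rw [intervalIntegral.integral_add hj hi, intervalIntegral.integral_const_mul]
        refine add_le_add (integral_abs_heatGradProd_le hN ht x) ?_
        exact mul_le_mul_of_nonneg_left (integral_one_add_rpow_le' (by norm_num) ht)
          (by positivity)
    _ ≤ _ := by norm_num; linarith

/-- The weighted energy reduces to `∫ p(r;0)² dr`, and the squared return probability decays like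
`1/(1+r)`. This is the source of the logarithm in the final estimate. -/
theorem KernelBounds.integral_heatGradProd_dist_le (h : KernelBounds u β K T a) (hu0 : 0 < u)
    (hu1 : u ≤ 1) {t : ℝ} (ht : 0 ≤ t) (htT : t ≤ (N : ℝ) ^ 2 * T) (x : ZMod N) :
    ∫ r in (0 : ℝ)..t, ∑ y, |heatGradProd r x y| * (torusDist x y : ℝ) ^ u
      ≤ K ^ 2 * Real.log (1 + t) := by
  have c2 := continuous_heatGradProd (N := N)
  have c3 := continuous_heatProfile (N := N)
  set ψ : ZMod N → ℝ := fun k => (torusDist k 0 : ℝ) ^ u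
  have c4 := continuous_heatEnergy ψ
  have hl : ∫ r in (0 : ℝ)..t, (1 + r)⁻¹ = Real.log (1 + t) := by
    rw [intervalIntegral.integral_comp_add_left (fun s : ℝ => s⁻¹) 1, add_zero,
      integral_inv_of_pos one_pos (by linarith), div_one]
  calc ∫ r in (0 : ℝ)..t, ∑ y, |heatGradProd r x y| * (torusDist x y : ℝ) ^ u
      ≤ ∫ r in (0 : ℝ)..t, (1 / 2) * heatEnergy ψ r := by
        refine intervalIntegral.integral_mono_on ht
          (Continuous.intervalIntegrable (by fun_prop) _ _)
          (Continuous.intervalIntegrable (by fun_prop) _ _) fun r hr => ?_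
        refine le_of_eq_of_le (Finset.sum_congr rfl fun y _ => ?_)
          (InhomASEP.sum_abs_heatGradProd_le ψ (fun k => by positivity) r x)
        change _ = _ * (torusDist (x - y) 0 : ℝ) ^ u
        rw [← torusDist_sub x y]
    _ ≤ ∫ r in (0 : ℝ)..t, heatProfile N r 0 ^ 2 := by
        rw [intervalIntegral.integral_const_mul]
        exact integral_heatEnergy_rpow_dist_le hu0 hu1 ht
    _ ≤ ∫ r in (0 : ℝ)..t, K ^ 2 * (1 + r)⁻¹ := by
        refine intervalIntegral.integral_mono_on ht
          (Continuous.intervalIntegrable (by fun_prop) _ _) ?_ fun r hr => ?_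
        · refine ContinuousOn.intervalIntegrable ?_
          rw [Set.uIcc_of_le ht]
          refine continuousOn_const.mul (ContinuousOn.inv₀ (by fun_prop) fun s hs => ?_)
          linarith [hs.1]
        · have h1 := h.heat_sup_le r hr.1 (hr.2.trans htT) 0 0
          rw [heatKernel_eq_profile, sub_zero] at h1
          have hr0 : 0 ≤ r := hr.1
          refine (pow_le_pow_left₀ (heatProfile_nonneg hr.1 0) h1 2).trans_eq ?_
          rw [mul_pow, ← Real.rpow_natCast ((1 + r) ^ (-(1 / 2) : ℝ)),
            ← Real.rpow_mul (by linarith), ← Real.rpow_neg_one]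
          norm_num
    _ = _ := by rw [intervalIntegral.integral_const_mul, hl]

theorem KernelBounds.heatProfile_double_le (h : KernelBounds u β K T a) {t : ℝ} (ht : 0 ≤ t)
    (htT : t ≤ (N : ℝ) ^ 2 * T) (k : ZMod N) :
    heatProfile N (t + t) k ≤ K * (1 + t) ^ (-(1 / 2) : ℝ) := by
  rw [heatProfile, heatKernel_add]
  calc ∑ z, heatKernel t k z * heatKernel t z 0
      ≤ ∑ z, heatKernel t k z * (K * (1 + t) ^ (-(1 / 2) : ℝ)) :=
        Finset.sum_le_sum fun z _ => mul_le_mul_of_nonneg_left (h.heat_sup_le t ht htT z 0)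
          (heatKernel_nonneg ht k z)
    _ = _ := by rw [← Finset.sum_mul, sum_heatKernel, one_mul]

/-- The error in the approximation of `N` times the bracket by `Z² - N ∇Z ∇Z`. -/
def bracketError (a : ZMod N → ℝ) (x : ZMod N) (A : HalfFilled N) : ℝ :=
  N * bracket a x A - (zsq x A - gradProd x A)

/-- Two errors add up: the asymmetry, equal to `N^(-1/2)`, and the replacement of `a x` by `1`,
which costs `|a x - 1| ≤ K N^(-β)`. -/
theorem KernelBounds.abs_bracketError_le (hN : 2 ≤ N) (h : KernelBounds u β K T a)
    (hβ : β ≤ 1 / 2) (x : ZMod N) (A : HalfFilled N) :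
    |bracketError a x A| ≤ 21 * K * (N : ℝ) ^ (-β) * zsq x A := by
  have hN1 : (1 : ℝ) ≤ N := by exact_mod_cast (by omega : 1 ≤ N)
  have hK := h.nonneg
  have h1 := abs_bracket_sub_le hN h.env_nonneg x A
  have h2 := abs_gradProd_le hN x A
  have h3 := h.env_sub_le x
  have h0 : 0 ≤ zsq x A := sq_nonneg _
  have hr : 0 ≤ (N : ℝ) ^ (-β) := by positivity
  have has : asym N ≤ (N : ℝ) ^ (-β) := by
    have e : asym N = (N : ℝ) ^ (-(1 / 2) : ℝ) := by
      have h4 := asym_sq hN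
      have h5 : ((N : ℝ) ^ (-(1 / 2) : ℝ)) ^ 2 = 1 / N := by
        rw [← Real.rpow_natCast, ← Real.rpow_mul (by positivity)]
        norm_num [Real.rpow_neg_one]
      exact (pow_left_inj₀ (asym_pos hN).le (by positivity) two_ne_zero).1 (h4.trans h5.symm)
    rw [e]
    exact Real.rpow_le_rpow_of_exponent_le hN1 (by linarith)
  change |gradProd x A| ≤ 10 * zsq x A at h2
  change |_ - a x * (zsq x A - gradProd x A)| ≤ 10 * asym N * a x * zsq x A at h1
  have h6 : |(a x - 1) * (zsq x A - gradProd x A)| ≤ K * (N : ℝ) ^ (-β) * (11 * zsq x A) := by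
    rw [abs_mul]
    refine mul_le_mul h3 ?_ (abs_nonneg _) (by positivity)
    refine (abs_sub _ _).trans ?_
    rw [abs_of_nonneg h0]
    linarith
  have h7 : 10 * asym N * a x * zsq x A ≤ 10 * (N : ℝ) ^ (-β) * K * zsq x A := by
    have := h.env_le x
    have := h.env_nonneg x
    gcongr
  have h8 := abs_add_le (N * bracket a x A - a x * (zsq x A - gradProd x A))
    ((a x - 1) * (zsq x A - gradProd x A))
  rw [bracketError, show N * bracket a x A - (zsq x A - gradProd x A)
    = (N * bracket a x A - a x * (zsq x A - gradProd x A))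
      + (a x - 1) * (zsq x A - gradProd x A) by ring]
  linarith

end Contraction

end InhomASEP

/-! ### Convolution inequalities for the renewal argument. -/

namespace InhomASEP

section Renewal

open scoped Matrix

theorem intervalIntegrable_rpow_sub (γ : ℝ) {t : ℝ} (ht : 0 ≤ t) :
    IntervalIntegrable (fun r : ℝ => (1 + (t - r)) ^ γ) volume 0 t := by
  have := (intervalIntegrable_one_add_rpow γ ht).comp_sub_left t
  rw [sub_zero, sub_self] at this
  exact this.symm

theorem integral_rpow_sub (γ : ℝ) (t : ℝ) :
    ∫ r in (0 : ℝ)..t, (1 + (t - r)) ^ γ = ∫ s in (0 : ℝ)..t, (1 + s) ^ γ := by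
  rw [intervalIntegral.integral_comp_sub_left (fun s : ℝ => (1 + s) ^ γ), sub_self, sub_zero]

/-- The product is at most the `-5/4` power of the smaller base. It bounds a convolution integrand
by two one-variable functions, integrable uniformly in `t`. -/
theorem rpow_mul_rpow_le_add {p q : ℝ} (hp : 1 ≤ p) (hq : 1 ≤ q) :
    p ^ (-(1 / 2) : ℝ) * q ^ (-(3 / 4) : ℝ) ≤ p ^ (-(5 / 4) : ℝ) + q ^ (-(5 / 4) : ℝ) := by
  have hp0 : 0 < p := by linarith
  have hq0 : 0 < q := by linarith
  rcases le_total p q with h | h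
  · have h1 : q ^ (-(3 / 4) : ℝ) ≤ p ^ (-(3 / 4) : ℝ) :=
      Real.rpow_le_rpow_of_nonpos hp0 h (by norm_num)
    have h2 : p ^ (-(5 / 4) : ℝ) = p ^ (-(1 / 2) : ℝ) * p ^ (-(3 / 4) : ℝ) := by
      rw [← Real.rpow_add hp0]; norm_num
    have h3 : 0 ≤ q ^ (-(5 / 4) : ℝ) := by positivity
    rw [h2]
    have := mul_le_mul_of_nonneg_left h1 (by positivity : 0 ≤ p ^ (-(1 / 2) : ℝ))
    linarith
  · have h1 : p ^ (-(1 / 2) : ℝ) ≤ q ^ (-(1 / 2) : ℝ) :=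
      Real.rpow_le_rpow_of_nonpos hq0 h (by norm_num)
    have h2 : q ^ (-(5 / 4) : ℝ) = q ^ (-(1 / 2) : ℝ) * q ^ (-(3 / 4) : ℝ) := by
      rw [← Real.rpow_add hq0]; norm_num
    have h3 : 0 ≤ p ^ (-(5 / 4) : ℝ) := by positivity
    rw [h2]
    have := mul_le_mul_of_nonneg_right h1 (by positivity : 0 ≤ q ^ (-(3 / 4) : ℝ))
    linarith

/-- A convolution against an integrable weight of mass `q₀` and decay `(1 + s) ^ (-3/2)` almost
preserves the profile `A + B / (t + L)` when `L` is large. -/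
theorem convolution_weight_le {k : ℝ → ℝ} {q₀ K A B L t : ℝ} (hk : Continuous k)
    (hL : 1 ≤ L) (hA : 0 ≤ A) (hB : 0 ≤ B) (ht : 0 ≤ t)
    (hq : ∫ s in (0 : ℝ)..t, k s ≤ q₀)
    (hkK : ∀ s, 0 ≤ s → s ≤ t → k s ≤ K ^ 2 * (1 + s) ^ (-(3 / 2) : ℝ)) :
    ∫ r in (0 : ℝ)..t, k (t - r) * (A + B / (r + L))
      ≤ (q₀ + 8 * K ^ 2 * L ^ (-(1 / 4) : ℝ)) * (A + B / (t + L)) := by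
  set c := K ^ 2 * L ^ (-(1 / 4) : ℝ) with hc
  have hc0 : 0 ≤ c := by positivity
  have hL0 : 0 < t + L := by linarith
  have i1 := intervalIntegrable_rpow_sub (-(5 / 4)) ht
  have i2 := intervalIntegrable_one_add_rpow (-(5 / 4)) ht
  have i3 : IntervalIntegrable (fun r => k (t - r)) volume 0 t :=
    Continuous.intervalIntegrable (by fun_prop) _ _
  have e3 : ∫ r in (0 : ℝ)..t, k (t - r) = ∫ s in (0 : ℝ)..t, k s := by
    rw [intervalIntegral.integral_comp_sub_left k, sub_self, sub_zero]
  calc ∫ r in (0 : ℝ)..t, k (t - r) * (A + B / (r + L))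
      ≤ ∫ r in (0 : ℝ)..t, (A + B / (t + L)) * (k (t - r)
          + c * ((1 + (t - r)) ^ (-(5 / 4) : ℝ) + (1 + r) ^ (-(5 / 4) : ℝ))) := by
        refine intervalIntegral.integral_mono_on ht ?_ ?_ fun r hr => ?_
        · refine ContinuousOn.intervalIntegrable ?_
          rw [Set.uIcc_of_le ht]
          refine ContinuousOn.mul (by fun_prop) (continuousOn_const.add
            (ContinuousOn.div continuousOn_const (by fun_prop) fun s hs => ?_))
          linarith [hs.1]
        · exact (i3.add ((i1.add i2).const_mul c)).const_mul _
        · have hr0 : 0 ≤ r := hr.1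
          have hrL : 0 < r + L := by linarith
          have htr : 0 ≤ t - r := by linarith [hr.2]
          set p := 1 + (t - r) with hp
          have hp1 : 1 ≤ p := by linarith
          -- The excess of `1/(r+L)` over `1/(t+L)` carries the factor `(t-r)/(r+L)`. The decay
          -- `3/2` of `k` absorbs `t - r`, and `1/(r+L)` is split to release the small factor
          -- `L^(-1/4)`.
          have h1 : k (t - r) * ((t - r) / (r + L))
              ≤ c * (p ^ (-(5 / 4) : ℝ) + (1 + r) ^ (-(5 / 4) : ℝ)) := by
            have h2 : (r + L)⁻¹ ≤ L ^ (-(1 / 4) : ℝ) * (1 + r) ^ (-(3 / 4) : ℝ) := by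
              have e : (r + L)⁻¹ = (r + L) ^ (-(1 / 4) : ℝ) * (r + L) ^ (-(3 / 4) : ℝ) := by
                rw [← Real.rpow_add hrL, ← Real.rpow_neg_one]; norm_num
              rw [e]
              refine mul_le_mul (Real.rpow_le_rpow_of_nonpos (by linarith) (by linarith)
                (by norm_num)) (Real.rpow_le_rpow_of_nonpos (by linarith) (by linarith)
                (by norm_num)) (by positivity) (by positivity)
            have h3 : k (t - r) * (t - r) ≤ K ^ 2 * p ^ (-(1 / 2) : ℝ) := by
              have e : p ^ (-(1 / 2) : ℝ) = p ^ (-(3 / 2) : ℝ) * p := by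
                nth_rewrite 3 [← Real.rpow_one p]
                rw [← Real.rpow_add (by linarith)]; norm_num
              rw [e, ← mul_assoc]
              exact mul_le_mul (hkK _ htr (by linarith)) (by linarith) htr (by positivity)
            rw [div_eq_mul_inv, ← mul_assoc]
            calc k (t - r) * (t - r) * (r + L)⁻¹
                ≤ (K ^ 2 * p ^ (-(1 / 2) : ℝ))
                  * (L ^ (-(1 / 4) : ℝ) * (1 + r) ^ (-(3 / 4) : ℝ)) :=
                  mul_le_mul h3 h2 (by positivity) (by positivity)
              _ = c * (p ^ (-(1 / 2) : ℝ) * (1 + r) ^ (-(3 / 4) : ℝ)) := by rw [hc]; ring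
              _ ≤ _ := mul_le_mul_of_nonneg_left
                (rpow_mul_rpow_le_add hp1 (by linarith)) hc0
          have h4 : B / (r + L) = B / (t + L) * (1 + (t - r) / (r + L)) := by
            field_simp; ring
          have h5 : 0 ≤ c * (p ^ (-(5 / 4) : ℝ) + (1 + r) ^ (-(5 / 4) : ℝ)) := by positivity
          have h6 : 0 ≤ B / (t + L) := by positivity
          rw [h4]
          nlinarith [mul_le_mul_of_nonneg_left h1 h6, mul_nonneg hA h5]
    _ = (A + B / (t + L)) * ((∫ s in (0 : ℝ)..t, k s)
          + c * (2 * ∫ s in (0 : ℝ)..t, (1 + s) ^ (-(5 / 4) : ℝ))) := by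
        rw [intervalIntegral.integral_const_mul, intervalIntegral.integral_add i3
          ((i1.add i2).const_mul c), intervalIntegral.integral_const_mul,
          intervalIntegral.integral_add i1 i2, integral_rpow_sub, e3]
        ring
    _ ≤ (A + B / (t + L)) * (q₀ + c * (2 * (1 / (-1 - -(5 / 4))))) := by
        have := integral_one_add_rpow_le' (γ := -(5 / 4)) (by norm_num) ht
        have h6 : 0 ≤ B / (t + L) := by positivity
        gcongr
    _ = _ := by rw [hc]; norm_num; ring

end Renewal

/-! ### The renewal inequality for `N ∇Z ∇Z`. -/

section OneStep

open scoped Matrix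

variable {N : ℕ} [NeZero N] {u β K T : ℝ} {a : ZMod N → ℝ}

/-- The expectation `E |P_t (N ∇Z ∇Z)|`. -/
def gradMoment (a : ZMod N → ℝ) (m : HalfFilled N → ℝ) (t : ℝ) (x : ZMod N) : ℝ :=
  m ⬝ᵥ (fun A => |(propagator a t *ᵥ gradProd x) A|)

theorem continuous_gradMoment (a : ZMod N → ℝ) (m : HalfFilled N → ℝ) (x : ZMod N) :
    Continuous fun t => gradMoment a m t x := by
  have h : ∀ A, Continuous fun t => (propagator a t *ᵥ gradProd x) A := fun A => by
    have := continuous_vecMul_propagator a (Pi.single A 1) (gradProd x)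
    simpa only [← Matrix.dotProduct_mulVec, single_dotProduct, one_mul] using this
  exact continuous_finsetSum _ fun A _ => continuous_const.mul (h A).abs

theorem abs_dotProduct_le {ι : Type*} [Fintype ι] {m m' : ι → ℝ} (hm : ∀ i, |m' i| ≤ m i)
    (f : ι → ℝ) : |m' ⬝ᵥ f| ≤ m ⬝ᵥ (fun i => |f i|) := by
  refine (Finset.abs_sum_le_sum_abs _ _).trans (Finset.sum_le_sum fun i _ => ?_)
  rw [abs_mul]
  exact mul_le_mul_of_nonneg_right (hm i) (abs_nonneg _)

/-- Domination of a signed measure by a positive one persists under the propagator because its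
entries are nonnegative. -/
theorem abs_vecMul_dotProduct_le (hN : 2 ≤ N) (ha : ∀ x, 0 ≤ a x) {t : ℝ} (ht : 0 ≤ t)
    {m m' : HalfFilled N → ℝ} (hm : ∀ i, |m' i| ≤ m i) (f : HalfFilled N → ℝ) :
    |(m' ᵥ* propagator a t) ⬝ᵥ f| ≤ (m ᵥ* propagator a t) ⬝ᵥ (fun i => |f i|) := by
  refine abs_dotProduct_le (fun B => ?_) f
  refine (Finset.abs_sum_le_sum_abs _ _).trans (Finset.sum_le_sum fun A _ => ?_)
  rw [abs_mul, abs_of_nonneg (propagator_nonneg hN ha ht A B)]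
  exact mul_le_mul_of_nonneg_right (hm A) (propagator_nonneg hN ha ht A B)

/-- Duhamel formula for `N ∇Z ∇Z`. -/
theorem duhamel_gradProd (hN : 2 ≤ N) (a : ZMod N → ℝ) (m : HalfFilled N → ℝ) (t : ℝ) (x : ZMod N) :
    (m ᵥ* propagator a t) ⬝ᵥ gradProd x
      = N * (m ⬝ᵥ (fun A => zlin (kernelRow a (gradRow x) t) A
          * zlin (kernelRow a (gradRow (x - 1)) t) A))
        + ∫ r in (0 : ℝ)..t, ∑ y, kernelGradProd a (t - r) x y
          * ((m ᵥ* propagator a r) ⬝ᵥ zsq y - (m ᵥ* propagator a r) ⬝ᵥ gradProd y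
            + (m ᵥ* propagator a r) ⬝ᵥ bracketError a y) := by
  have h := duhamel hN a (gradRow x) (gradRow (x - 1)) m t
  have e : gradProd x = (N : ℝ) • fun A : HalfFilled N =>
      zlin (gradRow x) A * zlin (gradRow (x - 1)) A := by
    ext A
    simp [gradProd, zlin_gradRow]
  rw [e, dotProduct_smul, h, smul_eq_mul, mul_add, ← intervalIntegral.integral_const_mul]
  congr 2
  ext r
  rw [Finset.mul_sum]
  refine Finset.sum_congr rfl fun y _ => ?_
  have e2 : bracketError a y = (N : ℝ) • bracket a y - (zsq y - gradProd y) := by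
    ext A; simp [bracketError]
  rw [e2, dotProduct_sub, dotProduct_sub, dotProduct_smul, kernelGradProd_eq, smul_eq_mul]
  ring

end OneStep

end InhomASEP

namespace InhomASEP

section OneStep

open scoped Matrix

variable {N : ℕ} [NeZero N] {u β K T : ℝ} {a : ZMod N → ℝ}

/-- A regular function integrated against `∇q ∇q` gains from the cancellation in `∑ ∇p ∇p`. -/
theorem KernelBounds.abs_integral_kernelGradProd_le (hN : 2 ≤ N) (h : KernelBounds u β K T a)
    (hu0 : 0 < u) (hu1 : u < 1) {t M : ℝ} (ht : 0 ≤ t)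
    (htT : t ≤ (N : ℝ) ^ 2 * T) (x : ZMod N) {D : ℝ → ZMod N → ℝ}
    (hD : ∀ y, Continuous fun r => D r y) (hM : ∀ r, 0 ≤ r → r ≤ t → ∀ y, |D r y| ≤ M)
    (hM' : ∀ r, 0 ≤ r → r ≤ t → ∀ y, |D r y - D t x|
      ≤ M * ((N : ℝ) ^ (-β) * ((torusDist x y : ℝ) ^ u + (1 + (t - r)) ^ (u / 2)))) :
    |∫ r in (0 : ℝ)..t, ∑ y, kernelGradProd a (t - r) x y * D r y|
      ≤ M * (K ^ 2 * (N : ℝ) ^ (-β) * (8 + Real.log (1 + t) + 2 / (1 - u))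
        + K * (1 + t) ^ (-(1 / 2) : ℝ)) := by
  set ν : ℝ := (N : ℝ) ^ (-β) with hν
  have hν0 : 0 ≤ ν := by positivity
  have hM0 : 0 ≤ M := (abs_nonneg _).trans (hM 0 le_rfl ht 0)
  have hK := h.nonneg
  have c1 := continuous_kernelGradProd a
  have c2 := continuous_heatGradProd (N := N)
  set p : ℝ → ℝ := fun s => (1 + s) ^ (-(5 / 4) : ℝ) with hp
  set w : ℝ → ℝ := fun s => ∑ y, |heatGradProd s x y| * (torusDist x y : ℝ) ^ u with hw
  set q : ℝ → ℝ := fun s => (1 + s) ^ (-(3 / 2) + u / 2 : ℝ) with hq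
  have ip : IntervalIntegrable p volume 0 t := intervalIntegrable_one_add_rpow _ ht
  have iq : IntervalIntegrable q volume 0 t := intervalIntegrable_one_add_rpow _ ht
  have iw : IntervalIntegrable w volume 0 t := Continuous.intervalIntegrable (by fun_prop) _ _
  set g : ℝ → ℝ := fun s => M * (2 * K ^ 2 * ν * p s) + M * ν * (w s + K ^ 2 * q s) with hg
  have ig : IntervalIntegrable g volume 0 t :=
    ((ip.const_mul _).const_mul _).add ((iw.add (iq.const_mul _)).const_mul _)
  have hgi : ∫ s in (0 : ℝ)..t, g s
      ≤ M * (K ^ 2 * ν * (8 + Real.log (1 + t) + 2 / (1 - u))) := by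
    have j1 : ∫ s in (0 : ℝ)..t, p s ≤ 4 :=
      (integral_one_add_rpow_le' (by norm_num) ht).trans_eq (by norm_num)
    have j2 : ∫ s in (0 : ℝ)..t, q s ≤ 2 / (1 - u) := by
      have h1u : 1 - u ≠ 0 := by linarith
      refine (integral_one_add_rpow_le' (by linarith) ht).trans_eq ?_
      rw [show -1 - (-(3 / 2) + u / 2) = (1 - u) / 2 by ring, one_div_div]
    have j3 := h.integral_heatGradProd_dist_le hu0 hu1.le ht htT x
    rw [hg, intervalIntegral.integral_add ((ip.const_mul _).const_mul _)
      ((iw.add (iq.const_mul _)).const_mul _), intervalIntegral.integral_const_mul,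
      intervalIntegral.integral_const_mul, intervalIntegral.integral_const_mul,
      intervalIntegral.integral_add iw (iq.const_mul _), intervalIntegral.integral_const_mul]
    calc _ ≤ M * (2 * K ^ 2 * ν * 4) + M * ν * (K ^ 2 * Real.log (1 + t)
          + K ^ 2 * (2 / (1 - u))) := by gcongr
      _ = _ := by ring
  -- Three pieces: `∇q∇q` is replaced by `∇p∇p`, then `D` is frozen at its value at time `t` and
  -- site `x`, and the frozen term is integrated exactly to the profile at time `2t`.
  have hsplit : ∀ r, ∑ y, kernelGradProd a (t - r) x y * D r y
      = (∑ y, ((kernelGradProd a (t - r) x y - heatGradProd (t - r) x y) * D r y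
          + heatGradProd (t - r) x y * (D r y - D t x)))
        + D t x * ∑ y, heatGradProd (t - r) x y := by
    intro r
    rw [Finset.mul_sum, ← Finset.sum_add_distrib]
    exact Finset.sum_congr rfl fun y _ => by ring
  have c3 : Continuous fun r => ∑ y, ((kernelGradProd a (t - r) x y - heatGradProd (t - r) x y)
      * D r y + heatGradProd (t - r) x y * (D r y - D t x)) := by fun_prop
  have c4 : Continuous fun r => D t x * ∑ y, heatGradProd (t - r) x y := by fun_prop
  have hmain : |∫ r in (0 : ℝ)..t, D t x * ∑ y, heatGradProd (t - r) x y|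
      ≤ M * (K * (1 + t) ^ (-(1 / 2) : ℝ)) := by
    rw [intervalIntegral.integral_const_mul,
      intervalIntegral.integral_comp_sub_left (fun s => ∑ y, heatGradProd s x y), sub_self,
      sub_zero, integral_heatGradProd_sum hN, abs_mul, abs_neg,
      abs_of_nonneg (heatProfile_nonneg (by linarith) _)]
    exact mul_le_mul (hM t ht le_rfl x) (h.heatProfile_double_le ht htT 1)
      (heatProfile_nonneg (by linarith) _) hM0
  have herr : |∫ r in (0 : ℝ)..t, ∑ y, ((kernelGradProd a (t - r) x y - heatGradProd (t - r) x y)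
      * D r y + heatGradProd (t - r) x y * (D r y - D t x))| ≤ ∫ s in (0 : ℝ)..t, g s := by
    refine (intervalIntegral.abs_integral_le_integral_abs ht).trans ?_
    refine integral_le_of_le_sub ht c3.abs ig fun r h0 h1 => ?_
    have hs : 0 ≤ t - r := by linarith
    have hsT : t - r ≤ (N : ℝ) ^ 2 * T := by linarith
    have b1 := h.sum_abs_gradProd_sub_le hs hsT x
    have b2 := h.sum_abs_heatGradProd_le hs hsT x
    have e2 : (1 + (t - r)) ^ (-(3 / 2) : ℝ) * (1 + (t - r)) ^ (u / 2) = q (t - r) := by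
      rw [hq, ← Real.rpow_add (by linarith)]
    calc |∑ y, ((kernelGradProd a (t - r) x y - heatGradProd (t - r) x y)
          * D r y + heatGradProd (t - r) x y * (D r y - D t x))|
        ≤ ∑ y, (|kernelGradProd a (t - r) x y - heatGradProd (t - r) x y| * M
          + |heatGradProd (t - r) x y| * (M * (ν * ((torusDist x y : ℝ) ^ u
            + (1 + (t - r)) ^ (u / 2))))) := by
          refine (Finset.abs_sum_le_sum_abs _ _).trans (Finset.sum_le_sum fun y _ => ?_)
          refine (abs_add_le _ _).trans ?_
          rw [abs_mul, abs_mul]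
          exact add_le_add (mul_le_mul_of_nonneg_left (hM r h0 h1 y) (abs_nonneg _))
            (mul_le_mul_of_nonneg_left (hM' r h0 h1 y) (abs_nonneg _))
      _ = M * (∑ y, |kernelGradProd a (t - r) x y - heatGradProd (t - r) x y|)
          + M * ν * (w (t - r) + (∑ y, |heatGradProd (t - r) x y|)
            * (1 + (t - r)) ^ (u / 2)) := by
          simp only [hw, Finset.mul_sum, Finset.sum_mul, ← Finset.sum_add_distrib]
          exact Finset.sum_congr rfl fun y _ => by ring
      _ ≤ M * (2 * K ^ 2 * ν * p (t - r)) + M * ν * (w (t - r)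
            + (K ^ 2 * (1 + (t - r)) ^ (-(3 / 2) : ℝ)) * (1 + (t - r)) ^ (u / 2)) := by
          have : 0 ≤ (1 + (t - r)) ^ (u / 2) := by positivity
          gcongr
      _ = g (t - r) := by rw [hg, mul_assoc (K ^ 2), e2]
  calc |∫ r in (0 : ℝ)..t, ∑ y, kernelGradProd a (t - r) x y * D r y|
      = |(∫ r in (0 : ℝ)..t, ∑ y, ((kernelGradProd a (t - r) x y - heatGradProd (t - r) x y)
          * D r y + heatGradProd (t - r) x y * (D r y - D t x)))
        + ∫ r in (0 : ℝ)..t, D t x * ∑ y, heatGradProd (t - r) x y| := by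
        rw [← intervalIntegral.integral_add (c3.intervalIntegrable _ _)
          (c4.intervalIntegrable _ _)]
        simp only [hsplit]
    _ ≤ _ := (abs_add_le _ _).trans (add_le_add (herr.trans hgi) hmain)
    _ = _ := by ring

/-- The `ℓ¹` norm of `∇q` is at most `K (1+t)^(-1/2)`, so each factor has second moment at most `K²
V/(1+t)`. The prefactor `N` of `gradProd` turns this into the term `N/(t+1)`. -/
theorem KernelBounds.initial_gradProd_le (h : KernelBounds u β K T a) {m m' : HalfFilled N → ℝ}
    (hm : ∀ A, |m' A| ≤ m A) {V : ℝ} (hV : ∀ x, m ⬝ᵥ zsq x ≤ V) {t : ℝ} (ht : 0 ≤ t)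
    (htT : t ≤ (N : ℝ) ^ 2 * T) (x : ZMod N) :
    |m' ⬝ᵥ (fun A => zlin (kernelRow a (gradRow x) t) A
      * zlin (kernelRow a (gradRow (x - 1)) t) A)| ≤ K ^ 2 * V / (1 + t) := by
  have hm0 : ∀ A, 0 ≤ m A := fun A => (abs_nonneg _).trans (hm A)
  have hV0 : 0 ≤ V := (dotProduct_nonneg' hm0 fun A => sq_nonneg _).trans (hV 0)
  have hg : ∀ x, m ⬝ᵥ (fun A => zlin (kernelRow a (gradRow x) t) A ^ 2) ≤ K ^ 2 * V / (1 + t) := by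
    intro x
    have h1 := h.grad_sum_le t ht htT x
    simp only [← kernelRow_gradRow] at h1
    refine (dotProduct_zlin_sq_le hm0 _ h1 hV).trans_eq ?_
    rw [mul_pow, ← Real.rpow_natCast ((1 + t) ^ (-(1 / 2) : ℝ)), ← Real.rpow_mul (by linarith)]
    norm_num [Real.rpow_neg_one]
    ring
  refine (abs_dotProduct_le hm _).trans ?_
  calc m ⬝ᵥ (fun A => |zlin (kernelRow a (gradRow x) t) A
        * zlin (kernelRow a (gradRow (x - 1)) t) A|)
      ≤ m ⬝ᵥ ((1 / 2 : ℝ) • ((fun A => zlin (kernelRow a (gradRow x) t) A ^ 2)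
        + fun A => zlin (kernelRow a (gradRow (x - 1)) t) A ^ 2)) := by
        refine dotProduct_mono hm0 fun A => ?_
        simp only [Pi.smul_apply, Pi.add_apply, smul_eq_mul]
        rw [abs_mul]
        have := two_mul_le_add_sq |zlin (kernelRow a (gradRow x) t) A|
          |zlin (kernelRow a (gradRow (x - 1)) t) A|
        rw [sq_abs, sq_abs] at this
        linarith
    _ ≤ _ := by
        rw [dotProduct_smul, dotProduct_add, smul_eq_mul]
        linarith [hg x, hg (x - 1)]

set_option maxHeartbeats 1600000 in
/-- The renewal inequality for `E |P_t (N ∇Z ∇Z)|`. -/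
theorem gradMoment_le_convolution (K T u β : ℝ) (hK : 1 ≤ K) (hT : 0 ≤ T) (hu0 : 0 < u)
    (hu1 : u < 1) (hβ : 0 ≤ β) (hβu : β ≤ u / 2) : ∃ C : ℝ, 1 ≤ C ∧
    ∀ (N : ℕ) [NeZero N], 2 ≤ N → ∀ (a : ZMod N → ℝ), KernelBounds u β K T a →
    ∀ (m : HalfFilled N → ℝ), (∀ A, 0 ≤ m A) → ∀ V : ℝ, (∀ x, m ⬝ᵥ zsq x ≤ V) →
    (∀ x y, m ⬝ᵥ zdiffSq x y ≤ V * ((N : ℝ) ^ (-β) * (torusDist x y : ℝ) ^ u) ^ 2) →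
    ∀ t : ℝ, 0 ≤ t → t ≤ (N : ℝ) ^ 2 * T → ∀ x,
      gradMoment a m t x ≤ C * V * ((N : ℝ) ^ (-β) * Real.log (N + 1) + N / (t + 1))
        + ∫ r in (0 : ℝ)..t, ∑ y, |kernelGradProd a (t - r) x y| * gradMoment a m r y := by
  obtain ⟨C₁, hC₁, hmom⟩ := second_moment_bound K T hK hT
  obtain ⟨C₂, hC₂, hspat⟩ := spatial_regularity K T u β hK hT hu0 hu1 hβu
  obtain ⟨C₃, hC₃, htemp⟩ := temporal_regularity K T u β hK hT hu0 hu1 hβ hβu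
  set M₀ : ℝ := C₃ * (C₁ + C₂) with hM₀
  have hM₀1 : C₁ ≤ M₀ := by nlinarith
  have hu1' : 0 < 1 - u := by linarith
  set G : ℝ := K ^ 2 * (10 + T + 2 / (1 - u)) with hG
  refine ⟨K ^ 2 + M₀ * (G + K * (1 + T)) + 42 * K ^ 3 * C₁, ?_, ?_⟩
  · have : 0 ≤ M₀ * (G + K * (1 + T)) := by positivity
    have : 0 ≤ 42 * K ^ 3 * C₁ := by positivity
    nlinarith
  intro N _ hN a h m hm V hV hH t ht htT x
  have hN0 : (0 : ℝ) < N := by positivity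
  have hN2 : (2 : ℝ) ≤ N := by exact_mod_cast hN
  have hV0 : 0 ≤ V := (dotProduct_nonneg' hm fun A => sq_nonneg _).trans (hV 0)
  have hK0 : 0 ≤ K := by linarith
  have c1 := continuous_kernelGradProd a
  have c2 := continuous_gradMoment a m
  set ν : ℝ := (N : ℝ) ^ (-β) with hν
  have hν0 : 0 ≤ ν := by positivity
  set F : HalfFilled N → ℝ := propagator a t *ᵥ gradProd x with hF
  -- Testing against the sign of `P_t W` converts the expected absolute value into a linear
  -- functional, to which the Duhamel formula applies. Every later estimate uses only `|m'| ≤ m`.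
  set m' : HalfFilled N → ℝ := fun A => m A * SignType.sign (F A) with hm'
  have hm'm : ∀ A, |m' A| ≤ m A := by
    intro A
    rw [hm', abs_mul, abs_of_nonneg (hm A)]
    refine mul_le_of_le_one_right (hm A) ?_
    rcases lt_trichotomy (F A) 0 with h | h | h <;> simp [h]
  have hgm : gradMoment a m t x = (m' ᵥ* propagator a t) ⬝ᵥ gradProd x := by
    rw [← Matrix.dotProduct_mulVec]
    refine Finset.sum_congr rfl fun A _ => ?_
    rw [hm', mul_assoc, sign_mul_self]
  -- bounds on the three terms
  set D : ℝ → ZMod N → ℝ := fun r y => (m' ᵥ* propagator a r) ⬝ᵥ zsq y with hD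
  have hDc : ∀ y, Continuous fun r => D r y := fun y => continuous_vecMul_propagator a m' (zsq y)
  have hmomr : ∀ r, 0 ≤ r → r ≤ t → ∀ y, (m ᵥ* propagator a r) ⬝ᵥ zsq y ≤ C₁ * V :=
    fun r h0 h1 y => hmom N hN u β a h m hm V hV r h0 (h1.trans htT) y
  have hDM : ∀ r, 0 ≤ r → r ≤ t → ∀ y, |D r y| ≤ M₀ * V := by
    intro r h0 h1 y
    refine (abs_vecMul_dotProduct_le hN h.env_nonneg h0 hm'm _).trans ?_
    have e : (fun A : HalfFilled N => |zsq y A|) = zsq y := by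
      ext A; exact abs_of_nonneg (sq_nonneg _)
    rw [e]
    exact (hmomr r h0 h1 y).trans (mul_le_mul_of_nonneg_right hM₀1 hV0)
  have hDM' : ∀ r, 0 ≤ r → r ≤ t → ∀ y, |D r y - D t x|
      ≤ M₀ * V * (ν * ((torusDist x y : ℝ) ^ u + (1 + (t - r)) ^ (u / 2))) := by
    intro r h0 h1 y
    -- By the semigroup property the increment is the law at time `r` tested against `Z²(y) -
    -- P_(t-r) Z²(x)`. Regularity in time applies from that law, which satisfies the moment and
    -- Hölder hypotheses by propagation.
    have e : D r y - D t x = (m' ᵥ* propagator a r) ⬝ᵥ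
        (zsq y - propagator a (t - r) *ᵥ zsq x) := by
      rw [dotProduct_sub, Matrix.dotProduct_mulVec, Matrix.vecMul_vecMul, ← propagator_add,
        add_sub_cancel]
    rw [e]
    refine (abs_vecMul_dotProduct_le hN h.env_nonneg h0 hm'm _).trans ?_
    have hVr : ∀ y, (m ᵥ* propagator a r) ⬝ᵥ zsq y ≤ (C₁ + C₂) * V := fun y =>
      (hmomr r h0 h1 y).trans (by nlinarith)
    refine (htemp N hN a h (m ᵥ* propagator a r)
      (fun B => vecMul_propagator_nonneg hN h.env_nonneg h0 hm B) ((C₁ + C₂) * V) hVr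
      (fun x y => ?_) (t - r) (by linarith) (by linarith) x y).trans_eq (by rw [hM₀]; ring)
    refine (hspat N hN a h m hm V hV hH r h0 (h1.trans htT) x y).trans ?_
    refine mul_le_mul_of_nonneg_right ?_ (sq_nonneg _)
    nlinarith
  have hZ := h.abs_integral_kernelGradProd_le hN hu0 hu1 ht htT x hDc hDM hDM'
  have hI := h.initial_gradProd_le hm'm hV ht htT x
  have hEr : ∀ r, 0 ≤ r → r ≤ t → ∀ y, |(m' ᵥ* propagator a r) ⬝ᵥ bracketError a y|
      ≤ 21 * K * ν * (C₁ * V) := by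
    intro r h0 h1 y
    refine (abs_vecMul_dotProduct_le hN h.env_nonneg h0 hm'm _).trans ?_
    calc (m ᵥ* propagator a r) ⬝ᵥ (fun A => |bracketError a y A|)
        ≤ (m ᵥ* propagator a r) ⬝ᵥ ((21 * K * ν) • zsq y) :=
          dotProduct_mono (fun B => vecMul_propagator_nonneg hN h.env_nonneg h0 hm B)
            fun A => h.abs_bracketError_le hN (by linarith) y A
      _ = 21 * K * ν * ((m ᵥ* propagator a r) ⬝ᵥ zsq y) := by rw [dotProduct_smul, smul_eq_mul]
      _ ≤ _ := mul_le_mul_of_nonneg_left (hmomr r h0 h1 y) (by positivity)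
  have hWr : ∀ r y, |(m' ᵥ* propagator a r) ⬝ᵥ gradProd y| ≤ gradMoment a m r y := by
    intro r y
    rw [← Matrix.dotProduct_mulVec]
    exact abs_dotProduct_le hm'm _
  have cW := fun y => continuous_vecMul_propagator a m' (gradProd y)
  have cE := fun y => continuous_vecMul_propagator a m' (bracketError a y)
  have i1 : IntervalIntegrable (fun r => ∑ y, kernelGradProd a (t - r) x y * D r y) volume 0 t :=
    Continuous.intervalIntegrable (by fun_prop) _ _
  have i2 : IntervalIntegrable (fun r => ∑ y, kernelGradProd a (t - r) x y
      * (-(m' ᵥ* propagator a r) ⬝ᵥ gradProd y + (m' ᵥ* propagator a r) ⬝ᵥ bracketError a y))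
      volume 0 t := Continuous.intervalIntegrable (by
        refine continuous_finsetSum _ fun y _ => ((c1 x y).comp (by fun_prop)).mul ?_
        simp only [neg_dotProduct]
        exact (cW y).neg.add (cE y)) _ _
  have i3 : IntervalIntegrable (fun r => ∑ y, |kernelGradProd a (t - r) x y|
      * gradMoment a m r y) volume 0 t := Continuous.intervalIntegrable (by fun_prop) _ _
  have i4 : IntervalIntegrable (fun r : ℝ => K ^ 2 * (1 + (t - r)) ^ (-(3 / 2) : ℝ)
      * (21 * K * ν * (C₁ * V))) volume 0 t :=
    ((intervalIntegrable_rpow_sub _ ht).const_mul _).mul_const _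
  have hR : |∫ r in (0 : ℝ)..t, ∑ y, kernelGradProd a (t - r) x y
      * (-(m' ᵥ* propagator a r) ⬝ᵥ gradProd y + (m' ᵥ* propagator a r) ⬝ᵥ bracketError a y)|
      ≤ (∫ r in (0 : ℝ)..t, ∑ y, |kernelGradProd a (t - r) x y| * gradMoment a m r y)
        + 42 * K ^ 3 * C₁ * V * ν := by
    refine (intervalIntegral.abs_integral_le_integral_abs ht).trans ?_
    calc _ ≤ ∫ r in (0 : ℝ)..t, ((∑ y, |kernelGradProd a (t - r) x y| * gradMoment a m r y)
          + K ^ 2 * (1 + (t - r)) ^ (-(3 / 2) : ℝ) * (21 * K * ν * (C₁ * V))) := by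
          refine intervalIntegral.integral_mono_on ht i2.abs (i3.add i4) fun r hr => ?_
          have b1 := h.sum_abs_kernelGradProd_le (sub_nonneg.2 hr.2)
            (by linarith [hr.1] : t - r ≤ (N : ℝ) ^ 2 * T) x
          refine le_trans ?_ (add_le_add le_rfl (mul_le_mul_of_nonneg_right b1
            (by positivity)))
          rw [Finset.sum_mul, ← Finset.sum_add_distrib]
          refine (Finset.abs_sum_le_sum_abs _ _).trans (Finset.sum_le_sum fun y _ => ?_)
          rw [abs_mul, ← mul_add]
          refine mul_le_mul_of_nonneg_left ((abs_add_le _ _).trans ?_) (abs_nonneg _)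
          rw [neg_dotProduct, abs_neg]
          exact add_le_add (hWr r y) (hEr r hr.1 hr.2 y)
      _ ≤ _ := by
          rw [intervalIntegral.integral_add i3 i4, intervalIntegral.integral_mul_const,
            intervalIntegral.integral_const_mul, integral_rpow_sub]
          refine add_le_add le_rfl ?_
          have := integral_one_add_rpow_le' (γ := -(3 / 2)) (by norm_num) ht
          calc K ^ 2 * (∫ s in (0 : ℝ)..t, (1 + s) ^ (-(3 / 2) : ℝ)) * (21 * K * ν * (C₁ * V))
              ≤ K ^ 2 * (1 / (-1 - -(3 / 2))) * (21 * K * ν * (C₁ * V)) := by gcongr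
            _ = _ := by norm_num; ring
  have hdu := duhamel_gradProd hN a m' t x
  have hsum : ∫ r in (0 : ℝ)..t, ∑ y, kernelGradProd a (t - r) x y
          * ((m' ᵥ* propagator a r) ⬝ᵥ zsq y - (m' ᵥ* propagator a r) ⬝ᵥ gradProd y
            + (m' ᵥ* propagator a r) ⬝ᵥ bracketError a y)
      = (∫ r in (0 : ℝ)..t, ∑ y, kernelGradProd a (t - r) x y * D r y)
        + ∫ r in (0 : ℝ)..t, ∑ y, kernelGradProd a (t - r) x y
      * (-(m' ᵥ* propagator a r) ⬝ᵥ gradProd y + (m' ᵥ* propagator a r) ⬝ᵥ bracketError a y) := by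
    rw [← intervalIntegral.integral_add i1 i2]
    congr 1
    ext r
    rw [← Finset.sum_add_distrib]
    refine Finset.sum_congr rfl fun y _ => ?_
    rw [hD, neg_dotProduct]
    ring
  rw [hgm, hdu, hsum]
  -- elementary comparison of the error terms
  have hlog1 : 1 ≤ Real.log (N + 1) := by
    rw [Real.le_log_iff_exp_le (by positivity)]
    linarith [Real.exp_one_lt_d9]
  have hlogt : Real.log (1 + t) ≤ (2 + T) * Real.log (N + 1) := by
    have h1 : 1 + t ≤ ((N : ℝ) + 1) ^ 2 * (1 + T) := by nlinarith
    calc Real.log (1 + t) ≤ Real.log (((N : ℝ) + 1) ^ 2 * (1 + T)) :=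
          Real.log_le_log (by linarith) h1
      _ = 2 * Real.log (N + 1) + Real.log (1 + T) := by
          rw [Real.log_mul (by positivity) (by positivity), Real.log_pow]; norm_num
      _ ≤ 2 * Real.log (N + 1) + T := by
          have := Real.log_le_sub_one_of_pos (by linarith : 0 < 1 + T)
          linarith
      _ ≤ _ := by nlinarith
  set ℓ : ℝ := Real.log (N + 1) with hℓ
  -- Up to times `N² T` one has `√(1+t) ≤ (1+T) N`, so a term of order `1/√(1+t)` is already
  -- dominated by `N/(t+1)`.
  have hsq : (1 + t) ^ (-(1 / 2) : ℝ) ≤ (1 + T) * (N / (t + 1)) := by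
    have h1 : (1 + t) ^ (-(1 / 2) : ℝ) = √(1 + t) / (t + 1) := by
      rw [Real.rpow_neg (by linarith), ← Real.sqrt_eq_rpow, inv_eq_one_div,
        div_eq_div_iff (by positivity) (by positivity), one_mul, Real.mul_self_sqrt (by linarith)]
      ring
    have h2 : √(1 + t) ≤ (1 + T) * N := by
      rw [Real.sqrt_le_left (by positivity)]
      have q1 : 0 ≤ T * (N : ℝ) ^ 2 := by positivity
      have q2 : 0 ≤ T ^ 2 * (N : ℝ) ^ 2 := by positivity
      have q3 : (1 : ℝ) ≤ (N : ℝ) ^ 2 := one_le_pow₀ (by linarith)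
      linarith [show ((1 + T) * (N : ℝ)) ^ 2
        = (N : ℝ) ^ 2 + 2 * (T * (N : ℝ) ^ 2) + T ^ 2 * (N : ℝ) ^ 2 by ring]
    rw [h1, ← mul_div_assoc]
    gcongr
  have hZ' : |∫ r in (0 : ℝ)..t, ∑ y, kernelGradProd a (t - r) x y * D r y|
      ≤ M₀ * V * (G * (ν * ℓ) + K * ((1 + T) * (N / (t + 1)))) := by
    refine hZ.trans ?_
    have h3 : 8 + Real.log (1 + t) + 2 / (1 - u) ≤ (10 + T + 2 / (1 - u)) * ℓ := by
      have : 0 ≤ 2 / (1 - u) := by positivity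
      nlinarith
    have h4 : K ^ 2 * ν * (8 + Real.log (1 + t) + 2 / (1 - u)) ≤ G * (ν * ℓ) := by
      rw [hG]
      calc _ ≤ K ^ 2 * ν * ((10 + T + 2 / (1 - u)) * ℓ) := by gcongr
        _ = _ := by ring
    gcongr
  have hn0 : 0 ≤ (N : ℝ) / (t + 1) := by positivity
  have hI' : (N : ℝ) * (m' ⬝ᵥ fun A => zlin (kernelRow a (gradRow x) t) A
      * zlin (kernelRow a (gradRow (x - 1)) t) A) ≤ K ^ 2 * V * (N / (t + 1)) := by
    calc _ ≤ (N : ℝ) * (K ^ 2 * V / (1 + t)) :=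
          mul_le_mul_of_nonneg_left ((le_abs_self _).trans hI) hN0.le
      _ = _ := by rw [add_comm]; ring
  have hνℓ : ν ≤ ν * ℓ := le_mul_of_one_le_right hν0 hlog1
  have hνℓ0 : 0 ≤ ν * ℓ := by positivity
  have h8 := (le_abs_self _).trans hZ'
  have h9 := (le_abs_self _).trans hR
  have hfin : K ^ 2 * V * (N / (t + 1)) + M₀ * V * (G * (ν * ℓ) + K * ((1 + T) * (N / (t + 1))))
      + 42 * K ^ 3 * C₁ * V * ν
      ≤ (K ^ 2 + M₀ * (G + K * (1 + T)) + 42 * K ^ 3 * C₁) * V * (ν * ℓ + N / (t + 1)) := by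
    have p1 : 0 ≤ K ^ 2 * V * (ν * ℓ) := by positivity
    have p2 : 0 ≤ M₀ * V * G * (N / (t + 1)) := by positivity
    have p3 : 0 ≤ M₀ * V * (K * (1 + T)) * (ν * ℓ) := by positivity
    have p4 : 0 ≤ 42 * K ^ 3 * C₁ * V * (N / (t + 1)) := by positivity
    have p5 : 42 * K ^ 3 * C₁ * V * ν ≤ 42 * K ^ 3 * C₁ * V * (ν * ℓ) :=
      mul_le_mul_of_nonneg_left hνℓ (by positivity)
    linear_combination p1 + p2 + p3 + p4 + p5
  linarith

end OneStep

end InhomASEP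

/-! ### Solution of the renewal inequality and the estimate for a fixed environment. -/

namespace InhomASEP

section Deterministic

open scoped Matrix

set_option maxHeartbeats 800000 in
/-- Decay of `E |P_t (N ∇Z ∇Z)|`. -/
theorem gradMoment_bound (K T u β : ℝ) (hK : 1 ≤ K) (hT : 0 ≤ T) (hu0 : 0 < u)
    (hu1 : u < 1) (hβ : 0 < β) (hβu : β ≤ u / 2) : ∃ C : ℝ, 1 ≤ C ∧
    ∀ (N : ℕ) [NeZero N], 2 ≤ N → ∀ (a : ZMod N → ℝ), KernelBounds u β K T a →
    ∀ (m : HalfFilled N → ℝ), (∀ A, 0 ≤ m A) → ∀ V : ℝ, (∀ x, m ⬝ᵥ zsq x ≤ V) →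
    (∀ x y, m ⬝ᵥ zdiffSq x y ≤ V * ((N : ℝ) ^ (-β) * (torusDist x y : ℝ) ^ u) ^ 2) →
    ∀ t : ℝ, 0 ≤ t → t ≤ (N : ℝ) ^ 2 * T → ∀ x,
      gradMoment a m t x ≤ C * V * ((N : ℝ) ^ (-β) * Real.log (N + 1) + N / (t + 1)) := by
  obtain ⟨C₁, hC₁, hmom⟩ := second_moment_bound K T hK hT
  obtain ⟨C₂, hC₂, hconv⟩ := gradMoment_le_convolution K T u β hK hT hu0 hu1 hβ.le hβu
  -- Chosen so that `8K² L^(-1/4) = 1/800`: the convolution loses half of the gap `1/400` and the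
  -- contraction factor is `1 - 1/800`.
  set L : ℝ := (6400 * K ^ 2) ^ 4 with hL
  have hK2 : 1 ≤ 6400 * K ^ 2 := by nlinarith
  have hL1 : 1 ≤ L := one_le_pow₀ hK2
  have hLK : 8 * K ^ 2 * L ^ (-(1 / 4) : ℝ) = 1 / 800 := by
    have e : L ^ (-(1 / 4) : ℝ) = (6400 * K ^ 2)⁻¹ := by
      rw [hL, ← Real.rpow_natCast (6400 * K ^ 2) 4, ← Real.rpow_mul (by positivity),
        ← Real.rpow_neg_one]
      norm_num
    rw [e]
    field_simp
    norm_num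
  refine ⟨800 * C₂ * L + 32000 * C₁ * K ^ 2, by nlinarith, ?_⟩
  intro N _ hN a h m hm V hV hH t ht htT x
  have hN0 : (0 : ℝ) < N := by positivity
  have hN2 : (2 : ℝ) ≤ N := by exact_mod_cast hN
  have hV0 : 0 ≤ V := (dotProduct_nonneg' hm fun A => sq_nonneg _).trans (hV 0)
  have c1 := continuous_kernelGradProd a
  have c2 := continuous_gradMoment a m
  set ν : ℝ := (N : ℝ) ^ (-β) with hν
  have hν0 : 0 ≤ ν := by positivity
  have hlog1 : 1 ≤ Real.log (N + 1) := by
    rw [Real.le_log_iff_exp_le (by positivity)]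
    linarith [Real.exp_one_lt_d9]
  set E : ℝ := ν * Real.log (N + 1) with hE
  have hE0 : 0 ≤ E := by positivity
  -- Since `|W| ≤ 10 Z²`, moments of `Z` give a bound without decay. It initialises the iteration
  -- and settles the case where `N^(-β)` is not small.
  have hapriori : ∀ r, 0 ≤ r → r ≤ (N : ℝ) ^ 2 * T → ∀ y, gradMoment a m r y ≤ 10 * C₁ * V := by
    intro r h0 h1 y
    calc gradMoment a m r y ≤ m ⬝ᵥ (propagator a r *ᵥ ((10 : ℝ) • zsq y)) := by
          refine dotProduct_mono hm fun A => ?_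
          have := abs_vecMul_dotProduct_le hN h.env_nonneg h0 (m := Pi.single A 1)
            (m' := Pi.single A 1) (fun B => by
              rw [abs_of_nonneg]
              exact (Pi.single_nonneg.2 zero_le_one : (0 : HalfFilled N → ℝ) ≤ Pi.single A 1) B)
            (gradProd y)
          rw [← Matrix.dotProduct_mulVec, ← Matrix.dotProduct_mulVec, single_dotProduct,
            single_dotProduct, one_mul, one_mul] at this
          exact this.trans (dotProduct_mono (propagator_nonneg hN h.env_nonneg h0 A)
            fun B => abs_gradProd_le hN y B)
      _ = 10 * ((m ᵥ* propagator a r) ⬝ᵥ zsq y) := by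
          rw [Matrix.dotProduct_mulVec, dotProduct_smul, smul_eq_mul]
      _ ≤ 10 * (C₁ * V) := by
          have := hmom N hN u β a h m hm V hV r h0 h1 y
          linarith
      _ = _ := by ring
  -- If `N^(-β)` is small the kernel weights are subcritical. Otherwise the right-hand side is
  -- bounded below by a constant and the a priori bound suffices.
  by_cases hs : 8 * K ^ 2 * ν ≤ 1 / 400
  · have hN3 : 3 ≤ N := by
      by_contra hcon
      have hN' : N = 2 := by omega
      have h1 : (2 : ℝ)⁻¹ ≤ ν := by
        rw [hν, hN', ← Real.rpow_neg_one]
        exact Real.rpow_le_rpow_of_exponent_le (by norm_num) (by linarith)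
      nlinarith
    set w : ℝ → ℝ := fun r => E + N / (r + L) with hw
    set S := {r : ℝ // 0 ≤ r ∧ r ≤ (N : ℝ) ^ 2 * T} × ZMod N
    have hLr : ∀ r : ℝ, 0 ≤ r → 0 < r + L := fun r hr => by linarith
    -- The value of `M₀` makes the a priori bound fit under `M₀ w`, since `w ≥ N/(r+L)` and `r ≤ N²
    -- T`. The profile uses `r + L`, and `N/(r+1) ≤ L · N/(r+L)` passes between the two forms.
    have hkey := le_of_contraction (S := S) (f := fun s => gradMoment a m s.1.1 s.2)
      (w := fun s => w s.1.1) (A := C₂ * V * L) (q := 1 - 1 / 800)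
      (M₀ := 10 * C₁ * V * ((N : ℝ) ^ 2 * T + L)) (by norm_num) (by norm_num) (by positivity)
      ?_ (by positivity) ?_ ?_ (⟨t, ht, htT⟩, x)
    · refine hkey.trans ?_
      have h1 : w t ≤ E + N / (t + 1) := by
        have : (N : ℝ) / (t + L) ≤ N / (t + 1) :=
          div_le_div_of_nonneg_left hN0.le (by linarith) (by linarith)
        rw [hw]
        linarith
      have h2 : 0 ≤ E + N / (t + 1) := by positivity
      calc C₂ * V * L / (1 - (1 - 1 / 800)) * w t
          = 800 * C₂ * L * V * w t := by ring
        _ ≤ 800 * C₂ * L * V * (E + N / (t + 1)) := by gcongr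
        _ ≤ _ := by
          have : 0 ≤ 32000 * C₁ * K ^ 2 * V * (E + N / (t + 1)) := by positivity
          linarith
    · rintro ⟨⟨r, h0, h1⟩, y⟩
      refine (hapriori r h0 h1 y).trans ?_
      have h2 : 1 ≤ ((N : ℝ) ^ 2 * T + L) * w r := by
        have h3 : 1 ≤ ((N : ℝ) ^ 2 * T + L) * (N / (r + L)) := by
          rw [← mul_div_assoc, le_div_iff₀ (hLr r h0)]
          nlinarith [hLr r h0]
        have h4 : 0 ≤ ((N : ℝ) ^ 2 * T + L) * E := by positivity
        rw [hw]
        linarith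
      have h5 : 0 ≤ 10 * C₁ * V := by positivity
      calc 10 * C₁ * V ≤ 10 * C₁ * V * (((N : ℝ) ^ 2 * T + L) * w r) :=
            le_mul_of_one_le_right h5 h2
        _ = _ := by ring
    · rintro ⟨⟨r, h0, h1⟩, y⟩
      have := hLr r h0
      change 0 ≤ E + N / (r + L)
      positivity
    · rintro M hM hf ⟨⟨s, h0, h1⟩, y⟩
      have hw0 : 0 < s + L := hLr s h0
      have hcv := hconv N hN a h m hm V hV hH s h0 h1 y
      have hd : (N : ℝ) / (s + 1) ≤ L * (N / (s + L)) := by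
        rw [← mul_div_assoc, div_le_div_iff₀ (by linarith) hw0]
        nlinarith [mul_nonneg h0 (by linarith : 0 ≤ L - 1), mul_nonneg hN0.le
          (mul_nonneg h0 (by linarith : 0 ≤ L - 1))]
      have h3 : C₂ * V * (E + N / (s + 1)) ≤ C₂ * V * L * w s := by
        calc C₂ * V * (E + N / (s + 1)) ≤ C₂ * V * (L * E + L * (N / (s + L))) := by
              have : E ≤ L * E := le_mul_of_one_le_left hE0 hL1
              gcongr
          _ = _ := by rw [hw]; ring
      have h4 : ∫ r in (0 : ℝ)..s, ∑ z, |kernelGradProd a (s - r) y z| * gradMoment a m r z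
          ≤ M * ∫ r in (0 : ℝ)..s, (∑ z, |kernelGradProd a (s - r) y z|)
            * (E + N / (r + L)) := by
        rw [← intervalIntegral.integral_const_mul]
        refine intervalIntegral.integral_mono_on h0
          (Continuous.intervalIntegrable (by fun_prop) _ _) ?_ fun r hr => ?_
        · refine ContinuousOn.intervalIntegrable ?_
          rw [Set.uIcc_of_le h0]
          refine ContinuousOn.mul (by fun_prop) (ContinuousOn.mul (by fun_prop)
            (continuousOn_const.add (ContinuousOn.div continuousOn_const (by fun_prop)
              fun s hs => ?_)))
          exact (hLr s hs.1).ne'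
        · rw [Finset.sum_mul, Finset.mul_sum]
          refine Finset.sum_le_sum fun z _ => ?_
          have := mul_le_mul_of_nonneg_left (hf (⟨r, hr.1, hr.2.trans h1⟩, z))
            (abs_nonneg (kernelGradProd a (s - r) y z))
          refine this.trans_eq ?_
          simp only [hw]
          ring
      have h5 := convolution_weight_le (k := fun s => ∑ z, |kernelGradProd a s y z|)
        (q₀ := 1 - 1 / 400) (K := K) (A := E) (B := N) (L := L) (t := s) (by fun_prop) hL1 hE0
        hN0.le h0 (h.integral_abs_kernelGradProd_le hN3 hs h0 h1 y)
        (fun r hr0 hr1 => h.sum_abs_kernelGradProd_le hr0 (hr1.trans h1) y)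
      rw [hLK] at h5
      have h6 := mul_le_mul_of_nonneg_left h5 hM
      have h7 : (1 - 1 / 400 + 1 / 800 : ℝ) = 1 - 1 / 800 := by norm_num
      rw [h7] at h6
      change gradMoment a m s y ≤ (C₂ * V * L + (1 - 1 / 800) * M) * w s
      have h8 : M * ((1 - 1 / 800) * (E + N / (s + L))) = (1 - 1 / 800) * M * w s := by
        rw [hw]; ring
      linarith
  · push Not at hs
    refine (hapriori t ht htT x).trans ?_
    have h1 : 1 ≤ 3200 * K ^ 2 * E := by
      have : ν ≤ E := le_mul_of_one_le_right hν0 hlog1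
      have : K ^ 2 * ν ≤ K ^ 2 * E := by gcongr
      linarith
    have h2 : 0 ≤ 10 * C₁ * V := by positivity
    have h3 : 0 ≤ 32000 * C₁ * K ^ 2 * V * (N / (t + 1)) := by positivity
    have h4 : 0 ≤ 800 * C₂ * L * V * (E + N / (t + 1)) := by positivity
    have h5 := le_mul_of_one_le_right h2 h1
    linarith

/-- The deterministic form of the main estimate, for a fixed environment. -/
theorem deterministic_bound (uRt uIc cRt cIc u v Λ T : ℝ) (huIc : 0 < uIc)
    (hu : 1 / 2 < u) (hu1 : u < 1) (hv : 0 < v) (hvRt : v < uRt) :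
    ∃ C : ℝ, 0 < C ∧ ∀ (N : ℕ) [NeZero N], 2 ≤ N → ∀ (A₀ : HalfFilled N),
      NearStationary uIc cIc A₀.1 → ∀ a : ZMod N → ℝ, (∀ x, 0 ≤ a x) → (∀ x, a x ≤ cRt) →
      GoodEnvironment uRt u v Λ T a → GoodEnvironment uRt 1 v Λ T a →
      ∀ s t : ℝ, 0 ≤ s → 0 ≤ t → s ≤ (N : ℝ) ^ 2 * T → t ≤ (N : ℝ) ^ 2 * T → ∀ x,
        gradMoment a (propagator a s A₀) t x
          ≤ C * ((N : ℝ) ^ (-(min (min (u / 2) uIc) v)) * Real.log (N + 1) + N / (t + 1)) := by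
  -- For negative `T` no admissible time exists, and for `Λ < 1` no environment is good, so any
  -- positive constant works.
  by_cases hT : 0 ≤ T
  swap
  · refine ⟨1, one_pos, fun N _ hN A₀ _ a _ _ _ _ s t hs _ hsT => absurd ?_ hT⟩
    have : (0 : ℝ) < (N : ℝ) ^ 2 := by positivity
    nlinarith
  by_cases hΛ : 1 ≤ Λ
  swap
  · exact ⟨1, one_pos, fun N _ hN A₀ _ a _ _ hg => absurd (hg.one_le hT) hΛ⟩
  set β := min (min (u / 2) uIc) v with hβ
  have hβ0 : 0 < β := lt_min (lt_min (by linarith) huIc) hv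
  have hβu : β ≤ u / 2 := (min_le_left _ _).trans (min_le_left _ _)
  have hβI : β ≤ uIc := (min_le_left _ _).trans (min_le_right _ _)
  have hu0 : 0 < u := by linarith
  set K : ℝ := 7 * Λ * (T + 1) + Λ * (T + 1) ^ (v / 2) + max cRt 0 with hKdef
  have hK : 1 ≤ K := by
    have h1 : 0 ≤ Λ * (T + 1) ^ (v / 2) := by positivity
    have h2 := le_max_right cRt 0
    nlinarith
  obtain ⟨C₁, hC₁, hmom⟩ := second_moment_bound K T hK hT
  obtain ⟨C₂, hC₂, hspat⟩ := spatial_regularity K T u β hK hT hu0 hu1 hβu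
  obtain ⟨C₃, hC₃, hbd⟩ := gradMoment_bound K T u β hK hT hu0 hu1 hβ0 hβu
  refine ⟨C₃ * ((C₁ + C₂) * cIc ^ 2) + 1, by positivity, ?_⟩
  intro N _ hN A₀ hns a ha hac hg hg1 s t hs ht hsT htT x
  have hN0 : (0 : ℝ) < N := by positivity
  have hKB : KernelBounds u β K T a := kernelBounds_of_good hN hT hu0.le hu1.le hvRt.le hβ0.le
    (min_le_right _ _) hβu ha (fun x => (hac x).trans (le_max_left _ _)) hg hg1
  have hz : ∀ x, gartner (initialHeight A₀.1) 0 x = zval A₀ x := fun x => by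
    simp [gartner, tau_rpow_half hN, zval]
  simp only [NearStationary, hz] at hns
  have hc0 : 0 ≤ cIc := (zval_pos hN A₀ 0).le.trans (hns.1 0)
  set m : HalfFilled N → ℝ := Pi.single A₀ 1 with hm
  have hm0 : ∀ A, 0 ≤ m A := fun A =>
    (Pi.single_nonneg.2 zero_le_one : (0 : HalfFilled N → ℝ) ≤ Pi.single A₀ 1) A
  have hV : ∀ x, m ⬝ᵥ zsq x ≤ cIc ^ 2 := fun x => by
    rw [hm, single_dotProduct, one_mul, zsq]
    exact pow_le_pow_left₀ (zval_pos hN A₀ x).le (hns.1 x) 2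
  -- With `d` the distance, `(d/N)^uIc ≤ (d/N)^β = N^(-β) d^β ≤ N^(-β) d^u`, because `d ≤ N` and,
  -- off the diagonal, `d ≥ 1`. On the diagonal both sides vanish.
  have hH : ∀ x y, m ⬝ᵥ zdiffSq x y
      ≤ cIc ^ 2 * ((N : ℝ) ^ (-β) * (torusDist x y : ℝ) ^ u) ^ 2 := fun x y => by
    rw [hm, single_dotProduct, one_mul, zdiffSq, ← mul_pow, ← sq_abs]
    refine pow_le_pow_left₀ (abs_nonneg _) ((hns.2 x y).trans ?_) 2
    refine mul_le_mul_of_nonneg_left ?_ hc0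
    by_cases hxy : x = y
    · rw [hxy, torusDist_self]
      simp [huIc.ne', hu0.ne']
    have hd1 : (1 : ℝ) ≤ torusDist x y := by exact_mod_cast one_le_torusDist hxy
    have hdN : (torusDist x y : ℝ) ≤ N := by exact_mod_cast torusDist_le x y
    have hq : 0 < (torusDist x y : ℝ) / N := by positivity
    calc ((torusDist x y : ℝ) / N) ^ uIc ≤ ((torusDist x y : ℝ) / N) ^ β :=
          Real.rpow_le_rpow_of_exponent_ge hq ((div_le_one hN0).2 hdN) hβI
      _ = (N : ℝ) ^ (-β) * (torusDist x y : ℝ) ^ β := by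
          rw [Real.div_rpow (by positivity) hN0.le, Real.rpow_neg hN0.le]; ring
      _ ≤ _ := by
          refine mul_le_mul_of_nonneg_left ?_ (by positivity)
          exact Real.rpow_le_rpow_of_exponent_le hd1 (by linarith)
  have hms : m ᵥ* propagator a s = propagator a s A₀ := by
    rw [hm, Matrix.single_one_vecMul]
    rfl
  -- The law at time `s` inherits the moment and Hölder bounds of the initial condition, so the
  -- decay in `t` can be started from it.
  have hW : ∀ y, propagator a s A₀ ⬝ᵥ zsq y ≤ (C₁ + C₂) * cIc ^ 2 := fun y => by
    rw [← hms]
    refine (hmom N hN u β a hKB m hm0 _ hV s hs hsT y).trans ?_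
    exact mul_le_mul_of_nonneg_right (by linarith) (sq_nonneg _)
  have hW' : ∀ x y, propagator a s A₀ ⬝ᵥ zdiffSq x y
      ≤ (C₁ + C₂) * cIc ^ 2 * ((N : ℝ) ^ (-β) * (torusDist x y : ℝ) ^ u) ^ 2 := fun x y => by
    rw [← hms]
    refine (hspat N hN a hKB m hm0 _ hV hH s hs hsT x y).trans ?_
    refine mul_le_mul_of_nonneg_right ?_ (sq_nonneg _)
    exact mul_le_mul_of_nonneg_right (by linarith) (sq_nonneg _)
  refine (hbd N hN a hKB _ (propagator_nonneg hN ha hs A₀) _ hW hW' t ht htT x).trans ?_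
  refine mul_le_mul_of_nonneg_right (by linarith) ?_
  have : 0 ≤ Real.log (N + 1) := Real.log_nonneg (by linarith)
  positivity

end Deterministic

end InhomASEP

/-! ## Particle dynamics along a realisation of the clocks -/

namespace InhomASEP

section Paths

open scoped Matrix

variable {N : ℕ} [NeZero N]

/-- A half-filled state whose height function has the occupation variables as gradient. -/
structure State.Consistent (σ : State N) : Prop where
  card : 2 * σ.occupied.card = N
  rel : ∀ x, σ.height (x + 1) = σ.height x + (2 * (if x + 1 ∈ σ.occupied then 1 else 0) - 1)

/-- The point mass at the configuration of `σ`, with weight `τ ^ h(0)`. -/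
def stateVec (σ : State N) (B : HalfFilled N) : ℝ :=
  if B.1 = σ.occupied then tau N ^ σ.height 0 else 0

theorem stateVec_nonneg (hN : 2 ≤ N) (σ : State N) (B : HalfFilled N) : 0 ≤ stateVec σ B := by
  have := tau_pos hN
  rw [stateVec]
  split_ifs <;> positivity

theorem stateVec_dotProduct {σ : State N} (hσ : 2 * σ.occupied.card = N) (f : HalfFilled N → ℝ) :
    stateVec σ ⬝ᵥ f = tau N ^ σ.height 0 * f ⟨σ.occupied, hσ⟩ := by
  rw [dotProduct, Finset.sum_eq_single (⟨σ.occupied, hσ⟩ : HalfFilled N)]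
  · simp [stateVec]
  · intro B _ hB
    rw [stateVec, if_neg fun h => hB (Subtype.ext h), zero_mul]
  · simp

theorem consistent_initialState {A : Finset (ZMod N)} (hA : 2 * A.card = N) :
    (initialState A).Consistent :=
  ⟨hA, initialHeight_succ hA⟩

theorem State.Consistent.jumpRight (hN : 2 ≤ N) {σ : State N} (h : σ.Consistent) (x : ZMod N) :
    (jumpRight x σ).Consistent := by
  unfold InhomASEP.jumpRight
  split_ifs with hx
  · exact ⟨by simpa [card_exchange hx.1 hx.2] using h.card,
      height_relation_right hN h.rel hx.1 hx.2⟩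
  · exact h

theorem State.Consistent.jumpLeft (hN : 2 ≤ N) {σ : State N} (h : σ.Consistent) (x : ZMod N) :
    (jumpLeft x σ).Consistent := by
  unfold InhomASEP.jumpLeft
  split_ifs with hx
  · exact ⟨by simpa [card_exchange hx.1 hx.2] using h.card,
      height_relation_left hN h.rel hx.2 hx.1⟩
  · exact h

/-- The weight `weightRight` is the ratio of `τ^(h(0))` after and before the jump. Jumping the state
is thus dual to the weighted move acting on functions, and this connects the particle system with
`jumpMatrix`. -/
theorem stateVec_jumpRight (hN : 2 ≤ N) {σ : State N} (h : σ.Consistent) (x : ZMod N)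
    (f : HalfFilled N → ℝ) : stateVec (jumpRight x σ) ⬝ᵥ f
      = stateVec σ ⬝ᵥ fun A => weightRight x A * f (moveRight x A) := by
  have ht := (tau_pos hN).ne'
  rw [stateVec_dotProduct (h.jumpRight hN x).card, stateVec_dotProduct h.card, ← mul_assoc]
  by_cases hx : x ∈ σ.occupied ∧ x + 1 ∉ σ.occupied
  · congr 1
    · by_cases h0 : x = 0
      · subst h0
        simp only [jumpRight, if_pos hx, Function.update_self, weightRight, true_and]
        rw [zpow_sub₀ ht]
        simp [div_eq_mul_inv]
      · simp [jumpRight, if_pos hx, weightRight, h0, Function.update_of_ne (Ne.symm h0)]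
    · congr 1
      simp [moveRight, hx, jumpRight]
  · congr 1
    · simp only [jumpRight, if_neg hx, weightRight]
      rw [if_neg fun h => hx h.2, mul_one]
    · congr 1
      rw [moveRight, dif_neg hx, Subtype.mk.injEq, jumpRight, if_neg hx]

theorem stateVec_jumpLeft (hN : 2 ≤ N) {σ : State N} (h : σ.Consistent) (x : ZMod N)
    (f : HalfFilled N → ℝ) : stateVec (jumpLeft x σ) ⬝ᵥ f
      = stateVec σ ⬝ᵥ fun A => weightLeft x A * f (moveLeft x A) := by
  have ht := (tau_pos hN).ne'
  rw [stateVec_dotProduct (h.jumpLeft hN x).card, stateVec_dotProduct h.card, ← mul_assoc]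
  by_cases hx : x + 1 ∈ σ.occupied ∧ x ∉ σ.occupied
  · congr 1
    · by_cases h0 : x = 0
      · subst h0
        simp only [jumpLeft, if_pos hx, Function.update_self, weightLeft, true_and]
        rw [zpow_add₀ ht]
        norm_cast
      · simp [jumpLeft, if_pos hx, weightLeft, h0, Function.update_of_ne (Ne.symm h0)]
    · congr 1
      simp [moveLeft, hx, jumpLeft]
  · congr 1
    · simp only [jumpLeft, if_neg hx, weightLeft]
      rw [if_neg fun h => hx h.2, mul_one]
    · congr 1
      rw [moveLeft, dif_neg hx, Subtype.mk.injEq, jumpLeft, if_neg hx]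

theorem stateVec_jumpMatrix (hN : 2 ≤ N) {σ : State N} (h : σ.Consistent) (a : ZMod N → ℝ)
    (f : HalfFilled N → ℝ) : stateVec σ ⬝ᵥ (jumpMatrix a *ᵥ f)
      = ∑ x, a x * (rateR N * (stateVec (jumpRight x σ) ⬝ᵥ f)
        + rateL N * (stateVec (jumpLeft x σ) ⬝ᵥ f)) := by
  have e : jumpMatrix a *ᵥ f = fun A => ∑ x, a x * (rateR N * (weightRight x A * f (moveRight x A))
      + rateL N * (weightLeft x A * f (moveLeft x A))) := by
    ext A
    exact jumpMatrix_mulVec a f A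
  rw [e, stateVec_dotProduct h.card, Finset.mul_sum]
  refine Finset.sum_congr rfl fun x _ => ?_
  rw [stateVec_jumpRight hN h, stateVec_jumpLeft hN h, stateVec_dotProduct h.card,
    stateVec_dotProduct h.card]
  ring

/-! ### The graphical construction along one realisation of the clocks. -/

section Clocks

variable (QL QR : ℝ≥0 → ZMod N → ℕ) (A : Finset (ZMod N))

theorem consistent_stateAfter (hN : 2 ≤ N) (hA : 2 * A.card = N) (n : ℕ) :
    (stateAfter QL QR A n).Consistent := by
  induction n with
  | zero => exact consistent_initialState hA
  | succ n ih =>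
    rw [stateAfter]
    split_ifs
    · exact ih.jumpRight hN _
    · exact ih.jumpLeft hN _
    · exact ih

/-- One ring lowers the height at the origin by at most two. As `τ ≤ 1`, the weight `τ^(h(0))` is at
most `τ^(-2n)` after `n` rings, so exponential moments of the number of rings give integrability. -/
theorem height_stateAfter_ge (n : ℕ) : -2 * (n : ℤ) ≤ (stateAfter QL QR A n).height 0 := by
  have h1 : ∀ (x : ZMod N) (σ : State N), σ.height 0 - 2 ≤ (jumpRight x σ).height 0 := by
    intro x σ
    unfold jumpRight
    split_ifs
    · by_cases h0 : x = 0
      · subst h0; simp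
      · simp [Function.update_of_ne (Ne.symm h0)]
    · simp
  have h2 : ∀ (x : ZMod N) (σ : State N), σ.height 0 ≤ (jumpLeft x σ).height 0 := by
    intro x σ
    unfold jumpLeft
    split_ifs
    · by_cases h0 : x = 0
      · subst h0; simp
      · simp [Function.update_of_ne (Ne.symm h0)]
    · simp
  induction n with
  | zero => simp [stateAfter, initialState, initialHeight_zero]
  | succ n ih =>
    rw [stateAfter]
    push_cast
    split_ifs with hR hL
    · have := h1 hR.choose (stateAfter QL QR A n)
      omega
    · have := h2 hL.choose (stateAfter QL QR A n)
      omega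
    · omega

theorem sum_stateVec_stateAfter_le (hN : 2 ≤ N) (hA : 2 * A.card = N) (n : ℕ) :
    ∑ B, stateVec (stateAfter QL QR A n) B ≤ ((tau N)⁻¹ ^ 2) ^ n := by
  have ht := tau_pos hN
  have h1 := stateVec_dotProduct (consistent_stateAfter QL QR A hN hA n).card (fun _ => 1)
  simp only [dotProduct, mul_one] at h1
  rw [h1, ← pow_mul, inv_pow, ← zpow_natCast, ← zpow_neg]
  refine zpow_le_zpow_right_of_le_one₀ ht (tau_le_one hN) ?_
  have := height_stateAfter_ge QL QR A n
  push_cast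
  linarith

/-- Products of two values of `Z` depend on the full height only through `τ^(h(0))`; the rest is a
function of the configuration. This is the reduction to a finite state space. -/
theorem gartner_mul_gartner (hN : 2 ≤ N) {σ : State N} (h : σ.Consistent) (t : ℝ≥0)
    (x y : ZMod N) : gartner σ.height t x * gartner σ.height t y
      = Real.exp (2 * nu N * t) * (tau N ^ σ.height 0
        * (zval ⟨σ.occupied, h.card⟩ x * zval ⟨σ.occupied, h.card⟩ y)) := by
  have h0 := (sqrtTau_pos hN).ne'
  have hx := eq_initialHeight h.card h.rel x
  have hy := eq_initialHeight h.card h.rel y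
  rw [gartner, gartner, tau_rpow_half hN, tau_rpow_half hN, hx, hy, zpow_add₀ h0, zpow_add₀ h0,
    ← sqrtTau_sq hN, ← zpow_natCast (sqrtTau N) 2, ← zpow_mul, mul_comm ((2 : ℕ) : ℤ), zpow_mul,
    show 2 * nu N * (t : ℝ) = nu N * t + nu N * t by ring, Real.exp_add, zval, zval]
  norm_cast
  ring

theorem gradient_product_eq (hN : 2 ≤ N) {σ : State N} (h : σ.Consistent) (t : ℝ≥0) (x : ZMod N) :
    N * (gartner σ.height t (x + 1) - gartner σ.height t x)
      * (gartner σ.height t x - gartner σ.height t (x - 1))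
      = Real.exp (2 * nu N * t) * (stateVec σ ⬝ᵥ gradProd x) := by
  have e := fun x y => gartner_mul_gartner hN h t x y
  rw [stateVec_dotProduct h.card, gradProd]
  linear_combination (N : ℝ) * (e (x + 1) x - e (x + 1) (x - 1) - e x x + e x (x - 1))

/-- A realisation of the clocks. -/
structure IsClockPath : Prop where
  left_zero : ∀ x, QL 0 x = 0
  right_zero : ∀ x, QR 0 x = 0
  left_mono : ∀ x, Monotone fun t => QL t x
  right_mono : ∀ x, Monotone fun t => QR t x
  left_rightCont : ∀ x t, ContinuousWithinAt (fun t => QL t x) (Set.Ici t) t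
  right_rightCont : ∀ x t, ContinuousWithinAt (fun t => QR t x) (Set.Ici t) t

variable {QL QR}

theorem IsClockPath.exists_const_right (h : IsClockPath QL QR) (t : ℝ≥0) :
    ∃ t', t < t' ∧ ∀ s ∈ Set.Icc t t', ∀ x, QL s x = QL t x ∧ QR s x = QR t x := by
  have hd : ∀ f : ℝ≥0 → ℕ, ContinuousWithinAt f (Set.Ici t) t →
      ∀ᶠ s in nhdsWithin t (Set.Ici t), f s = f t := fun f hf => by
    have := hf.eventually (isOpen_discrete {f t} |>.mem_nhds rfl)
    exact this
  have h1 : ∀ᶠ s in nhdsWithin t (Set.Ici t), ∀ x, QL s x = QL t x ∧ QR s x = QR t x := by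
    rw [Filter.eventually_all]
    exact fun x => (hd _ (h.left_rightCont x t)).and (hd _ (h.right_rightCont x t))
  obtain ⟨t', ht', hs⟩ := mem_nhdsGE_iff_exists_Icc_subset.1 h1
  exact ⟨t', ht', fun s hs' => hs hs'⟩

theorem IsClockPath.totalRings_mono (h : IsClockPath QL QR) : Monotone (totalRings QL QR) :=
  fun _ _ hst => Finset.sum_le_sum fun x _ => add_le_add (h.left_mono x hst) (h.right_mono x hst)

theorem IsClockPath.totalRings_zero (h : IsClockPath QL QR) : totalRings QL QR 0 = 0 := by
  simp [totalRings, h.left_zero, h.right_zero]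

theorem IsClockPath.ringTime_le {n : ℕ} {t : ℝ≥0} (hn : n ≤ totalRings QL QR t) :
    ringTime QL QR n ≤ t :=
  csInf_le (OrderBot.bddBelow _) hn

/-- By right continuity the infimum defining the ring time is attained. The hypothesis ensures that
the infimum is over a nonempty set. -/
theorem IsClockPath.le_totalRings_ringTime (h : IsClockPath QL QR) {n : ℕ} {t : ℝ≥0}
    (hn : n ≤ totalRings QL QR t) : n ≤ totalRings QL QR (ringTime QL QR n) := by
  by_contra hcon
  push Not at hcon
  obtain ⟨t', ht', hs⟩ := h.exists_const_right (ringTime QL QR n)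
  have h1 : totalRings QL QR t' < n := by
    refine lt_of_eq_of_lt (Finset.sum_congr rfl fun x _ => ?_) hcon
    have := hs t' ⟨ht'.le, le_rfl⟩ x
    rw [this.1, this.2]
  have h2 : t' ≤ ringTime QL QR n := le_csInf ⟨t, hn⟩ fun s hs' => by
    by_contra hlt
    push Not at hlt
    have := h.totalRings_mono hlt.le
    exact absurd (hs'.out.trans this) (by omega)
  exact absurd h2 (not_le.2 ht')

/-- Between a ring time and any later time with the same number of rings nothing happens. -/
theorem IsClockPath.ringTime_eq (h : IsClockPath QL QR) {n : ℕ} {t : ℝ≥0}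
    (hn : totalRings QL QR t = n) (x : ZMod N) :
    QL (ringTime QL QR n) x = QL t x ∧ QR (ringTime QL QR n) x = QR t x := by
  have h1 := IsClockPath.ringTime_le hn.ge
  have h2 := h.le_totalRings_ringTime hn.ge
  have h3 : totalRings QL QR (ringTime QL QR n) = totalRings QL QR t :=
    le_antisymm (h.totalRings_mono h1) (hn.trans_le h2)
  have h4 := (Finset.sum_eq_sum_iff_of_le fun x _ =>
    add_le_add (h.left_mono x h1) (h.right_mono x h1)).1 h3 x (Finset.mem_univ x)
  have h5 : QL (ringTime QL QR n) x ≤ QL t x := h.left_mono x h1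
  have h6 : QR (ringTime QL QR n) x ≤ QR t x := h.right_mono x h1
  simp only at h4
  omega

theorem totalRings_add {s t : ℝ≥0} {k l : ZMod N → ℕ}
    (hkl : ∀ x, QL t x = QL s x + k x ∧ QR t x = QR s x + l x) :
    totalRings QL QR t = totalRings QL QR s + ∑ x, (k x + l x) := by
  rw [totalRings, totalRings, ← Finset.sum_add_distrib]
  refine Finset.sum_congr rfl fun x _ => ?_
  rw [(hkl x).1, (hkl x).2]
  ring

theorem IsClockPath.asep_zero (h : IsClockPath QL QR) : asep QL QR A 0 = initialState A := by
  rw [asep, h.totalRings_zero, stateAfter]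

theorem asep_of_no_ring {s t : ℝ≥0} (hkl : ∀ x, QL t x = QL s x + (0 : ZMod N → ℕ) x
      ∧ QR t x = QR s x + (0 : ZMod N → ℕ) x) : asep QL QR A t = asep QL QR A s := by
  rw [asep, asep, totalRings_add hkl]
  simp

theorem IsClockPath.asep_of_right_ring (h : IsClockPath QL QR) {s t : ℝ≥0} {x : ZMod N}
    (hkl : ∀ y, QL t y = QL s y + (0 : ZMod N → ℕ) y
      ∧ QR t y = QR s y + (Pi.single x 1 : ZMod N → ℕ) y) :
    asep QL QR A t = jumpRight x (asep QL QR A s) := by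
  have hV : totalRings QL QR t = totalRings QL QR s + 1 := by
    rw [totalRings_add hkl]
    simp [Finset.sum_pi_single']
  have e1 := h.ringTime_eq (rfl : totalRings QL QR s = _)
  have e2 := h.ringTime_eq hV
  have hR : ∀ y, QR (ringTime QL QR (totalRings QL QR s)) y
      < QR (ringTime QL QR (totalRings QL QR s + 1)) y ↔ y = x := fun y => by
    rw [(e1 y).2, (e2 y).2, (hkl y).2]
    by_cases hy : y = x <;> simp [hy]
  have hex : ∃ y, QR (ringTime QL QR (totalRings QL QR s)) y
      < QR (ringTime QL QR (totalRings QL QR s + 1)) y := ⟨x, (hR x).2 rfl⟩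
  rw [asep, hV, stateAfter, dif_pos hex, (hR _).1 hex.choose_spec, asep]

theorem IsClockPath.asep_of_left_ring (h : IsClockPath QL QR) {s t : ℝ≥0} {x : ZMod N}
    (hkl : ∀ y, QL t y = QL s y + (Pi.single x 1 : ZMod N → ℕ) y
      ∧ QR t y = QR s y + (0 : ZMod N → ℕ) y) :
    asep QL QR A t = jumpLeft x (asep QL QR A s) := by
  have hV : totalRings QL QR t = totalRings QL QR s + 1 := by
    rw [totalRings_add hkl]
    simp [Finset.sum_pi_single']
  have e1 := h.ringTime_eq (rfl : totalRings QL QR s = _)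
  have e2 := h.ringTime_eq hV
  have hR : ∀ y, ¬ QR (ringTime QL QR (totalRings QL QR s)) y
      < QR (ringTime QL QR (totalRings QL QR s + 1)) y := fun y => by
    rw [(e1 y).2, (e2 y).2, (hkl y).2]
    simp
  have hL : ∀ y, QL (ringTime QL QR (totalRings QL QR s)) y
      < QL (ringTime QL QR (totalRings QL QR s + 1)) y ↔ y = x := fun y => by
    rw [(e1 y).1, (e2 y).1, (hkl y).1]
    by_cases hy : y = x <;> simp [hy]
  have hex : ∃ y, QL (ringTime QL QR (totalRings QL QR s)) y
      < QL (ringTime QL QR (totalRings QL QR s + 1)) y := ⟨x, (hL x).2 rfl⟩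
  rw [asep, hV, stateAfter, dif_neg (fun ⟨y, hy⟩ => hR y hy), dif_pos hex,
    (hL _).1 hex.choose_spec, asep]

/-- The counts at a ring time are detected by the clocks before `t`. -/
theorem IsClockPath.ringTime_count_le_iff (h : IsClockPath QL QR) {n : ℕ} {t : ℝ≥0}
    (hn : n ≤ totalRings QL QR t) {q : ℝ≥0 → ℕ} (hq : q ∈ Set.range (fun x s => QL s x)
      ∪ Set.range (fun x s => QR s x)) (j : ℕ) :
    q (ringTime QL QR n) ≤ j ↔ (n ≤ totalRings QL QR t ∧ q t ≤ j) ∨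
      ∃ r : ℚ, Real.toNNReal r ≤ t ∧ n ≤ totalRings QL QR (Real.toNNReal r)
        ∧ q (Real.toNNReal r) ≤ j := by
  have hm : Monotone q := by
    rcases hq with ⟨x, rfl⟩ | ⟨x, rfl⟩
    · exact h.left_mono x
    · exact h.right_mono x
  have hc : ∀ t, ∃ t', t < t' ∧ ∀ s ∈ Set.Icc t t', q s = q t := by
    intro t
    obtain ⟨t', ht', hs⟩ := h.exists_const_right t
    refine ⟨t', ht', fun s hs' => ?_⟩
    rcases hq with ⟨x, rfl⟩ | ⟨x, rfl⟩
    · exact (hs s hs' x).1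
    · exact (hs s hs' x).2
  constructor
  · intro hj
    -- Either the ring time is `t` itself, or the counts stay constant just after it and a rational
    -- time before `t` sees the same values. Only countably many times are then involved.
    rcases (IsClockPath.ringTime_le hn).eq_or_lt with he | hlt
    · exact Or.inl ⟨hn, he ▸ hj⟩
    · right
      obtain ⟨t', ht', hs⟩ := hc (ringTime QL QR n)
      obtain ⟨r, hr1, hr2⟩ := exists_rat_btwn
        (NNReal.coe_lt_coe.2 (lt_min hlt ht') : ((ringTime QL QR n : ℝ≥0) : ℝ) < (min t t' : ℝ≥0))
      have hr0 : (0 : ℝ) ≤ r := (NNReal.coe_nonneg _).trans hr1.le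
      have h1 : ringTime QL QR n ≤ Real.toNNReal r := NNReal.le_toNNReal_of_coe_le hr1.le
      have h2 : Real.toNNReal r ≤ min t t' := Real.toNNReal_le_iff_le_coe.2 hr2.le
      refine ⟨r, h2.trans (min_le_left _ _), ?_, ?_⟩
      · exact (h.le_totalRings_ringTime hn).trans (h.totalRings_mono h1)
      · rw [hs _ ⟨h1, h2.trans (min_le_right _ _)⟩]
        exact hj
  · rintro (⟨h1, h2⟩ | ⟨r, _, h1, h2⟩)
    · exact (hm (IsClockPath.ringTime_le h1)).trans h2
    · exact (hm (IsClockPath.ringTime_le h1)).trans h2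

end Clocks

end Paths

end InhomASEP

/-! ### Measurability of the process with respect to the clocks. -/

namespace InhomASEP

section Adapted

open scoped Matrix

variable {N : ℕ} [NeZero N] {Ω : Type*}

open Classical in
/-- One step of the graphical construction, given which right and left clocks ring. -/
def ringStep (b : (ZMod N → Prop) × (ZMod N → Prop)) (σ : State N) : State N :=
  if hR : ∃ x, b.1 x then jumpRight hR.choose σ
  else if hL : ∃ x, b.2 x then jumpLeft hL.choose σ else σ

theorem stateAfter_succ (QL QR : ℝ≥0 → ZMod N → ℕ) (A : Finset (ZMod N)) (n : ℕ) :
    stateAfter QL QR A (n + 1) = ringStep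
      (fun x => QR (ringTime QL QR n) x < QR (ringTime QL QR (n + 1)) x,
        fun x => QL (ringTime QL QR n) x < QL (ringTime QL QR (n + 1)) x) (stateAfter QL QR A n) := by
  rw [stateAfter, ringStep]
  split_ifs <;> rfl

variable {QL QR : Ω → ℝ≥0 → ZMod N → ℕ} {ℱ : MeasurableSpace Ω} {t : ℝ≥0}

theorem measurable_totalRings (hL : ∀ s ≤ t, ∀ x, Measurable[ℱ] fun ω => QL ω s x)
    (hR : ∀ s ≤ t, ∀ x, Measurable[ℱ] fun ω => QR ω s x) {s : ℝ≥0} (hs : s ≤ t) :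
    Measurable[ℱ] fun ω => totalRings (QL ω) (QR ω) s :=
  Finset.measurable_fun_sum _ fun x _ => (hL s hs x).add (hR s hs x)

theorem measurableSet_ringTime_count_le (hp : ∀ ω, IsClockPath (QL ω) (QR ω))
    (hL : ∀ s ≤ t, ∀ x, Measurable[ℱ] fun ω => QL ω s x)
    (hR : ∀ s ≤ t, ∀ x, Measurable[ℱ] fun ω => QR ω s x) {q : Ω → ℝ≥0 → ℕ}
    (hq : ∀ ω, q ω ∈ Set.range (fun x s => QL ω s x) ∪ Set.range (fun x s => QR ω s x))
    (hqm : ∀ s ≤ t, Measurable[ℱ] fun ω => q ω s) (n j : ℕ) :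
    MeasurableSet[ℱ] {ω | n ≤ totalRings (QL ω) (QR ω) t
      ∧ q ω (ringTime (QL ω) (QR ω) n) ≤ j} := by
  have hV := fun (s : ℝ≥0) (hs : s ≤ t) => measurable_totalRings hL hR hs
  have h1 : ∀ s ≤ t, MeasurableSet[ℱ] {ω | n ≤ totalRings (QL ω) (QR ω) s ∧ q ω s ≤ j} :=
    fun s hs => ((hV s hs) (measurableSet_Ici (a := n))).inter
      ((hqm s hs) (measurableSet_Iic (a := j)))
  have h2 : ∀ r : ℚ, MeasurableSet[ℱ] {ω | Real.toNNReal r ≤ t ∧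
      n ≤ totalRings (QL ω) (QR ω) (Real.toNNReal r) ∧ q ω (Real.toNNReal r) ≤ j} := by
    intro r
    by_cases hr : Real.toNNReal r ≤ t
    · simpa only [hr, true_and] using h1 _ hr
    · simp only [hr, false_and, Set.ofPred_false, MeasurableSet.empty]
  have e : {ω | n ≤ totalRings (QL ω) (QR ω) t ∧ q ω (ringTime (QL ω) (QR ω) n) ≤ j}
      = {ω | n ≤ totalRings (QL ω) (QR ω) t} ∩
        ({ω | n ≤ totalRings (QL ω) (QR ω) t ∧ q ω t ≤ j} ∪ ⋃ r : ℚ, {ω | Real.toNNReal r ≤ t ∧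
      n ≤ totalRings (QL ω) (QR ω) (Real.toNNReal r) ∧ q ω (Real.toNNReal r) ≤ j}) := by
    ext ω
    simp only [Set.mem_inter_iff, Set.mem_union, Set.mem_iUnion, Set.mem_ofPred_eq]
    exact and_congr_right fun hn => (hp ω).ringTime_count_le_iff hn (hq ω) j
  rw [e]
  exact ((hV t le_rfl) (measurableSet_Ici (a := n))).inter
    ((h1 t le_rfl).union (MeasurableSet.iUnion h2))

/-- A strict inequality between two integer counts means that some threshold `j` separates them, so
the event is a countable combination of the preceding ones. -/
theorem measurableSet_ring (hp : ∀ ω, IsClockPath (QL ω) (QR ω))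
    (hL : ∀ s ≤ t, ∀ x, Measurable[ℱ] fun ω => QL ω s x)
    (hR : ∀ s ≤ t, ∀ x, Measurable[ℱ] fun ω => QR ω s x) {q : Ω → ℝ≥0 → ℕ}
    (hq : ∀ ω, q ω ∈ Set.range (fun x s => QL ω s x) ∪ Set.range (fun x s => QR ω s x))
    (hqm : ∀ s ≤ t, Measurable[ℱ] fun ω => q ω s) (n : ℕ) :
    MeasurableSet[ℱ] {ω | n + 1 ≤ totalRings (QL ω) (QR ω) t
      ∧ q ω (ringTime (QL ω) (QR ω) n) < q ω (ringTime (QL ω) (QR ω) (n + 1))} := by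
  have h := measurableSet_ringTime_count_le hp hL hR hq hqm
  have e : {ω | n + 1 ≤ totalRings (QL ω) (QR ω) t
      ∧ q ω (ringTime (QL ω) (QR ω) n) < q ω (ringTime (QL ω) (QR ω) (n + 1))}
      = {ω | n + 1 ≤ totalRings (QL ω) (QR ω) t} ∩ ⋃ j, {ω | n ≤ totalRings (QL ω) (QR ω) t
          ∧ q ω (ringTime (QL ω) (QR ω) n) ≤ j} \ {ω | n + 1 ≤ totalRings (QL ω) (QR ω) t
          ∧ q ω (ringTime (QL ω) (QR ω) (n + 1)) ≤ j} := by
    ext ω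
    simp only [Set.mem_inter_iff, Set.mem_iUnion, Set.mem_ofPred_eq, Set.mem_sdiff]
    refine and_congr_right fun hn => ⟨fun hlt => ⟨_, ⟨by omega, le_rfl⟩, fun h => ?_⟩, ?_⟩
    · omega
    · rintro ⟨j, h1, h2⟩
      by_contra hcon
      exact h2 ⟨hn, by omega⟩
  rw [e]
  exact ((measurable_totalRings hL hR le_rfl) (measurableSet_Ici (a := n + 1))).inter
    (MeasurableSet.iUnion fun j => (h n j).diff (h (n + 1) j))

/-- The process is adapted to the clocks. -/
theorem measurableSet_asep (hp : ∀ ω, IsClockPath (QL ω) (QR ω))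
    (hL : ∀ s ≤ t, ∀ x, Measurable[ℱ] fun ω => QL ω s x)
    (hR : ∀ s ≤ t, ∀ x, Measurable[ℱ] fun ω => QR ω s x) (A : Finset (ZMod N))
    (S : Set (State N)) : MeasurableSet[ℱ] {ω | asep (QL ω) (QR ω) A t ∈ S} := by
  have hV := measurable_totalRings hL hR le_rfl
  have hRr := fun x n => measurableSet_ring hp hL hR (q := fun ω s => QR ω s x)
    (fun ω => Or.inr ⟨x, rfl⟩) (fun s hs => hR s hs x) n
  have hLr := fun x n => measurableSet_ring hp hL hR (q := fun ω s => QL ω s x)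
    (fun ω => Or.inl ⟨x, rfl⟩) (fun s hs => hL s hs x) n
  -- Restricting to `n ≤ totalRings` places the `n`-th ring time before `t`. The induction needs
  -- arbitrary `S`, because one step replaces `S` by its preimage under `ringStep b`, where `b`
  -- ranges over a finite type.
  have key : ∀ (n : ℕ) (S : Set (State N)), MeasurableSet[ℱ] {ω | n ≤ totalRings (QL ω) (QR ω) t
      ∧ stateAfter (QL ω) (QR ω) A n ∈ S} := by
    intro n
    induction n with
    | zero =>
      intro S
      by_cases h : initialState A ∈ S <;> simp [stateAfter, h]
    | succ n ih =>
      intro S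
      have hbit : ∀ (q : ZMod N → Ω → ℝ≥0 → ℕ), (∀ x, MeasurableSet[ℱ]
          {ω | n + 1 ≤ totalRings (QL ω) (QR ω) t ∧ q x ω (ringTime (QL ω) (QR ω) n)
            < q x ω (ringTime (QL ω) (QR ω) (n + 1))}) → ∀ b : ZMod N → Prop,
          MeasurableSet[ℱ] {ω | n + 1 ≤ totalRings (QL ω) (QR ω) t ∧
            (fun x => q x ω (ringTime (QL ω) (QR ω) n)
              < q x ω (ringTime (QL ω) (QR ω) (n + 1))) = b} := by
        intro q hq b
        have e : {ω | n + 1 ≤ totalRings (QL ω) (QR ω) t ∧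
            (fun x => q x ω (ringTime (QL ω) (QR ω) n)
              < q x ω (ringTime (QL ω) (QR ω) (n + 1))) = b}
            = {ω | n + 1 ≤ totalRings (QL ω) (QR ω) t} ∩ ⋂ x, {ω | ω ∈ {ω | n + 1 ≤
              totalRings (QL ω) (QR ω) t ∧ q x ω (ringTime (QL ω) (QR ω) n)
                < q x ω (ringTime (QL ω) (QR ω) (n + 1))} ↔ b x} := by
          ext ω
          simp only [Set.mem_inter_iff, Set.mem_iInter, Set.mem_ofPred_eq, funext_iff, eq_iff_iff]
          exact and_congr_right fun hn => forall_congr' fun x => by simp [hn]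
        rw [e]
        refine (hV (measurableSet_Ici (a := n + 1))).inter (MeasurableSet.iInter fun x => ?_)
        by_cases hx : b x
        · convert hq x using 1
          ext ω
          simp [hx]
        · convert (hq x).compl using 1
          ext ω
          simp [hx]
      have e : {ω | n + 1 ≤ totalRings (QL ω) (QR ω) t
          ∧ stateAfter (QL ω) (QR ω) A (n + 1) ∈ S}
          = ⋃ b : (ZMod N → Prop) × (ZMod N → Prop),
            ({ω | n + 1 ≤ totalRings (QL ω) (QR ω) t ∧
              (fun x => QR ω (ringTime (QL ω) (QR ω) n) x
                < QR ω (ringTime (QL ω) (QR ω) (n + 1)) x) = b.1}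
            ∩ {ω | n + 1 ≤ totalRings (QL ω) (QR ω) t ∧
              (fun x => QL ω (ringTime (QL ω) (QR ω) n) x
                < QL ω (ringTime (QL ω) (QR ω) (n + 1)) x) = b.2})
            ∩ {ω | n ≤ totalRings (QL ω) (QR ω) t
              ∧ stateAfter (QL ω) (QR ω) A n ∈ ringStep b ⁻¹' S} := by
        ext ω
        simp only [Set.mem_iUnion, Set.mem_inter_iff, Set.mem_ofPred_eq, Set.mem_preimage]
        constructor
        · rintro ⟨hn, hs⟩
          rw [stateAfter_succ] at hs
          exact ⟨(_, _), ⟨⟨hn, rfl⟩, hn, rfl⟩, by omega, hs⟩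
        · rintro ⟨⟨b1, b2⟩, ⟨⟨hn, h1⟩, _, h2⟩, _, hs⟩
          refine ⟨hn, ?_⟩
          rw [stateAfter_succ, h1, h2]
          exact hs
      rw [e]
      exact MeasurableSet.iUnion fun b =>
        ((hbit (fun x ω s => QR ω s x) (fun x => hRr x n) b.1).inter
          (hbit (fun x ω s => QL ω s x) (fun x => hLr x n) b.2)).inter (ih _)
  have e : {ω | asep (QL ω) (QR ω) A t ∈ S} = ⋃ n, {ω | totalRings (QL ω) (QR ω) t = n}
      ∩ {ω | n ≤ totalRings (QL ω) (QR ω) t ∧ stateAfter (QL ω) (QR ω) A n ∈ S} := by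
    ext ω
    simp only [Set.mem_iUnion, Set.mem_inter_iff, Set.mem_ofPred_eq, asep]
    constructor
    · exact fun h => ⟨_, rfl, le_rfl, h⟩
    · rintro ⟨n, rfl, _, h⟩
      exact h
  rw [e]
  exact MeasurableSet.iUnion fun n => (hV (measurableSet_singleton n)).inter (key n S)

theorem measurable_stateVec (hp : ∀ ω, IsClockPath (QL ω) (QR ω))
    (hL : ∀ s ≤ t, ∀ x, Measurable[ℱ] fun ω => QL ω s x)
    (hR : ∀ s ≤ t, ∀ x, Measurable[ℱ] fun ω => QR ω s x) (A : Finset (ZMod N))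
    (B : HalfFilled N) : Measurable[ℱ] fun ω => stateVec (asep (QL ω) (QR ω) A t) B :=
  fun S _ => measurableSet_asep hp hL hR A {σ | stateVec σ B ∈ S}

end Adapted

/-! ### The filtration of the environment and the clocks. -/

section Filtration

variable {N : ℕ} [NeZero N] {Ω : Type*} [MeasurableSpace Ω] {μ : Measure Ω}
  {a : Ω → ZMod N → ℝ} {QL QR : Ω → ℝ≥0 → ZMod N → ℕ}

theorem envSigma_le_clockSigma (t : ℝ≥0) : envSigma a ≤ clockSigma a QL QR t :=
  le_sup_left

theorem measurable_left_clockSigma {s t : ℝ≥0} (hs : s ≤ t) (x : ZMod N) :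
    Measurable[clockSigma a QL QR t] fun ω => QL ω s x := by
  have h : MeasurableSpace.comap (fun ω => QL ω s x) ⊤ ≤ clockSigma a QL QR t :=
    (le_sup_left.trans ((le_iSup (fun x => MeasurableSpace.comap (fun ω => QL ω s x) ⊤ ⊔
      MeasurableSpace.comap (fun ω => QR ω s x) ⊤) x).trans (le_iSup (fun r : Set.Iic t => ⨆ x,
      (MeasurableSpace.comap (fun ω => QL ω r x) ⊤ ⊔ MeasurableSpace.comap (fun ω => QR ω r x) ⊤))
      ⟨s, hs⟩))).trans le_sup_right
  exact Measurable.mono (comap_measurable _) h le_top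

theorem measurable_right_clockSigma {s t : ℝ≥0} (hs : s ≤ t) (x : ZMod N) :
    Measurable[clockSigma a QL QR t] fun ω => QR ω s x := by
  have h : MeasurableSpace.comap (fun ω => QR ω s x) ⊤ ≤ clockSigma a QL QR t :=
    (le_sup_right.trans ((le_iSup (fun x => MeasurableSpace.comap (fun ω => QL ω s x) ⊤ ⊔
      MeasurableSpace.comap (fun ω => QR ω s x) ⊤) x).trans (le_iSup (fun r : Set.Iic t => ⨆ x,
      (MeasurableSpace.comap (fun ω => QL ω r x) ⊤ ⊔ MeasurableSpace.comap (fun ω => QR ω r x) ⊤))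
      ⟨s, hs⟩))).trans le_sup_right
  exact Measurable.mono (comap_measurable _) h le_top

theorem clockSigma_mono {s t : ℝ≥0} (hst : s ≤ t) :
    clockSigma a QL QR s ≤ clockSigma a QL QR t :=
  sup_le_sup le_rfl (iSup_le fun r => le_iSup_of_le ⟨r.1, r.2.out.trans hst⟩ le_rfl)

theorem measurable_env_envSigma : Measurable[envSigma a] a := by
  refine @measurable_pi_lambda _ _ _ (envSigma a) _ _ fun x => ?_
  have h : MeasurableSpace.comap (fun ω => a ω x - 1) inferInstance ≤ envSigma a :=
    le_iSup (fun x => MeasurableSpace.comap (fun ω => a ω x - 1) inferInstance) x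
  have h1 : Measurable[envSigma a] fun ω => a ω x - 1 := Measurable.mono (comap_measurable _) h le_rfl
  have h2 : Measurable[envSigma a] fun ω => (a ω x - 1) + 1 := Measurable.add_const h1 1
  simpa only [sub_add_cancel] using h2

theorem IsClockSystem.clockSigma_le (h : IsClockSystem μ a QL QR) (t : ℝ≥0) :
    clockSigma a QL QR t ≤ ‹MeasurableSpace Ω› := by
  refine sup_le (iSup_le fun x => ?_) (iSup_le fun s => iSup_le fun x => sup_le ?_ ?_)
  · exact ((h.measurable_env x).sub_const 1).comap_le
  · exact (h.measurable_left s x).comap_le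
  · exact (h.measurable_right s x).comap_le

theorem IsClockSystem.isClockPath (h : IsClockSystem μ a QL QR) (ω : Ω) :
    IsClockPath (QL ω) (QR ω) :=
  ⟨h.left_zero ω, h.right_zero ω, h.left_mono ω, h.right_mono ω, h.left_rightCont ω,
    h.right_rightCont ω⟩

end Filtration

end InhomASEP

/-! ## Generating function of the number of rings -/

namespace InhomASEP

open scoped ENNReal

/-- The defining property of conditional probability, extended from indicators to nonnegative
measurable `c` by monotone approximation. No integrability of `c` is required, as exponential
moments of the rings are not yet known to be finite. -/
theorem setLIntegral_eq_lintegral_mul_condExp {Ω : Type*} {m m₀ : MeasurableSpace Ω}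
    {μ : Measure Ω} [IsProbabilityMeasure μ] (hm : m ≤ m₀) {E : Set Ω} (hE : MeasurableSet E)
    {p : Ω → ℝ} (hp : μ[E.indicator (fun _ => (1 : ℝ)) | m] =ᵐ[μ] p) (hpm : Measurable p)
    {c : Ω → ℝ≥0∞} (hc : Measurable[m] c) :
    ∫⁻ ω in E, c ω ∂μ = ∫⁻ ω, c ω * ENNReal.ofReal (p ω) ∂μ := by
  have hint : Integrable (E.indicator (fun _ => (1 : ℝ))) μ :=
    (integrable_const 1).indicator hE
  refine hc.ennreal_induction (mα := m) (motive := fun c => ∫⁻ ω in E, c ω ∂μ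
    = ∫⁻ ω, c ω * ENNReal.ofReal (p ω) ∂μ) ?_ ?_ ?_
  · intro d B hB
    have hB' := hm _ hB
    have h1 : ∫ ω in B, p ω ∂μ = μ.real (E ∩ B) := by
      rw [← setIntegral_congr_ae hB' (hp.mono fun ω h _ => h), setIntegral_condExp hm hint hB,
        integral_indicator_const _ hE, smul_eq_mul, mul_one, measureReal_restrict_apply hE]
    have h2 : 0 ≤ᵐ[μ.restrict B] p := by
      refine ae_restrict_of_ae ?_
      have := condExp_nonneg (m := m) (μ := μ) (f := E.indicator (fun _ => (1 : ℝ)))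
        (ae_of_all _ fun ω => Set.indicator_nonneg (fun _ _ => zero_le_one) ω)
      exact this.trans hp.le
    have h3 : Integrable p (μ.restrict B) := (integrable_condExp.congr hp).restrict
    rw [lintegral_indicator_const hB', Measure.restrict_apply hB']
    have h4 : (fun ω => B.indicator (fun _ => d) ω * ENNReal.ofReal (p ω))
        = B.indicator fun ω => d * ENNReal.ofReal (p ω) := by
      ext ω
      by_cases h : ω ∈ B <;> simp [h]
    rw [h4, lintegral_indicator hB', lintegral_const_mul _ hpm.ennreal_ofReal,
      ← ofReal_integral_eq_lintegral_ofReal h3 h2, h1, Measure.real,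
      ENNReal.ofReal_toReal (measure_ne_top _ _), Set.inter_comm]
  · intro f g _ hf hg h1 h2
    simp only [Pi.add_apply, add_mul]
    rw [lintegral_add_left (hf.mono hm le_rfl), h1, h2,
      lintegral_add_left ((hf.mono hm le_rfl).fun_mul hpm.ennreal_ofReal)]
  · intro f hf hmono h
    have hf' := fun n => (hf n).mono hm le_rfl
    simp only [ENNReal.iSup_mul]
    rw [lintegral_iSup hf' hmono, lintegral_iSup (fun n => (hf' n).fun_mul hpm.ennreal_ofReal)
      fun i j hij ω => mul_le_mul_left (hmono hij ω) _]
    simp only [h]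

theorem sum_poissonWeight_le {m ζ : ℝ} (hm : 0 ≤ m) (hζ : 0 ≤ ζ) (M : ℕ) :
    ∑ i ∈ Finset.range M, ζ ^ i * poissonWeight m i ≤ Real.exp (m * ζ) := by
  refine le_trans (Finset.sum_le_sum fun i _ => ?_)
    (Real.sum_le_exp_of_nonneg (mul_nonneg hm hζ) M)
  have h1 : Real.exp (-m) ≤ 1 := Real.exp_le_one_iff.2 (by linarith)
  have h2 : 0 ≤ (m * ζ) ^ i / (i ! : ℝ) := by positivity
  calc ζ ^ i * poissonWeight m i = Real.exp (-m) * ((m * ζ) ^ i / (i ! : ℝ)) := by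
        rw [poissonWeight, mul_pow]; ring
    _ ≤ _ := mul_le_of_le_one_left h2 h1

theorem poissonWeight_nonneg {m : ℝ} (hm : 0 ≤ m) (i : ℕ) : 0 ≤ poissonWeight m i := by
  unfold poissonWeight
  positivity

section Rings

variable {N : ℕ} [NeZero N]

/-- The Poisson generating function factorises over sites and clocks. Dropping the factors `e^(-m)`
costs nothing that matters, and the two rates at a site sum to `b x`. -/
theorem sum_prod_poissonWeight_le (hN : 2 ≤ N) {b : ZMod N → ℝ} (hb : ∀ x, 0 ≤ b x) {h ζ c : ℝ}
    (hbc : ∀ x, b x ≤ c) (hh : 0 ≤ h) (hζ : 0 ≤ ζ) (S : Finset (ZMod N → ℕ × ℕ)) :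
    ∑ p ∈ S, ζ ^ (∑ x, ((p x).1 + (p x).2)) * ∏ x, (poissonWeight (rateL N * b x * h) (p x).1 *
      poissonWeight (rateR N * b x * h) (p x).2) ≤ Real.exp (N * c * h * ζ) := by
  have hl := (rateL_pos hN).le
  have hr := (rateR_pos hN).le
  have h1 : ∀ x, 0 ≤ rateL N * b x * h := fun x => mul_nonneg (mul_nonneg hl (hb x)) hh
  have h2 : ∀ x, 0 ≤ rateR N * b x * h := fun x => mul_nonneg (mul_nonneg hr (hb x)) hh
  set g : ZMod N → ℕ × ℕ → ℝ := fun x q => (ζ ^ q.1 * poissonWeight (rateL N * b x * h) q.1)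
    * (ζ ^ q.2 * poissonWeight (rateR N * b x * h) q.2) with hg
  have hg0 : ∀ x q, 0 ≤ g x q := fun x q => mul_nonneg
    (mul_nonneg (by positivity) (poissonWeight_nonneg (h1 x) _))
    (mul_nonneg (by positivity) (poissonWeight_nonneg (h2 x) _))
  -- The finite set is enlarged to a full box, over which the sum of products becomes a product of
  -- sums.
  obtain ⟨M, hM⟩ : ∃ M, ∀ p ∈ S, ∀ x, (p x).1 < M ∧ (p x).2 < M := by
    refine ⟨(S.sup fun p => Finset.univ.sup fun x => max (p x).1 (p x).2) + 1, fun p hp x => ?_⟩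
    have h3 := Finset.le_sup (f := fun p : ZMod N → ℕ × ℕ =>
      Finset.univ.sup fun x => max (p x).1 (p x).2) hp
    have h4 := Finset.le_sup (f := fun x => max (p x).1 (p x).2) (Finset.mem_univ x)
    constructor <;> omega
  calc ∑ p ∈ S, ζ ^ (∑ x, ((p x).1 + (p x).2)) * ∏ x, (poissonWeight (rateL N * b x * h) (p x).1 *
        poissonWeight (rateR N * b x * h) (p x).2)
      = ∑ p ∈ S, ∏ x, g x (p x) := by
        refine Finset.sum_congr rfl fun p _ => ?_
        rw [← Finset.prod_pow_eq_pow_sum, ← Finset.prod_mul_distrib]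
        refine Finset.prod_congr rfl fun x _ => ?_
        rw [hg, pow_add]
        ring
    _ ≤ ∑ p ∈ Fintype.piFinset fun _ : ZMod N => Finset.range M ×ˢ Finset.range M,
          ∏ x, g x (p x) := by
        refine Finset.sum_le_sum_of_subset_of_nonneg (fun p hp => ?_)
          fun p _ _ => Finset.prod_nonneg fun x _ => hg0 x _
        rw [Fintype.mem_piFinset]
        exact fun x => Finset.mem_product.2 ⟨Finset.mem_range.2 (hM p hp x).1,
          Finset.mem_range.2 (hM p hp x).2⟩
    _ = ∏ x, ∑ q ∈ Finset.range M ×ˢ Finset.range M, g x q :=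
        (Finset.prod_univ_sum (fun _ : ZMod N => Finset.range M ×ˢ Finset.range M) g).symm
    _ ≤ ∏ _x : ZMod N, Real.exp (c * h * ζ) := by
        refine Finset.prod_le_prod (fun x _ => Finset.sum_nonneg fun q _ => hg0 x q) fun x _ => ?_
        have e : ∑ q ∈ Finset.range M ×ˢ Finset.range M, g x q
            = (∑ i ∈ Finset.range M, ζ ^ i * poissonWeight (rateL N * b x * h) i)
              * ∑ j ∈ Finset.range M, ζ ^ j * poissonWeight (rateR N * b x * h) j := by
          rw [Finset.sum_mul_sum, Finset.sum_product]
        rw [e]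
        refine (mul_le_mul (sum_poissonWeight_le (h1 x) hζ M) (sum_poissonWeight_le (h2 x) hζ M)
          (Finset.sum_nonneg fun i _ => mul_nonneg (by positivity) (poissonWeight_nonneg (h2 x) i))
          (Real.exp_pos _).le).trans ?_
        rw [← Real.exp_add, ← add_mul, ← add_mul, ← add_mul, add_comm (rateL N),
          rateR_add_rateL, one_mul]
        have := hbc x
        gcongr
    _ = _ := by
        rw [Finset.prod_const, Finset.card_univ, ZMod.card, ← Real.exp_nat_mul]
        ring_nf

variable {Ω : Type*} [MeasurableSpace Ω] {μ : Measure Ω} [IsProbabilityMeasure μ]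
  {a : Ω → ZMod N → ℝ} {QL QR : Ω → ℝ≥0 → ZMod N → ℕ}

/-- The event that the clocks ring prescribed numbers of times between `s` and `t`. -/
def ringBox (QL QR : Ω → ℝ≥0 → ZMod N → ℕ) (s t : ℝ≥0) (k l : ZMod N → ℕ) : Set Ω :=
  {ω | ∀ x, QL ω t x = QL ω s x + k x ∧ QR ω t x = QR ω s x + l x}

/-- The conditional probability of `ringBox`. -/
def boxWeight (b : ZMod N → ℝ) (h : ℝ) (k l : ZMod N → ℕ) : ℝ :=
  ∏ x, (poissonWeight (rateL N * b x * h) (k x) * poissonWeight (rateR N * b x * h) (l x))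

theorem continuous_boxWeight (h : ℝ) (k l : ZMod N → ℕ) :
    Continuous fun b : ZMod N → ℝ => boxWeight b h k l := by
  unfold boxWeight poissonWeight
  fun_prop

theorem IsClockSystem.measurableSet_ringBox (h : IsClockSystem μ a QL QR) (s t : ℝ≥0)
    (k l : ZMod N → ℕ) : MeasurableSet (ringBox QL QR s t k l) := by
  have e : ringBox QL QR s t k l = ⋂ x, ({ω | QL ω t x = QL ω s x + k x}
      ∩ {ω | QR ω t x = QR ω s x + l x}) := by
    ext ω
    simp [ringBox]
  rw [e]
  exact MeasurableSet.iInter fun x =>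
    (measurableSet_eq_fun (h.measurable_left t x) ((h.measurable_left s x).add_const _)).inter
      (measurableSet_eq_fun (h.measurable_right t x) ((h.measurable_right s x).add_const _))

theorem IsClockSystem.measurable_boxWeight (h : IsClockSystem μ a QL QR) (r : ℝ)
    (k l : ZMod N → ℕ) : Measurable fun ω => boxWeight (a ω) r k l :=
  (continuous_boxWeight r k l).measurable.comp (measurable_pi_lambda _ h.measurable_env)

theorem IsClockSystem.setLIntegral_ringBox (h : IsClockSystem μ a QL QR) {s t : ℝ≥0} (hst : s ≤ t)
    (k l : ZMod N → ℕ) {c : Ω → ℝ≥0∞} (hc : Measurable[clockSigma a QL QR s] c) :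
    ∫⁻ ω in ringBox QL QR s t k l, c ω ∂μ
      = ∫⁻ ω, c ω * ENNReal.ofReal (boxWeight (a ω) ((t : ℝ) - s) k l) ∂μ :=
  setLIntegral_eq_lintegral_mul_condExp (h.clockSigma_le s) (h.measurableSet_ringBox s t k l)
    (h.increments s t hst k l) (h.measurable_boxWeight _ k l) hc

/-- Exponential moments of the number of rings. -/
theorem IsClockSystem.lintegral_pow_rings_le (hN : 2 ≤ N) (h : IsClockSystem μ a QL QR) {b : ℝ}
    (ha : ∀ᵐ ω ∂μ, ∀ x, 0 ≤ a ω x ∧ a ω x ≤ b) {s t : ℝ≥0} (hst : s ≤ t) {ζ : ℝ} (hζ : 0 ≤ ζ)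
    {c : Ω → ℝ≥0∞} (hc : Measurable[clockSigma a QL QR s] c) :
    ∫⁻ ω, c ω * ENNReal.ofReal
        (ζ ^ (totalRings (QL ω) (QR ω) t - totalRings (QL ω) (QR ω) s)) ∂μ
      ≤ ENNReal.ofReal (Real.exp (N * b * ((t : ℝ) - s) * ζ)) * ∫⁻ ω, c ω ∂μ := by
  have hcm : Measurable c := hc.mono (h.clockSigma_le s) le_rfl
  set box : (ZMod N → ℕ × ℕ) → Set Ω := fun p =>
    ringBox QL QR s t (fun x => (p x).1) (fun x => (p x).2) with hbox
  set ex : (ZMod N → ℕ × ℕ) → ℕ := fun p => ∑ x, ((p x).1 + (p x).2) with hex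
  -- The increments of the counts partition the probability space into countably many boxes, with
  -- conditional probabilities given by the Poisson weights.
  have hdisj : Pairwise (Function.onFun Disjoint box) := by
    intro p q hpq
    refine Set.disjoint_left.2 fun ω hp hq => hpq ?_
    ext x
    · have h1 := (hp x).1
      have h2 := (hq x).1
      simp only at h1 h2
      omega
    · have h1 := (hp x).2
      have h2 := (hq x).2
      simp only at h1 h2
      omega
  have huniv : ⋃ p, box p = Set.univ := by
    refine Set.eq_univ_of_forall fun ω => Set.mem_iUnion.2
      ⟨fun x => (QL ω t x - QL ω s x, QR ω t x - QR ω s x), fun x => ?_⟩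
    have h1 : QL ω s x ≤ QL ω t x := h.left_mono ω x hst
    have h2 : QR ω s x ≤ QR ω t x := h.right_mono ω x hst
    simp only
    omega
  rw [← setLIntegral_univ, ← huniv, lintegral_iUnion
    (fun p => h.measurableSet_ringBox s t _ _) hdisj, ENNReal.tsum_eq_iSup_sum]
  refine iSup_le fun S => ?_
  have e1 : ∀ p, ∫⁻ ω in box p, c ω * ENNReal.ofReal
      (ζ ^ (totalRings (QL ω) (QR ω) t - totalRings (QL ω) (QR ω) s)) ∂μ
      = ∫⁻ ω, c ω * (ENNReal.ofReal (ζ ^ ex p) * ENNReal.ofReal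
        (boxWeight (a ω) ((t : ℝ) - s) (fun x => (p x).1) (fun x => (p x).2))) ∂μ := by
    intro p
    calc _ = ∫⁻ ω in box p, ENNReal.ofReal (ζ ^ ex p) * c ω ∂μ := by
          refine setLIntegral_congr_fun (h.measurableSet_ringBox s t _ _) fun ω hω => ?_
          rw [totalRings_add hω, Nat.add_sub_cancel_left, mul_comm]
      _ = _ := by
          rw [lintegral_const_mul _ hcm, h.setLIntegral_ringBox hst _ _ hc,
            ← lintegral_const_mul' _ _ ENNReal.ofReal_ne_top]
          refine lintegral_congr fun ω => ?_
          ring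
  rw [Finset.sum_congr rfl fun p _ => e1 p, ← lintegral_finsetSum _ fun p _ => hcm.fun_mul
    ((h.measurable_boxWeight _ _ _).ennreal_ofReal.const_mul _), ← lintegral_const_mul _ hcm]
  refine lintegral_mono_ae (ha.mono fun ω hω => ?_)
  rw [← Finset.mul_sum, mul_comm]
  refine mul_le_mul_left ?_ _
  have hst' : 0 ≤ (t : ℝ) - s := sub_nonneg.2 (by exact_mod_cast hst)
  have hbw : ∀ k l, 0 ≤ boxWeight (a ω) ((t : ℝ) - s) k l := fun k l =>
    Finset.prod_nonneg fun x _ => mul_nonneg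
      (poissonWeight_nonneg (mul_nonneg (mul_nonneg (rateL_pos hN).le (hω x).1) hst') _)
      (poissonWeight_nonneg (mul_nonneg (mul_nonneg (rateR_pos hN).le (hω x).1) hst') _)
  have e2 : ∀ p : ZMod N → ℕ × ℕ, ENNReal.ofReal (ζ ^ ex p) * ENNReal.ofReal
        (boxWeight (a ω) ((t : ℝ) - s) (fun x => (p x).1) (fun x => (p x).2))
      = ENNReal.ofReal (ζ ^ ex p
        * boxWeight (a ω) ((t : ℝ) - s) (fun x => (p x).1) (fun x => (p x).2)) :=
    fun p => (ENNReal.ofReal_mul (by positivity)).symm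
  simp only [e2]
  rw [← ENNReal.ofReal_sum_of_nonneg fun p _ => mul_nonneg (by positivity) (hbw _ _)]
  exact ENNReal.ofReal_le_ofReal
    (sum_prod_poissonWeight_le hN (fun x => (hω x).1) (fun x => (hω x).2) hst' hζ S)

theorem IsClockSystem.lintegral_pow_totalRings_le (hN : 2 ≤ N) (h : IsClockSystem μ a QL QR) {b : ℝ}
    (ha : ∀ᵐ ω ∂μ, ∀ x, 0 ≤ a ω x ∧ a ω x ≤ b) (t : ℝ≥0) {ζ : ℝ} (hζ : 0 ≤ ζ) :
    ∫⁻ ω, ENNReal.ofReal (ζ ^ totalRings (QL ω) (QR ω) t) ∂μ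
      ≤ ENNReal.ofReal (Real.exp (N * b * t * ζ)) := by
  have := h.lintegral_pow_rings_le hN ha (zero_le : 0 ≤ t) hζ (c := fun _ => 1) measurable_const
  simpa [(h.isClockPath _).totalRings_zero] using this

theorem IsClockSystem.measurable_totalRings (h : IsClockSystem μ a QL QR) (t : ℝ≥0) :
    Measurable fun ω => totalRings (QL ω) (QR ω) t :=
  Finset.measurable_fun_sum _ fun x _ => (h.measurable_left t x).add (h.measurable_right t x)

theorem IsClockSystem.integrable_pow_totalRings (hN : 2 ≤ N) (h : IsClockSystem μ a QL QR) {b : ℝ}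
    (ha : ∀ᵐ ω ∂μ, ∀ x, 0 ≤ a ω x ∧ a ω x ≤ b) (t : ℝ≥0) {ζ : ℝ} (hζ : 0 ≤ ζ) :
    Integrable (fun ω => ζ ^ totalRings (QL ω) (QR ω) t) μ := by
  have hm : Measurable fun ω => ζ ^ totalRings (QL ω) (QR ω) t :=
    (measurable_from_nat (f := fun n => ζ ^ n)).comp (h.measurable_totalRings t)
  refine ⟨hm.aestronglyMeasurable, ?_⟩
  rw [hasFiniteIntegral_iff_ofReal (ae_of_all _ fun ω => by positivity)]
  exact (h.lintegral_pow_totalRings_le hN ha t hζ).trans_lt ENNReal.ofReal_lt_top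

theorem IsClockSystem.integral_pow_totalRings_le (hN : 2 ≤ N) (h : IsClockSystem μ a QL QR) {b : ℝ}
    (ha : ∀ᵐ ω ∂μ, ∀ x, 0 ≤ a ω x ∧ a ω x ≤ b) (t : ℝ≥0) {ζ : ℝ} (hζ : 0 ≤ ζ) :
    ∫ ω, ζ ^ totalRings (QL ω) (QR ω) t ∂μ ≤ Real.exp (N * b * t * ζ) := by
  rw [integral_eq_lintegral_of_nonneg_ae (ae_of_all _ fun ω => by positivity)
    (h.integrable_pow_totalRings hN ha t hζ).aestronglyMeasurable]
  exact ENNReal.toReal_le_of_le_ofReal (Real.exp_pos _).le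
    (h.lintegral_pow_totalRings_le hN ha t hζ)

/-- Two or more rings in a short time are unlikely, even with exponential weights. -/
theorem IsClockSystem.setIntegral_two_rings_le (hN : 2 ≤ N) (h : IsClockSystem μ a QL QR) {b : ℝ}
    (ha : ∀ᵐ ω ∂μ, ∀ x, 0 ≤ a ω x ∧ a ω x ≤ b) {s t : ℝ≥0} (hst : s < t)
    (hst1 : (t : ℝ) - s ≤ 1) {ζ : ℝ} (hζ : 0 ≤ ζ) :
    ∫ ω in {ω | totalRings (QL ω) (QR ω) s + 2 ≤ totalRings (QL ω) (QR ω) t},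
        ζ ^ totalRings (QL ω) (QR ω) t ∂μ
      ≤ Real.exp (N * b * ζ) * Real.exp (N * b * s * ζ) * ((t : ℝ) - s) ^ 2 := by
  set r : ℝ := (t : ℝ) - s with hr
  have hr0 : 0 < r := sub_pos.2 (by exact_mod_cast hst)
  have hE : MeasurableSet {ω | totalRings (QL ω) (QR ω) s + 2 ≤ totalRings (QL ω) (QR ω) t} :=
    measurableSet_le ((h.measurable_totalRings s).add_const 2) (h.measurable_totalRings t)
  have hm : Measurable fun ω => ζ ^ totalRings (QL ω) (QR ω) t :=
    (measurable_from_nat (f := fun n => ζ ^ n)).comp (h.measurable_totalRings t)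
  have hcs : Measurable[clockSigma a QL QR s] fun ω =>
      ENNReal.ofReal (ζ ^ totalRings (QL ω) (QR ω) s) :=
    (measurable_from_nat (f := fun n => ENNReal.ofReal (ζ ^ n))).comp
      (InhomASEP.measurable_totalRings (fun s hs x => measurable_left_clockSigma hs x)
        (fun s hs x => measurable_right_clockSigma hs x) le_rfl)
  rw [integral_eq_lintegral_of_nonneg_ae (ae_of_all _ fun ω => by positivity)
    hm.aestronglyMeasurable]
  refine ENNReal.toReal_le_of_le_ofReal (by positivity) ?_
  -- The trick is the base `ζ/r` with `r = t - s ≤ 1`: on at least two new rings `(ζ/r)^j ≥ ζ^j /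
  -- r²`, while the exponential moment stays bounded because the rate times `r · (ζ/r)` does not
  -- depend on `r`.
  have hg := h.lintegral_pow_rings_le hN ha hst.le (div_nonneg hζ hr0.le) hcs
  calc _ ≤ ∫⁻ ω, ENNReal.ofReal (r ^ 2) * (ENNReal.ofReal (ζ ^ totalRings (QL ω) (QR ω) s)
        * ENNReal.ofReal ((ζ / r) ^
          (totalRings (QL ω) (QR ω) t - totalRings (QL ω) (QR ω) s))) ∂μ := by
        rw [← lintegral_indicator hE]
        refine lintegral_mono fun ω => ?_
        by_cases hω : ω ∈ {ω | totalRings (QL ω) (QR ω) s + 2 ≤ totalRings (QL ω) (QR ω) t}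
        · rw [Set.indicator_of_mem hω, ← ENNReal.ofReal_mul (by positivity),
            ← ENNReal.ofReal_mul (by positivity)]
          refine ENNReal.ofReal_le_ofReal ?_
          obtain ⟨j, hj⟩ := Nat.exists_eq_add_of_le hω.out
          rw [hj, show totalRings (QL ω) (QR ω) s + 2 + j - totalRings (QL ω) (QR ω) s = 2 + j by
            omega, add_assoc, pow_add ζ, div_pow]
          have h1 : r ^ (2 + j) ≤ r ^ 2 := pow_le_pow_of_le_one hr0.le hst1 (by omega)
          have h2 : 0 ≤ ζ ^ totalRings (QL ω) (QR ω) s * ζ ^ (2 + j) := by positivity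
          rw [← mul_div_assoc, ← mul_div_assoc, le_div_iff₀ (by positivity)]
          nlinarith
        · rw [Set.indicator_of_notMem hω]
          exact zero_le
    _ ≤ ENNReal.ofReal (r ^ 2) * (ENNReal.ofReal (Real.exp (N * b * r * (ζ / r)))
          * ENNReal.ofReal (Real.exp (N * b * s * ζ))) := by
        rw [lintegral_const_mul']
        · exact mul_le_mul_right (hg.trans (mul_le_mul_right
            (h.lintegral_pow_totalRings_le hN ha s hζ) _)) _
        · exact ENNReal.ofReal_ne_top
    _ = _ := by
        rw [← ENNReal.ofReal_mul (by positivity), ← ENNReal.ofReal_mul (by positivity),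
          mul_assoc (N * b) r, mul_div_cancel₀ _ hr0.ne']
        congr 1
        ring

end Rings

end InhomASEP

/-! ## The semigroup as a function of the environment -/

namespace InhomASEP

section Evolution

open scoped Matrix Matrix.Norms.Operator

variable {N : ℕ} [NeZero N]

/-- The semigroup generated by `generator b` applied to `f`. -/
def evol (b : ZMod N → ℝ) (t : ℝ) (f : HalfFilled N → ℝ) : HalfFilled N → ℝ :=
  NormedSpace.exp (t • generator b) *ᵥ f

theorem continuous_jumpMatrix : Continuous fun b : ZMod N → ℝ => jumpMatrix b := by
  refine continuous_matrix fun A B => ?_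
  simp only [jumpMatrix, Matrix.of_apply]
  fun_prop

theorem continuous_generator : Continuous fun b : ZMod N → ℝ => generator b := by
  refine continuous_matrix fun A B => ?_
  simp only [generator, Matrix.add_apply, Matrix.smul_apply, smul_eq_mul]
  have := (continuous_jumpMatrix (N := N)).matrix_elem A B
  fun_prop

/-- Joint continuity serves twice: it gives measurability in the random environment, and bounds
uniform over the compact set of admissible environments and times. -/
theorem continuous_evol (f : HalfFilled N → ℝ) :
    Continuous fun p : (ZMod N → ℝ) × ℝ => evol p.1 p.2 f := by
  have h1 : Continuous fun p : (ZMod N → ℝ) × ℝ => NormedSpace.exp (p.2 • generator p.1) :=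
    NormedSpace.exp_continuous.comp
      (continuous_snd.smul (continuous_generator.comp continuous_fst))
  exact h1.matrix_mulVec continuous_const

theorem continuous_evol_env (t : ℝ) (f : HalfFilled N → ℝ) (A : HalfFilled N) :
    Continuous fun b : ZMod N → ℝ => evol b t f A :=
  (continuous_apply A).comp ((continuous_evol f).comp (by fun_prop : Continuous fun b => (b, t)))

theorem evol_zero (b : ZMod N → ℝ) (f : HalfFilled N → ℝ) : evol b 0 f = f := by
  simp [evol]

/-- The diagonal part of `generator` is the total rate `∑ b`. Extracting it yields the probability
of no ring, with `jumpMatrix` expanding over the rings. -/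
theorem evol_add (b : ZMod N → ℝ) (h t : ℝ) (f : HalfFilled N → ℝ) :
    evol b (h + t) f = Real.exp (-(∑ x, b x) * h) •
      (NormedSpace.exp (h • jumpMatrix b) *ᵥ evol b t f) := by
  rw [evol, matrixExp_add, ← Matrix.mulVec_mulVec, ← Matrix.smul_mulVec]
  congr 1
  exact matrixExp_add_scalar (jumpMatrix b) (-∑ x, b x) h

theorem propagator_mulVec (b : ZMod N → ℝ) (t : ℝ) (f : HalfFilled N → ℝ) :
    propagator b t *ᵥ f = Real.exp (2 * nu N * t) • evol b t f := by
  rw [propagator, matrixExp_add_scalar, evol, Matrix.smul_mulVec]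

theorem mem_box_iff {b : ZMod N → ℝ} {c : ℝ} :
    b ∈ Set.Icc (0 : ZMod N → ℝ) (fun _ => c) ↔ ∀ x, 0 ≤ b x ∧ b x ≤ c :=
  ⟨fun h x => ⟨h.1 x, h.2 x⟩, fun h => ⟨fun x => (h x).1, fun x => (h x).2⟩⟩

theorem exists_norm_evol_le (c R : ℝ) (f : HalfFilled N → ℝ) : ∃ G : ℝ, 0 ≤ G ∧
    ∀ b : ZMod N → ℝ, (∀ x, 0 ≤ b x ∧ b x ≤ c) → ∀ t, 0 ≤ t → t ≤ R → ‖evol b t f‖ ≤ G := by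
  obtain ⟨G, hG⟩ := (isCompact_Icc.prod isCompact_Icc :
    IsCompact (Set.Icc (0 : ZMod N → ℝ) (fun _ => c) ×ˢ Set.Icc (0 : ℝ) R)).exists_bound_of_continuousOn
    (continuous_evol f).continuousOn
  exact ⟨max G 0, le_max_right _ _, fun b hb t h0 h1 =>
    (hG (b, t) ⟨mem_box_iff.2 hb, h0, h1⟩).trans (le_max_left _ _)⟩

theorem exists_norm_exp_remainder_le (c : ℝ) : ∃ q : ℝ, 0 ≤ q ∧
    ∀ b : ZMod N → ℝ, (∀ x, 0 ≤ b x ∧ b x ≤ c) → ∀ h, 0 ≤ h → h ≤ 1 → ∀ v : HalfFilled N → ℝ,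
      ‖NormedSpace.exp (h • jumpMatrix b) *ᵥ v - v - h • (jumpMatrix b *ᵥ v)‖ ≤ q * h ^ 2 * ‖v‖ := by
  obtain ⟨q, hq⟩ := (isCompact_Icc :
    IsCompact (Set.Icc (0 : ZMod N → ℝ) (fun _ => c))).exists_bound_of_continuousOn
    (continuous_jumpMatrix (N := N)).continuousOn
  have hq' : ∀ b : ZMod N → ℝ, (∀ x, 0 ≤ b x ∧ b x ≤ c) → ‖jumpMatrix b‖ ≤ max q 0 :=
    fun b hb => (hq b (mem_box_iff.2 hb)).trans (le_max_left _ _)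
  refine ⟨max q 0 ^ 2 * Real.exp (max q 0), by positivity, fun b hb h h0 h1 v => ?_⟩
  have hb' := hq' b hb
  have hn : ‖h • jumpMatrix b‖ ≤ h * max q 0 := by
    rw [norm_smul, Real.norm_of_nonneg h0]
    exact mul_le_mul_of_nonneg_left hb' h0
  have e : NormedSpace.exp (h • jumpMatrix b) *ᵥ v - v - h • (jumpMatrix b *ᵥ v)
      = (NormedSpace.exp (h • jumpMatrix b) - 1 - h • jumpMatrix b) *ᵥ v := by
    rw [Matrix.sub_mulVec, Matrix.sub_mulVec, Matrix.one_mulVec, Matrix.smul_mulVec]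
  rw [e]
  refine (Matrix.linfty_opNorm_mulVec _ v).trans (mul_le_mul_of_nonneg_right ?_ (norm_nonneg v))
  refine (norm_matrixExp_sub_one_sub_le _).trans ?_
  have h2 : h * max q 0 ≤ max q 0 := mul_le_of_le_one_left (le_max_right _ _) h1
  calc ‖h • jumpMatrix b‖ ^ 2 * Real.exp ‖h • jumpMatrix b‖
      ≤ (h * max q 0) ^ 2 * Real.exp (max q 0) := by
        have := hn.trans h2
        gcongr
    _ = _ := by ring

theorem abs_stateVec_dotProduct_le (hN : 2 ≤ N) (σ : State N) (v : HalfFilled N → ℝ) :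
    |stateVec σ ⬝ᵥ v| ≤ (∑ B, stateVec σ B) * ‖v‖ := by
  rw [Finset.sum_mul]
  refine (Finset.abs_sum_le_sum_abs _ _).trans (Finset.sum_le_sum fun B _ => ?_)
  rw [abs_mul, abs_of_nonneg (stateVec_nonneg hN σ B)]
  exact mul_le_mul_of_nonneg_left (norm_le_pi_norm v B) (stateVec_nonneg hN σ B)

end Evolution

end InhomASEP

/-! ## The Markov property -/

namespace InhomASEP

section OneRing

open scoped Matrix

variable {N : ℕ} [NeZero N] {Ω : Type*} {QL QR : Ω → ℝ≥0 → ZMod N → ℕ}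

theorem totalRings_of_mem_ringBox {s t : ℝ≥0} {k l : ZMod N → ℕ} {ω : Ω}
    (h : ω ∈ ringBox QL QR s t k l) :
    totalRings (QL ω) (QR ω) t = totalRings (QL ω) (QR ω) s + ∑ x, (k x + l x) :=
  totalRings_add h

theorem ringBox_unique {s t : ℝ≥0} {k l k' l' : ZMod N → ℕ} {ω : Ω}
    (h : ω ∈ ringBox QL QR s t k l) (h' : ω ∈ ringBox QL QR s t k' l') : k = k' ∧ l = l' := by
  constructor <;> ext x
  · have h1 := (h x).1
    have h2 := (h' x).1
    omega
  · have h1 := (h x).2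
    have h2 := (h' x).2
    omega

theorem single_one_injective {x y : ZMod N} (h : (Pi.single x 1 : ZMod N → ℕ) = Pi.single y 1) :
    x = y := by
  by_contra hne
  have := congrFun h x
  rw [Pi.single_eq_same, Pi.single_eq_of_ne hne] at this
  omega

theorem single_one_ne_zero (x : ZMod N) : (Pi.single x 1 : ZMod N → ℕ) ≠ 0 := fun h => by
  have := congrFun h x
  simp at this

/-- The contribution of at most one ring between `s` and `t`. -/
def oneRingPart (QL QR : Ω → ℝ≥0 → ZMod N → ℕ) (A : Finset (ZMod N)) (s t : ℝ≥0)
    (v : Ω → HalfFilled N → ℝ) (ω : Ω) : ℝ :=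
  (ringBox QL QR s t 0 0).indicator (fun ω => stateVec (asep (QL ω) (QR ω) A s) ⬝ᵥ v ω) ω
  + ∑ x, ((ringBox QL QR s t 0 (Pi.single x 1)).indicator
      (fun ω => stateVec (jumpRight x (asep (QL ω) (QR ω) A s)) ⬝ᵥ v ω) ω
    + (ringBox QL QR s t (Pi.single x 1) 0).indicator
      (fun ω => stateVec (jumpLeft x (asep (QL ω) (QR ω) A s)) ⬝ᵥ v ω) ω)

/-- Partition according to the number of rings in `(s, t]`: with none the state is unchanged, with
one the clock that rang determines the jump, and all other cases go to the last term. -/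
theorem stateVec_eq_oneRingPart_add (hp : ∀ ω, IsClockPath (QL ω) (QR ω)) (A : Finset (ZMod N))
    {s t : ℝ≥0} (hst : s ≤ t) (v : Ω → HalfFilled N → ℝ) (ω : Ω) :
    stateVec (asep (QL ω) (QR ω) A t) ⬝ᵥ v ω = oneRingPart QL QR A s t v ω
      + {ω | totalRings (QL ω) (QR ω) s + 2 ≤ totalRings (QL ω) (QR ω) t}.indicator
        (fun ω => stateVec (asep (QL ω) (QR ω) A t) ⬝ᵥ v ω) ω := by
  set k : ZMod N → ℕ := fun x => QL ω t x - QL ω s x with hk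
  set l : ZMod N → ℕ := fun x => QR ω t x - QR ω s x with hl
  have hb : ω ∈ ringBox QL QR s t k l := fun x => by
    have h1 : QL ω s x ≤ QL ω t x := (hp ω).left_mono x hst
    have h2 : QR ω s x ≤ QR ω t x := (hp ω).right_mono x hst
    simp only [hk, hl]
    omega
  have hV := totalRings_of_mem_ringBox hb
  have hbox : ∀ k' l', ω ∈ ringBox QL QR s t k' l' ↔ k = k' ∧ l = l' := fun k' l' =>
    ⟨fun h => ringBox_unique hb h, fun ⟨h1, h2⟩ => h1 ▸ h2 ▸ hb⟩
  have hs1 : ∀ x : ZMod N, ∑ y, ((0 : ZMod N → ℕ) y + (Pi.single x 1 : ZMod N → ℕ) y) = 1 :=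
    fun x => by simp [Finset.sum_pi_single']
  have hs2 : ∀ x : ZMod N, ∑ y, ((Pi.single x 1 : ZMod N → ℕ) y + (0 : ZMod N → ℕ) y) = 1 :=
    fun x => by simp [Finset.sum_pi_single']
  by_cases h2 : totalRings (QL ω) (QR ω) s + 2 ≤ totalRings (QL ω) (QR ω) t
  · rw [Set.indicator_of_mem (Set.mem_ofPred_eq ▸ h2), oneRingPart, Set.indicator_of_notMem,
      Finset.sum_eq_zero, add_zero, zero_add]
    · intro x _
      rw [Set.indicator_of_notMem, Set.indicator_of_notMem, add_zero]
      · intro h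
        have := totalRings_of_mem_ringBox h
        rw [hs2] at this
        omega
      · intro h
        have := totalRings_of_mem_ringBox h
        rw [hs1] at this
        omega
    · intro h
      have := totalRings_of_mem_ringBox h
      simp at this
      omega
  · have hnot : ω ∉ {ω | totalRings (QL ω) (QR ω) s + 2 ≤ totalRings (QL ω) (QR ω) t} := h2
    rw [Set.indicator_of_notMem hnot, add_zero, oneRingPart]
    rcases Nat.eq_zero_or_pos (∑ x, (k x + l x)) with h0 | h0
    · rw [Finset.sum_eq_zero_iff] at h0
      have hk0 : k = 0 := by
        ext x
        have := h0 x (Finset.mem_univ x)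
        simp only [Pi.zero_apply]
        omega
      have hl0 : l = 0 := by
        ext x
        have := h0 x (Finset.mem_univ x)
        simp only [Pi.zero_apply]
        omega
      rw [Set.indicator_of_mem ((hbox 0 0).2 ⟨hk0, hl0⟩), Finset.sum_eq_zero, add_zero,
        asep_of_no_ring A ((hbox 0 0).2 ⟨hk0, hl0⟩)]
      intro x _
      rw [Set.indicator_of_notMem, Set.indicator_of_notMem, add_zero]
      · exact fun h => single_one_ne_zero x (((hbox _ _).1 h).1.symm.trans hk0)
      · exact fun h => single_one_ne_zero x (((hbox _ _).1 h).2.symm.trans hl0)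
    · have hsum : ∑ x, (k x + l x) = 1 := by omega
      obtain ⟨y, hy⟩ : ∃ y, k y + l y ≠ 0 := by
        by_contra hcon
        push Not at hcon
        rw [Finset.sum_eq_zero fun x _ => hcon x] at hsum
        omega
      have hsplit := Finset.add_sum_erase Finset.univ (fun x => k x + l x) (Finset.mem_univ y)
      simp only [hsum] at hsplit
      have hz : ∑ x ∈ Finset.univ.erase y, (k x + l x) = 0 := by omega
      have hy1 : k y + l y = 1 := by omega
      rw [Finset.sum_eq_zero_iff] at hz
      have hz' : ∀ x, x ≠ y → k x = 0 ∧ l x = 0 := fun x hx => by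
        have := hz x (Finset.mem_erase.2 ⟨hx, Finset.mem_univ x⟩)
        omega
      rcases Nat.eq_zero_or_pos (k y) with hky | hky
      · have hk0 : k = 0 := by
          ext x
          by_cases hx : x = y
          · rw [hx, hky]; rfl
          · rw [(hz' x hx).1]; rfl
        have hl1 : l = Pi.single y 1 := by
          ext x
          by_cases hx : x = y
          · rw [hx, Pi.single_eq_same]; omega
          · rw [(hz' x hx).2, Pi.single_eq_of_ne hx]
        have hm := (hbox 0 (Pi.single y 1)).2 ⟨hk0, hl1⟩
        rw [Set.indicator_of_notMem, Finset.sum_eq_single y, Set.indicator_of_mem hm,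
          Set.indicator_of_notMem, zero_add, add_zero, (hp ω).asep_of_right_ring A hm]
        · exact fun h => single_one_ne_zero y (((hbox _ _).1 h).1.symm.trans hk0)
        · intro x _ hx
          rw [Set.indicator_of_notMem, Set.indicator_of_notMem, add_zero]
          · exact fun h => single_one_ne_zero x (((hbox _ _).1 h).1.symm.trans hk0)
          · exact fun h => hx (single_one_injective (((hbox _ _).1 h).2.symm.trans hl1))
        · simp
        · exact fun h => single_one_ne_zero y (hl1.symm.trans ((hbox _ _).1 h).2)
      · have hl0 : l = 0 := by
          ext x
          by_cases hx : x = y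
          · rw [hx]; simp only [Pi.zero_apply]; omega
          · rw [(hz' x hx).2]; rfl
        have hk1 : k = Pi.single y 1 := by
          ext x
          by_cases hx : x = y
          · rw [hx, Pi.single_eq_same]; omega
          · rw [(hz' x hx).1, Pi.single_eq_of_ne hx]
        have hm := (hbox (Pi.single y 1) 0).2 ⟨hk1, hl0⟩
        rw [Set.indicator_of_notMem, Finset.sum_eq_single y, Set.indicator_of_notMem,
          Set.indicator_of_mem hm, zero_add, zero_add, (hp ω).asep_of_left_ring A hm]
        · exact fun h => single_one_ne_zero y (((hbox _ _).1 h).2.symm.trans hl0)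
        · intro x _ hx
          rw [Set.indicator_of_notMem, Set.indicator_of_notMem, add_zero]
          · exact fun h => hx (single_one_injective (((hbox _ _).1 h).1.symm.trans hk1))
          · exact fun h => single_one_ne_zero x (((hbox _ _).1 h).2.symm.trans hl0)
        · simp
        · exact fun h => single_one_ne_zero y (hk1.symm.trans ((hbox _ _).1 h).1)

end OneRing

/-! ### Probabilities of no ring and of a single ring. -/

section BoxWeights

variable {N : ℕ} [NeZero N]

theorem boxWeight_eq (b : ZMod N → ℝ) (h : ℝ) (k l : ZMod N → ℕ) :
    boxWeight b h k l = Real.exp (-(∑ x, b x) * h)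
      * ∏ x, ((rateL N * b x * h) ^ k x / (k x)! * ((rateR N * b x * h) ^ l x / (l x)!)) := by
  rw [← Finset.sum_neg_distrib, Finset.sum_mul, Real.exp_sum, ← Finset.prod_mul_distrib]
  refine Finset.prod_congr rfl fun x _ => ?_
  have e : Real.exp (-b x * h) = Real.exp (-(rateL N * b x * h)) * Real.exp (-(rateR N * b x * h)) := by
    rw [← Real.exp_add]
    congr 1
    linear_combination (-(b x * h)) * (rateR_add_rateL N).symm
  rw [e, poissonWeight, poissonWeight]
  ring

theorem boxWeight_zero (b : ZMod N → ℝ) (h : ℝ) :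
    boxWeight b h 0 0 = Real.exp (-(∑ x, b x) * h) := by
  rw [boxWeight_eq]
  simp

theorem boxWeight_left (b : ZMod N → ℝ) (h : ℝ) (x : ZMod N) :
    boxWeight b h (Pi.single x 1) 0 = Real.exp (-(∑ x, b x) * h) * (rateL N * b x * h) := by
  rw [boxWeight_eq, Finset.prod_eq_single x]
  · simp
  · intro y _ hy
    simp [Pi.single_eq_of_ne hy]
  · simp

theorem boxWeight_right (b : ZMod N → ℝ) (h : ℝ) (x : ZMod N) :
    boxWeight b h 0 (Pi.single x 1) = Real.exp (-(∑ x, b x) * h) * (rateR N * b x * h) := by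
  rw [boxWeight_eq, Finset.prod_eq_single x]
  · simp
  · intro y _ hy
    simp [Pi.single_eq_of_ne hy]
  · simp

end BoxWeights

end InhomASEP

/-! ### Conditional expectations over one time step. -/

namespace InhomASEP

theorem measurable_dotProduct {Ω ι : Type*} [Fintype ι] {m : MeasurableSpace Ω} {X v : Ω → ι → ℝ}
    (hX : ∀ i, Measurable[m] fun ω => X ω i) (hv : ∀ i, Measurable[m] fun ω => v ω i) :
    Measurable[m] fun ω => X ω ⬝ᵥ v ω :=
  Finset.measurable_fun_sum _ fun i _ => (hX i).fun_mul (hv i)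

section Step

open scoped Matrix

variable {N : ℕ} [NeZero N] {Ω : Type*} [MeasurableSpace Ω] {μ : Measure Ω}
  [IsProbabilityMeasure μ] {a : Ω → ZMod N → ℝ} {QL QR : Ω → ℝ≥0 → ZMod N → ℕ}

/-- The factor `c` is known at time `s`, so it is pulled out of the conditional probability of the
box. Integrability comes for free, since the weighted function is a version of a conditional
expectation. -/
theorem IsClockSystem.setIntegral_ringBox (h : IsClockSystem μ a QL QR) {s t : ℝ≥0} (hst : s ≤ t)
    (k l : ZMod N → ℕ) {c : Ω → ℝ} (hc : Measurable[clockSigma a QL QR s] c) (hci : Integrable c μ)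
    {B : Set Ω} (hB : MeasurableSet[clockSigma a QL QR s] B) :
    Integrable (fun ω => boxWeight (a ω) ((t : ℝ) - s) k l * c ω) μ ∧
    ∫ ω in B, (ringBox QL QR s t k l).indicator c ω ∂μ
      = ∫ ω in B, boxWeight (a ω) ((t : ℝ) - s) k l * c ω ∂μ := by
  have hm := h.clockSigma_le s
  have hE := h.measurableSet_ringBox s t k l
  have e : (ringBox QL QR s t k l).indicator c
      = (ringBox QL QR s t k l).indicator (fun _ => (1 : ℝ)) * c := by
    ext ω
    by_cases hω : ω ∈ ringBox QL QR s t k l <;> simp [hω]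
  have hci' : Integrable ((ringBox QL QR s t k l).indicator c) μ := hci.indicator hE
  have h1 : μ[(ringBox QL QR s t k l).indicator c | clockSigma a QL QR s]
      =ᵐ[μ] fun ω => boxWeight (a ω) ((t : ℝ) - s) k l * c ω := by
    rw [e]
    refine (condExp_mul_of_stronglyMeasurable_right hc.stronglyMeasurable (e ▸ hci')
      ((integrable_const 1).indicator hE)).trans ?_
    filter_upwards [h.increments s t hst k l] with ω hω
    rw [Pi.mul_apply]
    congr 1
  refine ⟨integrable_condExp.congr h1, ?_⟩
  rw [← setIntegral_condExp hm hci' hB]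
  exact setIntegral_congr_ae (hm _ hB) (h1.mono fun ω hω _ => hω)

theorem IsClockSystem.measurable_stateVec_asep (h : IsClockSystem μ a QL QR) (A : Finset (ZMod N))
    (t : ℝ≥0) (B : HalfFilled N) :
    Measurable[clockSigma a QL QR t] fun ω => stateVec (asep (QL ω) (QR ω) A t) B :=
  measurable_stateVec h.isClockPath (fun _ hs x => measurable_left_clockSigma hs x)
    (fun _ hs x => measurable_right_clockSigma hs x) A B

theorem sum_stateVec_asep_le (hN : 2 ≤ N) {A : Finset (ZMod N)} (hA : 2 * A.card = N)
    (QL QR : ℝ≥0 → ZMod N → ℕ) (t : ℝ≥0) :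
    ∑ B, stateVec (asep QL QR A t) B ≤ ((tau N)⁻¹ ^ 2) ^ totalRings QL QR t :=
  sum_stateVec_stateAfter_le QL QR A hN hA _

theorem IsClockSystem.integrable_stateVec_dotProduct (hN : 2 ≤ N) (h : IsClockSystem μ a QL QR)
    {b : ℝ} (ha : ∀ᵐ ω ∂μ, ∀ x, 0 ≤ a ω x ∧ a ω x ≤ b) {A : Finset (ZMod N)} (hA : 2 * A.card = N)
    (t : ℝ≥0) {v : Ω → HalfFilled N → ℝ} (hv : ∀ B, Measurable fun ω => v ω B) {G : ℝ}
    (hG : ∀ᵐ ω ∂μ, ‖v ω‖ ≤ G) :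
    Integrable (fun ω => stateVec (asep (QL ω) (QR ω) A t) ⬝ᵥ v ω) μ := by
  have hz := h.integrable_pow_totalRings hN ha t (sq_nonneg (tau N)⁻¹)
  refine (hz.mul_const G).mono'
    (measurable_dotProduct (fun B => (h.measurable_stateVec_asep A t B).mono (h.clockSigma_le t)
      le_rfl) hv).aestronglyMeasurable ?_
  filter_upwards [hG] with ω hω
  have h1 := sum_stateVec_asep_le hN hA (QL ω) (QR ω) t
  have h2 : 0 ≤ ((tau N)⁻¹ ^ 2) ^ totalRings (QL ω) (QR ω) t := by positivity
  exact (abs_stateVec_dotProduct_le hN _ _).trans (mul_le_mul h1 hω (norm_nonneg _) h2)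

theorem norm_weight_move_le {w : HalfFilled N → ℝ} (g : HalfFilled N → HalfFilled N)
    (hw : ∀ B, |w B| ≤ (tau N)⁻¹ ^ 2) (v : HalfFilled N → ℝ) :
    ‖fun B => w B * v (g B)‖ ≤ (tau N)⁻¹ ^ 2 * ‖v‖ := by
  refine (pi_norm_le_iff_of_nonneg (by positivity)).2 fun B => ?_
  rw [norm_mul]
  exact mul_le_mul (hw B) (norm_le_pi_norm v _) (norm_nonneg _) (by positivity)

theorem abs_weightRight_le (hN : 2 ≤ N) (x : ZMod N) (B : HalfFilled N) :
    |weightRight x B| ≤ (tau N)⁻¹ ^ 2 := by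
  have h1 := tau_pos hN
  have h2 : 1 ≤ (tau N)⁻¹ ^ 2 := one_le_pow₀ ((one_le_inv₀ h1).2 (tau_le_one hN))
  rw [weightRight]
  split_ifs
  · rw [abs_of_nonneg (by positivity)]
  · rwa [abs_one]

theorem abs_weightLeft_le (hN : 2 ≤ N) (x : ZMod N) (B : HalfFilled N) :
    |weightLeft x B| ≤ (tau N)⁻¹ ^ 2 := by
  have h1 := tau_pos hN
  have h2 : 1 ≤ (tau N)⁻¹ ^ 2 := one_le_pow₀ ((one_le_inv₀ h1).2 (tau_le_one hN))
  rw [weightLeft]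
  split_ifs
  · rw [abs_of_nonneg (by positivity)]
    exact (pow_le_one₀ h1.le (tau_le_one hN)).trans h2
  · rwa [abs_one]

theorem consistent_asep (hN : 2 ≤ N) {A : Finset (ZMod N)} (hA : 2 * A.card = N)
    (QL QR : ℝ≥0 → ZMod N → ℕ) (t : ℝ≥0) : (asep QL QR A t).Consistent :=
  consistent_stateAfter QL QR A hN hA _

/-- Expectation of the contribution of at most one ring. -/
theorem IsClockSystem.setIntegral_oneRingPart (hN : 2 ≤ N) (h : IsClockSystem μ a QL QR)
    {b : ℝ} (ha : ∀ᵐ ω ∂μ, ∀ x, 0 ≤ a ω x ∧ a ω x ≤ b) {A : Finset (ZMod N)} (hA : 2 * A.card = N)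
    {s t : ℝ≥0} (hst : s ≤ t) {v : Ω → HalfFilled N → ℝ}
    (hv : ∀ B, Measurable[clockSigma a QL QR s] fun ω => v ω B) {G : ℝ}
    (hG : ∀ᵐ ω ∂μ, ‖v ω‖ ≤ G) {B : Set Ω} (hB : MeasurableSet[clockSigma a QL QR s] B) :
    Integrable (oneRingPart QL QR A s t v) μ ∧
    Integrable (fun ω => Real.exp (-(∑ x, a ω x) * ((t : ℝ) - s))
        * (stateVec (asep (QL ω) (QR ω) A s) ⬝ᵥ (v ω + ((t : ℝ) - s) • (jumpMatrix (a ω) *ᵥ v ω)))) μ ∧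
    ∫ ω in B, oneRingPart QL QR A s t v ω ∂μ
      = ∫ ω in B, Real.exp (-(∑ x, a ω x) * ((t : ℝ) - s))
        * (stateVec (asep (QL ω) (QR ω) A s) ⬝ᵥ (v ω + ((t : ℝ) - s) • (jumpMatrix (a ω) *ᵥ v ω)))
          ∂μ := by
  have hms := h.clockSigma_le s
  have hv' := fun B => (hv B).mono hms le_rfl
  have hcon := fun ω => consistent_asep hN hA (QL ω) (QR ω) s
  have hG' : ∀ᵐ ω ∂μ, (tau N)⁻¹ ^ 2 * ‖v ω‖ ≤ (tau N)⁻¹ ^ 2 * G :=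
    hG.mono fun ω hω => mul_le_mul_of_nonneg_left hω (sq_nonneg _)
  -- the three types of terms
  have m0 : Measurable[clockSigma a QL QR s] fun ω => stateVec (asep (QL ω) (QR ω) A s) ⬝ᵥ v ω :=
    measurable_dotProduct (h.measurable_stateVec_asep A s) hv
  have i0 : Integrable (fun ω => stateVec (asep (QL ω) (QR ω) A s) ⬝ᵥ v ω) μ :=
    h.integrable_stateVec_dotProduct hN ha hA s hv' hG
  have mR : ∀ x, Measurable[clockSigma a QL QR s] fun ω =>
      stateVec (jumpRight x (asep (QL ω) (QR ω) A s)) ⬝ᵥ v ω := fun x => by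
    simp only [fun ω => stateVec_jumpRight hN (hcon ω) x (v ω)]
    exact measurable_dotProduct (h.measurable_stateVec_asep A s) fun B => (hv _).const_mul _
  have iR : ∀ x, Integrable (fun ω =>
      stateVec (jumpRight x (asep (QL ω) (QR ω) A s)) ⬝ᵥ v ω) μ := fun x => by
    simp only [fun ω => stateVec_jumpRight hN (hcon ω) x (v ω)]
    refine h.integrable_stateVec_dotProduct hN ha hA s (G := (tau N)⁻¹ ^ 2 * G)
      (fun B => (hv' _).const_mul _) (hG'.mono fun ω hω => ?_)
    exact (norm_weight_move_le _ (abs_weightRight_le hN x) _).trans hω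
  have mL : ∀ x, Measurable[clockSigma a QL QR s] fun ω =>
      stateVec (jumpLeft x (asep (QL ω) (QR ω) A s)) ⬝ᵥ v ω := fun x => by
    simp only [fun ω => stateVec_jumpLeft hN (hcon ω) x (v ω)]
    exact measurable_dotProduct (h.measurable_stateVec_asep A s) fun B => (hv _).const_mul _
  have iL : ∀ x, Integrable (fun ω =>
      stateVec (jumpLeft x (asep (QL ω) (QR ω) A s)) ⬝ᵥ v ω) μ := fun x => by
    simp only [fun ω => stateVec_jumpLeft hN (hcon ω) x (v ω)]
    refine h.integrable_stateVec_dotProduct hN ha hA s (G := (tau N)⁻¹ ^ 2 * G)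
      (fun B => (hv' _).const_mul _) (hG'.mono fun ω hω => ?_)
    exact (norm_weight_move_le _ (abs_weightLeft_le hN x) _).trans hω
  obtain ⟨w0, e0⟩ := h.setIntegral_ringBox hst 0 0 m0 i0 hB
  have hRr := fun x => h.setIntegral_ringBox hst 0 (Pi.single x 1) (mR x) (iR x) hB
  have hLl := fun x => h.setIntegral_ringBox hst (Pi.single x 1) 0 (mL x) (iL x) hB
  have j0 := i0.indicator (h.measurableSet_ringBox s t 0 0)
  have jR := fun x => (iR x).indicator (h.measurableSet_ringBox s t 0 (Pi.single x 1))
  have jL := fun x => (iL x).indicator (h.measurableSet_ringBox s t (Pi.single x 1) 0)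
  have jS := integrable_finsetSum (μ := μ) Finset.univ fun x _ => (jR x).add (jL x)
  have wS := integrable_finsetSum (μ := μ) Finset.univ fun x _ => (hRr x).1.add (hLl x).1
  -- None or one ring reproduces `e^(-hΣa) (1 + h · jumpMatrix)`, the expansion of the semigroup to
  -- first order in `h = t - s` inside the exponential prefactor.
  have ept : ∀ ω, Real.exp (-(∑ x, a ω x) * ((t : ℝ) - s))
      * (stateVec (asep (QL ω) (QR ω) A s) ⬝ᵥ (v ω + ((t : ℝ) - s) • (jumpMatrix (a ω) *ᵥ v ω)))
      = boxWeight (a ω) ((t : ℝ) - s) 0 0 * (stateVec (asep (QL ω) (QR ω) A s) ⬝ᵥ v ω)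
        + ∑ x, (boxWeight (a ω) ((t : ℝ) - s) 0 (Pi.single x 1)
            * (stateVec (jumpRight x (asep (QL ω) (QR ω) A s)) ⬝ᵥ v ω)
          + boxWeight (a ω) ((t : ℝ) - s) (Pi.single x 1) 0
            * (stateVec (jumpLeft x (asep (QL ω) (QR ω) A s)) ⬝ᵥ v ω)) := by
    intro ω
    rw [dotProduct_add, dotProduct_smul, stateVec_jumpMatrix hN (hcon ω), smul_eq_mul,
      Finset.mul_sum, mul_add, Finset.mul_sum, boxWeight_zero]
    congr 1
    refine Finset.sum_congr rfl fun x _ => ?_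
    rw [boxWeight_left, boxWeight_right]
    ring
  refine ⟨?_, ?_, ?_⟩
  · refine (j0.add jS).congr (ae_of_all _ fun ω => ?_)
    simp only [oneRingPart, Pi.add_apply]
  · refine (w0.add wS).congr (ae_of_all _ fun ω => ?_)
    simp only [Pi.add_apply]
    rw [ept]
  · have hl : ∫ ω in B, oneRingPart QL QR A s t v ω ∂μ
        = ∫ ω in B, (ringBox QL QR s t 0 0).indicator
          (fun ω => stateVec (asep (QL ω) (QR ω) A s) ⬝ᵥ v ω) ω ∂μ
        + ∑ x, (∫ ω in B, (ringBox QL QR s t 0 (Pi.single x 1)).indicator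
          (fun ω => stateVec (jumpRight x (asep (QL ω) (QR ω) A s)) ⬝ᵥ v ω) ω ∂μ
        + ∫ ω in B, (ringBox QL QR s t (Pi.single x 1) 0).indicator
          (fun ω => stateVec (jumpLeft x (asep (QL ω) (QR ω) A s)) ⬝ᵥ v ω) ω ∂μ) := by
      simp only [oneRingPart]
      rw [integral_add j0.restrict, integral_finsetSum]
      · congr 1
        exact Finset.sum_congr rfl fun x _ => integral_add (jR x).restrict (jL x).restrict
      · exact fun x _ => ((jR x).add (jL x)).restrict
      · refine jS.restrict.congr (ae_of_all _ fun ω => ?_)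
        simp only [Pi.add_apply]
    have hr : ∫ ω in B, Real.exp (-(∑ x, a ω x) * ((t : ℝ) - s))
        * (stateVec (asep (QL ω) (QR ω) A s) ⬝ᵥ (v ω + ((t : ℝ) - s) • (jumpMatrix (a ω) *ᵥ v ω))) ∂μ
        = ∫ ω in B, boxWeight (a ω) ((t : ℝ) - s) 0 0
            * (stateVec (asep (QL ω) (QR ω) A s) ⬝ᵥ v ω) ∂μ
        + ∑ x, (∫ ω in B, boxWeight (a ω) ((t : ℝ) - s) 0 (Pi.single x 1)
            * (stateVec (jumpRight x (asep (QL ω) (QR ω) A s)) ⬝ᵥ v ω) ∂μ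
          + ∫ ω in B, boxWeight (a ω) ((t : ℝ) - s) (Pi.single x 1) 0
            * (stateVec (jumpLeft x (asep (QL ω) (QR ω) A s)) ⬝ᵥ v ω) ∂μ) := by
      simp only [ept]
      rw [integral_add w0.restrict, integral_finsetSum]
      · congr 1
        exact Finset.sum_congr rfl fun x _ => integral_add (hRr x).1.restrict (hLl x).1.restrict
      · exact fun x _ => ((hRr x).1.add (hLl x).1).restrict
      · refine wS.restrict.congr (ae_of_all _ fun ω => ?_)
        simp only [Pi.add_apply]
    rw [hl, hr, e0]
    congr 1
    exact Finset.sum_congr rfl fun x _ => by rw [(hRr x).2, (hLl x).2]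

end Step

end InhomASEP

/-! ### From short time steps to the Markov property. -/

namespace InhomASEP

/-- A function of time with quadratically small increments is constant. -/
theorem eq_of_abs_sub_le_sq {ψ : ℝ≥0 → ℝ} {C : ℝ} {s t : ℝ≥0}
    (h : ∀ r r' : ℝ≥0, s ≤ r → r < r' → r' ≤ s + t → (r' : ℝ) - r ≤ 1 →
      |ψ r' - ψ r| ≤ C * ((r' : ℝ) - r) ^ 2) : ψ (s + t) = ψ s := by
  rcases eq_or_ne t 0 with rfl | ht
  · rw [add_zero]
  have ht0 : 0 < t := pos_iff_ne_zero.2 ht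
  -- Cutting `[s, s + t]` into `n` equal steps gives a total increment of at most `n · C (t/n)² = C
  -- t²/n`. The condition `t ≤ n` makes each step at most one.
  have key : ∀ n : ℕ, (t : ℝ) ≤ n → 0 < n → |ψ (s + t) - ψ s| ≤ C * (t : ℝ) ^ 2 / n := by
    intro n htn hn
    have hn0 : (0 : ℝ) < n := by exact_mod_cast hn
    set g : ℕ → ℝ≥0 := fun i => s + i * (t / n) with hg
    have hg0 : g 0 = s := by simp [hg]
    have hgn : g n = s + t := by
      rw [hg]
      simp only
      rw [mul_div_cancel₀]
      exact_mod_cast hn.ne'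
    have hstep : ∀ i < n, |ψ (g (i + 1)) - ψ (g i)| ≤ C * ((t : ℝ) / n) ^ 2 := by
      intro i hi
      have e : ((g (i + 1) : ℝ≥0) : ℝ) - g i = t / n := by
        rw [hg]
        push_cast
        ring
      have hpos : (0 : ℝ) < t / n := by positivity
      have hlt : g i < g (i + 1) := by
        rw [← NNReal.coe_lt_coe]
        linarith
      have hle : g (i + 1) ≤ s + t := by
        rw [← hgn, ← NNReal.coe_le_coe]
        simp only [hg]
        push_cast
        have : (i : ℝ) + 1 ≤ n := by exact_mod_cast hi
        have := mul_le_mul_of_nonneg_right this hpos.le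
        linarith
      have hsle : s ≤ g i := le_self_add
      rw [← e]
      refine h _ _ hsle hlt hle ?_
      rw [e]
      exact (div_le_one hn0).2 htn
    have hsum : ψ (s + t) - ψ s = ∑ i ∈ Finset.range n, (ψ (g (i + 1)) - ψ (g i)) := by
      rw [Finset.sum_range_sub (fun i => ψ (g i)), hgn, hg0]
    rw [hsum]
    refine (Finset.abs_sum_le_sum_abs _ _).trans
      ((Finset.sum_le_sum fun i hi => hstep i (Finset.mem_range.1 hi)).trans_eq ?_)
    rw [Finset.sum_const, Finset.card_range, nsmul_eq_mul]
    field_simp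
  have hlim : Filter.Tendsto (fun n : ℕ => C * (t : ℝ) ^ 2 / n) Filter.atTop (nhds 0) :=
    tendsto_const_div_atTop_nhds_zero_nat _
  have h0 : |ψ (s + t) - ψ s| ≤ 0 := by
    refine ge_of_tendsto hlim ?_
    filter_upwards [Filter.eventually_ge_atTop (⌈(t : ℝ)⌉₊ + 1)] with n hn
    exact key n ((Nat.le_ceil _).trans (by exact_mod_cast (by omega : ⌈(t : ℝ)⌉₊ ≤ n))) (by omega)
  have := abs_nonpos_iff.1 h0
  linarith

section Markov

open scoped Matrix

variable {N : ℕ} [NeZero N] {Ω : Type*} [MeasurableSpace Ω] {μ : Measure Ω}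
  [IsProbabilityMeasure μ] {a : Ω → ZMod N → ℝ} {QL QR : Ω → ℝ≥0 → ZMod N → ℕ}

/-- Two errors, both quadratic in `t - s`: the event of at least two rings, with its exponential
weight, and the Taylor remainder of `exp` beyond first order. -/
theorem IsClockSystem.abs_setIntegral_step_le (hN : 2 ≤ N) (h : IsClockSystem μ a QL QR)
    {b : ℝ} (ha : ∀ᵐ ω ∂μ, ∀ x, 0 ≤ a ω x ∧ a ω x ≤ b) {A : Finset (ZMod N)} (hA : 2 * A.card = N)
    {q : ℝ} (hq0 : 0 ≤ q) (hq : ∀ b' : ZMod N → ℝ, (∀ x, 0 ≤ b' x ∧ b' x ≤ b) → ∀ h, 0 ≤ h → h ≤ 1 →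
      ∀ v : HalfFilled N → ℝ, ‖NormedSpace.exp (h • jumpMatrix b') *ᵥ v - v
        - h • (jumpMatrix b' *ᵥ v)‖ ≤ q * h ^ 2 * ‖v‖)
    {s t : ℝ≥0} (hst : s < t) (hst1 : (t : ℝ) - s ≤ 1) {v : Ω → HalfFilled N → ℝ}
    (hv : ∀ B, Measurable[clockSigma a QL QR s] fun ω => v ω B)
    {w : Ω → HalfFilled N → ℝ} (hw : ∀ B, Measurable fun ω => w ω B)
    (hwv : ∀ ω, w ω = Real.exp (-(∑ x, a ω x) * ((t : ℝ) - s)) •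
      (NormedSpace.exp (((t : ℝ) - s) • jumpMatrix (a ω)) *ᵥ v ω)) {G : ℝ} (hG0 : 0 ≤ G)
    (hG : ∀ᵐ ω ∂μ, ‖v ω‖ ≤ G) (hGw : ∀ᵐ ω ∂μ, ‖w ω‖ ≤ G)
    {B : Set Ω} (hB : MeasurableSet[clockSigma a QL QR s] B) :
    |∫ ω in B, stateVec (asep (QL ω) (QR ω) A t) ⬝ᵥ v ω ∂μ
        - ∫ ω in B, stateVec (asep (QL ω) (QR ω) A s) ⬝ᵥ w ω ∂μ|
      ≤ G * (q + Real.exp (N * b * (tau N)⁻¹ ^ 2)) * Real.exp (N * b * s * (tau N)⁻¹ ^ 2)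
        * ((t : ℝ) - s) ^ 2 := by
  set z : ℝ := (tau N)⁻¹ ^ 2 with hz
  have hz0 : 0 ≤ z := sq_nonneg _
  have hms := h.clockSigma_le s
  have hv' := fun B => (hv B).mono hms le_rfl
  have hr0 : 0 ≤ (t : ℝ) - s := sub_nonneg.2 (by exact_mod_cast hst.le)
  obtain ⟨k1, k2, k3⟩ := h.setIntegral_oneRingPart hN ha hA hst.le hv hG hB
  set E : Set Ω := {ω | totalRings (QL ω) (QR ω) s + 2 ≤ totalRings (QL ω) (QR ω) t} with hE
  have hEm : MeasurableSet E :=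
    measurableSet_le ((h.measurable_totalRings s).add_const 2) (h.measurable_totalRings t)
  have it := h.integrable_stateVec_dotProduct hN ha hA t hv' hG
  have is := h.integrable_stateVec_dotProduct hN ha hA s hw hGw
  have e1 : ∫ ω in B, stateVec (asep (QL ω) (QR ω) A t) ⬝ᵥ v ω ∂μ
      = ∫ ω in B, oneRingPart QL QR A s t v ω ∂μ
        + ∫ ω in B, E.indicator (fun ω => stateVec (asep (QL ω) (QR ω) A t) ⬝ᵥ v ω) ω ∂μ := by
    rw [← integral_add k1.restrict (it.indicator hEm).restrict]
    exact integral_congr_ae (ae_of_all _ fun ω =>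
      stateVec_eq_oneRingPart_add h.isClockPath A hst.le v ω)
  have hVt := h.integrable_pow_totalRings hN ha t hz0
  have hVs := h.integrable_pow_totalRings hN ha s hz0
  have b1 : |∫ ω in B, E.indicator (fun ω => stateVec (asep (QL ω) (QR ω) A t) ⬝ᵥ v ω) ω ∂μ|
      ≤ G * (Real.exp (N * b * z) * Real.exp (N * b * s * z) * ((t : ℝ) - s) ^ 2) := by
    calc _ ≤ ∫ ω in B, |E.indicator (fun ω => stateVec (asep (QL ω) (QR ω) A t) ⬝ᵥ v ω) ω| ∂μ :=
          abs_integral_le_integral_abs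
      _ ≤ ∫ ω, |E.indicator (fun ω => stateVec (asep (QL ω) (QR ω) A t) ⬝ᵥ v ω) ω| ∂μ :=
          setIntegral_le_integral (it.indicator hEm).abs (ae_of_all _ fun ω => abs_nonneg _)
      _ ≤ ∫ ω, G * E.indicator (fun ω => z ^ totalRings (QL ω) (QR ω) t) ω ∂μ := by
          refine integral_mono_ae (it.indicator hEm).abs ((hVt.indicator hEm).const_mul G) ?_
          filter_upwards [hG] with ω hω
          by_cases hωE : ω ∈ E
          · rw [Set.indicator_of_mem hωE, Set.indicator_of_mem hωE, mul_comm G]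
            exact (abs_stateVec_dotProduct_le hN _ _).trans
              (mul_le_mul (sum_stateVec_asep_le hN hA _ _ t) hω (norm_nonneg _) (by positivity))
          · rw [Set.indicator_of_notMem hωE, Set.indicator_of_notMem hωE, abs_zero, mul_zero]
      _ = G * ∫ ω in E, z ^ totalRings (QL ω) (QR ω) t ∂μ := by
          rw [integral_const_mul, integral_indicator hEm]
      _ ≤ _ := mul_le_mul_of_nonneg_left (h.setIntegral_two_rings_le hN ha hst hst1 hz0) hG0
  have b2 : |∫ ω in B, oneRingPart QL QR A s t v ω ∂μ
      - ∫ ω in B, stateVec (asep (QL ω) (QR ω) A s) ⬝ᵥ w ω ∂μ|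
      ≤ G * q * ((t : ℝ) - s) ^ 2 * Real.exp (N * b * s * z) := by
    rw [k3, ← integral_sub k2.restrict is.restrict]
    calc _ ≤ ∫ ω in B, |Real.exp (-(∑ x, a ω x) * ((t : ℝ) - s)) * (stateVec
            (asep (QL ω) (QR ω) A s) ⬝ᵥ (v ω + ((t : ℝ) - s) • (jumpMatrix (a ω) *ᵥ v ω)))
            - stateVec (asep (QL ω) (QR ω) A s) ⬝ᵥ w ω| ∂μ := abs_integral_le_integral_abs
      _ ≤ ∫ ω, |Real.exp (-(∑ x, a ω x) * ((t : ℝ) - s)) * (stateVec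
            (asep (QL ω) (QR ω) A s) ⬝ᵥ (v ω + ((t : ℝ) - s) • (jumpMatrix (a ω) *ᵥ v ω)))
            - stateVec (asep (QL ω) (QR ω) A s) ⬝ᵥ w ω| ∂μ :=
          setIntegral_le_integral (k2.sub is).abs (ae_of_all _ fun ω => abs_nonneg _)
      _ ≤ ∫ ω, G * q * ((t : ℝ) - s) ^ 2 * z ^ totalRings (QL ω) (QR ω) s ∂μ := by
          refine integral_mono_ae (k2.sub is).abs (hVs.const_mul _) ?_
          filter_upwards [hG, ha] with ω hω haω
          have e : Real.exp (-(∑ x, a ω x) * ((t : ℝ) - s)) * (stateVec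
              (asep (QL ω) (QR ω) A s) ⬝ᵥ (v ω + ((t : ℝ) - s) • (jumpMatrix (a ω) *ᵥ v ω)))
              - stateVec (asep (QL ω) (QR ω) A s) ⬝ᵥ w ω
              = -(Real.exp (-(∑ x, a ω x) * ((t : ℝ) - s)) * (stateVec (asep (QL ω) (QR ω) A s) ⬝ᵥ
                (NormedSpace.exp (((t : ℝ) - s) • jumpMatrix (a ω)) *ᵥ v ω - v ω
                  - ((t : ℝ) - s) • (jumpMatrix (a ω) *ᵥ v ω)))) := by
            rw [hwv, dotProduct_smul, smul_eq_mul, dotProduct_sub, dotProduct_sub, dotProduct_add]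
            ring
          have h1 : Real.exp (-(∑ x, a ω x) * ((t : ℝ) - s)) ≤ 1 := by
            rw [Real.exp_le_one_iff]
            have : 0 ≤ ∑ x, a ω x := Finset.sum_nonneg fun x _ => (haω x).1
            nlinarith
          have h2 := abs_stateVec_dotProduct_le hN (asep (QL ω) (QR ω) A s)
            (NormedSpace.exp (((t : ℝ) - s) • jumpMatrix (a ω)) *ᵥ v ω - v ω
              - ((t : ℝ) - s) • (jumpMatrix (a ω) *ᵥ v ω))
          have h3 := hq (a ω) haω _ hr0 hst1 (v ω)
          have h4 := sum_stateVec_asep_le hN hA (QL ω) (QR ω) s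
          have h5 : q * ((t : ℝ) - s) ^ 2 * ‖v ω‖ ≤ q * ((t : ℝ) - s) ^ 2 * G := by gcongr
          have h6 := h2.trans (mul_le_mul h4 (h3.trans h5) (norm_nonneg _) (by positivity))
          rw [e, abs_neg, abs_mul, abs_of_pos (Real.exp_pos _)]
          refine (mul_le_of_le_one_left (abs_nonneg _) h1).trans (h6.trans_eq ?_)
          ring
      _ ≤ _ := by
          rw [integral_const_mul]
          exact mul_le_mul_of_nonneg_left (h.integral_pow_totalRings_le hN ha s hz0) (by positivity)
  rw [e1]
  calc _ ≤ |∫ ω in B, oneRingPart QL QR A s t v ω ∂μ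
        - ∫ ω in B, stateVec (asep (QL ω) (QR ω) A s) ⬝ᵥ w ω ∂μ|
        + |∫ ω in B, E.indicator (fun ω => stateVec (asep (QL ω) (QR ω) A t) ⬝ᵥ v ω) ω ∂μ| := by
        refine le_of_eq_of_le (congrArg _ ?_) (abs_add_le _ _)
        ring
    _ ≤ _ := (add_le_add b2 b1).trans_eq (by ring)

theorem measurable_evol (t : ℝ) (f : HalfFilled N → ℝ)
    (B : HalfFilled N) : Measurable[envSigma a] fun ω => evol (a ω) t f B :=
  (continuous_evol_env t f B).measurable.comp measurable_env_envSigma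

theorem IsClockSystem.envSigma_le (h : IsClockSystem μ a QL QR) : envSigma a ≤ ‹MeasurableSpace Ω› :=
  (envSigma_le_clockSigma 0).trans (h.clockSigma_le 0)

/-- The Markov property of the inhomogeneous exclusion process. -/
theorem IsClockSystem.condExp_stateVec (hN : 2 ≤ N) (h : IsClockSystem μ a QL QR)
    {b : ℝ} (ha : ∀ᵐ ω ∂μ, ∀ x, 0 ≤ a ω x ∧ a ω x ≤ b) {A : Finset (ZMod N)} (hA : 2 * A.card = N)
    (s t : ℝ≥0) (f : HalfFilled N → ℝ) :
    μ[fun ω => stateVec (asep (QL ω) (QR ω) A (s + t)) ⬝ᵥ f | clockSigma a QL QR s]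
      =ᵐ[μ] fun ω => stateVec (asep (QL ω) (QR ω) A s) ⬝ᵥ evol (a ω) t f := by
  obtain ⟨G, hG0, hG⟩ := exists_norm_evol_le (N := N) b ((s : ℝ) + t) f
  obtain ⟨q, hq0, hq⟩ := exists_norm_exp_remainder_le (N := N) b
  -- The backward interpolation between time `s` and time `s + t`. Its integral over any event of
  -- `clockSigma a QL QR s` has quadratically small increments in `r` and is therefore constant.
  set U : ℝ≥0 → Ω → ℝ := fun r ω =>
    stateVec (asep (QL ω) (QR ω) A r) ⬝ᵥ evol (a ω) ((s : ℝ) + t - r) f with hU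
  have hev : ∀ (r : ℝ) B, Measurable fun ω => evol (a ω) r f B := fun r B =>
    (measurable_evol r f B).mono h.envSigma_le le_rfl
  have hGae : ∀ r : ℝ≥0, r ≤ s + t → ∀ᵐ ω ∂μ, ‖evol (a ω) ((s : ℝ) + t - r) f‖ ≤ G := by
    intro r hr
    have hr' : (r : ℝ) ≤ s + t := by exact_mod_cast hr
    filter_upwards [ha] with ω hω
    exact hG (a ω) hω _ (by linarith) (by linarith [r.coe_nonneg])
  have hUi : ∀ r : ℝ≥0, r ≤ s + t → Integrable (U r) μ := fun r hr =>
    h.integrable_stateVec_dotProduct hN ha hA r (hev _) (hGae r hr)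
  have hUst : U (s + t) = fun ω => stateVec (asep (QL ω) (QR ω) A (s + t)) ⬝ᵥ f := by
    ext ω
    simp [hU, evol_zero]
  have hUs : U s = fun ω => stateVec (asep (QL ω) (QR ω) A s) ⬝ᵥ evol (a ω) t f := by
    ext ω
    simp [hU]
  have hconst : ∀ B, MeasurableSet[clockSigma a QL QR s] B →
      ∫ ω in B, U (s + t) ω ∂μ = ∫ ω in B, U s ω ∂μ := by
    intro B hB
    refine eq_of_abs_sub_le_sq (ψ := fun r => ∫ ω in B, U r ω ∂μ)
      -- The absolute value of `b` makes the exponent monotone in time, so that one constant serves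
      -- all intermediate `r`.
      (C := G * (q + Real.exp (N * b * (tau N)⁻¹ ^ 2))
        * Real.exp (N * |b| * (s + t) * (tau N)⁻¹ ^ 2)) fun r r' hsr hrr' hr' h1 => ?_
    refine (h.abs_setIntegral_step_le hN ha hA hq0 hq hrr' h1
      (v := fun ω => evol (a ω) ((s : ℝ) + t - r') f)
      (w := fun ω => evol (a ω) ((s : ℝ) + t - r) f)
      (fun B => (measurable_evol _ f B).mono (envSigma_le_clockSigma r) le_rfl)
      (hev _) (fun ω => ?_) hG0 (hGae r' hr') (hGae r (hrr'.le.trans hr'))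
      (clockSigma_mono hsr _ hB)).trans ?_
    · rw [← evol_add]
      congr 1
      ring
    · have hr'' : (r : ℝ) ≤ s + t := by exact_mod_cast hrr'.le.trans hr'
      have hb := le_abs_self b
      have h2 : N * b * r * (tau N)⁻¹ ^ 2 ≤ N * |b| * (s + t) * (tau N)⁻¹ ^ 2 := by
        have h3 : (N : ℝ) * b * r ≤ N * |b| * (s + t) := by
          calc (N : ℝ) * b * r ≤ N * |b| * r := by gcongr
            _ ≤ _ := by gcongr
        exact mul_le_mul_of_nonneg_right h3 (sq_nonneg _)
      gcongr
  rw [← hUst, ← hUs]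
  refine (ae_eq_condExp_of_forall_setIntegral_eq (h.clockSigma_le s) (hUi _ le_rfl)
    (fun B _ _ => (hUi s le_self_add).integrableOn) (fun B hB _ => (hconst B hB).symm) ?_).symm
  exact (measurable_dotProduct (h.measurable_stateVec_asep A s) fun B =>
    (measurable_evol _ f B).mono (envSigma_le_clockSigma s) le_rfl).stronglyMeasurable.aestronglyMeasurable

end Markov

end InhomASEP

/-! ### Quenched expectations and the passage to the semigroup. -/

namespace InhomASEP

section Quenched

open scoped Matrix

variable {N : ℕ} [NeZero N] {Ω : Type*} [MeasurableSpace Ω] {μ : Measure Ω}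
  [IsProbabilityMeasure μ] {a : Ω → ZMod N → ℝ} {QL QR : Ω → ℝ≥0 → ZMod N → ℕ}

theorem W_eq (hN : 2 ≤ N) {A : Finset (ZMod N)} (hA : 2 * A.card = N) (t : ℝ≥0) (x : ZMod N) :
    W QL QR A t x = fun ω => Real.exp (2 * nu N * t)
      * (stateVec (asep (QL ω) (QR ω) A t) ⬝ᵥ gradProd x) := by
  ext ω
  exact gradient_product_eq hN (consistent_asep hN hA _ _ t) t x

theorem IsClockSystem.integrable_W (hN : 2 ≤ N) (h : IsClockSystem μ a QL QR)
    {b : ℝ} (ha : ∀ᵐ ω ∂μ, ∀ x, 0 ≤ a ω x ∧ a ω x ≤ b) {A : Finset (ZMod N)} (hA : 2 * A.card = N)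
    (t : ℝ≥0) (x : ZMod N) : Integrable (W QL QR A t x) μ := by
  rw [W_eq hN hA]
  exact (h.integrable_stateVec_dotProduct hN ha hA t (v := fun _ => gradProd x)
    (G := ‖gradProd (N := N) x‖) (fun _ => measurable_const)
    (ae_of_all _ fun _ => le_rfl)).const_mul _

theorem IsClockSystem.condExp_W (hN : 2 ≤ N) (h : IsClockSystem μ a QL QR)
    {b : ℝ} (ha : ∀ᵐ ω ∂μ, ∀ x, 0 ≤ a ω x ∧ a ω x ≤ b) {A : Finset (ZMod N)} (hA : 2 * A.card = N)
    (s t : ℝ≥0) (x : ZMod N) :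
    μ[W QL QR A (t + s) x | clockSigma a QL QR s] =ᵐ[μ] fun ω => Real.exp (2 * nu N * s) *
      (stateVec (asep (QL ω) (QR ω) A s) ⬝ᵥ (propagator (a ω) t *ᵥ gradProd x)) := by
  rw [W_eq hN hA, add_comm t s]
  refine (condExp_smul (Real.exp (2 * nu N * (s + t : ℝ≥0)))
    (fun ω => stateVec (asep (QL ω) (QR ω) A (s + t)) ⬝ᵥ gradProd x) _).trans ?_
  filter_upwards [h.condExp_stateVec hN ha hA s t (gradProd x)] with ω hω
  rw [Pi.smul_apply, hω, propagator_mulVec, dotProduct_smul, smul_eq_mul, smul_eq_mul, ← mul_assoc,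
    ← Real.exp_add]
  congr 2
  push_cast
  ring

theorem stateVec_initialState_dotProduct (A₀ : HalfFilled N) (f : HalfFilled N → ℝ) :
    stateVec (initialState A₀.1) ⬝ᵥ f = f A₀ := by
  rw [stateVec_dotProduct (σ := initialState A₀.1) A₀.2]
  simp [initialState, initialHeight]

theorem propagator_apply (b : ZMod N → ℝ) (t : ℝ) (A₀ B : HalfFilled N) :
    propagator b t A₀ B = Real.exp (2 * nu N * t) * evol b t (Pi.single B 1) A₀ := by
  have := congrFun (propagator_mulVec b t (Pi.single B 1)) A₀
  rwa [Matrix.mulVec_single_one] at this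

theorem measurable_propagator_mulVec (t : ℝ) (f : HalfFilled N → ℝ) (B : HalfFilled N) :
    Measurable[envSigma a] fun ω => (propagator (a ω) t *ᵥ f) B := by
  simp only [propagator_mulVec, Pi.smul_apply, smul_eq_mul]
  exact (measurable_evol t f B).const_mul _

theorem IsClockSystem.condExp_stateVec_env (hN : 2 ≤ N) (h : IsClockSystem μ a QL QR)
    {b : ℝ} (ha : ∀ᵐ ω ∂μ, ∀ x, 0 ≤ a ω x ∧ a ω x ≤ b) (A₀ : HalfFilled N) (s : ℝ≥0)
    (f : HalfFilled N → ℝ) :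
    μ[fun ω => stateVec (asep (QL ω) (QR ω) A₀.1 s) ⬝ᵥ f | envSigma a]
      =ᵐ[μ] fun ω => evol (a ω) s f A₀ := by
  -- The Markov property from time zero, where the state is deterministic. The result depends only
  -- on the environment, so the clocks at time zero can be averaged out.
  have e := h.condExp_stateVec hN ha A₀.2 0 s f
  simp only [zero_add, fun ω => (h.isClockPath ω).asep_zero A₀.1, stateVec_initialState_dotProduct]
    at e
  obtain ⟨G, -, hG⟩ := exists_norm_evol_le (N := N) b s f
  have hm := (measurable_evol (a := a) s f A₀)
  have hi : Integrable (fun ω => evol (a ω) s f A₀) μ := by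
    refine Integrable.of_bound (hm.mono h.envSigma_le le_rfl).aestronglyMeasurable G ?_
    filter_upwards [ha] with ω hω
    exact (norm_le_pi_norm _ _).trans (hG _ hω _ s.coe_nonneg le_rfl)
  refine (condExp_condExp_of_le (envSigma_le_clockSigma 0) (h.clockSigma_le 0)).symm.trans
    ((condExp_congr_ae e).trans (Filter.EventuallyEq.of_eq ?_))
  exact condExp_of_stronglyMeasurable h.envSigma_le hm.stronglyMeasurable hi

/-- Conditional expectation, given the environment, of a functional of the configuration. -/
theorem IsClockSystem.condExp_env_dotProduct (hN : 2 ≤ N) (h : IsClockSystem μ a QL QR)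
    {b : ℝ} (ha : ∀ᵐ ω ∂μ, ∀ x, 0 ≤ a ω x ∧ a ω x ≤ b) (A₀ : HalfFilled N) (s : ℝ≥0)
    {v : Ω → HalfFilled N → ℝ} (hv : ∀ B, Measurable[envSigma a] fun ω => v ω B) {G : ℝ}
    (hG : ∀ᵐ ω ∂μ, ‖v ω‖ ≤ G) :
    μ[fun ω => Real.exp (2 * nu N * s) * (stateVec (asep (QL ω) (QR ω) A₀.1 s) ⬝ᵥ v ω) | envSigma a]
      =ᵐ[μ] fun ω => propagator (a ω) s A₀ ⬝ᵥ v ω := by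
  have hX : ∀ B : HalfFilled N, Integrable (fun ω =>
      stateVec (asep (QL ω) (QR ω) A₀.1 s) B) μ := fun B => by
    simpa using h.integrable_stateVec_dotProduct hN ha A₀.2 s (v := fun _ => Pi.single B 1)
      (fun _ => measurable_const) (ae_of_all _ fun _ => le_rfl)
  have hbd : ∀ B, ∀ᵐ ω ∂μ, ‖v ω B‖ ≤ G := fun B =>
    hG.mono fun ω hω => (norm_le_pi_norm _ B).trans hω
  have hterm : ∀ B : HalfFilled N, Integrable ((fun ω => v ω B) *
      fun ω => stateVec (asep (QL ω) (QR ω) A₀.1 s) B) μ := fun B =>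
    (hX B).bdd_mul ((hv B).mono h.envSigma_le le_rfl).aestronglyMeasurable (hbd B)
  have hpull : ∀ B : HalfFilled N, μ[(fun ω => v ω B) *
      fun ω => stateVec (asep (QL ω) (QR ω) A₀.1 s) B | envSigma a]
      =ᵐ[μ] fun ω => v ω B * evol (a ω) s (Pi.single B 1) A₀ := fun B => by
    have e := h.condExp_stateVec_env hN ha A₀ s (Pi.single B 1)
    simp only [dotProduct_single, mul_one] at e
    filter_upwards [condExp_mul_of_stronglyMeasurable_left (hv B).stronglyMeasurable (hterm B)
      (hX B), e] with ω h1 h2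
    rw [h1, Pi.mul_apply, h2]
  have e1 : (fun ω => Real.exp (2 * nu N * s) * (stateVec (asep (QL ω) (QR ω) A₀.1 s) ⬝ᵥ v ω))
      = Real.exp (2 * nu N * s) • ∑ B : HalfFilled N, ((fun ω => v ω B) *
        fun ω => stateVec (asep (QL ω) (QR ω) A₀.1 s) B) := by
    ext ω
    simp [dotProduct, Finset.sum_apply, mul_comm]
  rw [e1]
  refine (condExp_smul _ _ _).trans ?_
  filter_upwards [condExp_finsetSum (fun B (_ : B ∈ Finset.univ) => hterm B) (envSigma a),
    ae_all_iff.2 hpull] with ω h1 h2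
  rw [Pi.smul_apply, h1, Finset.sum_apply, dotProduct, smul_eq_mul, Finset.mul_sum]
  refine Finset.sum_congr rfl fun B _ => ?_
  rw [h2, propagator_apply]
  ring

/-- The quenched expectation is controlled by the semigroup of the exclusion process. -/
theorem IsClockSystem.quenchedExp_le (hN : 2 ≤ N) (h : IsClockSystem μ a QL QR)
    {b : ℝ} (ha : ∀ᵐ ω ∂μ, ∀ x, 0 ≤ a ω x ∧ a ω x ≤ b) (A₀ : HalfFilled N) (G : Set Ω) (s t : ℝ≥0)
    (x : ZMod N) : ∀ᵐ ω ∂μ, 0 ≤ gradMoment (a ω) (propagator (a ω) s A₀) t x ∧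
      quenchedExp μ a G (fun ω' => |quenchedCondExp μ a QL QR G s (W QL QR A₀.1 (t + s) x) ω'|) ω
        ≤ G.indicator (fun ω => gradMoment (a ω) (propagator (a ω) s A₀) t x) ω := by
  set v : Ω → HalfFilled N → ℝ := fun ω B => |(propagator (a ω) t *ᵥ gradProd x) B| with hv
  have hvm : ∀ B, Measurable[envSigma a] fun ω => v ω B := fun B =>
    continuous_abs.measurable.comp (measurable_propagator_mulVec (t : ℝ) (gradProd x) B)
  obtain ⟨K, -, hK⟩ := exists_norm_evol_le (N := N) b t (gradProd x)
  have hvK : ∀ᵐ ω ∂μ, ‖v ω‖ ≤ Real.exp (2 * nu N * t) * K := by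
    filter_upwards [ha] with ω hω
    have h1 := hK _ hω _ t.coe_nonneg le_rfl
    have h2 : ‖v ω‖ = ‖propagator (a ω) t *ᵥ gradProd x‖ := by
      simp only [hv, Pi.norm_def, Real.nnnorm_abs]
    rw [h2, propagator_mulVec, norm_smul, Real.norm_of_nonneg (Real.exp_pos _).le]
    gcongr
  set H : Ω → ℝ := fun ω =>
    Real.exp (2 * nu N * s) * (stateVec (asep (QL ω) (QR ω) A₀.1 s) ⬝ᵥ v ω) with hH
  have hHi : Integrable H μ := (h.integrable_stateVec_dotProduct hN ha A₀.2 s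
    (fun B => (hvm B).mono h.envSigma_le le_rfl) hvK).const_mul _
  have hv0 : ∀ ω B, 0 ≤ v ω B := fun ω B => abs_nonneg _
  have hH0 : ∀ ω, 0 ≤ H ω := fun ω => mul_nonneg (Real.exp_pos _).le
    (Finset.sum_nonneg fun B _ => mul_nonneg (stateVec_nonneg hN _ B) (hv0 ω B))
  have hcond : μ[H | envSigma a] =ᵐ[μ] fun ω => gradMoment (a ω) (propagator (a ω) s A₀) t x :=
    h.condExp_env_dotProduct hN ha A₀ s hvm hvK
  have hle : (fun ω' => |quenchedCondExp μ a QL QR G s (W QL QR A₀.1 (t + s) x) ω'|) ≤ᵐ[μ] H := by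
    filter_upwards [h.condExp_W hN ha A₀.2 s t x] with ω hω
    rw [quenchedCondExp]
    by_cases hωG : ω ∈ G
    · rw [Set.indicator_of_mem hωG, hω, abs_mul, abs_of_pos (Real.exp_pos _)]
      exact mul_le_mul_of_nonneg_left
        (abs_dotProduct_le (fun B => (abs_of_nonneg (stateVec_nonneg hN _ B)).le) _)
        (Real.exp_pos _).le
    · rw [Set.indicator_of_notMem hωG, abs_zero]
      exact hH0 ω
  have hmain : μ[fun ω' => |quenchedCondExp μ a QL QR G s (W QL QR A₀.1 (t + s) x) ω'| | envSigma a]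
      ≤ᵐ[μ] μ[H | envSigma a] := by
    -- The good event is not assumed measurable, so integrability is not automatic. In the
    -- nonintegrable case the conditional expectation is zero by convention and the bound still
    -- holds.
    by_cases hi : Integrable
      (fun ω' => |quenchedCondExp μ a QL QR G s (W QL QR A₀.1 (t + s) x) ω'|) μ
    · exact condExp_mono hi hHi hle
    · rw [condExp_of_not_integrable hi]
      exact condExp_nonneg (ae_of_all _ hH0)
  filter_upwards [hmain, hcond, condExp_nonneg (m := envSigma a) (ae_of_all μ hH0)] with ω h1 h2 h3
  rw [← h2]
  refine ⟨h3, ?_⟩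
  rw [quenchedExp]
  by_cases hωG : ω ∈ G
  · rw [Set.indicator_of_mem hωG, Set.indicator_of_mem hωG, ← h2]
    exact h1
  · rw [Set.indicator_of_notMem hωG, Set.indicator_of_notMem hωG]

end Quenched

end InhomASEP

end

theorem mainTheorem7 (uRt uIc cRt cIc u v Λ T : ℝ) (huRt : 0 < uRt) (huIc : 0 < uIc)
    (hcRt : 0 < cRt) (hu : 1 / 2 < u) (hu1 : u < 1) (hv : 0 < v) (hvRt : v < uRt) :
    ∃ C : ℝ, 0 < C ∧
      ∀ (N : ℕ) [NeZero N], Even N →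
      ∀ (A : Finset (ZMod N)), 2 * A.card = N → InhomASEP.NearStationary uIc cIc A →
      ∀ (Ω : Type*) [MeasurableSpace Ω] (μ : Measure Ω) [IsProbabilityMeasure μ]
        (a : Ω → ZMod N → ℝ) (QL QR : Ω → ℝ≥0 → ZMod N → ℕ),
        InhomASEP.IsClockSystem μ a QL QR →
        (∀ᵐ ω ∂μ, ∀ x, 1 / cRt ≤ a ω x ∧ a ω x ≤ cRt) →
      ∀ s t : ℝ≥0, (s : ℝ) ≤ (N : ℝ) ^ 2 * T → (t : ℝ) ≤ (N : ℝ) ^ 2 * T → ∀ x : ZMod N,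
        Integrable (InhomASEP.W QL QR A (t + s) x) μ ∧
        ∀ᵐ ω ∂μ,
          InhomASEP.quenchedExp μ a (InhomASEP.goodEvent uRt u v Λ T a)
            (fun ω' => |InhomASEP.quenchedCondExp μ a QL QR
              (InhomASEP.goodEvent uRt u v Λ T a) s (InhomASEP.W QL QR A (t + s) x) ω'|) ω
          ≤ C * ((N : ℝ) ^ (-(min (min (u / 2) uIc) v)) * Real.log (N + 1)
              + 1 / √((t : ℝ) + 1) + (N : ℝ) / ((t : ℝ) + 1)) := by
  obtain ⟨C, hC, hdet⟩ :=
    InhomASEP.deterministic_bound uRt uIc cRt cIc u v Λ T huIc hu hu1 hv hvRt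
  refine ⟨C, hC, fun N _ hEven A hA hns Ω _ μ _ a QL QR h ha s t hs ht x => ?_⟩
  have hN : 2 ≤ N := by
    obtain ⟨k, hk⟩ := hEven
    have := NeZero.ne N
    omega
  have ha' : ∀ᵐ ω ∂μ, ∀ x, 0 ≤ a ω x ∧ a ω x ≤ cRt := by
    filter_upwards [ha] with ω hω x
    exact ⟨(by positivity : (0 : ℝ) ≤ 1 / cRt).trans (hω x).1, (hω x).2⟩
  refine ⟨h.integrable_W hN ha' hA _ x, ?_⟩
  filter_upwards [h.quenchedExp_le hN ha' ⟨A, hA⟩ (InhomASEP.goodEvent uRt u v Λ T a) s t x, ha']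
    with ω hω hωa
  refine hω.2.trans ?_
  have hlog : 0 ≤ Real.log ((N : ℝ) + 1) := Real.log_nonneg (by simp)
  -- The deterministic bound contains no such term; the nonnegative summand `1/√(t+1)` is simply
  -- added.
  have h1 : (0 : ℝ) ≤ 1 / √((t : ℝ) + 1) := by positivity
  by_cases hG : ω ∈ InhomASEP.goodEvent uRt u v Λ T a
  · rw [Set.indicator_of_mem hG]
    refine (hdet N hN ⟨A, hA⟩ hns (a ω) (fun x => (hωa x).1) (fun x => (hωa x).2) hG.1 hG.2
      s t s.coe_nonneg t.coe_nonneg hs ht x).trans (mul_le_mul_of_nonneg_left ?_ hC.le)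
    linarith
  · rw [Set.indicator_of_notMem hG]
    positivity
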